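/- **Double shuffle relation of $q$-analogues of symmetric multiple zeta values.** *Classical side.* An index is a finite (possibly empty) tuple of positive integers; $\mathrm{wt}(\mathbf k)$ is the sum of its entries, $\overline{\mathbf k}$ its reversal, $(\mathbf k,\mathbf l)$ denotes concatenation, and $\mathbf k$ is admissible if it is empty or its last entry is $\ge 2$. In $\mathbb Q\langle x,y\rangle$ put $z_k=yx^{k-1}$ and $z_{\mathbf k}=z_{k_1}\cdots z_{k_r}$ ($z_\varnothing=1$). Let $\ast$ be the bilinear harmonic product on the span of the $z_{\mathbf k}$, with unit $1$ and $wz_k\ast w'z_l=(w\ast w'z_l)z_k+(wz_k\ast w')z_l+(w\ast w')z_{k+l}$, and let $\mathrm{sh}$ be the usual shuffle product on $\mathbb Q\langle x,y\rangle$. The non-negative integers $d^{\bullet,\mathbf m}_{\mathbf k,\mathbf l}$ are defined by $z_{\mathbf k}\bullet z_{\mathbf l}=\sum_{\mathbf m}d^{\bullet,\mathbf m}_{\mathbf k,\mathbf l}z_{\mathbf m}$ for $\bullet\in\{\ast,\mathrm{sh}\}$ (finite sums). *Algebra.* Let $\mathcal C=\mathbb Q[\hbar]$, $\mathfrak H=\mathcal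 C\langle a,b\rangle$, $g_k=ba^k$, $e_k=b(a+\hbar)a^{k-1}$ ($k\ge1$; so $e_1-g_1=\hbar b$), $A=\{\hbar b\}\cup\{g_k\mid k\ge 1\}$, and let $\mathcal C\langle A\rangle$ be the subalgebra generated by $A$. Put $\widehat{\mathfrak H^0}=\mathcal C+\sum_{k\ge1}\mathcal C\langle A\rangle g_k$; let $\mathfrak n_0$ be the $\mathcal C$-span of the monomials $(e_1-g_1)^{\alpha_1}g_{\beta_1+1}\cdots(e_1-g_1)^{\alpha_r}g_{\beta_r+1}$ ($\alpha_i,\beta_i\ge0$) with $\alpha_s,\beta_t\ge1$ for some $s\le t$; and put $\mathfrak n=\mathfrak n_0+\hbar\widehat{\mathfrak H^0}$, $\mathfrak H^0=\mathcal C+\sum_{k\ge2}\mathcal C\langle A\rangle g_k+\mathfrak n$. The $\mathcal C$-bilinear product $\ast_\hbar$ on $\mathcal C\langle A\rangle$ has unit $1$ and satisfies $wu\ast_\hbar w'v=(w\ast_\hbar w'v)u+(wu\ast_\hbar w')v+(w\ast_\hbar w')(u\circ_\hbar v)$ for $u,v\in A$, where $\hbar b\circ_\hbar\hbar b=\hbar\cdot\hbar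 b$, $\hbar b\circ_\hbar g_k=g_k\circ_\hbar\hbar b=\hbar g_k$, $g_k\circ_\hbar g_l=g_{k+l}$. The $\mathcal C$-bilinear product $\mathrm{sh}_\hbar$ on $\mathfrak H$ has unit $1$ and satisfies $wa\,\mathrm{sh}_\hbar\,w'a=(wa\,\mathrm{sh}_\hbar\,w'+w\,\mathrm{sh}_\hbar\,w'a+\hbar\,w\,\mathrm{sh}_\hbar\,w')a$ and $wb\,\mathrm{sh}_\hbar\,w'=w\,\mathrm{sh}_\hbar\,w'b=(w\,\mathrm{sh}_\hbar\,w')b$. Let $\psi^\ast,\psi^{\mathrm{sh}}$ be the $\mathcal C$-linear anti-automorphisms of $\mathcal C\langle A\rangle$ that fix $\hbar b$ and satisfy $\psi^\ast(ba^k)=b(-a)^k$, $\psi^{\mathrm{sh}}(ba^k)=b(-a-\hbar)^k$, and for $\bullet\in\{\ast,\mathrm{sh}\}$ let $w^{\mathcal S,\bullet}_\hbar(u_1\cdots u_r)=\sum_{i=0}^r u_1\cdots u_i\bullet_\hbar\psi^\bullet(u_{i+1}\cdots u_r)$ ($u_j\in A$), extended $\mathcal C$-linearly. Put $g_{\mathbf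 k}=g_{k_1}\cdots g_{k_r}$, $E_{1^m}=\frac1{(m+1)!}\sum_{j=0}^m g_1^{\mathrm{sh}_\hbar j}\,\mathrm{sh}_\hbar\,e_1^{\mathrm{sh}_\hbar(m-j)}$, and for $\mathbf k=(1^{s_0},t_1+2,1^{s_1},\dots,t_r+2,1^{s_r})$ with $s_i,t_i\ge 0$ (where $1^s$ means $s$ entries equal to $1$) put $E_{\mathbf k}=E_{1^{s_0}}e_{t_1+2}E_{1^{s_1}}\cdots e_{t_r+2}E_{1^{s_r}}$. *Values.* Fix $q\in\mathbb C$ with $0<|q|<1$, let $\hbar$ act on $\mathbb C$ as $1-q$, and let $[m]=(1-q^m)/(1-q)$, $F_q(m;\hbar b)=1-q$, $F_q(m;g_k)=q^{km}/[m]^k$. For $M\ge1$ let $Z_{q,M}:\mathcal C\langle A\rangle\to\mathbb C$ be the $\mathcal C$-linear map with $Z_{q,M}(u_1\cdots u_r)=\sum_{0<m_1<\cdots<m_r<M}\prod_iF_q(m_i;u_i)$ for $u_i\in A$ (and $Z_{q,M}(1)=1$), and put $Z_q(w)=\lim_{M\to\infty}Z_{q,M}(w)$ for $w\in\widehat{\mathfrak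 H^0}$, where the limit exists. Then $\mathcal Z_q=Z_q(\mathfrak H^0)$ is a subalgebra of $\mathbb C$ and $\mathcal N_q=Z_q(\mathfrak n)$ is an ideal of it; let $\mathcal P_q$ be the ideal of $\mathcal Z_q$ generated by $Z_q(g_{2k})$, $k\ge1$. For an index $\mathbf k$ the element $w^{\mathcal S,\ast}_\hbar(g_{\mathbf k})$ lies in $\mathfrak H^0$; let $\zeta^{\mathcal S}_q(\mathbf k)\in\mathcal Z_q/(\mathcal N_q+\mathcal P_q)$ be the class of $Z_q(w^{\mathcal S,\ast}_\hbar(g_{\mathbf k}))$. **Theorem.** Let $q\in\mathbb C$ with $0<|q|<1$. In $\mathcal Z_q/(\mathcal N_q+\mathcal P_q)$ the following hold. 0. (Both descriptions of $\zeta_q^{\mathcal S}$ agree.) For every index $\mathbf k$, $w^{\mathcal S,\mathrm{sh}}_\hbar(E_{\mathbf k})\in\mathfrak H^0$, and $\zeta^{\mathcal S}_q(\mathbf k)$ is also the class of $Z_q(w^{\mathcal S,\mathrm{sh}}_\hbar(E_{\mathbf k}))$. 1. For all indices $\mathbf k,\mathbf l$: $\displaystyle \zeta_q^{\mathcal S}(\mathbf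 k)\,\zeta_q^{\mathcal S}(\mathbf l)=\sum_{\mathbf m}d^{\ast,\mathbf m}_{\mathbf k,\mathbf l}\,\zeta_q^{\mathcal S}(\mathbf m)$. 2. If at least one of $\mathbf k,\mathbf l$ is admissible: $\displaystyle (-1)^{\mathrm{wt}(\mathbf l)}\zeta_q^{\mathcal S}(\mathbf k,\overline{\mathbf l})=\sum_{\mathbf m}d^{\mathrm{sh},\mathbf m}_{\mathbf k,\mathbf l}\,\zeta_q^{\mathcal S}(\mathbf m)$. -/

import Mathlib

open scoped Polynomial Pointwise
open Filter Topology

namespace QSMZV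

/-! ### Noncommutative polynomials in two variables -/

/-- The two noncommuting variables. They are called `a, b` in the `q`-setting and
`x = a`, `y = b` in the classical setting. -/
inductive Gen : Type
  | a
  | b

/-- The noncommutative polynomial ring `R⟨a, b⟩`. -/
abbrev NC (R : Type) [CommRing R] : Type := FreeAlgebra R Gen

section Words

variable (R : Type) [CommRing R]

/-- The variable `a`. -/
noncomputable def va : NC R := FreeAlgebra.ι R Gen.a

/-- The variable `b`. -/
noncomputable def vb : NC R := FreeAlgebra.ι R Gen.b

/-- The monomial given by a word in `a` and `b`. -/
noncomputable def mono (w : List Gen) : NC R := (w.map (FreeAlgebra.ι R)).prod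

/-- The monomials form a basis of `R⟨a, b⟩`. -/
noncomputable def wordBasis : Module.Basis (List Gen) R (NC R) :=
  (FreeAlgebra.basisFreeMonoid R Gen).reindex FreeMonoid.toList

theorem wordBasis_apply (w : List Gen) : wordBasis R w = mono R w := by
  simp only [wordBasis, FreeAlgebra.basisFreeMonoid, Module.Basis.reindex_apply,
    Module.Basis.map_apply, Finsupp.coe_basisSingleOne, mono]
  rw [LinearEquiv.symm_apply_eq]
  have h : FreeAlgebra.equivMonoidAlgebraFreeMonoid ((w.map (FreeAlgebra.ι R)).prod)
      = MonoidAlgebra.of R (FreeMonoid Gen) (FreeMonoid.ofList w) := by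
    induction w with
    | nil => simp [MonoidAlgebra.one_def]
    | cons x w ih =>
      rw [List.map_cons, List.prod_cons, map_mul, ih, FreeMonoid.ofList_cons, map_mul]
      congr 1
      simp [FreeAlgebra.equivMonoidAlgebraFreeMonoid]
  simp only [LinearEquiv.trans_apply]
  erw [h]
  simp [MonoidAlgebra.of]

/-- Every word is uniquely of the form `aⁿ (b a^{k₁}) ⋯ (b a^{kᵣ})`;
this is the pair `(n, [k₁, …, kᵣ])`. -/
def blocks : List Gen → ℕ × List ℕ
  | [] => (0, [])
  | Gen.a :: w => ((blocks w).1 + 1, (blocks w).2)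
  | Gen.b :: w => (0, (blocks w).1 :: (blocks w).2)

/-- The element `c_k = b a^k`, `k ≥ 0`. -/
noncomputable def cl (k : ℕ) : NC R := vb R * va R ^ k

/-- The monomial `c_{k₁} ⋯ c_{kᵣ}`. These monomials form a basis of `R + b R⟨a, b⟩`. -/
noncomputable def cmono (ks : List ℕ) : NC R := (ks.map (cl R)).prod

/-- The word of `c_{k₁} ⋯ c_{kᵣ}`. -/
def cword (ks : List ℕ) : List Gen := ks.flatMap fun k => Gen.b :: List.replicate k Gen.a

theorem blocks_cword (ks : List ℕ) : blocks (cword ks) = (0, ks) := by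
  have aux : ∀ (n : ℕ) (w : List Gen), blocks (List.replicate n Gen.a ++ w)
      = ((blocks w).1 + n, (blocks w).2) := by
    intro n w
    induction n with
    | zero => simp
    | succ n ih => simp [List.replicate_succ, blocks, ih, add_assoc]
  induction ks with
  | nil => rfl
  | cons k ks ih =>
    have : cword (k :: ks) = Gen.b :: (List.replicate k Gen.a ++ cword ks) := by
      simp [cword]
    rw [this, blocks, aux, ih]
    simp

theorem mono_cword (ks : List ℕ) : mono R (cword ks) = cmono R ks := by
  induction ks with
  | nil => simp [mono, cword, cmono]
  | cons k ks ih =>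
    simp only [mono, cword, cmono, List.flatMap_cons, List.map_append, List.prod_append,
      List.map_cons, List.prod_cons, List.map_replicate, List.prod_replicate] at ih ⊢
    rw [ih]; rfl

variable {R}

/-- The linear extension of a function given on the monomials `c_{k₁} ⋯ c_{kᵣ}`
(extended by zero to the monomials that start with `a`, which play no role). -/
noncomputable def cext {M : Type} [AddCommGroup M] [Module R M] (f : List ℕ → M) :
    NC R →ₗ[R] M :=
  (wordBasis R).constr R fun w => if (blocks w).1 = 0 then f (blocks w).2 else 0

theorem cext_cmono {M : Type} [AddCommGroup M] [Module R M] (f : List ℕ → M) (ks : List ℕ) :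
    cext f (cmono R ks) = f ks := by
  rw [← mono_cword, ← wordBasis_apply, cext, Module.Basis.constr_basis, blocks_cword]
  simp

/-- Harmonic product of two monomials in letters `c`, written from right to left
(so the head of a list is the last letter); `op` is the product of indices of letters. -/
noncomputable def harmRev (op : ℕ → ℕ → ℕ) : List ℕ → List ℕ → NC R
  | [], v => cmono R v.reverse
  | k :: u, [] => cmono R (k :: u).reverse
  | k :: u, l :: v =>
      harmRev op u (l :: v) * cl R k + harmRev op (k :: u) v * cl R l
        + harmRev op u v * cl R (op k l)
  termination_by u v => u.length + v.length

/-- The bilinear harmonic product on `R + b R⟨a, b⟩` with `c_k ∘ c_l = c_{op k l}`. -/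
noncomputable def harm (op : ℕ → ℕ → ℕ) : NC R →ₗ[R] NC R →ₗ[R] NC R :=
  cext fun u => cext fun v => harmRev op u.reverse v.reverse

theorem harm_cmono (op : ℕ → ℕ → ℕ) (u v : List ℕ) :
    harm op (cmono R u) (cmono R v) = harmRev op u.reverse v.reverse := by
  simp [harm, cext_cmono]

/-- Shuffle product of two words in `a, b` written from right to left, with
`w b ⧢ w' = w ⧢ w' b = (w ⧢ w') b` and
`w a ⧢ w' a = (w a ⧢ w' + w ⧢ w' a + t (w ⧢ w')) a`. -/
noncomputable def qshRev (t : R) : List Gen → List Gen → NC R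
  | [], v => mono R v.reverse
  | k :: u, [] => mono R (k :: u).reverse
  | Gen.b :: u, l :: v => qshRev t u (l :: v) * vb R
  | Gen.a :: u, Gen.b :: v => qshRev t (Gen.a :: u) v * vb R
  | Gen.a :: u, Gen.a :: v =>
      (qshRev t (Gen.a :: u) v + qshRev t u (Gen.a :: v) + t • qshRev t u v) * va R
  termination_by u v => u.length + v.length

/-- The usual shuffle product of two words written from right to left. -/
noncomputable def shRev : List Gen → List Gen → NC R
  | [], v => mono R v.reverse
  | k :: u, [] => mono R (k :: u).reverse
  | k :: u, l :: v =>
      shRev u (l :: v) * FreeAlgebra.ι R k + shRev (k :: u) v * FreeAlgebra.ι R l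
  termination_by u v => u.length + v.length

/-- Bilinear extension of a product of words (the words are passed reversed). -/
noncomputable def bilin (p : List Gen → List Gen → NC R) : NC R →ₗ[R] NC R →ₗ[R] NC R :=
  (wordBasis R).constr R fun u => (wordBasis R).constr R fun v => p u.reverse v.reverse

end Words

/-! ### Indices and the structure constants of the classical double shuffle products -/

/-- An index is a finite tuple of positive integers. -/
abbrev Index : Type := List ℕ+

namespace Index

/-- The weight of an index. -/
def wt (k : Index) : ℕ := (k.map fun i : ℕ+ => (i : ℕ)).sum

/-- An index is admissible if it is empty or its last entry is at least two. -/
def Admissible (k : Index) : Prop := ∀ i ∈ k.getLast?, 2 ≤ (i : ℕ)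

end Index

/-- `z_k = z_{k₁} ⋯ z_{kᵣ}` with `z_k = y x^{k-1}`, in `ℚ⟨x, y⟩` (here `x = a`, `y = b`). -/
noncomputable def z (k : Index) : NC ℚ :=
  (k.map fun i : ℕ+ => vb ℚ * va ℚ ^ ((i : ℕ) - 1)).prod

/-- The classical harmonic product; `z_k ∘ z_l = z_{k+l}` reads
`c_i ∘ c_j = c_{i+j+1}` because `z_k = c_{k-1}`. -/
noncomputable def starProd : NC ℚ →ₗ[ℚ] NC ℚ →ₗ[ℚ] NC ℚ := harm fun i j => i + j + 1

/-- The classical shuffle product on `ℚ⟨x, y⟩`. -/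
noncomputable def shProd : NC ℚ →ₗ[ℚ] NC ℚ →ₗ[ℚ] NC ℚ := bilin shRev

theorem z_eq_cmono (k : Index) : z k = cmono ℚ (k.map fun i : ℕ+ => (i : ℕ) - 1) := by
  simp [z, cmono, cl, Function.comp_def]

theorem cmono_eq_z (ks : List ℕ) : ∃ k : Index, z k = cmono ℚ ks := by
  refine ⟨ks.map Nat.succPNat, ?_⟩
  simp [z_eq_cmono, Function.comp_def]

theorem mono_eq_blocks (w : List Gen) :
    mono ℚ w = va ℚ ^ (blocks w).1 * cmono ℚ (blocks w).2 := by
  induction w with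
  | nil => simp [mono, cmono, blocks]
  | cons x w ih =>
    have h : mono ℚ (x :: w) = FreeAlgebra.ι ℚ x * mono ℚ w := by simp [mono]
    rw [h, ih]
    cases x
    · simp [blocks, pow_succ', mul_assoc, va]
    · simp [blocks, cmono, cl, mul_assoc, vb]

theorem z_linearIndependent : LinearIndependent ℚ z := by
  have h : z = wordBasis ℚ ∘ fun k : Index => cword (k.map fun i : ℕ+ => (i : ℕ) - 1) := by
    funext k
    rw [Function.comp_apply, wordBasis_apply, mono_cword, z_eq_cmono]
  rw [h]
  refine (wordBasis ℚ).linearIndependent.comp _ ?_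
  intro k l hkl
  have h2 := congrArg (fun w => (blocks w).2) hkl
  simp only [blocks_cword] at h2
  refine List.map_injective_iff.mpr ?_ h2
  intro i j hij
  have hi := i.pos
  have hj := j.pos
  apply PNat.eq
  simp only at hij
  omega

theorem existsUnique_coeff {x : NC ℚ} (hx : x ∈ AddSubmonoid.closure (Set.range z)) :
    ∃! d : Index →₀ ℕ, x = d.sum fun m c => c • z m := by
  have hex : ∃ d : Index →₀ ℕ, x = d.sum fun m c => c • z m := by
    induction hx using AddSubmonoid.closure_induction with
    | mem x hx =>
      obtain ⟨k, rfl⟩ := hx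
      exact ⟨Finsupp.single k 1, by simp⟩
    | zero => exact ⟨0, by simp⟩
    | add x y _ _ hx hy =>
      obtain ⟨d, rfl⟩ := hx
      obtain ⟨e, rfl⟩ := hy
      refine ⟨d + e, ?_⟩
      rw [Finsupp.sum_add_index']
      · simp
      · intro m c c2
        rw [add_smul]
  obtain ⟨d, hd⟩ := hex
  refine ⟨d, hd, fun e he => ?_⟩
  have hli : LinearIndependent ℕ z :=
    z_linearIndependent.restrict_scalars (by
      intro m n h
      simpa using h)
  exact hli (he.symm.trans hd)

theorem closure_mul_cl {x : NC ℚ} (hx : x ∈ AddSubmonoid.closure (Set.range z)) (k : ℕ) :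
    x * cl ℚ k ∈ AddSubmonoid.closure (Set.range z) := by
  induction hx using AddSubmonoid.closure_induction with
  | mem x hx =>
    obtain ⟨l, rfl⟩ := hx
    obtain ⟨m, hm⟩ := cmono_eq_z ((l.map fun i : ℕ+ => (i : ℕ) - 1) ++ [k])
    refine AddSubmonoid.subset_closure ⟨m, ?_⟩
    rw [hm, z_eq_cmono]
    simp [cmono]
  | zero => simp
  | add x y _ _ hx hy => rw [add_mul]; exact add_mem hx hy

theorem harmRev_mem (op : ℕ → ℕ → ℕ) (u v : List ℕ) :
    harmRev op u v ∈ AddSubmonoid.closure (Set.range z) := by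
  have base : ∀ w : List ℕ, cmono ℚ w ∈ AddSubmonoid.closure (Set.range z) := by
    intro w
    obtain ⟨k, hk⟩ := cmono_eq_z w
    exact AddSubmonoid.subset_closure ⟨k, hk⟩
  induction u, v using harmRev.induct with
  | case1 v => rw [harmRev]; exact base _
  | case2 k u => rw [harmRev]; exact base _
  | case3 k u l v h1 h2 h3 =>
    rw [harmRev]
    exact add_mem (add_mem (closure_mul_cl h1 _) (closure_mul_cl h2 _)) (closure_mul_cl h3 _)

theorem starProd_mem (k l : Index) :
    starProd (z k) (z l) ∈ AddSubmonoid.closure (Set.range z) := by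
  rw [z_eq_cmono, z_eq_cmono, starProd, harm_cmono]
  exact harmRev_mem _ _ _

theorem shRev_mem (u v : List Gen) (hu : u = [] ∨ ∃ w, u = w ++ [Gen.b])
    (hv : v = [] ∨ ∃ w, v = w ++ [Gen.b]) (huv : u ≠ [] ∨ v ≠ []) :
    shRev u v ∈ AddSubmonoid.closure (Set.range fun w => mono ℚ (Gen.b :: w)) := by
  have tl : ∀ (k : Gen) (u : List Gen), (k :: u = [] ∨ ∃ w, k :: u = w ++ [Gen.b]) →
      (u = [] ∨ ∃ w, u = w ++ [Gen.b]) := by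
    rintro k u (h | ⟨w, h⟩)
    · simp at h
    · rcases w with _ | ⟨x, w⟩
      · left; simp_all
      · right; exact ⟨w, by simp_all⟩
  have base : ∀ u : List Gen, u ≠ [] → (u = [] ∨ ∃ w, u = w ++ [Gen.b]) →
      mono ℚ u.reverse ∈ AddSubmonoid.closure (Set.range fun w => mono ℚ (Gen.b :: w)) := by
    rintro u h0 (h | ⟨w, h⟩)
    · exact absurd h h0
    · subst h
      exact AddSubmonoid.subset_closure ⟨w.reverse, by simp⟩
  have mulr : ∀ (x : NC ℚ) (g : Gen),
      x ∈ AddSubmonoid.closure (Set.range fun w => mono ℚ (Gen.b :: w)) →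
      x * FreeAlgebra.ι ℚ g ∈ AddSubmonoid.closure (Set.range fun w => mono ℚ (Gen.b :: w)) := by
    intro x g hx
    induction hx using AddSubmonoid.closure_induction with
    | mem x hx =>
      obtain ⟨w, rfl⟩ := hx
      exact AddSubmonoid.subset_closure ⟨w ++ [g], by simp [mono, mul_assoc]⟩
    | zero => simp
    | add x y _ _ hx hy => rw [add_mul]; exact add_mem hx hy
  induction u, v using shRev.induct with
  | case1 v =>
    rw [shRev]
    exact base v (by simpa using huv) hv
  | case2 k u =>
    rw [shRev]
    exact base _ (by simp) hu
  | case3 k u l v h1 h2 =>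
    rw [shRev]
    exact add_mem (mulr _ _ (h1 (tl _ _ hu) hv (by simp))) (mulr _ _ (h2 hu (tl _ _ hv) (by simp)))

theorem shProd_mem (k l : Index) :
    shProd (z k) (z l) ∈ AddSubmonoid.closure (Set.range z) := by
  have hz : ∀ k : Index, ∃ u : List Gen, z k = mono ℚ u.reverse ∧
      (u = [] ∨ ∃ w, u = w ++ [Gen.b]) := by
    intro k
    refine ⟨(cword (k.map fun i : ℕ+ => (i : ℕ) - 1)).reverse, ?_, ?_⟩
    · rw [List.reverse_reverse, mono_cword, z_eq_cmono]
    · rcases k with _ | ⟨i, k⟩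
      · left; simp [cword]
      · right
        refine ⟨(List.replicate ((i : ℕ) - 1) Gen.a
          ++ cword (k.map fun i : ℕ+ => (i : ℕ) - 1)).reverse, ?_⟩
        simp [cword]
  obtain ⟨u, hu, hu2⟩ := hz k
  obtain ⟨v, hv, hv2⟩ := hz l
  have h : shProd (z k) (z l) = shRev u v := by
    rw [hu, hv, shProd, bilin, ← wordBasis_apply, ← wordBasis_apply, Module.Basis.constr_basis,
      Module.Basis.constr_basis, List.reverse_reverse, List.reverse_reverse]
  rw [h]
  by_cases h0 : u = [] ∧ v = []
  · rw [h0.1, h0.2, shRev]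
    exact AddSubmonoid.subset_closure ⟨[], by simp [z, mono]⟩
  · refine AddSubmonoid.closure_mono ?_ (shRev_mem u v hu2 hv2 (by tauto))
    rintro _ ⟨w, rfl⟩
    obtain ⟨m, hm⟩ := cmono_eq_z ((blocks w).1 :: (blocks w).2)
    refine ⟨m, ?_⟩
    simp only [hm, mono_eq_blocks (Gen.b :: w)]
    simp [blocks]

/-- The non-negative integers `d^{∗,m}_{k,l}`, defined by `z_k ∗ z_l = ∑_m d^{∗,m}_{k,l} z_m`. -/
noncomputable def dStar (k l : Index) : Index →₀ ℕ :=
  (existsUnique_coeff (starProd_mem k l)).choose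

theorem dStar_spec (k l : Index) :
    starProd (z k) (z l) = (dStar k l).sum fun m c => c • z m :=
  (existsUnique_coeff (starProd_mem k l)).choose_spec.1

/-- The non-negative integers `d^{sh,m}_{k,l}`, defined by
`z_k sh z_l = ∑_m d^{sh,m}_{k,l} z_m`. -/
noncomputable def dSh (k l : Index) : Index →₀ ℕ :=
  (existsUnique_coeff (shProd_mem k l)).choose

theorem dSh_spec (k l : Index) :
    shProd (z k) (z l) = (dSh k l).sum fun m c => c • z m :=
  (existsUnique_coeff (shProd_mem k l)).choose_spec.1

/-! ### The algebra for the `q`-analogue -/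

/-- The coefficient ring `𝒞 = ℚ[ħ]`. -/
abbrev CC : Type := ℚ[X]

/-- The formal variable `ħ`. -/
noncomputable abbrev hb : CC := Polynomial.X

/-- `ℌ = 𝒞⟨a, b⟩`. -/
abbrev HH : Type := NC CC

/-- `g_k = b a^k`. -/
noncomputable def g (k : ℕ) : HH := vb CC * va CC ^ k

/-- `e_k = b (a + ħ) a^{k-1}`, `k ≥ 1`. -/
noncomputable def e (k : ℕ) : HH :=
  vb CC * (va CC + algebraMap CC HH hb) * va CC ^ (k - 1)

/-- The set `A = {ħ b} ∪ {b a^k ∣ k ≥ 1}`. -/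
noncomputable def setA : Set HH := {hb • vb CC} ∪ {x | ∃ k : ℕ, 1 ≤ k ∧ x = vb CC * va CC ^ k}

/-- `𝒞⟨A⟩`, the subalgebra of `ℌ` generated by `A`. -/
noncomputable def CA : Subalgebra CC HH := Algebra.adjoin CC setA

/-- The module `𝒞 + ∑_{k ≥ 1} 𝒞⟨A⟩ g_k`. -/
noncomputable def Hhat : Submodule CC HH :=
  Submodule.span CC ({1} ∪ {x | ∃ w ∈ CA, ∃ k : ℕ, 1 ≤ k ∧ x = w * g k})

/-- The span of the monomials
`(e₁ - g₁)^{α₁} g_{β₁+1} ⋯ (e₁ - g₁)^{αᵣ} g_{βᵣ+1}` with `α_s ≥ 1` and `β_t ≥ 1` for some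
`s ≤ t`; a monomial is given by the list of the pairs `(α_i, β_i)`. -/
noncomputable def nZero : Submodule CC HH :=
  Submodule.span CC {x | ∃ L : List (ℕ × ℕ),
    (∃ s t : Fin L.length, s ≤ t ∧ 1 ≤ (L.get s).1 ∧ 1 ≤ (L.get t).2) ∧
    x = (L.map fun p => (e 1 - g 1) ^ p.1 * g (p.2 + 1)).prod}

/-- The module `𝔫 = 𝔫₀ + ħ Ĥ⁰`. -/
noncomputable def nMod : Submodule CC HH := nZero ⊔ hb • Hhat

/-- The module `ℌ⁰ = 𝒞 + ∑_{k ≥ 2} 𝒞⟨A⟩ g_k + 𝔫`. -/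
noncomputable def HZero : Submodule CC HH :=
  Submodule.span CC ({1} ∪ {x | ∃ w ∈ CA, ∃ k : ℕ, 2 ≤ k ∧ x = w * g k}) ⊔ nMod

/-- The harmonic product `∗_ħ`: the quasi-shuffle product with `(b a^k) ∘ (b a^l) = b a^{k+l}`
for `k, l ≥ 0`. On `A` this is `(ħb) ∘ (ħb) = ħ (ħb)`, `(ħb) ∘ g_k = ħ g_k`,
`g_k ∘ g_l = g_{k+l}`. -/
noncomputable def hstar : HH →ₗ[CC] HH →ₗ[CC] HH := harm fun k l => k + l

/-- The shuffle product `sh_ħ` on `ℌ`. -/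
noncomputable def hsh : HH →ₗ[CC] HH →ₗ[CC] HH := bilin (qshRev hb)

/-- The anti-automorphism `ψ^∗` with `b a^k ↦ b (-a)^k`. -/
noncomputable def psiStar : HH →ₗ[CC] HH :=
  cext fun ks => (ks.reverse.map fun k => vb CC * (-va CC) ^ k).prod

/-- The anti-automorphism `ψ^sh` with `b a^k ↦ b (-a-ħ)^k`. -/
noncomputable def psiSh : HH →ₗ[CC] HH :=
  cext fun ks => (ks.reverse.map fun k => vb CC * (-va CC - algebraMap CC HH hb) ^ k).prod

/-- The linear map `u₁ ⋯ uᵣ ↦ ∑_{i=0}^r (u₁ ⋯ uᵢ) • ψ(u_{i+1} ⋯ uᵣ)` on monomials in the letters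
`u = b a^k`. -/
noncomputable def wS (prod : HH →ₗ[CC] HH →ₗ[CC] HH) (psi : HH →ₗ[CC] HH) : HH →ₗ[CC] HH :=
  cext fun ks => ∑ i ∈ Finset.range (ks.length + 1),
    prod (cmono CC (ks.take i)) (psi (cmono CC (ks.drop i)))

/-- `w_ħ^{S,∗}`. -/
noncomputable def wStar : HH →ₗ[CC] HH := wS hstar psiStar

/-- `w_ħ^{S,sh}`. -/
noncomputable def wSh : HH →ₗ[CC] HH := wS hsh psiSh

/-! ### `q`-multiple zeta values -/

/-- The `q`-integer `[m] = (1 - q^m) / (1 - q)`. -/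
noncomputable def qInt (q : ℂ) (m : ℕ) : ℂ := (1 - q ^ m) / (1 - q)

/-- `F_q(m; b a^k) = q^{km} / [m]^k`. -/
noncomputable def Fq (q : ℂ) (m k : ℕ) : ℂ := q ^ (k * m) / qInt q m ^ k

/-- `∑_{0 < m₁ < ⋯ < mᵣ < M} ∏ F_q(mᵢ; b a^{kᵢ})`, as an iterated sum, for the list
`[kᵣ, …, k₁]`. -/
noncomputable def nest (q : ℂ) : ℕ → List ℕ → ℂ
  | _, [] => 1
  | M, k :: ks => ∑ m ∈ Finset.Ico 1 M, Fq q m k * nest q m ks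

/-- The map `Z_{q,M}`, with `ħ` acting on `ℂ` as `1 - q` and
`(b a^{k₁}) ⋯ (b a^{kᵣ}) ↦ ∑_{0 < m₁ < ⋯ < mᵣ < M} ∏ F_q(mᵢ; b a^{kᵢ})`
(and zero on the monomials that start with `a`, which play no role). -/
noncomputable def ZqM (q : ℂ) (M : ℕ) (w : HH) : ℂ :=
  ((wordBasis CC).repr w).sum fun v c =>
    Polynomial.aeval (1 - q) c *
      (if (blocks v).1 = 0 then nest q M (blocks v).2.reverse else 0)

/-- The map `Z_q = lim_{M → ∞} Z_{q,M}`. -/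
noncomputable def Zq (q : ℂ) (w : HH) : ℂ := limUnder atTop fun M => ZqM q M w

/-! ### Basic facts: `Z_q` is multiplicative and `ℌ⁰` is closed under the harmonic product -/

theorem ZqM_add (q : ℂ) (M : ℕ) (x y : HH) : ZqM q M (x + y) = ZqM q M x + ZqM q M y := by
  unfold ZqM
  rw [map_add, Finsupp.sum_add_index']
  · simp
  · intro v c d
    rw [map_add, add_mul]

theorem ZqM_smul (q : ℂ) (M : ℕ) (c : CC) (x : HH) :
    ZqM q M (c • x) = Polynomial.aeval (1 - q) c * ZqM q M x := by
  unfold ZqM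
  rw [map_smul, Finsupp.sum_smul_index', Finsupp.mul_sum]
  · refine Finsupp.sum_congr fun v _ => ?_
    rw [smul_eq_mul, map_mul, mul_assoc]
  · simp

theorem ZqM_zero (q : ℂ) (M : ℕ) : ZqM q M 0 = 0 := by simp [ZqM]

theorem ZqM_cmono (q : ℂ) (M : ℕ) (ks : List ℕ) :
    ZqM q M (cmono CC ks) = nest q M ks.reverse := by
  rw [← mono_cword, ← wordBasis_apply, ZqM, Module.Basis.repr_self, Finsupp.sum_single_index]
  · simp [blocks_cword]
  · simp

/-- The span of the monomials in the letters `b a^k`, `k ≥ 0`. -/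
noncomputable def Wmod : Submodule CC HH := Submodule.span CC (Set.range (cmono CC))

theorem cmono_append (u v : List ℕ) : cmono CC (u ++ v) = cmono CC u * cmono CC v := by
  simp [cmono]

theorem cmono_single (k : ℕ) : cmono CC [k] = cl CC k := by simp [cmono]

theorem mul_cl_mem_Wmod {x : HH} (hx : x ∈ Wmod) (k : ℕ) : x * cl CC k ∈ Wmod := by
  induction hx using Submodule.span_induction with
  | mem x hx =>
    obtain ⟨u, rfl⟩ := hx
    exact Submodule.subset_span ⟨u ++ [k], by rw [cmono_append, cmono_single]⟩
  | zero => simp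
  | add x y _ _ hx hy => rw [add_mul]; exact add_mem hx hy
  | smul c x _ hx => rw [smul_mul_assoc]; exact Submodule.smul_mem _ _ hx

theorem ZqM_mul_cl (q : ℂ) (M : ℕ) {x : HH} (hx : x ∈ Wmod) (k : ℕ) :
    ZqM q M (x * cl CC k) = ∑ m ∈ Finset.Ico 1 M, Fq q m k * ZqM q m x := by
  induction hx using Submodule.span_induction with
  | mem x hx =>
    obtain ⟨u, rfl⟩ := hx
    rw [← cmono_single, ← cmono_append, ZqM_cmono]
    simp [nest, ZqM_cmono]
  | zero => simp [ZqM_zero]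
  | add x y _ _ hx hy => simp [add_mul, ZqM_add, hx, hy, mul_add, Finset.sum_add_distrib]
  | smul c x _ hx =>
    rw [smul_mul_assoc, ZqM_smul, hx, Finset.mul_sum]
    refine Finset.sum_congr rfl fun m _ => ?_
    rw [ZqM_smul]; ring

theorem harmRev_mem_Wmod (op : ℕ → ℕ → ℕ) (u v : List ℕ) :
    (harmRev op u v : HH) ∈ Wmod := by
  induction u, v using harmRev.induct with
  | case1 v => rw [harmRev]; exact Submodule.subset_span ⟨_, rfl⟩
  | case2 k u => rw [harmRev]; exact Submodule.subset_span ⟨_, rfl⟩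
  | case3 k u l v h1 h2 h3 =>
    rw [harmRev]
    exact add_mem (add_mem (mul_cl_mem_Wmod h1 _) (mul_cl_mem_Wmod h2 _)) (mul_cl_mem_Wmod h3 _)

theorem sum_mul_sum_Ico (a b : ℕ → ℂ) (M : ℕ) :
    (∑ m ∈ Finset.Ico 1 M, a m) * (∑ m ∈ Finset.Ico 1 M, b m)
      = ∑ m ∈ Finset.Ico 1 M, a m * (∑ n ∈ Finset.Ico 1 m, b n)
        + ∑ m ∈ Finset.Ico 1 M, b m * (∑ n ∈ Finset.Ico 1 m, a n)
        + ∑ m ∈ Finset.Ico 1 M, a m * b m := by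
  induction M with
  | zero => simp
  | succ M ih =>
    rcases Nat.eq_zero_or_pos M with rfl | h
    · simp
    · simp only [Finset.sum_Ico_succ_top h]
      linear_combination ih

theorem Fq_mul (q : ℂ) (m k l : ℕ) : Fq q m k * Fq q m l = Fq q m (k + l) := by
  simp only [Fq, add_mul, pow_add, div_mul_div_comm]

theorem ZqM_harmRev (q : ℂ) (M : ℕ) (u v : List ℕ) :
    ZqM q M (harmRev (fun k l => k + l) u v) = nest q M u * nest q M v := by
  induction u, v using harmRev.induct generalizing M with
  | case1 v => rw [harmRev, ZqM_cmono, List.reverse_reverse, nest, one_mul]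
  | case2 k u => rw [harmRev, ZqM_cmono, List.reverse_reverse, nest.eq_1, mul_one]
  | case3 k u l v h1 h2 h3 =>
    rw [harmRev, ZqM_add, ZqM_add, ZqM_mul_cl q M (harmRev_mem_Wmod _ _ _),
      ZqM_mul_cl q M (harmRev_mem_Wmod _ _ _), ZqM_mul_cl q M (harmRev_mem_Wmod _ _ _)]
    simp only [h1, h2, h3]
    simp only [nest]
    rw [sum_mul_sum_Ico]
    congr 1
    · congr 1
      · refine Finset.sum_congr rfl fun m _ => by ring
      · refine Finset.sum_congr rfl fun m _ => by ring
    · refine Finset.sum_congr rfl fun m _ => ?_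
      rw [← Fq_mul]; ring

theorem ZqM_hstar (q : ℂ) (M : ℕ) {x y : HH} (hx : x ∈ Wmod) (hy : y ∈ Wmod) :
    ZqM q M (hstar x y) = ZqM q M x * ZqM q M y := by
  induction hx using Submodule.span_induction with
  | mem x hx =>
    obtain ⟨u, rfl⟩ := hx
    induction hy using Submodule.span_induction with
    | mem y hy =>
      obtain ⟨v, rfl⟩ := hy
      rw [hstar, harm_cmono, ZqM_harmRev, ZqM_cmono, ZqM_cmono]
    | zero => simp [ZqM_zero]
    | add x y _ _ hx hy => rw [map_add, ZqM_add, hx, hy, ZqM_add, mul_add]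
    | smul c x _ hx => rw [map_smul, ZqM_smul, hx, ZqM_smul]; ring
  | zero => simp [ZqM_zero]
  | add x y _ _ hx hy => rw [map_add, LinearMap.add_apply, ZqM_add, hx, hy, ZqM_add, add_mul]
  | smul c x _ hx => rw [map_smul, LinearMap.smul_apply, ZqM_smul, hx, ZqM_smul]; ring

theorem exists_norm_Fq_le {q : ℂ} (hq : ‖q‖ < 1) :
    ∃ K : ℝ, 0 ≤ K ∧ ∀ m k, 1 ≤ m → ‖Fq q m k‖ ≤ (K * ‖q‖ ^ m) ^ k := by
  have h1 : 0 < ‖1 - q‖ := by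
    rw [norm_pos_iff, sub_ne_zero]
    rintro rfl
    simp at hq
  have hD : 0 < (1 - ‖q‖) / ‖1 - q‖ := div_pos (by linarith) h1
  refine ⟨((1 - ‖q‖) / ‖1 - q‖)⁻¹, (inv_pos.mpr hD).le, fun m k hm => ?_⟩
  have h2 : (1 - ‖q‖) / ‖1 - q‖ ≤ ‖qInt q m‖ := by
    rw [qInt, norm_div]
    gcongr
    have h3 : ‖q‖ ^ m ≤ ‖q‖ := pow_le_of_le_one (norm_nonneg _) hq.le (by omega)
    have h4 := norm_sub_norm_le (1 : ℂ) (q ^ m)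
    rw [norm_one, norm_pow] at h4
    linarith
  rw [Fq, norm_div, norm_pow, norm_pow, mul_comm k m, pow_mul, ← div_pow, div_eq_inv_mul]
  gcongr

theorem exists_norm_nest_le {q : ℂ} (hq : ‖q‖ < 1) (ks : List ℕ) :
    ∃ (B : ℝ) (n : ℕ), 0 ≤ B ∧ ∀ m, ‖nest q m ks‖ ≤ B * (m : ℝ) ^ n := by
  obtain ⟨K, hK, hF⟩ := exists_norm_Fq_le hq
  induction ks with
  | nil => exact ⟨1, 0, zero_le_one, fun m => by simp [nest]⟩
  | cons k ks ih =>
    obtain ⟨B, n, hB, h⟩ := ih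
    refine ⟨K ^ k * B, n + 1, by positivity, fun M => ?_⟩
    rw [nest]
    have : ∀ m ∈ Finset.Ico 1 M, ‖Fq q m k * nest q m ks‖ ≤ K ^ k * (B * (M : ℝ) ^ n) := by
      intro m hm
      rw [Finset.mem_Ico] at hm
      rw [norm_mul]
      have h1 : ‖Fq q m k‖ ≤ K ^ k := by
        refine (hF m k hm.1).trans ?_
        gcongr
        exact mul_le_of_le_one_right hK (pow_le_one₀ (norm_nonneg _) hq.le)
      have h2 : ‖nest q m ks‖ ≤ B * (M : ℝ) ^ n := by
        refine (h m).trans ?_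
        gcongr
        exact hm.2.le
      gcongr
    refine (norm_sum_le_of_le _ this).trans ?_
    rw [Finset.sum_const, Nat.card_Ico, nsmul_eq_mul]
    have h3 : ((M - 1 : ℕ) : ℝ) ≤ M := by exact_mod_cast Nat.sub_le _ _
    calc ((M - 1 : ℕ) : ℝ) * (K ^ k * (B * (M : ℝ) ^ n))
        ≤ (M : ℝ) * (K ^ k * (B * (M : ℝ) ^ n)) := by gcongr
      _ = K ^ k * B * (M : ℝ) ^ (n + 1) := by ring

theorem exists_tendsto_nest {q : ℂ} (hq : ‖q‖ < 1) {k : ℕ} (hk : 1 ≤ k) (ks : List ℕ) :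
    ∃ l : ℂ, Tendsto (fun M => nest q M (k :: ks)) atTop (𝓝 l) := by
  obtain ⟨K, hK, hF⟩ := exists_norm_Fq_le hq
  obtain ⟨B, n, hB, hn⟩ := exists_norm_nest_le hq ks
  have hs : Summable fun m : ℕ => if m = 0 then (0 : ℂ) else Fq q m k * nest q m ks := by
    have hq2 : ‖(‖q‖ : ℝ)‖ < 1 := by rwa [norm_norm]
    have hg0 : Summable fun m : ℕ => (m : ℝ) ^ n * ‖q‖ ^ m :=
      summable_pow_mul_geometric_of_norm_lt_one n hq2
    have hg : Summable fun m : ℕ => (K ^ k * B) * ((m : ℝ) ^ n * ‖q‖ ^ m) := hg0.mul_left _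
    refine Summable.of_norm_bounded hg fun m => ?_
    split_ifs with h
    · rw [norm_zero]; positivity
    · have h1 := hF m k (Nat.one_le_iff_ne_zero.mpr h)
      have h2 : (‖q‖ ^ m) ^ k ≤ ‖q‖ ^ m :=
        pow_le_of_le_one (by positivity) (pow_le_one₀ (norm_nonneg _) hq.le) (by omega)
      rw [norm_mul]
      calc ‖Fq q m k‖ * ‖nest q m ks‖ ≤ (K * ‖q‖ ^ m) ^ k * (B * (m : ℝ) ^ n) := by
            gcongr
            exact hn m
        _ = K ^ k * (‖q‖ ^ m) ^ k * (B * (m : ℝ) ^ n) := by rw [mul_pow]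
        _ ≤ K ^ k * ‖q‖ ^ m * (B * (m : ℝ) ^ n) := by gcongr
        _ = (K ^ k * B) * ((m : ℝ) ^ n * ‖q‖ ^ m) := by ring
  refine ⟨_, hs.hasSum.tendsto_sum_nat.congr fun M => ?_⟩
  rw [nest]
  rcases Nat.eq_zero_or_pos M with rfl | h
  · simp
  · rw [Finset.range_eq_Ico, Finset.sum_eq_sum_Ico_succ_bot h]
    simp only [if_true, zero_add]
    refine Finset.sum_congr rfl fun m hm => ?_
    rw [Finset.mem_Ico] at hm
    rw [if_neg (by omega)]

/-- The letters of `A`: `u_0 = ħ b` and `u_k = b a^k`, `k ≥ 1`. -/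
noncomputable def uA (k : ℕ) : HH := if k = 0 then hb • cl CC 0 else cl CC k

/-- Monomials in the letters of `A`. -/
noncomputable def uw (ks : List ℕ) : HH := (ks.map uA).prod

theorem uw_append_single (u : List ℕ) (k : ℕ) : uw (u ++ [k]) = uw u * uA k := by
  simp [uw]

theorem uA_eq_smul (k : ℕ) : ∃ c : CC, uA k = c • cl CC k := by
  unfold uA
  split_ifs with h
  · exact ⟨hb, by rw [h]⟩
  · exact ⟨1, by simp⟩

theorem uw_eq_smul (u : List ℕ) : ∃ c : CC, uw u = c • cmono CC u := by
  induction u using List.reverseRecOn with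
  | nil => exact ⟨1, by simp [uw, cmono]⟩
  | append_singleton u k ih =>
    obtain ⟨c, hc⟩ := ih
    obtain ⟨d, hd⟩ := uA_eq_smul k
    refine ⟨c * d, ?_⟩
    rw [uw_append_single, hc, hd, cmono_append, cmono_single, smul_mul_smul_comm]

theorem setA_eq : setA = Set.range uA := by
  ext x
  constructor
  · rintro (h | ⟨k, hk, h⟩)
    · exact ⟨0, by rw [Set.mem_singleton_iff.mp h]; simp [uA, cl]⟩
    · exact ⟨k, by rw [h, uA, if_neg (by omega), cl]⟩
  · rintro ⟨k, rfl⟩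
    rcases Nat.eq_zero_or_pos k with rfl | h
    · left; simp [uA, cl]
    · right; exact ⟨k, h, by rw [uA, if_neg (by omega), cl]⟩

/-- The span of the monomials in the letters of `A` that satisfy `P`. -/
noncomputable def uspan (P : List ℕ → Prop) : Submodule CC HH :=
  Submodule.span CC {x | ∃ u, P u ∧ x = uw u}

theorem CA_eq : Subalgebra.toSubmodule CA = uspan fun _ => True := by
  rw [CA, Algebra.adjoin_eq_span, uspan, setA_eq]
  congr 1
  ext x
  constructor
  · intro hx
    induction hx using Submonoid.closure_induction with
    | mem x hx =>
      obtain ⟨k, rfl⟩ := hx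
      exact ⟨[k], trivial, by simp [uw]⟩
    | one => exact ⟨[], trivial, by simp [uw]⟩
    | mul x y _ _ hx hy =>
      obtain ⟨u, -, rfl⟩ := hx
      obtain ⟨v, -, rfl⟩ := hy
      exact ⟨u ++ v, trivial, by simp [uw]⟩
  · rintro ⟨u, -, rfl⟩
    refine Submonoid.list_prod_mem _ fun x hx => ?_
    obtain ⟨k, -, rfl⟩ := List.mem_map.mp hx
    exact Submonoid.subset_closure ⟨k, rfl⟩

theorem uspan_mono {P Q : List ℕ → Prop} (h : ∀ u, P u → Q u) : uspan P ≤ uspan Q := by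
  refine Submodule.span_mono ?_
  rintro _ ⟨u, hu, rfl⟩
  exact ⟨u, h u hu, rfl⟩

theorem uspan_mul {P Q : List ℕ → Prop} {k : ℕ} (h : ∀ u, P u → Q (u ++ [k])) {x : HH}
    (hx : x ∈ uspan P) : x * uA k ∈ uspan Q := by
  induction hx using Submodule.span_induction with
  | mem x hx =>
    obtain ⟨u, hu, rfl⟩ := hx
    exact Submodule.subset_span ⟨u ++ [k], h u hu, (uw_append_single u k).symm⟩
  | zero => simp
  | add x y _ _ hx hy => rw [add_mul]; exact add_mem hx hy
  | smul c x _ hx => rw [smul_mul_assoc]; exact Submodule.smul_mem _ _ hx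

/-- `span {P} + ħ span {R}`. -/
noncomputable def vspan (P R : List ℕ → Prop) : Submodule CC HH := uspan P ⊔ hb • uspan R

theorem smul_uspan_mul {P Q : List ℕ → Prop} {k : ℕ} (h : ∀ u, P u → Q (u ++ [k])) {x : HH}
    (hx : x ∈ hb • uspan P) : x * uA k ∈ hb • uspan Q := by
  obtain ⟨y, hy, rfl⟩ := (Submodule.mem_smul_pointwise_iff_exists _ _ _).mp hx
  rw [smul_mul_assoc]
  exact Submodule.smul_mem_pointwise_smul _ _ _ (uspan_mul h hy)

theorem vspan_mul {P R P2 R2 : List ℕ → Prop} {k : ℕ} (h : ∀ u, P u → P2 (u ++ [k]))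
    (h2 : ∀ u, R u → R2 (u ++ [k])) {x : HH} (hx : x ∈ vspan P R) :
    x * uA k ∈ vspan P2 R2 := by
  obtain ⟨y, hy, t, ht, rfl⟩ := Submodule.mem_sup.mp hx
  rw [add_mul]
  exact add_mem (Submodule.mem_sup_left (uspan_mul h hy))
    (Submodule.mem_sup_right (smul_uspan_mul h2 ht))

theorem vspan_smul {P R R2 : List ℕ → Prop} (h1 : ∀ u, P u → R2 u) (h2 : ∀ u, R u → R2 u)
    {Q : List ℕ → Prop} {x : HH} (hx : x ∈ vspan P R) : hb • x ∈ vspan Q R2 := by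
  refine Submodule.mem_sup_right (Submodule.smul_mem_pointwise_smul _ _ _ ?_)
  obtain ⟨y, hy, t, ht, rfl⟩ := Submodule.mem_sup.mp hx
  refine add_mem (uspan_mono h1 hy) ?_
  obtain ⟨s, hs, rfl⟩ := (Submodule.mem_smul_pointwise_iff_exists _ _ _).mp ht
  exact Submodule.smul_mem _ _ (uspan_mono h2 hs)

theorem hstar_nil_left (x : HH) (hx : x ∈ Wmod) : hstar 1 x = x := by
  have h1 : (1 : HH) = cmono CC [] := by simp [cmono]
  induction hx using Submodule.span_induction with
  | mem x hx =>
    obtain ⟨u, rfl⟩ := hx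
    rw [h1, hstar, harm_cmono, List.reverse_nil, harmRev, List.reverse_reverse]
  | zero => simp
  | add x y _ _ hx hy => rw [map_add, hx, hy]
  | smul c x _ hx => rw [map_smul, hx]

theorem harmRev_comm (u v : List ℕ) :
    (harmRev (fun k l => k + l) u v : HH) = harmRev (fun k l => k + l) v u := by
  induction u, v using harmRev.induct with
  | case1 v =>
    rcases v with _ | ⟨l, v⟩
    · rfl
    · rw [harmRev, harmRev]
  | case2 k u => rw [harmRev, harmRev]
  | case3 k u l v h1 h2 h3 =>
    rw [harmRev, harmRev, h1, h2, h3, Nat.add_comm k l]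
    abel

theorem hstar_comm {x y : HH} (hx : x ∈ Wmod) (hy : y ∈ Wmod) : hstar x y = hstar y x := by
  induction hx using Submodule.span_induction with
  | mem x hx =>
    obtain ⟨u, rfl⟩ := hx
    induction hy using Submodule.span_induction with
    | mem y hy =>
      obtain ⟨v, rfl⟩ := hy
      rw [hstar, harm_cmono, harm_cmono, harmRev_comm]
    | zero => simp
    | add x y _ _ hx hy => rw [map_add, hx, hy, map_add, LinearMap.add_apply]
    | smul c x _ hx => rw [map_smul, hx, map_smul, LinearMap.smul_apply]
  | zero => simp
  | add x y _ _ hx hy => rw [map_add, LinearMap.add_apply, hx, hy, map_add]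
  | smul c x _ hx => rw [map_smul, LinearMap.smul_apply, hx, map_smul]

theorem hstar_cmono_append (u v : List ℕ) (k l : ℕ) :
    hstar (cmono CC (u ++ [k])) (cmono CC (v ++ [l]))
      = hstar (cmono CC u) (cmono CC (v ++ [l])) * cl CC k
        + hstar (cmono CC (u ++ [k])) (cmono CC v) * cl CC l
        + hstar (cmono CC u) (cmono CC v) * cl CC (k + l) := by
  simp only [hstar, harm_cmono, List.reverse_append, List.reverse_cons, List.reverse_nil,
    List.nil_append, List.singleton_append]
  rw [harmRev]

/-- The product `∘_ħ` of letters of `A`. -/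
noncomputable def circ (k l : ℕ) : HH :=
  if k = 0 ∨ l = 0 then hb • uA (k + l) else uA (k + l)

theorem hstar_uw_append (u v : List ℕ) (k l : ℕ) :
    hstar (uw (u ++ [k])) (uw (v ++ [l]))
      = hstar (uw u) (uw (v ++ [l])) * uA k + hstar (uw (u ++ [k])) (uw v) * uA l
        + hstar (uw u) (uw v) * circ k l := by
  obtain ⟨c, hc⟩ := uw_eq_smul u
  obtain ⟨d, hd⟩ := uw_eq_smul v
  have key : ∀ s t r : CC, uA k = s • cl CC k → uA l = t • cl CC l →
      circ k l = (s * t) • cl CC (k + l) → hstar (uw (u ++ [k])) (uw (v ++ [l]))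
      = hstar (uw u) (uw (v ++ [l])) * uA k + hstar (uw (u ++ [k])) (uw v) * uA l
        + hstar (uw u) (uw v) * circ k l := by
    intro s t r hs ht hr
    have hu : uw (u ++ [k]) = (c * s) • cmono CC (u ++ [k]) := by
      rw [uw_append_single, hc, hs, cmono_append, cmono_single, smul_mul_smul_comm]
    have hv : uw (v ++ [l]) = (d * t) • cmono CC (v ++ [l]) := by
      rw [uw_append_single, hd, ht, cmono_append, cmono_single, smul_mul_smul_comm]
    rw [hu, hv, hc, hd, hs, ht, hr]
    simp only [map_smul, LinearMap.smul_apply, hstar_cmono_append, smul_add, smul_smul, smul_mul_assoc, mul_smul_comm]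
    congr 1
    · congr 1
      · congr 1; ring
      · congr 1; ring
    · congr 1; ring
  unfold circ uA at *
  by_cases hk : k = 0 <;> by_cases hl : l = 0
  · exact key hb hb 0 (by simp [hk]) (by simp [hl]) (by simp [hk, hl, smul_smul])
  · exact key hb 1 0 (by simp [hk]) (by simp [hl]) (by simp [hk, hl])
  · exact key 1 hb 0 (by simp [hk]) (by simp [hl]) (by simp [hk, hl])
  · exact key 1 1 0 (by simp [hk]) (by simp [hl]) (by simp [hk, hl])

theorem uw_mem_Wmod (u : List ℕ) : uw u ∈ Wmod := by
  obtain ⟨c, hc⟩ := uw_eq_smul u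
  rw [hc]
  exact Submodule.smul_mem _ _ (Submodule.subset_span ⟨u, rfl⟩)

/-- The word contains the letter `u_0` and, further to the right, a letter `u_k` with `k ≥ 2`. -/
def pat (u : List ℕ) : Prop := ∃ k, 2 ≤ k ∧ List.Sublist [0, k] u

theorem pat_append (u : List ℕ) (k : ℕ) (h : pat u) : pat (u ++ [k]) := by
  obtain ⟨j, hj, h⟩ := h
  exact ⟨j, hj, h.trans (List.sublist_append_left _ _)⟩

theorem pat_of_zero_mem (u : List ℕ) (k : ℕ) (h : 0 ∈ u) (hk : 2 ≤ k) : pat (u ++ [k]) := by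
  refine ⟨k, hk, ?_⟩
  have h1 : List.Sublist [0] u := List.singleton_sublist.mpr h
  exact h1.append (List.Sublist.refl [k])

theorem pat_append_iff (u : List ℕ) (k : ℕ) (h : pat (u ++ [k])) : pat u ∨ (0 ∈ u ∧ 2 ≤ k) := by
  obtain ⟨j, hj, h⟩ := h
  obtain ⟨l1, l2, h3, h1, h2⟩ := List.sublist_append_iff.mp h
  rcases l2 with _ | ⟨x, l2⟩
  · left
    rw [List.append_nil] at h3
    exact ⟨j, hj, h3 ▸ h1⟩
  · right
    have h4 := h2.length_le
    have h5 : l2 = [] := by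
      rcases l2 with _ | _
      · rfl
      · simp at h4
    subst h5
    have h6 : l1 = [0] ∧ x = j := by
      rcases l1 with _ | ⟨y, _ | ⟨w, l1⟩⟩ <;> simp_all
    obtain ⟨rfl, rfl⟩ := h6
    refine ⟨List.singleton_sublist.mp h1, ?_⟩
    have := List.singleton_sublist.mp h2
    simp at this
    omega

theorem hstar_uw_mem (u v : List ℕ) :
    hstar (uw u) (uw v) ∈ vspan (fun _ => True) (fun _ => True) ∧
    (0 ∈ u → hstar (uw u) (uw v) ∈ vspan (fun w => 0 ∈ w) (fun _ => True)) ∧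
    (pat u → hstar (uw u) (uw v) ∈ vspan pat (fun _ => True)) := by
  have memu : ∀ (P : List ℕ → Prop) (w : List ℕ), P w → uw w ∈ vspan P (fun _ => True) :=
    fun P w h => Submodule.mem_sup_left (Submodule.subset_span ⟨w, h, rfl⟩)
  have one : uw [] = 1 := by simp [uw]
  induction u using List.reverseRecOn generalizing v with
  | nil =>
    rw [one, hstar_nil_left _ (uw_mem_Wmod v)]
    refine ⟨memu _ _ trivial, by simp, ?_⟩
    rintro ⟨k, -, h⟩
    simp at h
  | append_singleton u k ihu =>
    induction v using List.reverseRecOn with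
    | nil =>
      rw [one, hstar_comm (uw_mem_Wmod _) (one ▸ uw_mem_Wmod []),
        hstar_nil_left _ (uw_mem_Wmod _)]
      exact ⟨memu _ _ trivial, fun h => memu _ _ h, fun h => memu _ _ h⟩
    | append_singleton v l ihv =>
      obtain ⟨a0, a1, a2⟩ := ihu (v ++ [l])
      obtain ⟨b0, b1, b2⟩ := ihv
      obtain ⟨c0, c1, c2⟩ := ihu v
      rw [hstar_uw_append]
      have cc : ∀ P Q : List ℕ → Prop, (hstar (uw u) (uw v) ∈ vspan P (fun _ => True)) →
          (k ≠ 0 → l ≠ 0 → ∀ w, P w → Q (w ++ [k + l])) →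
          hstar (uw u) (uw v) * circ k l ∈ vspan Q (fun _ => True) := by
        intro P Q h hPQ
        unfold circ
        split_ifs with h0
        · rw [mul_smul_comm]
          exact vspan_smul (P := fun _ => True) (R := fun _ => True) (fun _ _ => trivial)
            (fun _ _ => trivial) (vspan_mul (fun _ _ => trivial) (fun _ _ => trivial) c0)
        · push Not at h0
          exact vspan_mul (hPQ h0.1 h0.2) (fun _ _ => trivial) h
      refine ⟨?_, ?_, ?_⟩
      · exact add_mem (add_mem (vspan_mul (fun _ _ => trivial) (fun _ _ => trivial) a0)
          (vspan_mul (fun _ _ => trivial) (fun _ _ => trivial) b0))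
          (cc _ _ c0 (fun _ _ _ _ => trivial))
      · intro h0
        have h1 : 0 ∈ u ∨ k = 0 := by
          rw [List.mem_append, List.mem_singleton] at h0
          rcases h0 with h0 | h0
          · exact Or.inl h0
          · exact Or.inr h0.symm
        refine add_mem (add_mem ?_ ?_) ?_
        · rcases h1 with h1 | h1
          · exact vspan_mul (fun w h => by simp [h]) (fun _ _ => trivial) (a1 h1)
          · exact vspan_mul (fun w h => by simp [h1]) (fun _ _ => trivial) a0
        · exact vspan_mul (fun w h => by simp [h]) (fun _ _ => trivial) (b1 h0)
        · rcases h1 with h1 | h1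
          · exact cc _ _ (c1 h1) (fun _ _ w h => by simp [h])
          · exact cc _ _ c0 (fun h => absurd h1 h)
      · intro h0
        refine add_mem (add_mem ?_ ?_) ?_
        · rcases pat_append_iff u k h0 with h1 | ⟨h1, h2⟩
          · exact vspan_mul (fun w h => pat_append w k h) (fun _ _ => trivial) (a2 h1)
          · exact vspan_mul (fun w h => pat_of_zero_mem w k h h2) (fun _ _ => trivial) (a1 h1)
        · exact vspan_mul (fun w h => pat_append w l h) (fun _ _ => trivial) (b2 h0)
        · rcases pat_append_iff u k h0 with h1 | ⟨h1, h2⟩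
          · exact cc _ _ (c2 h1) (fun _ _ w h => pat_append w _ h)
          · exact cc _ _ (c1 h1) (fun _ _ w h => pat_of_zero_mem w _ h (by omega))

/-- The last letter, if any, is `u_k` with `k ≥ j`. -/
def lastGe (j : ℕ) (u : List ℕ) : Prop := ∀ i ∈ u.getLast?, j ≤ i

theorem lastGe_append (j : ℕ) (u : List ℕ) (k : ℕ) : lastGe j (u ++ [k]) ↔ j ≤ k := by
  simp [lastGe]

theorem lastGe_nil (j : ℕ) : lastGe j [] := by simp [lastGe]

/-- Words that span `𝔫₀`. -/
def nP (u : List ℕ) : Prop := lastGe 1 u ∧ pat u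

/-- Words that span `ℌ⁰` modulo `ħ`. -/
def hP (u : List ℕ) : Prop := lastGe 2 u ∨ nP u

theorem lastGe_one_of_hP (u : List ℕ) (h : hP u) : lastGe 1 u := by
  rcases h with h | h
  · intro i hi
    have := h i hi
    omega
  · exact h.1

theorem hstar_uw_mem_of_last (u v : List ℕ) (hu : lastGe 1 u) (hv : lastGe 1 v) :
    hstar (uw u) (uw v) ∈ vspan (lastGe 1) (lastGe 1) ∧
    (nP u → hstar (uw u) (uw v) ∈ vspan nP (lastGe 1)) ∧
    (lastGe 2 u → lastGe 2 v → hstar (uw u) (uw v) ∈ vspan hP (lastGe 1)) := by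
  have memu : ∀ (P R : List ℕ → Prop) (w : List ℕ), P w → uw w ∈ vspan P R :=
    fun P R w h => Submodule.mem_sup_left (Submodule.subset_span ⟨w, h, rfl⟩)
  have one : uw [] = 1 := by simp [uw]
  rcases List.eq_nil_or_concat u with rfl | ⟨u, k, rfl⟩
  · rw [one, hstar_nil_left _ (uw_mem_Wmod v)]
    refine ⟨memu _ _ _ hv, ?_, fun _ h => memu _ _ _ (Or.inl h)⟩
    rintro ⟨-, k, -, h⟩
    simp at h
  rcases List.eq_nil_or_concat v with rfl | ⟨v, l, rfl⟩
  · rw [one, hstar_comm (uw_mem_Wmod _) (one ▸ uw_mem_Wmod []),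
        hstar_nil_left _ (uw_mem_Wmod _)]
    exact ⟨memu _ _ _ hu, fun h => memu _ _ _ h, fun h _ => memu _ _ _ (Or.inl h)⟩
  simp only [List.concat_eq_append] at hu hv ⊢
  rw [lastGe_append] at hu hv
  obtain ⟨a0, a1, a2⟩ := hstar_uw_mem u (v ++ [l])
  obtain ⟨b0, b1, b2⟩ := hstar_uw_mem (u ++ [k]) v
  obtain ⟨c0, c1, c2⟩ := hstar_uw_mem u v
  have hc : circ k l = uA (k + l) := by
    rw [circ, if_neg (by omega)]
  have l1 : ∀ j i, j ≤ i → ∀ w : List ℕ, True → lastGe j (w ++ [i]) :=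
    fun j i h w _ => (lastGe_append j w i).mpr h
  rw [hstar_uw_append, hc]
  refine ⟨?_, ?_, ?_⟩
  · exact add_mem (add_mem (vspan_mul (l1 1 k hu) (l1 1 k hu) a0)
      (vspan_mul (l1 1 l hv) (l1 1 l hv) b0))
      (vspan_mul (l1 1 _ (by omega)) (l1 1 _ (by omega)) c0)
  · rintro ⟨-, h0⟩
    have p1 : ∀ i, 1 ≤ i → ∀ w, pat w → nP (w ++ [i]) :=
      fun i hi w h => ⟨(lastGe_append 1 w i).mpr hi, pat_append w i h⟩
    have p2 : ∀ i, 2 ≤ i → ∀ w, 0 ∈ w → nP (w ++ [i]) :=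
      fun i hi w h => ⟨(lastGe_append 1 w i).mpr (by omega), pat_of_zero_mem w i h hi⟩
    refine add_mem (add_mem ?_ (vspan_mul (p1 l hv) (l1 1 l hv) (b2 h0))) ?_
    · rcases pat_append_iff u k h0 with h1 | ⟨h1, h2⟩
      · exact vspan_mul (p1 k hu) (l1 1 k hu) (a2 h1)
      · exact vspan_mul (p2 k h2) (l1 1 k hu) (a1 h1)
    · rcases pat_append_iff u k h0 with h1 | ⟨h1, h2⟩
      · exact vspan_mul (p1 _ (by omega)) (l1 1 _ (by omega)) (c2 h1)
      · exact vspan_mul (p2 _ (by omega)) (l1 1 _ (by omega)) (c1 h1)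
  · intro h1 h2
    rw [lastGe_append] at h1 h2
    have p : ∀ i, 2 ≤ i → ∀ w : List ℕ, True → hP (w ++ [i]) :=
      fun i hi w _ => Or.inl ((lastGe_append 2 w i).mpr hi)
    exact add_mem (add_mem (vspan_mul (p k h1) (l1 1 k hu) a0)
      (vspan_mul (p l h2) (l1 1 l hv) b0))
      (vspan_mul (p _ (by omega)) (l1 1 _ (by omega)) c0)

theorem mul_g_mem {Q : List ℕ → Prop} {j : ℕ} (hj : 1 ≤ j)
    (h : ∀ (u : List ℕ) (k : ℕ), j ≤ k → Q (u ++ [k])) (h0 : Q []) :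
    Submodule.span CC ({1} ∪ {x | ∃ w ∈ CA, ∃ k : ℕ, j ≤ k ∧ x = w * g k}) ≤ uspan Q := by
  rw [Submodule.span_le]
  rintro x (hx | ⟨w, hw, k, hk, rfl⟩)
  · rw [Set.mem_singleton_iff.mp hx]
    exact Submodule.subset_span ⟨[], h0, by simp [uw]⟩
  · have hw2 : w ∈ uspan fun _ => True := by
      rw [← CA_eq]; exact hw
    have hg : g k = uA k := by rw [uA, if_neg (by omega), g, cl]
    rw [hg]
    exact uspan_mul (fun u _ => h u k hk) hw2

theorem span_lastGe {j : ℕ} (hj : 1 ≤ j) :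
    Submodule.span CC ({1} ∪ {x | ∃ w ∈ CA, ∃ k : ℕ, j ≤ k ∧ x = w * g k})
      = uspan (lastGe j) := by
  refine le_antisymm
    (mul_g_mem hj (fun u k hk => (lastGe_append j u k).mpr hk) (lastGe_nil j)) ?_
  rw [uspan, Submodule.span_le]
  rintro x ⟨u, hu, rfl⟩
  refine Submodule.subset_span ?_
  rcases List.eq_nil_or_concat u with rfl | ⟨v, k, rfl⟩
  · left; simp [uw]
  · right
    rw [List.concat_eq_append] at hu ⊢
    rw [lastGe_append] at hu
    refine ⟨uw v, ?_, k, hu, ?_⟩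
    · rw [← Subalgebra.mem_toSubmodule, CA_eq]
      exact Submodule.subset_span ⟨v, trivial, rfl⟩
    · rw [uw_append_single, uA, if_neg (by omega), g, cl]

theorem Hhat_eq : Hhat = uspan (lastGe 1) := span_lastGe le_rfl

/-- A recursive form of the condition on the pairs `(α_i, β_i)`. -/
def pairCond : List (ℕ × ℕ) → Prop
  | [] => False
  | p :: L => (1 ≤ p.1 ∧ ∃ r ∈ p :: L, 1 ≤ r.2) ∨ pairCond L

theorem pairCond_iff (L : List (ℕ × ℕ)) :
    (∃ s t : Fin L.length, s ≤ t ∧ 1 ≤ (L.get s).1 ∧ 1 ≤ (L.get t).2) ↔ pairCond L := by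
  induction L with
  | nil => simp [pairCond]
  | cons p L ih =>
    rw [pairCond, ← ih]
    constructor
    · rintro ⟨s, t, hst, hs, ht⟩
      induction s using Fin.cases with
      | zero => exact Or.inl ⟨hs, (p :: L).get t, List.get_mem _ _, ht⟩
      | succ s =>
        induction t using Fin.cases with
        | zero => exact absurd hst (by simp)
        | succ t => exact Or.inr ⟨s, t, Fin.succ_le_succ_iff.mp hst, hs, ht⟩
    · rintro (⟨hp, r, hr, h⟩ | ⟨s, t, hst, hs, ht⟩)
      · obtain ⟨t, rfl⟩ := List.get_of_mem hr
        exact ⟨⟨0, by simp⟩, t, by simp, hp, h⟩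
      · exact ⟨s.succ, t.succ, Fin.succ_le_succ_iff.mpr hst, hs, ht⟩

/-- The monomial attached to a list of pairs. -/
noncomputable def pairMono (L : List (ℕ × ℕ)) : HH :=
  (L.map fun p => (e 1 - g 1) ^ p.1 * g (p.2 + 1)).prod

theorem e_sub_g : e 1 - g 1 = uA 0 := by
  simp only [e, g, uA, cl, if_true, pow_zero, mul_one, pow_one, mul_add, add_sub_cancel_left,
    Nat.sub_self]
  rw [Algebra.smul_def, Algebra.commutes]

theorem g_succ_eq (k : ℕ) : g (k + 1) = uA (k + 1) := by
  rw [uA, if_neg (by omega), g, cl]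

theorem exists_pairs (u : List ℕ) (hu : lastGe 1 u) :
    ∃ L : List (ℕ × ℕ), uw u = pairMono L ∧ (u ≠ [] → L ≠ []) ∧
      ((∃ k ∈ u, 2 ≤ k) → ∃ r ∈ L, 1 ≤ r.2) ∧ (pat u → pairCond L) := by
  induction u with
  | nil =>
    refine ⟨[], by simp [uw, pairMono], by simp, by simp, ?_⟩
    rintro ⟨k, -, h⟩
    simp at h
  | cons k u ih =>
    have hu2 : lastGe 1 u := by
      intro i hi
      refine hu i ?_
      rcases u with _ | ⟨x, u⟩
      · simp at hi
      · rwa [List.getLast?_cons_cons]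
    obtain ⟨L, h1, h2, h3, h4⟩ := ih hu2
    rcases k with _ | k
    · have hne : u ≠ [] := by
        rintro rfl
        have := hu 0 (by simp)
        omega
      obtain ⟨p, L, rfl⟩ : ∃ p M, L = p :: M := by
        rcases L with _ | ⟨p, L⟩
        · exact absurd rfl (h2 hne)
        · exact ⟨p, L, rfl⟩
      have h5 : (∃ k ∈ (0 :: u), 2 ≤ k) → ∃ r ∈ (p.1 + 1, p.2) :: L, 1 ≤ r.2 := by
        rintro ⟨k, hk, hk2⟩
        rw [List.mem_cons] at hk
        rcases hk with hk | hk
        · omega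
        · obtain ⟨r, hr, hr2⟩ := h3 ⟨k, hk, hk2⟩
          rw [List.mem_cons] at hr
          rcases hr with rfl | hr
          · exact ⟨_, List.mem_cons_self, hr2⟩
          · exact ⟨r, List.mem_cons_of_mem _ hr, hr2⟩
      refine ⟨(p.1 + 1, p.2) :: L, ?_, by simp, h5, ?_⟩
      · have : uw (0 :: u) = uA 0 * uw u := by simp [uw]
        rw [this, h1]
        simp [pairMono, e_sub_g, pow_succ', mul_assoc]
      · rintro ⟨k, hk, h⟩
        refine Or.inl ⟨by simp, h5 ⟨k, ?_, hk⟩⟩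
        exact h.subset (by simp)
    · refine ⟨(0, k) :: L, ?_, by simp, ?_, ?_⟩
      · have : uw ((k + 1) :: u) = uA (k + 1) * uw u := by simp [uw]
        rw [this, h1]
        simp [pairMono, g_succ_eq]
      · rintro ⟨j, hj, hj2⟩
        rw [List.mem_cons] at hj
        rcases hj with rfl | hj
        · exact ⟨_, List.mem_cons_self, by simp only; omega⟩
        · obtain ⟨r, hr, hr2⟩ := h3 ⟨j, hj, hj2⟩
          exact ⟨r, List.mem_cons_of_mem _ hr, hr2⟩
      · rintro ⟨j, hj, h⟩
        refine Or.inr (h4 ⟨j, hj, ?_⟩)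
        rcases List.sublist_cons_iff.mp h with h | ⟨r, hr, -⟩
        · exact h
        · simp at hr

/-- The word attached to a list of pairs. -/
def pairWord (L : List (ℕ × ℕ)) : List ℕ :=
  L.flatMap fun p => List.replicate p.1 0 ++ [p.2 + 1]

theorem pairWord_spec (L : List (ℕ × ℕ)) :
    uw (pairWord L) = pairMono L ∧ lastGe 1 (pairWord L) ∧
      (∀ r ∈ L, r.2 + 1 ∈ pairWord L) ∧ (pairCond L → pat (pairWord L)) := by
  induction L with
  | nil => simp [pairWord, uw, pairMono, lastGe, pairCond]
  | cons p L ih =>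
    obtain ⟨h1, h2, h3, h4⟩ := ih
    have hc : pairWord (p :: L) = List.replicate p.1 0 ++ ((p.2 + 1) :: pairWord L) := by
      simp [pairWord]
    have h5 : ∀ r ∈ p :: L, r.2 + 1 ∈ (p.2 + 1) :: pairWord L := by
      intro r hr
      rw [List.mem_cons] at hr
      rcases hr with rfl | hr
      · exact List.mem_cons_self
      · exact List.mem_cons_of_mem _ (h3 r hr)
    refine ⟨?_, ?_, ?_, ?_⟩
    · have : uw (pairWord (p :: L)) = uA 0 ^ p.1 * (uA (p.2 + 1) * uw (pairWord L)) := by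
        simp [hc, uw]
      rw [this, h1]
      simp only [pairMono, e_sub_g, List.map_cons, List.prod_cons]
      rw [g_succ_eq p.2, mul_assoc]
    · rw [hc]
      intro i hi
      rcases hL : pairWord L with _ | ⟨x, M⟩
      · simp [hL] at hi
        omega
      · refine h2 i ?_
        simpa [hL] using hi
    · intro r hr
      rw [hc]
      exact List.mem_append_right _ (h5 r hr)
    · rintro (⟨hp, r, hr, h⟩ | h)
      · refine ⟨r.2 + 1, by omega, ?_⟩
        rw [hc]
        have a1 : List.Sublist [0] (List.replicate p.1 0) :=
          List.singleton_sublist.mpr (List.mem_replicate.mpr ⟨by omega, rfl⟩)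
        exact a1.append (List.singleton_sublist.mpr (h5 r hr))
      · obtain ⟨k, hk, hs⟩ := h4 h
        refine ⟨k, hk, hs.trans ?_⟩
        rw [hc]
        exact (List.sublist_cons_self _ _).trans (List.sublist_append_right _ _)

theorem nZero_eq : nZero = uspan nP := by
  apply le_antisymm
  · rw [nZero, Submodule.span_le]
    rintro x ⟨L, hL, rfl⟩
    obtain ⟨h1, h2, -, h4⟩ := pairWord_spec L
    exact Submodule.subset_span ⟨pairWord L, ⟨h2, h4 ((pairCond_iff L).mp hL)⟩, h1.symm⟩
  · rw [uspan, Submodule.span_le]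
    rintro x ⟨u, ⟨h1, h2⟩, rfl⟩
    obtain ⟨L, h3, -, -, h4⟩ := exists_pairs u h1
    exact Submodule.subset_span ⟨L, (pairCond_iff L).mpr (h4 h2), h3⟩

theorem nMod_eq : nMod = vspan nP (lastGe 1) := by
  rw [nMod, nZero_eq, Hhat_eq, vspan]

theorem HZero_eq : HZero = vspan hP (lastGe 1) := by
  rw [HZero, nMod_eq, span_lastGe one_le_two, vspan, vspan, ← sup_assoc]
  congr 1
  rw [uspan, uspan, uspan, ← Submodule.span_union]
  congr 1
  ext x
  constructor
  · rintro (⟨u, hu, rfl⟩ | ⟨u, hu, rfl⟩)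
    · exact ⟨u, Or.inl hu, rfl⟩
    · exact ⟨u, Or.inr hu, rfl⟩
  · rintro ⟨u, hu | hu, rfl⟩
    · exact Or.inl ⟨u, hu, rfl⟩
    · exact Or.inr ⟨u, hu, rfl⟩

theorem smul_uspan_le (P : List ℕ → Prop) : hb • uspan P ≤ uspan P := by
  intro x hx
  obtain ⟨y, hy, rfl⟩ := (Submodule.mem_smul_pointwise_iff_exists _ _ _).mp hx
  exact Submodule.smul_mem _ _ hy

theorem nMod_le_HZero : nMod ≤ HZero := le_sup_right

theorem HZero_le_Hhat : HZero ≤ Hhat := by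
  rw [HZero_eq, Hhat_eq, vspan]
  exact sup_le (uspan_mono lastGe_one_of_hP) (smul_uspan_le _)

theorem uspan_le_Wmod (P : List ℕ → Prop) : uspan P ≤ Wmod := by
  rw [uspan, Submodule.span_le]
  rintro _ ⟨u, -, rfl⟩
  exact uw_mem_Wmod u

theorem Hhat_le_Wmod : Hhat ≤ Wmod := by rw [Hhat_eq]; exact uspan_le_Wmod _

theorem hstar_uspan {P Q : List ℕ → Prop} {V : Submodule CC HH}
    (h : ∀ u v, P u → Q v → hstar (uw u) (uw v) ∈ V) {x y : HH} (hx : x ∈ uspan P)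
    (hy : y ∈ uspan Q) : hstar x y ∈ V := by
  induction hx using Submodule.span_induction with
  | mem x hx =>
    obtain ⟨u, hu, rfl⟩ := hx
    induction hy using Submodule.span_induction with
    | mem y hy =>
      obtain ⟨v, hv, rfl⟩ := hy
      exact h u v hu hv
    | zero => simp
    | add x y _ _ hx hy => rw [map_add]; exact add_mem hx hy
    | smul c x _ hx => rw [map_smul]; exact Submodule.smul_mem _ _ hx
  | zero => simp
  | add x y _ _ hx hy => rw [map_add]; exact add_mem hx hy
  | smul c x _ hx => rw [map_smul]; exact Submodule.smul_mem _ _ hx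

theorem hstar_vspan {P Q T : List ℕ → Prop} (hP1 : ∀ u, P u → lastGe 1 u)
    (hQ1 : ∀ u, Q u → lastGe 1 u)
    (h : ∀ u v, P u → Q v → hstar (uw u) (uw v) ∈ vspan T (lastGe 1)) {x y : HH}
    (hx : x ∈ vspan P (lastGe 1)) (hy : y ∈ vspan Q (lastGe 1)) :
    hstar x y ∈ vspan T (lastGe 1) := by
  have h1 : ∀ {x y : HH}, x ∈ uspan (lastGe 1) → y ∈ uspan (lastGe 1) →
      hb • hstar x y ∈ vspan T (lastGe 1) := fun hx hy =>
    vspan_smul (P := lastGe 1) (R := lastGe 1) (fun _ h => h) (fun _ h => h)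
      (hstar_uspan (fun u v hu hv => (hstar_uw_mem_of_last u v hu hv).1) hx hy)
  obtain ⟨x1, hx1, x2, hx2, rfl⟩ := Submodule.mem_sup.mp hx
  obtain ⟨y1, hy1, y2, hy2, rfl⟩ := Submodule.mem_sup.mp hy
  obtain ⟨x3, hx3, rfl⟩ := (Submodule.mem_smul_pointwise_iff_exists _ _ _).mp hx2
  obtain ⟨y3, hy3, rfl⟩ := (Submodule.mem_smul_pointwise_iff_exists _ _ _).mp hy2
  have h2 : hstar (x1 + hb • x3) (y1 + hb • y3)
      = hstar x1 y1 + hb • hstar x1 y3 + hb • hstar x3 (y1 + hb • y3) := by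
    simp only [map_add, LinearMap.add_apply, map_smul, LinearMap.smul_apply,
      smul_add]
    abel
  rw [h2]
  refine add_mem (add_mem (hstar_uspan h hx1 hy1) ?_) ?_
  · exact h1 (uspan_mono hP1 hx1) hy3
  · exact h1 hx3 (add_mem (uspan_mono hQ1 hy1) (Submodule.smul_mem _ _ hy3))

theorem hstar_mem_nMod {x y : HH} (hx : x ∈ nMod) (hy : y ∈ Hhat) : hstar x y ∈ nMod := by
  rw [nMod_eq] at hx ⊢
  rw [Hhat_eq] at hy
  exact hstar_vspan (Q := lastGe 1) (fun _ h => h.1) (fun _ h => h)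
    (fun u v hu hv => (hstar_uw_mem_of_last u v hu.1 hv).2.1 hu) hx (Submodule.mem_sup_left hy)

theorem hstar_mem_HZero {x y : HH} (hx : x ∈ HZero) (hy : y ∈ HZero) : hstar x y ∈ HZero := by
  rw [HZero_eq] at hx hy ⊢
  refine hstar_vspan lastGe_one_of_hP lastGe_one_of_hP (fun u v hu hv => ?_) hx hy
  have hu1 := lastGe_one_of_hP u hu
  have hv1 := lastGe_one_of_hP v hv
  have up : vspan nP (lastGe 1) ≤ vspan hP (lastGe 1) :=
    sup_le_sup_right (uspan_mono fun _ h => Or.inr h) _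
  rcases hu with hu | hu
  · rcases hv with hv | hv
    · exact (hstar_uw_mem_of_last u v hu1 hv1).2.2 hu hv
    · rw [hstar_comm (uw_mem_Wmod _) (uw_mem_Wmod _)]
      exact up ((hstar_uw_mem_of_last v u hv1 hu1).2.1 hv)
  · exact up ((hstar_uw_mem_of_last u v hu1 hv1).2.1 hu)

theorem exists_tendsto_ZqM {q : ℂ} (hq : ‖q‖ < 1) {x : HH} (hx : x ∈ Hhat) :
    ∃ l : ℂ, Tendsto (fun M => ZqM q M x) atTop (𝓝 l) := by
  rw [Hhat_eq] at hx
  induction hx using Submodule.span_induction with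
  | mem x hx =>
    obtain ⟨u, hu, rfl⟩ := hx
    obtain ⟨c, hc⟩ := uw_eq_smul u
    have h : ∃ l : ℂ, Tendsto (fun M => nest q M u.reverse) atTop (𝓝 l) := by
      rcases List.eq_nil_or_concat u with rfl | ⟨v, k, rfl⟩
      · exact ⟨1, by simp [nest]⟩
      · rw [List.concat_eq_append] at hu ⊢
        rw [lastGe_append] at hu
        rw [List.reverse_append]
        exact exists_tendsto_nest hq hu _
    obtain ⟨l, hl⟩ := h
    refine ⟨Polynomial.aeval (1 - q) c * l, (hl.const_mul _).congr fun M => ?_⟩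
    rw [hc, ZqM_smul, ZqM_cmono]
  | zero => exact ⟨0, by simp [ZqM_zero]⟩
  | add x y _ _ hx hy =>
    obtain ⟨l, hl⟩ := hx
    obtain ⟨m, hm⟩ := hy
    exact ⟨l + m, (hl.add hm).congr fun M => (ZqM_add q M x y).symm⟩
  | smul c x _ hx =>
    obtain ⟨l, hl⟩ := hx
    exact ⟨_, (hl.const_mul _).congr fun M => (ZqM_smul q M c x).symm⟩

theorem tendsto_ZqM {q : ℂ} (hq : ‖q‖ < 1) {x : HH} (hx : x ∈ Hhat) :
    Tendsto (fun M => ZqM q M x) atTop (𝓝 (Zq q x)) :=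
  tendsto_nhds_limUnder (exists_tendsto_ZqM hq hx)

theorem Zq_add {q : ℂ} (hq : ‖q‖ < 1) {x y : HH} (hx : x ∈ Hhat) (hy : y ∈ Hhat) :
    Zq q (x + y) = Zq q x + Zq q y :=
  tendsto_nhds_unique (tendsto_ZqM hq (add_mem hx hy))
    (((tendsto_ZqM hq hx).add (tendsto_ZqM hq hy)).congr fun M => (ZqM_add q M x y).symm)

theorem Zq_smul {q : ℂ} (hq : ‖q‖ < 1) (c : CC) {x : HH} (hx : x ∈ Hhat) :
    Zq q (c • x) = Polynomial.aeval (1 - q) c * Zq q x :=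
  tendsto_nhds_unique (tendsto_ZqM hq (Submodule.smul_mem _ c hx))
    (((tendsto_ZqM hq hx).const_mul _).congr fun M => (ZqM_smul q M c x).symm)

theorem hstar_mem_Hhat {x y : HH} (hx : x ∈ Hhat) (hy : y ∈ Hhat) : hstar x y ∈ Hhat := by
  rw [Hhat_eq] at hx hy ⊢
  refine hstar_uspan (fun u v hu hv => ?_) hx hy
  have h : vspan (lastGe 1) (lastGe 1) ≤ uspan (lastGe 1) := sup_le le_rfl (smul_uspan_le _)
  exact h (hstar_uw_mem_of_last u v hu hv).1

theorem Zq_hstar {q : ℂ} (hq : ‖q‖ < 1) {x y : HH} (hx : x ∈ Hhat) (hy : y ∈ Hhat) :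
    Zq q (hstar x y) = Zq q x * Zq q y :=
  tendsto_nhds_unique (tendsto_ZqM hq (hstar_mem_Hhat hx hy))
    (((tendsto_ZqM hq hx).mul (tendsto_ZqM hq hy)).congr fun M =>
      (ZqM_hstar q M (Hhat_le_Wmod hx) (Hhat_le_Wmod hy)).symm)

theorem one_mem_HZero : (1 : HH) ∈ HZero :=
  Submodule.mem_sup_left (Submodule.subset_span (Or.inl rfl))

theorem Zq_one {q : ℂ} (hq : ‖q‖ < 1) : Zq q 1 = 1 := by
  refine tendsto_nhds_unique (tendsto_ZqM hq (HZero_le_Hhat one_mem_HZero)) ?_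
  have h : ∀ M, ZqM q M 1 = 1 := by
    intro M
    have h1 : (1 : HH) = cmono CC [] := by simp [cmono]
    rw [h1, ZqM_cmono]
    simp [nest]
  simp [h]

/-! ### The algebra `𝒵_q` and its ideals -/

/-- `𝒵_q = Z_q(ℌ⁰)`. -/
noncomputable def Zalg (q : ℂ) (hq : ‖q‖ < 1) : Subalgebra ℚ ℂ where
  carrier := Zq q '' HZero
  mul_mem' := by
    rintro _ _ ⟨x, hx, rfl⟩ ⟨y, hy, rfl⟩
    exact ⟨hstar x y, hstar_mem_HZero hx hy,
      Zq_hstar hq (HZero_le_Hhat hx) (HZero_le_Hhat hy)⟩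
  add_mem' := by
    rintro _ _ ⟨x, hx, rfl⟩ ⟨y, hy, rfl⟩
    exact ⟨x + y, add_mem hx hy, Zq_add hq (HZero_le_Hhat hx) (HZero_le_Hhat hy)⟩
  algebraMap_mem' := by
    intro r
    refine ⟨Polynomial.C r • 1, Submodule.smul_mem _ _ one_mem_HZero, ?_⟩
    rw [Zq_smul hq _ (HZero_le_Hhat one_mem_HZero), Zq_one hq]
    simp

/-- The ideal `𝒩_q = Z_q(𝔫)` of `𝒵_q`. -/
noncomputable def Nideal (q : ℂ) (hq : ‖q‖ < 1) : Ideal (Zalg q hq) where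
  carrier := {z | (z : ℂ) ∈ Zq q '' nMod}
  zero_mem' := by
    refine ⟨0, Submodule.zero_mem _, ?_⟩
    have := Zq_smul hq 0 (HZero_le_Hhat one_mem_HZero)
    simpa using this
  add_mem' := by
    rintro a b ⟨x, hx, hxa⟩ ⟨y, hy, hyb⟩
    refine ⟨x + y, add_mem hx hy, ?_⟩
    rw [Zq_add hq (HZero_le_Hhat (nMod_le_HZero hx)) (HZero_le_Hhat (nMod_le_HZero hy)), hxa, hyb]
    rfl
  smul_mem' := by
    rintro ⟨c, y, hy, hyc⟩ a ⟨x, hx, hxa⟩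
    refine ⟨hstar x y, hstar_mem_nMod hx (HZero_le_Hhat hy), ?_⟩
    rw [Zq_hstar hq (HZero_le_Hhat (nMod_le_HZero hx)) (HZero_le_Hhat hy), hxa, mul_comm]
    exact congrArg (· * (a : ℂ)) hyc

/-- The ideal `𝒫_q` of `𝒵_q` generated by `Z_q(g_{2k})`, `k ≥ 1`. -/
noncomputable def Pideal (q : ℂ) (hq : ‖q‖ < 1) : Ideal (Zalg q hq) :=
  Ideal.span {z | ∃ k : ℕ, 1 ≤ k ∧ (z : ℂ) = Zq q (g (2 * k))}

/-- The quotient `𝒵_q / (𝒩_q + 𝒫_q)`. -/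
abbrev Zquot (q : ℂ) (hq : ‖q‖ < 1) : Type := Zalg q hq ⧸ (Nideal q hq ⊔ Pideal q hq)

/-! ### The element `w_ħ^{S,∗}(g_k)` belongs to `ℌ⁰` -/

/-- `g_k = g_{k₁} ⋯ g_{kᵣ}` for an index. -/
noncomputable def gI (k : Index) : HH := (k.map fun i : ℕ+ => g i).prod

theorem gI_eq (k : Index) : gI k = cmono CC (k.map fun i : ℕ+ => (i : ℕ)) := by
  simp only [gI, cmono, List.map_map]
  rfl

/-- The span of the monomials in the letters `g_k`, `k ≥ 1`. -/
noncomputable def Gmod : Submodule CC HH :=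
  Submodule.span CC {x | ∃ u : List ℕ, (∀ k ∈ u, 1 ≤ k) ∧ x = cmono CC u}

/-- Removal of a last letter `g_1`. -/
noncomputable def delta : HH →ₗ[CC] HH :=
  cext fun ks => if ks.getLast? = some 1 then cmono CC ks.dropLast else 0

theorem delta_mul_cl {x : HH} (hx : x ∈ Wmod) (k : ℕ) :
    delta (x * cl CC k) = if k = 1 then x else 0 := by
  induction hx using Submodule.span_induction with
  | mem x hx =>
    obtain ⟨u, rfl⟩ := hx
    rw [← cmono_single, ← cmono_append, delta, cext_cmono]
    simp
  | zero => simp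
  | add x y _ _ hx hy =>
    rw [add_mul, map_add, hx, hy]
    split_ifs <;> simp
  | smul c x _ hx =>
    rw [smul_mul_assoc, map_smul, hx]
    split_ifs <;> simp

theorem delta_one : delta 1 = 0 := by
  have h1 : (1 : HH) = cmono CC [] := by simp [cmono]
  rw [h1, delta, cext_cmono]
  simp

theorem hstar_cmono_mem_Wmod (u v : List ℕ) : hstar (cmono CC u) (cmono CC v) ∈ Wmod := by
  rw [hstar, harm_cmono]
  exact harmRev_mem_Wmod _ _ _

theorem delta_hstar (u v : List ℕ) (hu : ∀ k ∈ u, 1 ≤ k) (hv : ∀ k ∈ v, 1 ≤ k) :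
    delta (hstar (cmono CC u) (cmono CC v))
      = hstar (delta (cmono CC u)) (cmono CC v) + hstar (cmono CC u) (delta (cmono CC v)) := by
  have h1 : cmono CC [] = (1 : HH) := by simp [cmono]
  have mem : ∀ w, cmono CC w ∈ Wmod := fun w => Submodule.subset_span ⟨w, rfl⟩
  have hd : ∀ w, delta (cmono CC w) ∈ Wmod := by
    intro w
    rw [delta, cext_cmono]
    split_ifs
    · exact mem _
    · exact Submodule.zero_mem _
  rcases List.eq_nil_or_concat u with rfl | ⟨u, k, rfl⟩
  · rw [h1, hstar_nil_left _ (mem v), delta_one, hstar_nil_left _ (hd v)]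
    simp
  rcases List.eq_nil_or_concat v with rfl | ⟨v, l, rfl⟩
  · have hone : (1 : HH) ∈ Wmod := h1 ▸ mem []
    rw [h1, hstar_comm (mem _) hone, hstar_nil_left _ (mem _), delta_one,
      hstar_comm (hd _) hone, hstar_nil_left _ (hd _)]
    simp
  simp only [List.concat_eq_append] at hu hv ⊢
  have hk : 1 ≤ k := hu k (by simp)
  have hl : 1 ≤ l := hv l (by simp)
  rw [hstar_cmono_append, map_add, map_add, delta_mul_cl (hstar_cmono_mem_Wmod _ _),
    delta_mul_cl (hstar_cmono_mem_Wmod _ _), delta_mul_cl (hstar_cmono_mem_Wmod _ _),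
    if_neg (by omega : ¬ k + l = 1), add_zero]
  rw [cmono_append u [k], cmono_append v [l], cmono_single, cmono_single, delta_mul_cl (mem _),
    delta_mul_cl (mem _)]
  split_ifs <;> simp

theorem psiStar_cons (k : ℕ) (ks : List ℕ) :
    psiStar (cmono CC (k :: ks)) = (-1 : CC) ^ k • (psiStar (cmono CC ks) * cl CC k) := by
  rw [psiStar, cext_cmono, cext_cmono, List.reverse_cons, List.map_append, List.prod_append,
    List.map_singleton, List.prod_singleton, cl]
  rcases k.even_or_odd with h | h <;> simp [h.neg_pow]

theorem psiStar_nil : psiStar (cmono CC []) = 1 := by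
  rw [psiStar, cext_cmono]
  simp

theorem psiStar_cmono (ks : List ℕ) :
    ∃ c : CC, psiStar (cmono CC ks) = c • cmono CC ks.reverse := by
  induction ks with
  | nil => exact ⟨1, by rw [psiStar_nil]; simp [cmono]⟩
  | cons k ks ih =>
    obtain ⟨c, hc⟩ := ih
    refine ⟨(-1) ^ k * c, ?_⟩
    rw [psiStar_cons, hc, List.reverse_cons, cmono_append, cmono_single, smul_mul_assoc, smul_smul]

theorem psiStar_mem_Wmod (ks : List ℕ) : psiStar (cmono CC ks) ∈ Wmod := by
  obtain ⟨c, hc⟩ := psiStar_cmono ks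
  rw [hc]
  exact Submodule.smul_mem _ _ (Submodule.subset_span ⟨_, rfl⟩)

theorem delta_wStar (ks : List ℕ) (hks : ∀ k ∈ ks, 1 ≤ k) :
    delta (wStar (cmono CC ks)) = 0 := by
  have hT : ∀ i, delta (hstar (cmono CC (ks.take i)) (psiStar (cmono CC (ks.drop i))))
      = hstar (delta (cmono CC (ks.take i))) (psiStar (cmono CC (ks.drop i)))
        + hstar (cmono CC (ks.take i)) (delta (psiStar (cmono CC (ks.drop i)))) := by
    intro i
    obtain ⟨c, hc⟩ := psiStar_cmono (ks.drop i)
    rw [hc]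
    simp only [map_smul]
    rw [delta_hstar _ _ (fun k hk => hks k (List.mem_of_mem_take hk))
      (fun k hk => hks k (List.mem_of_mem_drop (List.mem_reverse.mp hk))), smul_add]
  rw [wStar, wS, cext_cmono, map_sum, Finset.sum_congr rfl fun i _ => hT i,
    Finset.sum_add_distrib, Finset.sum_range_succ', Finset.sum_range_succ (n := ks.length)]
  have e1 : delta (cmono CC (ks.take 0)) = 0 := by
    have h1 : cmono CC (ks.take 0) = (1 : HH) := by simp [cmono]
    rw [h1, delta_one]
  have e2 : delta (psiStar (cmono CC (ks.drop ks.length))) = 0 := by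
    rw [List.drop_length, psiStar_nil, delta_one]
  rw [e1, e2, map_zero, map_zero, LinearMap.zero_apply, add_zero, add_zero,
    ← Finset.sum_add_distrib]
  refine Finset.sum_eq_zero fun i hi => ?_
  rw [Finset.mem_range] at hi
  rw [List.take_succ_eq_append_getElem hi, List.drop_eq_getElem_cons hi, cmono_append,
    cmono_single, delta_mul_cl (Submodule.subset_span ⟨_, rfl⟩), psiStar_cons, map_smul,
    delta_mul_cl (psiStar_mem_Wmod _)]
  split_ifs with h
  · simp [h]
  · simp

theorem mul_cl_mem_Gmod {x : HH} (hx : x ∈ Gmod) {k : ℕ} (hk : 1 ≤ k) : x * cl CC k ∈ Gmod := by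
  induction hx using Submodule.span_induction with
  | mem x hx =>
    obtain ⟨u, hu, rfl⟩ := hx
    refine Submodule.subset_span ⟨u ++ [k], ?_, by rw [cmono_append, cmono_single]⟩
    intro j hj
    rw [List.mem_append, List.mem_singleton] at hj
    rcases hj with hj | rfl
    · exact hu j hj
    · exact hk
  | zero => simp
  | add x y _ _ hx hy => rw [add_mul]; exact add_mem hx hy
  | smul c x _ hx => rw [smul_mul_assoc]; exact Submodule.smul_mem _ _ hx

theorem harmRev_mem_Gmod (u v : List ℕ) (hu : ∀ k ∈ u, 1 ≤ k) (hv : ∀ k ∈ v, 1 ≤ k) :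
    (harmRev (fun k l => k + l) u v : HH) ∈ Gmod := by
  induction u, v using harmRev.induct with
  | case1 v =>
    rw [harmRev]
    exact Submodule.subset_span ⟨_, fun k hk => hv k (List.mem_reverse.mp hk), rfl⟩
  | case2 k u =>
    rw [harmRev]
    exact Submodule.subset_span ⟨_, fun k hk => hu k (List.mem_reverse.mp hk), rfl⟩
  | case3 k u l v h1 h2 h3 =>
    have hk : 1 ≤ k := hu k (by simp)
    have hl : 1 ≤ l := hv l (by simp)
    have hu2 : ∀ j ∈ u, 1 ≤ j := fun j hj => hu j (List.mem_cons_of_mem _ hj)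
    have hv2 : ∀ j ∈ v, 1 ≤ j := fun j hj => hv j (List.mem_cons_of_mem _ hj)
    rw [harmRev]
    exact add_mem (add_mem (mul_cl_mem_Gmod (h1 hu2 hv) hk) (mul_cl_mem_Gmod (h2 hu hv2) hl))
      (mul_cl_mem_Gmod (h3 hu2 hv2) (by omega))

theorem wStar_mem_Gmod (ks : List ℕ) (hks : ∀ k ∈ ks, 1 ≤ k) :
    wStar (cmono CC ks) ∈ Gmod := by
  rw [wStar, wS, cext_cmono]
  refine Submodule.sum_mem _ fun i _ => ?_
  obtain ⟨c, hc⟩ := psiStar_cmono (ks.drop i)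
  rw [hc, map_smul, hstar, harm_cmono, List.reverse_reverse]
  refine Submodule.smul_mem _ _ (harmRev_mem_Gmod _ _ ?_ ?_)
  · exact fun k hk => hks k (List.mem_of_mem_take (List.mem_reverse.mp hk))
  · exact fun k hk => hks k (List.mem_of_mem_drop hk)

theorem uw_eq_cmono (u : List ℕ) (hu : ∀ k ∈ u, 1 ≤ k) : uw u = cmono CC u := by
  rw [uw, cmono]
  congr 1
  refine List.map_congr_left fun k hk => ?_
  have := hu k hk
  rw [uA, if_neg (by omega)]

theorem sub_delta_mem {x : HH} (hx : x ∈ Gmod) : x - delta x * cl CC 1 ∈ HZero := by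
  induction hx using Submodule.span_induction with
  | mem x hx =>
    obtain ⟨u, hu, rfl⟩ := hx
    rcases List.eq_nil_or_concat u with rfl | ⟨v, k, rfl⟩
    · have h1 : cmono CC [] = (1 : HH) := by simp [cmono]
      rw [h1, delta_one, zero_mul, sub_zero]
      exact one_mem_HZero
    · rw [List.concat_eq_append] at hu ⊢
      by_cases h : k = 1
      · rw [cmono_append, cmono_single, delta_mul_cl (Submodule.subset_span ⟨_, rfl⟩), if_pos h, h,
          sub_self]
        exact Submodule.zero_mem _
      · have hd : delta (cmono CC (v ++ [k])) = 0 := by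
          rw [cmono_append, cmono_single, delta_mul_cl (Submodule.subset_span ⟨_, rfl⟩), if_neg h]
        rw [hd, zero_mul, sub_zero, ← uw_eq_cmono _ hu, HZero_eq]
        refine Submodule.mem_sup_left (Submodule.subset_span ⟨_, Or.inl ?_, rfl⟩)
        have := hu k (by simp)
        rw [lastGe_append]
        omega
  | zero => simp
  | add x y _ _ hx hy =>
    have h : x + y - delta (x + y) * cl CC 1
        = (x - delta x * cl CC 1) + (y - delta y * cl CC 1) := by
      rw [map_add, add_mul]; abel
    rw [h]
    exact add_mem hx hy
  | smul c x _ hx =>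
    rw [map_smul, smul_mul_assoc, ← smul_sub]
    exact Submodule.smul_mem _ _ hx

theorem wStar_gI_mem (k : Index) : wStar (gI k) ∈ HZero := by
  have hks : ∀ j ∈ k.map (fun i : ℕ+ => (i : ℕ)), 1 ≤ j := by
    intro j hj
    obtain ⟨i, -, rfl⟩ := List.mem_map.mp hj
    exact i.pos
  have h := sub_delta_mem (wStar_mem_Gmod _ hks)
  rwa [delta_wStar _ hks, zero_mul, sub_zero, ← gI_eq] at h

/-! ### The elements `E_k` and the `q`-analogue of symmetric multiple zeta values -/

/-- The power `u^{sh_ħ j}`. -/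
noncomputable def shPow (u : HH) : ℕ → HH
  | 0 => 1
  | j + 1 => hsh u (shPow u j)

/-- `E_{1^m} = (1/(m+1)!) ∑_{j=0}^m g₁^{sh j} sh_ħ e₁^{sh (m-j)}`. -/
noncomputable def EOne (m : ℕ) : HH :=
  (Polynomial.C (1 / ((m + 1).factorial : ℚ)) : CC) •
    ∑ j ∈ Finset.range (m + 1), hsh (shPow (g 1) j) (shPow (e 1) (m - j))

/-- Reads an index from the left; `s` is the number of the entries `1` read since the last
entry that is at least two. -/
noncomputable def EAux : ℕ → Index → HH
  | s, [] => EOne s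
  | s, k :: ks => if k = 1 then EAux (s + 1) ks else EOne s * e k * EAux 0 ks

/-- `E_k = E_{1^{s₀}} e_{t₁+2} E_{1^{s₁}} ⋯ e_{tᵣ+2} E_{1^{sᵣ}}` for
`k = (1^{s₀}, t₁+2, 1^{s₁}, …, tᵣ+2, 1^{sᵣ})`. -/
noncomputable def EI (k : Index) : HH := EAux 0 k

/-- `Z_q^{S,∗}(w) = lim_{M → ∞} Z_{q,M}(w_ħ^{S,∗}(w))`. -/
noncomputable def ZqStar (q : ℂ) (w : HH) : ℂ := Zq q (wStar w)

/-- `Z_q^{S,sh}(w) = lim_{M → ∞} Z_{q,M}(w_ħ^{S,sh}(w))`. -/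
noncomputable def ZqSh (q : ℂ) (w : HH) : ℂ := Zq q (wSh w)

theorem ZqStar_mem (q : ℂ) (hq : ‖q‖ < 1) (k : Index) : ZqStar q (gI k) ∈ Zalg q hq :=
  ⟨wStar (gI k), wStar_gI_mem k, rfl⟩

theorem ZqSh_mem (q : ℂ) (hq : ‖q‖ < 1) {w : HH} (hw : wSh w ∈ HZero) :
    ZqSh q w ∈ Zalg q hq :=
  ⟨wSh w, hw, rfl⟩

/-- The `q`-analogue of the symmetric multiple zeta value: the class of `Z_q^{S,∗}(g_k)` in
`𝒵_q / (𝒩_q + 𝒫_q)`. -/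
noncomputable def zetaS (q : ℂ) (hq : ‖q‖ < 1) (k : Index) : Zquot q hq :=
  Ideal.Quotient.mk _ ⟨ZqStar q (gI k), ZqStar_mem q hq k⟩

end QSMZV

/-!
The values `ζ_q^S` are compared with two families of regularized values, one for each product. Write
`x_m = q^m / [m]`, so that `Z_q(g_{k_1} ⋯ g_{k_r})` is the nested sum of `x_{m_1}^{k_1} ⋯ x_{m_r}^{k_r}`.

**Harmonic relation.** The truncation of `Z_q(w^{S,∗}(g_k))` at `M` is a nested sum over the list
`x_1, …, x_{M-1}, -x_{M-1}, …, -x_1` (`ZqM_wStar`). Nested sums over a fixed list satisfy the classical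
harmonic product formula, so the relation holds for the complex numbers themselves, before any quotient
is taken (`ZqStar_mul`, `zetaS_mul`).

**Multiplicativity of `Z_q` for `sh_ħ`.** A word is given a power series by letting
`b` act as multiplication by `t / (1 - t)` and `a` as the Rota–Baxter operator `t^m ↦ x_m t^m`. This turns
`sh_ħ` into the product of series (`ser_hsh`), and `Z_q` is the evaluation of the series at `t = 1`
(`Zq_eq_tsum`, `Zq_hsh`).

**The two descriptions agree.** Let `y_n` be the divided powers of `g_1` for `sh_ħ`; their generating
series is a shuffle exponential (`shp_ys_ys`). The cuts of `E_{1^m}` add up to the alternating sum of the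
products `y_i sh_ħ y_j` (`cutL_EOne`), which gives membership in `ℌ⁰`. On values, let `R_α(s)` be the
harmonic regularization of `g_α g_1^s`, defined by `g_α g_1^s = ∑ x_i ∗_ħ g_1^j` (`xreg`, `regVal`).
On the harmonic side the remaining factor is `∏ (1 - x_m² X²)`, whose logarithmic derivative consists of
the even values `Z_q(g_{2k})`, so it is `1` modulo `𝒫_q` (`coeff_oneSer_mem`, `wordVal_blk`). On the
shuffle side the factors `∑ Z_q(y_n) (±X)^n` cancel, and everything else differs by words of `𝔫`
(`Zq_cutOne_blk`). Both descriptions thus reduce to the same sum of the `R_α(s)`, which is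
`zetaS_eq_sh`.

**Shuffle relation.** The embedding `z_k ↦ g_k` respects the two shuffle products up to words that
contain `ħ b` (`shDefect_mem`). Hence the shuffle regularized values of words in `x, y` are
multiplicative in the quotient (`regCls_csh`), and they coincide with the harmonic regularized values
(`regCls_zword`). The symmetric value of `z_k` is then the sum over all deconcatenations of a regularized
value times a signed regularized value of the reversed tail (`symCls_z`). Because deconcatenation is
multiplicative for the shuffle product and `w ↦ (-1)^{|w|} rev(w)` is its antipode, the symmetric value
of `z_k sh z_l` and that of `z_k` followed by the reversal of `z_l` are given by the same expression up to
the sign `(-1)^{wt(l)}` (`symCls_csh`, `symCls_append_reverse`, `zetaS_shuffle`).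
-/

namespace QSMZV

/-! ### The two shuffle products on all of `R⟨a, b⟩` -/

section Shuffles

variable {R : Type} [CommRing R]

/-- Induction on noncommutative polynomials: from words by linearity. -/
theorem nc_induction {p : NC R → Prop} (hm : ∀ w, p (mono R w))
    (ha : ∀ x y, p x → p y → p (x + y)) (hs : ∀ (c : R) x, p x → p (c • x)) (x : NC R) : p x := by
  have h0 : p 0 := by simpa using hs 0 _ (hm [])
  have hx : x ∈ Submodule.span R (Set.range (wordBasis R)) := by
    rw [(wordBasis R).span_eq]; trivial
  induction hx using Submodule.span_induction with
  | mem x hx =>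
    obtain ⟨w, rfl⟩ := hx
    rw [wordBasis_apply]
    exact hm w
  | zero => exact h0
  | add x y _ _ hx hy => exact ha x y hx hy
  | smul c x _ hx => exact hs c x hx

theorem mono_nil : mono R [] = 1 := by simp [mono]

theorem mono_append (u v : List Gen) : mono R (u ++ v) = mono R u * mono R v := by
  simp [mono]

theorem mono_single (c : Gen) : mono R [c] = FreeAlgebra.ι R c := by simp [mono]

theorem mono_cons (c : Gen) (v : List Gen) : mono R (c :: v) = FreeAlgebra.ι R c * mono R v := by
  simp [mono]

theorem bilin_mono (p : List Gen → List Gen → NC R) (u v : List Gen) :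
    bilin p (mono R u) (mono R v) = p u.reverse v.reverse := by
  rw [bilin, ← wordBasis_apply, ← wordBasis_apply, Module.Basis.constr_basis,
    Module.Basis.constr_basis]

/-- The shuffle product with parameter `t`, of which `sh_ħ` is the case `t = ħ`. -/
noncomputable def qsh (t : R) : NC R →ₗ[R] NC R →ₗ[R] NC R := bilin (qshRev t)

/-- The usual shuffle product over an arbitrary coefficient ring. -/
noncomputable def csh : NC R →ₗ[R] NC R →ₗ[R] NC R := bilin shRev

theorem qsh_one_left (t : R) (y : NC R) : qsh t 1 y = y := by
  induction y using nc_induction with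
  | hm w => rw [← mono_nil, qsh, bilin_mono, List.reverse_nil, qshRev, List.reverse_reverse]
  | ha x y hx hy => rw [map_add, hx, hy]
  | hs c x hx => rw [map_smul, hx]

theorem csh_one_left (y : NC R) : csh 1 y = y := by
  induction y using nc_induction with
  | hm w => rw [← mono_nil, csh, bilin_mono, List.reverse_nil, shRev, List.reverse_reverse]
  | ha x y hx hy => rw [map_add, hx, hy]
  | hs c x hx => rw [map_smul, hx]

/-- Two bilinear maps on `R⟨a, b⟩` agree if they agree on words. -/
theorem nc_ext₂ {M : Type} [AddCommGroup M] [Module R M] {f g : NC R →ₗ[R] NC R →ₗ[R] M}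
    (h : ∀ u v, f (mono R u) (mono R v) = g (mono R u) (mono R v)) (x y : NC R) :
    f x y = g x y := by
  have : f = g := by
    refine (wordBasis R).ext fun u => (wordBasis R).ext fun v => ?_
    rw [wordBasis_apply, wordBasis_apply, h]
  rw [this]

theorem qshRev_nil_right (t : R) (u : List Gen) : qshRev t u [] = mono R u.reverse := by
  cases u <;> rw [qshRev]

theorem shRev_nil_right (u : List Gen) : shRev u [] = mono R u.reverse := by
  cases u <;> rw [shRev]

theorem mono_reverse_cons (c : Gen) (u : List Gen) :
    mono R (c :: u).reverse = mono R u.reverse * FreeAlgebra.ι R c := by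
  rw [List.reverse_cons, mono_append, mono_single]

theorem qshRev_b_left (t : R) (u v : List Gen) :
    qshRev t (Gen.b :: u) v = qshRev t u v * vb R := by
  cases v with
  | nil => rw [qshRev_nil_right, qshRev_nil_right, mono_reverse_cons, vb]
  | cons l v => rw [qshRev]

theorem qshRev_b_right (t : R) (u v : List Gen) :
    qshRev t u (Gen.b :: v) = qshRev t u v * vb R := by
  induction u with
  | nil => rw [qshRev, qshRev, mono_reverse_cons, vb]
  | cons c u ih =>
    cases c with
    | a => rw [qshRev]
    | b => rw [qshRev_b_left, ih, qshRev_b_left]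

theorem qshRev_comm (t : R) (u v : List Gen) : qshRev t u v = qshRev t v u := by
  induction u, v using qshRev.induct with
  | case1 v => rw [qshRev, qshRev_nil_right]
  | case2 k u => rw [qshRev, qshRev]
  | case3 u l v h => rw [qshRev_b_left, qshRev_b_right, h]
  | case4 u v h => rw [qshRev_b_left, qshRev_b_right, h]
  | case5 u v h1 h2 h3 => rw [qshRev, qshRev, h1, h2, h3, add_comm (qshRev t v (Gen.a :: u))]

theorem shRev_comm (u v : List Gen) : (shRev u v : NC R) = shRev v u := by
  induction u, v using shRev.induct with
  | case1 v => rw [shRev, shRev_nil_right]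
  | case2 k u => rw [shRev, shRev]
  | case3 k u l v h1 h2 => rw [shRev, shRev, h1, h2, add_comm]

theorem qsh_comm (t : R) (x y : NC R) : qsh t x y = qsh t y x :=
  nc_ext₂ (g := (qsh t).flip) (fun u v => by
    rw [LinearMap.flip_apply, qsh, bilin_mono, bilin_mono, qshRev_comm]) x y

theorem csh_comm (x y : NC R) : csh x y = csh y x :=
  nc_ext₂ (g := csh.flip) (fun u v => by
    rw [LinearMap.flip_apply, csh, bilin_mono, bilin_mono, shRev_comm]) x y

theorem qsh_one_right (t : R) (y : NC R) : qsh t y 1 = y := by rw [qsh_comm, qsh_one_left]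

theorem csh_one_right (y : NC R) : csh y 1 = y := by rw [csh_comm, csh_one_left]

theorem qsh_mul_b_left (t : R) (x y : NC R) : qsh t (x * vb R) y = qsh t x y * vb R := by
  refine nc_ext₂ (f := (qsh t).comp (LinearMap.mulRight R (vb R)))
    (g := (qsh t).compr₂ (LinearMap.mulRight R (vb R))) (fun u v => ?_) x y
  simp only [LinearMap.comp_apply, LinearMap.compr₂_apply, LinearMap.mulRight_apply]
  rw [vb, ← mono_single, ← mono_append, qsh, bilin_mono, bilin_mono, List.reverse_append,
    mono_single]
  exact qshRev_b_left t _ _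

theorem qsh_mul_b_right (t : R) (x y : NC R) : qsh t x (y * vb R) = qsh t x y * vb R := by
  rw [qsh_comm, qsh_mul_b_left, qsh_comm]

theorem qsh_mul_a (t : R) (x y : NC R) : qsh t (x * va R) (y * va R)
    = (qsh t (x * va R) y + qsh t x (y * va R) + t • qsh t x y) * va R := by
  refine nc_ext₂ (f := (qsh t).compl₁₂ (LinearMap.mulRight R (va R)) (LinearMap.mulRight R (va R)))
    (g := ((qsh t).comp (LinearMap.mulRight R (va R))
      + (qsh t).compl₂ (LinearMap.mulRight R (va R)) + t • qsh t).compr₂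
        (LinearMap.mulRight R (va R))) (fun u v => ?_) x y
  simp only [LinearMap.comp_apply, LinearMap.compr₂_apply, LinearMap.mulRight_apply,
    LinearMap.compl₁₂_apply, LinearMap.add_apply, LinearMap.compl₂_apply, LinearMap.smul_apply]
  rw [va, ← mono_single, ← mono_append, ← mono_append, qsh, bilin_mono, bilin_mono, bilin_mono,
    bilin_mono, List.reverse_append, List.reverse_append, mono_single]
  exact qshRev.eq_5 t _ _

/-- The recursion of the shuffle product by last letters. -/
theorem csh_mul_ι (x y : NC R) (c d : Gen) :
    csh (x * FreeAlgebra.ι R c) (y * FreeAlgebra.ι R d)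
      = csh x (y * FreeAlgebra.ι R d) * FreeAlgebra.ι R c
        + csh (x * FreeAlgebra.ι R c) y * FreeAlgebra.ι R d := by
  refine nc_ext₂ (f := csh.compl₁₂ (LinearMap.mulRight R (FreeAlgebra.ι R c))
      (LinearMap.mulRight R (FreeAlgebra.ι R d)))
    (g := (csh.compl₂ (LinearMap.mulRight R (FreeAlgebra.ι R d))).compr₂
        (LinearMap.mulRight R (FreeAlgebra.ι R c))
      + (csh.comp (LinearMap.mulRight R (FreeAlgebra.ι R c))).compr₂
        (LinearMap.mulRight R (FreeAlgebra.ι R d))) (fun u v => ?_) x y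
  simp only [LinearMap.comp_apply, LinearMap.compr₂_apply, LinearMap.mulRight_apply,
    LinearMap.compl₁₂_apply, LinearMap.add_apply, LinearMap.compl₂_apply]
  rw [← mono_single, ← mono_single, ← mono_append, ← mono_append, csh, bilin_mono, bilin_mono,
    bilin_mono, List.reverse_append, List.reverse_append, mono_single, mono_single]
  exact shRev.eq_3 _ _ _ _

/-- Associativity on words, by induction on a bound for the total length through the recursion by last
letters. -/
theorem qsh_assoc_mono (t : R) (n : ℕ) : ∀ u v w : List Gen, u.length + v.length + w.length ≤ n →
    qsh t (qsh t (mono R u) (mono R v)) (mono R w)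
      = qsh t (mono R u) (qsh t (mono R v) (mono R w)) := by
  induction n with
  | zero =>
    intro u v w h
    obtain rfl : u = [] := List.length_eq_zero_iff.mp (by omega)
    rw [mono_nil, qsh_one_left, qsh_one_left]
  | succ n ih =>
    intro u v w h
    rcases List.eq_nil_or_concat u with rfl | ⟨u, c, rfl⟩
    · rw [mono_nil, qsh_one_left, qsh_one_left]
    rcases List.eq_nil_or_concat v with rfl | ⟨v, d, rfl⟩
    · rw [mono_nil, qsh_one_left, qsh_one_right]
    rcases List.eq_nil_or_concat w with rfl | ⟨w, e, rfl⟩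
    · rw [mono_nil, qsh_one_right, qsh_one_right]
    simp only [List.concat_eq_append, List.length_append, List.length_singleton, mono_append,
      mono_single] at h ⊢
    have hu := fun h => ih u (v ++ [d]) (w ++ [e]) h
    have hv := fun h => ih (u ++ [c]) v (w ++ [e]) h
    have hw := fun h => ih (u ++ [c]) (v ++ [d]) w h
    have huv := fun h => ih u v (w ++ [e]) h
    have huw := fun h => ih u (v ++ [d]) w h
    have hvw := fun h => ih (u ++ [c]) v w h
    have huvw := fun h => ih u v w h
    simp only [List.length_append, List.length_singleton, mono_append, mono_single] at *
    specialize hu (by omega)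
    specialize hv (by omega)
    specialize hw (by omega)
    specialize huv (by omega)
    specialize huw (by omega)
    specialize hvw (by omega)
    specialize huvw (by omega)
    cases c with
    | b =>
      change qsh t (qsh t (mono R u * vb R) _) _ = qsh t (mono R u * vb R) _
      rw [qsh_mul_b_left, qsh_mul_b_left, qsh_mul_b_left, hu]
    | a =>
    cases d with
    | b =>
      change qsh t (qsh t _ (mono R v * vb R)) _ = qsh t _ (qsh t (mono R v * vb R) _)
      rw [qsh_mul_b_left, qsh_mul_b_right, qsh_mul_b_left, qsh_mul_b_right, hv]
    | a =>
    cases e with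
    | b =>
      change qsh t _ (mono R w * vb R) = qsh t _ (qsh t _ (mono R w * vb R))
      rw [qsh_mul_b_right, qsh_mul_b_right, qsh_mul_b_right, hw]
    | a =>
      have hva : FreeAlgebra.ι R Gen.a = va R := rfl
      simp only [hva] at hu hv hw huv huw hvw ⊢
      have e1 : qsh t (qsh t (mono R u * va R) (mono R v * va R)) (mono R w * va R)
          = (qsh t (qsh t (mono R u * va R) (mono R v * va R)) (mono R w)
            + qsh t (qsh t (mono R u * va R) (mono R v) + qsh t (mono R u) (mono R v * va R)
              + t • qsh t (mono R u) (mono R v)) (mono R w * va R)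
            + t • qsh t (qsh t (mono R u * va R) (mono R v) + qsh t (mono R u) (mono R v * va R)
              + t • qsh t (mono R u) (mono R v)) (mono R w)) * va R := by
        rw [qsh_mul_a t (mono R u) (mono R v), qsh_mul_a]
      have e2 : qsh t (mono R u * va R) (qsh t (mono R v * va R) (mono R w * va R))
          = (qsh t (mono R u * va R) (qsh t (mono R v * va R) (mono R w)
              + qsh t (mono R v) (mono R w * va R) + t • qsh t (mono R v) (mono R w))
            + qsh t (mono R u) (qsh t (mono R v * va R) (mono R w * va R))
            + t • qsh t (mono R u) (qsh t (mono R v * va R) (mono R w)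
              + qsh t (mono R v) (mono R w * va R) + t • qsh t (mono R v) (mono R w)))
            * va R := by
        rw [qsh_mul_a t (mono R v) (mono R w), qsh_mul_a]
      rw [e1, e2]
      congr 1
      simp only [map_add, LinearMap.add_apply, map_smul, LinearMap.smul_apply, smul_add, hu, hv,
        hw, huv, huw, hvw, huvw]
      abel

theorem assoc_of_mono (m : NC R →ₗ[R] NC R →ₗ[R] NC R)
    (h : ∀ u v w, m (m (mono R u) (mono R v)) (mono R w)
      = m (mono R u) (m (mono R v) (mono R w))) (x y z : NC R) :
    m (m x y) z = m x (m y z) := by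
  induction x using nc_induction with
  | hm u =>
    induction y using nc_induction with
    | hm v =>
      induction z using nc_induction with
      | hm w => exact h u v w
      | ha x y hx hy => simp only [map_add, hx, hy]
      | hs c x hx => simp only [map_smul, hx]
    | ha x y hx hy => simp only [map_add, LinearMap.add_apply, hx, hy]
    | hs c x hx => simp only [map_smul, LinearMap.smul_apply, hx]
  | ha x y hx hy => simp only [map_add, LinearMap.add_apply, hx, hy]
  | hs c x hx => simp only [map_smul, LinearMap.smul_apply, hx]

theorem qsh_assoc (t : R) (x y z : NC R) : qsh t (qsh t x y) z = qsh t x (qsh t y z) :=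
  assoc_of_mono _ (fun u v w => qsh_assoc_mono t _ u v w le_rfl) x y z

/-- Associativity on words, by the recursion for the last letters. -/
theorem csh_assoc_mono (n : ℕ) : ∀ u v w : List Gen, u.length + v.length + w.length ≤ n →
    csh (csh (mono R u) (mono R v)) (mono R w)
      = csh (mono R u) (csh (mono R v) (mono R w)) := by
  induction n with
  | zero =>
    intro u v w h
    obtain rfl : u = [] := List.length_eq_zero_iff.mp (by omega)
    rw [mono_nil, csh_one_left, csh_one_left]
  | succ n ih =>
    intro u v w h
    rcases List.eq_nil_or_concat u with rfl | ⟨u, c, rfl⟩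
    · rw [mono_nil, csh_one_left, csh_one_left]
    rcases List.eq_nil_or_concat v with rfl | ⟨v, d, rfl⟩
    · rw [mono_nil, csh_one_left, csh_one_right]
    rcases List.eq_nil_or_concat w with rfl | ⟨w, e, rfl⟩
    · rw [mono_nil, csh_one_right, csh_one_right]
    have hu := ih u (v ++ [d]) (w ++ [e])
    have hv := ih (u ++ [c]) v (w ++ [e])
    have hw := ih (u ++ [c]) (v ++ [d]) w
    simp only [List.concat_eq_append, List.length_append, List.length_singleton, mono_append,
      mono_single] at *
    specialize hu (by omega)
    specialize hv (by omega)
    specialize hw (by omega)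
    have e1 : csh (csh (mono R u * FreeAlgebra.ι R c) (mono R v * FreeAlgebra.ι R d))
          (mono R w * FreeAlgebra.ι R e)
        = csh (csh (mono R u) (mono R v * FreeAlgebra.ι R d)) (mono R w * FreeAlgebra.ι R e)
            * FreeAlgebra.ι R c
          + csh (csh (mono R u * FreeAlgebra.ι R c) (mono R v)) (mono R w * FreeAlgebra.ι R e)
            * FreeAlgebra.ι R d
          + csh (csh (mono R u * FreeAlgebra.ι R c) (mono R v * FreeAlgebra.ι R d)) (mono R w)
            * FreeAlgebra.ι R e := by
      rw [csh_mul_ι (mono R u) (mono R v), map_add, LinearMap.add_apply, csh_mul_ι, csh_mul_ι,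
        LinearMap.add_apply]
      noncomm_ring
    have e2 : csh (mono R u * FreeAlgebra.ι R c) (csh (mono R v * FreeAlgebra.ι R d)
          (mono R w * FreeAlgebra.ι R e))
        = csh (mono R u) (csh (mono R v * FreeAlgebra.ι R d) (mono R w * FreeAlgebra.ι R e))
            * FreeAlgebra.ι R c
          + csh (mono R u * FreeAlgebra.ι R c) (csh (mono R v) (mono R w * FreeAlgebra.ι R e))
            * FreeAlgebra.ι R d
          + csh (mono R u * FreeAlgebra.ι R c) (csh (mono R v * FreeAlgebra.ι R d) (mono R w))
            * FreeAlgebra.ι R e := by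
      rw [csh_mul_ι (mono R v) (mono R w), map_add, csh_mul_ι, csh_mul_ι, map_add]
      noncomm_ring
    rw [e1, e2, hu, hv, hw]

theorem csh_assoc (x y z : NC R) : csh (csh x y) z = csh x (csh y z) :=
  assoc_of_mono _ (fun u v w => csh_assoc_mono _ u v w le_rfl) x y z

theorem csh_mul_mul_mul_comm (x y z w : NC R) :
    csh (csh x y) (csh z w) = csh (csh x z) (csh y w) := by
  rw [csh_assoc, ← csh_assoc y, csh_comm y z, csh_assoc z, ← csh_assoc]

/-- The recursion of the shuffle product by first letters. -/
theorem csh_ι_mul (c d : Gen) (x y : NC R) :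
    csh (FreeAlgebra.ι R c * x) (FreeAlgebra.ι R d * y)
      = FreeAlgebra.ι R c * csh x (FreeAlgebra.ι R d * y)
        + FreeAlgebra.ι R d * csh (FreeAlgebra.ι R c * x) y := by
  refine nc_ext₂ (f := csh.compl₁₂ (LinearMap.mulLeft R (FreeAlgebra.ι R c))
      (LinearMap.mulLeft R (FreeAlgebra.ι R d)))
    (g := (csh.compl₂ (LinearMap.mulLeft R (FreeAlgebra.ι R d))).compr₂
        (LinearMap.mulLeft R (FreeAlgebra.ι R c))
      + (csh.comp (LinearMap.mulLeft R (FreeAlgebra.ι R c))).compr₂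
        (LinearMap.mulLeft R (FreeAlgebra.ι R d))) (fun u v => ?_) x y
  simp only [LinearMap.comp_apply, LinearMap.compr₂_apply, LinearMap.mulLeft_apply,
    LinearMap.compl₁₂_apply, LinearMap.add_apply, LinearMap.compl₂_apply]
  have one_csh : ∀ (e f : Gen) (y : NC R), csh (FreeAlgebra.ι R e) (y * FreeAlgebra.ι R f)
      = y * FreeAlgebra.ι R f * FreeAlgebra.ι R e
        + csh (FreeAlgebra.ι R e) y * FreeAlgebra.ι R f := by
    intro e f y
    have := csh_mul_ι 1 y e f
    rwa [one_mul, csh_one_left] at this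
  induction u using List.reverseRecOn generalizing v with
  | nil =>
    induction v using List.reverseRecOn with
    | nil =>
      have := one_csh c d 1
      simp only [mono_nil, mul_one, one_mul, csh_one_left, csh_one_right] at this ⊢
      rw [this, add_comm]
    | append_singleton v f ih =>
      simp only [mono_nil, mul_one, csh_one_left, mono_append, mono_single,
        ← mul_assoc] at ih ⊢
      rw [one_csh, ih, one_csh]
      noncomm_ring
  | append_singleton u e ihu =>
    induction v using List.reverseRecOn with
    | nil =>
      have h1 := ihu []
      simp only [mono_nil, mul_one, csh_one_right, mono_append, mono_single,
        ← mul_assoc] at h1 ⊢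
      rw [csh_comm, one_csh, csh_comm, h1, csh_comm (mono R u * _), one_csh, csh_comm (mono R u)]
      noncomm_ring
    | append_singleton v f ihv =>
      have h1 := ihu (v ++ [f])
      simp only [mono_append, mono_single, ← mul_assoc] at h1 ihv ⊢
      rw [csh_mul_ι, h1, ihv, csh_mul_ι (mono R u), csh_mul_ι (_ * mono R u)]
      noncomm_ring

theorem hsh_eq : hsh = qsh hb := rfl

end Shuffles

/-! ### `Z_q` is multiplicative for the shuffle product -/

section Series

variable (q : ℂ)

/-- The value `x_m = q^m / [m]` of the variable `a` (with `x_0 = 0`). -/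
noncomputable def xval (m : ℕ) : ℂ := Fq q m 1

theorem Fq_eq_pow (m k : ℕ) : Fq q m k = xval q m ^ k := by
  rw [xval, Fq, Fq, div_pow, one_mul, pow_one, ← pow_mul, mul_comm k m]

theorem xval_zero : xval q 0 = 0 := by simp [xval, Fq, qInt]

/-- The Jackson-type operator `t^m ↦ x_m t^m`. -/
noncomputable def jack (f : PowerSeries ℂ) : PowerSeries ℂ :=
  PowerSeries.mk fun m => xval q m * PowerSeries.coeff m f

/-- The series `t / (1 - t)`. -/
noncomputable def geo : PowerSeries ℂ := PowerSeries.X * PowerSeries.mk fun _ => 1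

/-- The generating series of a word written from right to left: the letter `b` multiplies by
`t / (1 - t)` and the letter `a` acts by `t^m ↦ x_m t^m`. -/
noncomputable def serRev : List Gen → PowerSeries ℂ
  | [] => 1
  | Gen.a :: w => jack q (serRev w)
  | Gen.b :: w => serRev w * geo

/-- The additive extension of `serRev` on which `ħ` acts as `1 - q`. -/
noncomputable def ser (w : HH) : PowerSeries ℂ :=
  ((wordBasis CC).repr w).sum fun v c => Polynomial.aeval (1 - q) c • serRev q v.reverse

theorem ser_add (x y : HH) : ser q (x + y) = ser q x + ser q y := by
  unfold ser
  rw [map_add, Finsupp.sum_add_index']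
  · simp
  · intro v c d
    rw [map_add, add_smul]

theorem ser_smul (c : CC) (x : HH) : ser q (c • x) = Polynomial.aeval (1 - q) c • ser q x := by
  unfold ser
  rw [map_smul, Finsupp.sum_smul_index', Finsupp.smul_sum]
  · refine Finsupp.sum_congr fun v _ => ?_
    rw [smul_eq_mul, map_mul, mul_smul]
  · simp

theorem ser_mono (w : List Gen) : ser q (mono CC w) = serRev q w.reverse := by
  rw [← wordBasis_apply, ser, Module.Basis.repr_self, Finsupp.sum_single_index]
  · simp
  · simp

theorem jack_add (f g : PowerSeries ℂ) : jack q (f + g) = jack q f + jack q g := by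
  ext n; simp [jack, mul_add]

theorem jack_smul (c : ℂ) (f : PowerSeries ℂ) : jack q (c • f) = c • jack q f := by
  ext n; simp [jack]; ring

theorem ser_mul_a (x : HH) : ser q (x * va CC) = jack q (ser q x) := by
  induction x using nc_induction with
  | hm w => rw [va, ← mono_single, ← mono_append, ser_mono, ser_mono, List.reverse_append]; rfl
  | ha x y hx hy => rw [add_mul, ser_add, hx, hy, ser_add, jack_add]
  | hs c x hx => rw [smul_mul_assoc, ser_smul, hx, ser_smul, jack_smul]

theorem ser_mul_b (x : HH) : ser q (x * vb CC) = ser q x * geo := by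
  induction x using nc_induction with
  | hm w => rw [vb, ← mono_single, ← mono_append, ser_mono, ser_mono, List.reverse_append]; rfl
  | ha x y hx hy => rw [add_mul, ser_add, hx, hy, ser_add, add_mul]
  | hs c x hx => rw [smul_mul_assoc, ser_smul, hx, ser_smul, smul_mul_assoc]

theorem ser_one : ser q 1 = 1 := by
  rw [← mono_nil, ser_mono]; rfl

theorem coeff_geo_mul (f : PowerSeries ℂ) (m : ℕ) :
    PowerSeries.coeff m (f * geo) = ∑ n ∈ Finset.range m, PowerSeries.coeff n f := by
  rw [geo, mul_left_comm]
  cases m with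
  | zero => simp
  | succ m =>
    rw [PowerSeries.coeff_succ_X_mul, PowerSeries.coeff_mul,
      Finset.Nat.sum_antidiagonal_eq_sum_range_succ_mk]
    simp

variable {q}

theorem one_sub_pow_ne_zero (hq : ‖q‖ < 1) {m : ℕ} (hm : 1 ≤ m) : 1 - q ^ m ≠ 0 := by
  intro h
  have h1 : ‖q ^ m‖ < 1 := by
    rw [norm_pow]
    exact pow_lt_one₀ (norm_nonneg _) hq (by omega)
  rw [← sub_eq_zero.mp h] at h1
  simp at h1

theorem xval_eq (hq : ‖q‖ < 1) {m : ℕ} (hm : 1 ≤ m) :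
    xval q m = (1 - q) * q ^ m / (1 - q ^ m) := by
  have h1 := one_sub_pow_ne_zero hq hm
  have h2 : 1 - q ≠ 0 := by simpa using one_sub_pow_ne_zero hq le_rfl
  rw [xval, Fq, qInt, one_mul, pow_one]
  field_simp

/-- The partial fraction identity that corresponds to the rule of `sh_ħ` for two letters `a`. -/
theorem xval_mul_xval (hq : ‖q‖ < 1) {m n : ℕ} (hm : 1 ≤ m) (hn : 1 ≤ n) :
    xval q m * xval q n = xval q (m + n) * (xval q m + xval q n + (1 - q)) := by
  have h1 := one_sub_pow_ne_zero hq hm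
  have h2 := one_sub_pow_ne_zero hq hn
  have h3 := one_sub_pow_ne_zero hq (show 1 ≤ m + n by omega)
  rw [xval_eq hq hm, xval_eq hq hn, xval_eq hq (by omega)]
  rw [pow_add] at h3 ⊢
  field_simp
  ring

/-- The operator `t^m ↦ x_m t^m` is a Rota–Baxter operator of weight `1 - q` on the series
without constant term. -/
theorem jack_mul_jack (hq : ‖q‖ < 1) {f g : PowerSeries ℂ} (hf : PowerSeries.coeff 0 f = 0)
    (hg : PowerSeries.coeff 0 g = 0) :
    jack q f * jack q g = jack q (jack q f * g + f * jack q g + (1 - q) • (f * g)) := by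
  ext n
  simp only [jack, PowerSeries.coeff_mk, map_add, PowerSeries.coeff_mul, PowerSeries.coeff_smul,
    smul_eq_mul, Finset.mul_sum, ← Finset.sum_add_distrib]
  refine Finset.sum_congr rfl fun p hp => ?_
  rw [Finset.HasAntidiagonal.mem_antidiagonal] at hp
  rcases Nat.eq_zero_or_pos p.1 with h | h
  · rw [h, hf]; ring
  rcases Nat.eq_zero_or_pos p.2 with h2 | h2
  · rw [h2, hg]; ring
  have := xval_mul_xval hq h h2
  rw [hp] at this
  linear_combination (PowerSeries.coeff p.1 f * PowerSeries.coeff p.2 g) * this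

theorem coeff_zero_serRev (w : List Gen) (hw : w ≠ []) :
    PowerSeries.coeff 0 (serRev q w) = 0 := by
  rcases w with _ | ⟨_ | _, w⟩
  · exact absurd rfl hw
  · simp [serRev, jack, xval_zero]
  · rw [serRev, coeff_geo_mul]; simp

/-- Words that start with `b` (`u` and `v` are written from right to left): the letter `b` acts by a
multiplication and `a` by a Rota–Baxter operator, which is the recursion of `sh_ħ`. -/
theorem ser_qshRev (hq : ‖q‖ < 1) (u v : List Gen) (hu : u = [] ∨ ∃ w, u = w ++ [Gen.b])
    (hv : v = [] ∨ ∃ w, v = w ++ [Gen.b]) :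
    ser q (qshRev hb u v) = serRev q u * serRev q v := by
  have tl : ∀ {k : Gen} {u : List Gen}, (k :: u = [] ∨ ∃ w, k :: u = w ++ [Gen.b]) →
      (u = [] ∨ ∃ w, u = w ++ [Gen.b]) := by
    rintro k u (h | ⟨w, h⟩)
    · simp at h
    · rcases w with _ | ⟨x, w⟩
      · left; simp_all
      · right; exact ⟨w, by simp_all⟩
  induction u, v using qshRev.induct with
  | case1 v => rw [qshRev, ser_mono, List.reverse_reverse, serRev, one_mul]
  | case2 k u => rw [qshRev, ser_mono, List.reverse_reverse, serRev.eq_1, mul_one]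
  | case3 u l v h => rw [qshRev_b_left, ser_mul_b, h (tl hu) hv, serRev.eq_3]; ring
  | case4 u v h => rw [qshRev_b_right, ser_mul_b, h hu (tl hv), serRev.eq_3]; ring
  | case5 u v h1 h2 h3 =>
    have hne : ∀ {u : List Gen}, (Gen.a :: u = [] ∨ ∃ w, Gen.a :: u = w ++ [Gen.b]) → u ≠ [] := by
      rintro u (h | ⟨w, h⟩) rfl
      · simp at h
      · rcases w with _ | ⟨x, w⟩ <;> simp at h
    rw [qshRev, ser_mul_a, ser_add, ser_add, ser_smul, h1 hu (tl hv), h2 (tl hu) hv,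
      h3 (tl hu) (tl hv), serRev, serRev, jack_mul_jack hq (coeff_zero_serRev _ (hne hu))
      (coeff_zero_serRev _ (hne hv)), Polynomial.aeval_X]

theorem cword_reverse (ks : List ℕ) :
    (cword ks).reverse = [] ∨ ∃ w, (cword ks).reverse = w ++ [Gen.b] := by
  rcases ks with _ | ⟨k, ks⟩
  · left; simp [cword]
  · right; exact ⟨(List.replicate k Gen.a ++ cword ks).reverse, by simp [cword]⟩

/-- `x ↦ ser q x` turns `sh_ħ` into the product of series. -/
theorem ser_hsh (hq : ‖q‖ < 1) {x y : HH} (hx : x ∈ Wmod) (hy : y ∈ Wmod) :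
    ser q (hsh x y) = ser q x * ser q y := by
  have h0 : ser q 0 = 0 := by simp [ser]
  induction hx using Submodule.span_induction with
  | mem x hx =>
    obtain ⟨u, rfl⟩ := hx
    induction hy using Submodule.span_induction with
    | mem y hy =>
      obtain ⟨v, rfl⟩ := hy
      rw [← mono_cword, ← mono_cword, hsh, bilin_mono, ser_mono, ser_mono,
        ser_qshRev hq _ _ (cword_reverse u) (cword_reverse v)]
    | zero => simp [h0]
    | add x y _ _ hx hy => rw [map_add, ser_add, hx, hy, ser_add, mul_add]
    | smul c x _ hx => rw [map_smul, ser_smul, hx, ser_smul, mul_smul_comm]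
  | zero => simp [h0]
  | add x y _ _ hx hy => rw [map_add, LinearMap.add_apply, ser_add, hx, hy, ser_add, add_mul]
  | smul c x _ hx => rw [map_smul, LinearMap.smul_apply, ser_smul, hx, ser_smul, smul_mul_assoc]

theorem ser_mul_cl (x : HH) (k m : ℕ) : PowerSeries.coeff m (ser q (x * cl CC k))
    = xval q m ^ k * ∑ n ∈ Finset.range m, PowerSeries.coeff n (ser q x) := by
  have h : ser q (x * cl CC k) = (jack q)^[k] (ser q x * geo) := by
    rw [cl, ← mul_assoc]
    induction k with
    | zero => simp [ser_mul_b]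
    | succ k ih =>
      rw [pow_succ, ← mul_assoc, ser_mul_a, ih, Function.iterate_succ_apply']
  rw [h, ← coeff_geo_mul]
  clear h
  induction k with
  | zero => simp
  | succ k ih =>
    rw [Function.iterate_succ_apply', jack, PowerSeries.coeff_mk, ih, pow_succ]
    ring

/-- The numbers `Z_{q,M}` are the partial sums of the coefficients of the series. -/
theorem sum_coeff_ser (ks : List ℕ) (M : ℕ) :
    ∑ m ∈ Finset.range (M + 1), PowerSeries.coeff m (ser q (cmono CC ks))
      = nest q (M + 1) ks.reverse := by
  induction ks using List.reverseRecOn generalizing M with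
  | nil =>
    have h1 : cmono CC [] = (1 : HH) := by simp [cmono]
    rw [h1, ser_one, List.reverse_nil, nest, Finset.sum_range_succ']
    simp [PowerSeries.coeff_one]
  | append_singleton ks k ih =>
    rw [cmono_append, cmono_single, List.reverse_append, List.reverse_singleton,
      List.singleton_append, nest, Finset.sum_range_succ',
      Finset.sum_Ico_eq_sum_range, Nat.add_sub_cancel]
    simp only [ser_mul_cl, Finset.range_zero, Finset.sum_empty, mul_zero, add_zero]
    refine Finset.sum_congr rfl fun m _ => ?_
    rw [ih, Fq_eq_pow, add_comm 1 m]

theorem ZqM_eq_sum (x : HH) (hx : x ∈ Wmod) (M : ℕ) :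
    ZqM q (M + 1) x = ∑ m ∈ Finset.range (M + 1), PowerSeries.coeff m (ser q x) := by
  induction hx using Submodule.span_induction with
  | mem x hx =>
    obtain ⟨u, rfl⟩ := hx
    rw [ZqM_cmono, sum_coeff_ser]
  | zero => simp [ZqM_zero, ser]
  | add x y _ _ hx hy =>
    simp only [ZqM_add, hx, hy, ser_add, map_add, Finset.sum_add_distrib]
  | smul c x _ hx =>
    simp only [ZqM_smul, hx, ser_smul, PowerSeries.coeff_smul, smul_eq_mul, Finset.mul_sum]

theorem summable_coeff_ser (hq : ‖q‖ < 1) {x : HH} (hx : x ∈ Hhat) :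
    Summable fun m => ‖PowerSeries.coeff m (ser q x)‖ := by
  rw [Hhat_eq] at hx
  induction hx using Submodule.span_induction with
  | mem x hx =>
    obtain ⟨u, hu, rfl⟩ := hx
    obtain ⟨c, hc⟩ := uw_eq_smul u
    simp only [hc, ser_smul, PowerSeries.coeff_smul, norm_smul]
    refine Summable.mul_left _ ?_
    rcases List.eq_nil_or_concat u with rfl | ⟨v, k, rfl⟩
    · have h1 : cmono CC [] = (1 : HH) := by simp [cmono]
      refine summable_of_ne_finset_zero (s := {0}) fun m hm => ?_
      rw [Finset.mem_singleton] at hm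
      rw [h1, ser_one, PowerSeries.coeff_one, if_neg hm, norm_zero]
    · rw [List.concat_eq_append, lastGe_append] at hu
      obtain ⟨K, hK, hF⟩ := exists_norm_Fq_le hq
      obtain ⟨B, n, hB, hn⟩ := exists_norm_nest_le hq v.reverse
      have hq2 : ‖(‖q‖ : ℝ)‖ < 1 := by rwa [norm_norm]
      have hg0 : Summable fun m : ℕ => (m : ℝ) ^ n * ‖q‖ ^ m :=
        summable_pow_mul_geometric_of_norm_lt_one n hq2
      refine Summable.of_nonneg_of_le (fun _ => norm_nonneg _) (fun m => ?_)
        (hg0.mul_left (K ^ k * B))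
      rw [List.concat_eq_append, cmono_append, cmono_single, ser_mul_cl]
      rcases m with _ | m
      · simp only [Finset.range_zero, Finset.sum_empty, mul_zero, norm_zero]
        positivity
      · rw [sum_coeff_ser, ← Fq_eq_pow, norm_mul]
        have h1 := hF (m + 1) k (by omega)
        have h2 : (‖q‖ ^ (m + 1)) ^ k ≤ ‖q‖ ^ (m + 1) :=
          pow_le_of_le_one (by positivity) (pow_le_one₀ (norm_nonneg _) hq.le) (by omega)
        calc ‖Fq q (m + 1) k‖ * ‖nest q (m + 1) v.reverse‖
            ≤ (K * ‖q‖ ^ (m + 1)) ^ k * (B * ((m + 1 : ℕ) : ℝ) ^ n) := by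
              gcongr
              exact hn (m + 1)
          _ = K ^ k * (‖q‖ ^ (m + 1)) ^ k * (B * ((m + 1 : ℕ) : ℝ) ^ n) := by rw [mul_pow]
          _ ≤ K ^ k * ‖q‖ ^ (m + 1) * (B * ((m + 1 : ℕ) : ℝ) ^ n) := by gcongr
          _ = (K ^ k * B) * (((m + 1 : ℕ) : ℝ) ^ n * ‖q‖ ^ (m + 1)) := by ring
  | zero => simp [ser, summable_zero]
  | add x y _ _ hx hy =>
    refine Summable.of_nonneg_of_le (fun _ => norm_nonneg _) (fun m => ?_) (hx.add hy)
    rw [ser_add, map_add]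
    exact norm_add_le _ _
  | smul c x _ hx =>
    simp only [ser_smul, PowerSeries.coeff_smul, norm_smul]
    exact hx.mul_left _

/-- The value `Z_q(x)` is the value of the series of `x` at `t = 1`. -/
theorem Zq_eq_tsum (hq : ‖q‖ < 1) {x : HH} (hx : x ∈ Hhat) :
    Zq q x = ∑' m, PowerSeries.coeff m (ser q x) := by
  have h1 := ((summable_coeff_ser hq hx).of_norm.hasSum.tendsto_sum_nat).comp
    (tendsto_add_atTop_nat 1)
  have h2 := (tendsto_ZqM hq hx).comp (tendsto_add_atTop_nat 1)
  refine tendsto_nhds_unique h2 (h1.congr fun M => ?_)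
  simp only [Function.comp_apply]
  rw [ZqM_eq_sum _ (Hhat_le_Wmod hx)]

/-- `Z_q` is multiplicative for `sh_ħ`. -/
theorem Zq_hsh (hq : ‖q‖ < 1) {x y : HH} (hx : x ∈ Hhat) (hy : y ∈ Hhat)
    (hxy : hsh x y ∈ Hhat) : Zq q (hsh x y) = Zq q x * Zq q y := by
  rw [Zq_eq_tsum hq hx, Zq_eq_tsum hq hy, Zq_eq_tsum hq hxy,
    tsum_mul_tsum_eq_tsum_sum_antidiagonal_of_summable_norm (summable_coeff_ser hq hx)
      (summable_coeff_ser hq hy), ser_hsh hq (Hhat_le_Wmod hx) (Hhat_le_Wmod hy)]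
  simp only [PowerSeries.coeff_mul]

end Series

/-! ### Spans of words in the letters of `A` and the shuffle product -/

/-- The last letter exists and is `u_k` with `k ≥ j`. -/
def endsGe (j : ℕ) (u : List ℕ) : Prop := ∃ v k, j ≤ k ∧ u = v ++ [k]

/-- `𝒞⟨A⟩` as the span of all words in `A`. -/
noncomputable def Cm : Submodule CC HH := uspan fun _ => True

/-- The span of the nonempty words in `A` whose last letter is some `g_k`. -/
noncomputable def Vm : Submodule CC HH := uspan (endsGe 1)

/-- The ideal of `𝒞⟨A⟩` generated by `ħ` and `ħ b`. -/
noncomputable def Jm : Submodule CC HH := vspan (fun u => 0 ∈ u) fun _ => True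

/-- The part of the ideal `Jm` that is spanned by words ending in some `g_k`. -/
noncomputable def JVm : Submodule CC HH := vspan (fun u => 0 ∈ u ∧ endsGe 1 u) (endsGe 1)

/-- The ideal of `𝒞⟨A⟩` spanned by `ħ` and by the words in which `ħ b` precedes some `g_k`, `k ≥ 2`.
It cuts out `𝔫` in `Hhat`. -/
noncomputable def Km : Submodule CC HH := vspan pat fun _ => True

theorem endsGe_append {j k : ℕ} (u : List ℕ) : endsGe j (u ++ [k]) ↔ j ≤ k := by
  constructor
  · rintro ⟨v, l, h, e⟩
    obtain ⟨-, e⟩ := List.append_inj' e rfl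
    simp only [List.cons.injEq, and_true] at e
    omega
  · exact fun h => ⟨u, k, h, rfl⟩

theorem not_endsGe_nil (j : ℕ) : ¬ endsGe j [] := by
  rintro ⟨v, k, -, h⟩
  simp at h

theorem lastGe_of_endsGe {j : ℕ} {u : List ℕ} (h : endsGe j u) : lastGe j u := by
  obtain ⟨v, k, hk, rfl⟩ := h
  rwa [lastGe_append]

theorem lastGe_iff {j : ℕ} {u : List ℕ} : lastGe j u ↔ u = [] ∨ endsGe j u := by
  rcases List.eq_nil_or_concat u with rfl | ⟨v, k, rfl⟩
  · simp [lastGe_nil]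
  · rw [List.concat_eq_append, lastGe_append, endsGe_append]; simp

theorem uw_mem_uspan {P : List ℕ → Prop} {u : List ℕ} (h : P u) : uw u ∈ uspan P :=
  Submodule.subset_span ⟨u, h, rfl⟩

theorem uspan_induction {P : List ℕ → Prop} {V : Submodule CC HH} (h : ∀ u, P u → uw u ∈ V) :
    uspan P ≤ V := by
  rw [uspan, Submodule.span_le]
  rintro x ⟨u, hu, rfl⟩
  exact h u hu

theorem uspan_bilin {P Q : List ℕ → Prop} {V : Submodule CC HH} (f : HH →ₗ[CC] HH →ₗ[CC] HH)
    (h : ∀ u v, P u → Q v → f (uw u) (uw v) ∈ V) {x y : HH} (hx : x ∈ uspan P)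
    (hy : y ∈ uspan Q) : f x y ∈ V := by
  have h1 : ∀ u, P u → f (uw u) y ∈ V := fun u hu =>
    (uspan_induction (V := V.comap (f (uw u))) (fun v hv => h u v hu hv)) hy
  exact (uspan_induction (V := V.comap (f.flip y)) (fun u hu => h1 u hu)) hx

theorem uw_append (u v : List ℕ) : uw (u ++ v) = uw u * uw v := by simp [uw]

theorem uspan_mul_uspan {P Q R : List ℕ → Prop} (h : ∀ u v, P u → Q v → R (u ++ v)) {x y : HH}
    (hx : x ∈ uspan P) (hy : y ∈ uspan Q) : x * y ∈ uspan R :=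
  uspan_bilin (LinearMap.mul CC HH) (fun u v hu hv => by
    rw [LinearMap.mul_apply', ← uw_append]
    exact uw_mem_uspan (h u v hu hv)) hx hy

theorem vspan_mul_vspan {P Q R : List ℕ → Prop} (h : ∀ u v, P u → Q v → R (u ++ v)) {x y : HH}
    (hx : x ∈ vspan P fun _ => True) (hy : y ∈ vspan Q fun _ => True) :
    x * y ∈ vspan R fun _ => True := by
  obtain ⟨x1, hx1, x2, hx2, rfl⟩ := Submodule.mem_sup.mp hx
  obtain ⟨y1, hy1, y2, hy2, rfl⟩ := Submodule.mem_sup.mp hy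
  obtain ⟨x3, hx3, rfl⟩ := (Submodule.mem_smul_pointwise_iff_exists _ _ _).mp hx2
  obtain ⟨y3, hy3, rfl⟩ := (Submodule.mem_smul_pointwise_iff_exists _ _ _).mp hy2
  have e : (x1 + hb • x3) * (y1 + hb • y3) = x1 * y1 + hb • (x1 * y3 + x3 * (y1 + hb • y3)) := by
    simp only [add_mul, mul_add, smul_mul_assoc, mul_smul_comm, smul_add]
    abel
  rw [e]
  refine add_mem (Submodule.mem_sup_left (uspan_mul_uspan h hx1 hy1))
    (Submodule.mem_sup_right (Submodule.smul_mem_pointwise_smul _ _ _ (add_mem ?_ ?_)))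
  · exact uspan_mul_uspan (fun _ _ _ _ => trivial) hx1 hy3
  · refine uspan_mul_uspan (Q := fun _ => True) (fun _ _ _ _ => trivial) hx3
      (add_mem (uspan_mono (fun _ _ => trivial) hy1) (Submodule.smul_mem _ _ hy3))

theorem vspan_mono {P P2 R R2 : List ℕ → Prop} (h : ∀ u, P u → P2 u) (h2 : ∀ u, R u → R2 u) :
    vspan P R ≤ vspan P2 R2 := by
  refine sup_le_sup (uspan_mono h) ?_
  intro x hx
  obtain ⟨y, hy, rfl⟩ := (Submodule.mem_smul_pointwise_iff_exists _ _ _).mp hx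
  exact Submodule.smul_mem_pointwise_smul _ _ _ (uspan_mono h2 hy)

theorem uspan_le_vspan {P R : List ℕ → Prop} : uspan P ≤ vspan P R := le_sup_left

theorem smul_mem_vspan {P R : List ℕ → Prop} {x : HH} (hx : x ∈ uspan R) :
    hb • x ∈ vspan P R :=
  Submodule.mem_sup_right (Submodule.smul_mem_pointwise_smul _ _ _ hx)

theorem vspan_le_Cm (P R : List ℕ → Prop) : vspan P R ≤ Cm :=
  sup_le (uspan_mono fun _ _ => trivial) fun _ hx =>
    uspan_mono (fun _ _ => trivial) (smul_uspan_le _ hx)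

theorem Jm_le_Cm : Jm ≤ Cm := vspan_le_Cm _ _

theorem Vm_le_Cm : Vm ≤ Cm := uspan_mono fun _ _ => trivial

theorem JVm_le_Jm : JVm ≤ Jm := vspan_mono (fun _ h => h.1) fun _ _ => trivial

theorem Cm_mul {x y : HH} (hx : x ∈ Cm) (hy : y ∈ Cm) : x * y ∈ Cm :=
  uspan_mul_uspan (fun _ _ _ _ => trivial) hx hy

theorem Cm_mul_Vm {x y : HH} (hx : x ∈ Cm) (hy : y ∈ Vm) : x * y ∈ Vm := by
  refine uspan_mul_uspan ?_ hx hy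
  rintro u _ - ⟨v, k, hk, rfl⟩
  exact ⟨u ++ v, k, hk, by simp⟩

theorem Jm_mul_Cm {x y : HH} (hx : x ∈ Jm) (hy : y ∈ Cm) : x * y ∈ Jm :=
  vspan_mul_vspan (P := fun u => 0 ∈ u) (Q := fun _ => True) (R := fun u => 0 ∈ u)
    (fun _ _ h _ => List.mem_append_left _ h) hx (uspan_le_vspan (P := fun _ => True) hy)

theorem Cm_mul_Jm {x y : HH} (hx : x ∈ Cm) (hy : y ∈ Jm) : x * y ∈ Jm :=
  vspan_mul_vspan (P := fun _ => True) (Q := fun u => 0 ∈ u) (R := fun u => 0 ∈ u)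
    (fun _ _ _ h => List.mem_append_right _ h) (uspan_le_vspan (P := fun _ => True) hx) hy

theorem Km_mul_Cm {x y : HH} (hx : x ∈ Km) (hy : y ∈ Cm) : x * y ∈ Km := by
  refine vspan_mul_vspan (P := pat) (Q := fun _ => True) (R := pat) (fun u v h _ => ?_) hx
    (uspan_le_vspan (P := fun _ => True) hy)
  obtain ⟨k, hk, h⟩ := h
  exact ⟨k, hk, h.trans (List.sublist_append_left _ _)⟩

theorem Cm_mul_Km {x y : HH} (hx : x ∈ Cm) (hy : y ∈ Km) : x * y ∈ Km := by
  refine vspan_mul_vspan (P := fun _ => True) (Q := pat) (R := pat) (fun u v _ h => ?_)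
    (uspan_le_vspan (P := fun _ => True) hx) hy
  obtain ⟨k, hk, h⟩ := h
  exact ⟨k, hk, h.trans (List.sublist_append_right _ _)⟩

theorem one_mem_Cm : (1 : HH) ∈ Cm := by
  have : uw [] = (1 : HH) := by simp [uw]
  rw [← this]
  exact uw_mem_uspan trivial

theorem uA_mem_Cm (k : ℕ) : uA k ∈ Cm := by
  have : uw [k] = uA k := by simp [uw]
  rw [← this]
  exact uw_mem_uspan trivial

theorem cl_succ (k : ℕ) : cl CC (k + 1) = uA (k + 1) := by
  rw [uA, if_neg (by omega)]

theorem cl_succ_mem_Cm (k : ℕ) : cl CC (k + 1) ∈ Cm := cl_succ k ▸ uA_mem_Cm _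

theorem cl_succ_mem_Vm (k : ℕ) : cl CC (k + 1) ∈ Vm := by
  have : uw [k + 1] = cl CC (k + 1) := by simp [uw, cl_succ]
  rw [← this]
  exact uw_mem_uspan ⟨[], k + 1, by omega, rfl⟩

theorem uA_zero_mem_Jm : uA 0 ∈ Jm := by
  have : uw [0] = uA 0 := by simp [uw]
  rw [← this]
  exact uspan_le_vspan (uw_mem_uspan (by simp))

theorem Jm_mul_cl {x : HH} (hx : x ∈ Jm) (k : ℕ) : x * cl CC (k + 1) ∈ JVm := by
  rw [cl_succ]
  exact vspan_mul (fun u h => ⟨List.mem_append_left _ h, (endsGe_append u).mpr (by omega)⟩)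
    (fun u _ => (endsGe_append u).mpr (by omega)) hx

/-- A word with `ħ b` followed by some `g_k`, `k ≥ 2`, belongs to `Km`. -/
theorem Jm_mul_cl_two {x : HH} (hx : x ∈ Jm) (k : ℕ) : x * cl CC (k + 2) ∈ Km := by
  rw [cl_succ]
  exact vspan_mul (fun u h => pat_of_zero_mem u _ h (by omega)) (fun u _ => trivial) hx

theorem cl_mul_a (k : ℕ) : cl CC k * va CC = cl CC (k + 1) := by
  rw [cl, cl, pow_succ, mul_assoc]

theorem uw_mul_a (u : List ℕ) (k : ℕ) (hk : 1 ≤ k) :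
    uw (u ++ [k]) * va CC = uw (u ++ [k + 1]) := by
  obtain ⟨k, rfl⟩ : ∃ j, k = j + 1 := ⟨k - 1, by omega⟩
  rw [uw_append_single, uw_append_single, ← cl_succ, ← cl_succ, mul_assoc, cl_mul_a]

theorem uspan_mul_a {P Q : List ℕ → Prop} (h : ∀ u, P u → endsGe 1 u)
    (h2 : ∀ u k, 1 ≤ k → P (u ++ [k]) → Q (u ++ [k + 1])) {x : HH} (hx : x ∈ uspan P) :
    x * va CC ∈ uspan Q := by
  refine uspan_induction (V := (uspan Q).comap (LinearMap.mulRight CC (va CC))) (fun u hu => ?_) hx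
  obtain ⟨v, k, hk, rfl⟩ := h u hu
  rw [Submodule.mem_comap, LinearMap.mulRight_apply, uw_mul_a v k hk]
  exact uw_mem_uspan (h2 v k hk hu)

theorem vspan_mul_a {P Q R : List ℕ → Prop} (h : ∀ u, P u → endsGe 1 u)
    (h2 : ∀ u k, 1 ≤ k → P (u ++ [k]) → Q (u ++ [k + 1]))
    (h3 : ∀ u k, 1 ≤ k → R (u ++ [k + 1])) {x : HH}
    (hx : x ∈ vspan P (endsGe 1)) : x * va CC ∈ vspan Q R := by
  obtain ⟨x1, hx1, x2, hx2, rfl⟩ := Submodule.mem_sup.mp hx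
  obtain ⟨x3, hx3, rfl⟩ := (Submodule.mem_smul_pointwise_iff_exists _ _ _).mp hx2
  rw [add_mul, smul_mul_assoc]
  exact add_mem (uspan_le_vspan (uspan_mul_a h h2 hx1))
    (smul_mem_vspan (uspan_mul_a (fun _ h => h) (fun u k hk _ => h3 u k hk) hx3))

theorem Vm_mul_a {x : HH} (hx : x ∈ Vm) : x * va CC ∈ Vm :=
  uspan_mul_a (fun _ h => h) (fun u k _ _ => (endsGe_append u).mpr (by omega)) hx

theorem JVm_mul_a {x : HH} (hx : x ∈ JVm) : x * va CC ∈ JVm := by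
  refine vspan_mul_a (fun _ h => h.2) (fun u k hk h => ?_)
    (fun u k _ => (endsGe_append u).mpr (by omega)) hx
  refine ⟨?_, (endsGe_append u).mpr (by omega)⟩
  have := h.1
  simp only [List.mem_append, List.mem_singleton] at this ⊢
  left
  rcases this with h | h
  · exact h
  · omega

/-- Right multiplication by `a` raises the index of the last letter to at least two, so that a
preceding `ħ b` puts the word into `𝔫₀`. -/
theorem JVm_mul_a_mem_nMod {x : HH} (hx : x ∈ JVm) : x * va CC ∈ nMod := by
  rw [nMod_eq]
  refine vspan_mul_a (fun _ h => h.2) (fun u k hk h => ?_)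
    (fun u k _ => (lastGe_append _ u _).mpr (by omega)) hx
  refine ⟨(lastGe_append _ u _).mpr (by omega), pat_of_zero_mem u _ ?_ (by omega)⟩
  have := h.1
  simp only [List.mem_append, List.mem_singleton] at this
  rcases this with h | h
  · exact h
  · omega

theorem Vm_mul_a_mem_HZero {x : HH} (hx : x ∈ Vm) : x * va CC ∈ HZero := by
  rw [HZero_eq]
  exact uspan_le_vspan (uspan_mul_a (fun _ h => h)
    (fun u k _ _ => Or.inl ((lastGe_append _ u _).mpr (by omega))) hx)

theorem Vm_le_Hhat : Vm ≤ Hhat := by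
  rw [Hhat_eq]
  exact uspan_mono fun _ h => lastGe_of_endsGe h

theorem smul_mem_nMod {x : HH} (hx : x ∈ Hhat) : hb • x ∈ nMod :=
  Submodule.mem_sup_right (Submodule.smul_mem_pointwise_smul _ _ _ hx)

/-- The projection to the monomials that satisfy `Q`. -/
noncomputable def cproj (Q : List ℕ → Prop) : HH →ₗ[CC] HH := by
  classical exact cext fun ks => if Q ks then cmono CC ks else 0

theorem cproj_uw (Q : List ℕ → Prop) (u : List ℕ) :
    (Q u → cproj Q (uw u) = uw u) ∧ (¬ Q u → cproj Q (uw u) = 0) := by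
  obtain ⟨c, hc⟩ := uw_eq_smul u
  rw [hc, map_smul, cproj, cext_cmono]
  constructor
  · intro h; rw [if_pos h]
  · intro h; rw [if_neg h, smul_zero]

theorem cproj_mem {P Q : List ℕ → Prop} {x : HH} (hx : x ∈ uspan P) :
    cproj Q x ∈ uspan fun u => P u ∧ Q u := by
  refine uspan_induction (V := (uspan fun u => P u ∧ Q u).comap (cproj Q)) (fun u hu => ?_) hx
  rw [Submodule.mem_comap]
  by_cases h : Q u
  · rw [(cproj_uw Q u).1 h]
    exact uw_mem_uspan ⟨hu, h⟩
  · rw [(cproj_uw Q u).2 h]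
    exact Submodule.zero_mem _

/-- The coordinate projection onto the words with `Q` preserves the spans of words. -/
theorem vspan_inf_uspan {P R Q : List ℕ → Prop} {x : HH} (hx : x ∈ vspan P R)
    (hx2 : x ∈ uspan Q) : x ∈ vspan (fun u => P u ∧ Q u) (fun u => R u ∧ Q u) := by
  have h : cproj Q x = x := by
    have : uspan Q ≤ LinearMap.eqLocus (cproj Q) LinearMap.id :=
      uspan_induction fun u hu => (cproj_uw Q u).1 hu
    exact this hx2
  rw [← h]
  obtain ⟨x1, hx1, x4, hx4, rfl⟩ := Submodule.mem_sup.mp hx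
  obtain ⟨x3, hx3, rfl⟩ := (Submodule.mem_smul_pointwise_iff_exists _ _ _).mp hx4
  rw [map_add, map_smul]
  exact add_mem (uspan_le_vspan (cproj_mem hx1)) (smul_mem_vspan (cproj_mem hx3))

/-- `Km ∩ Ĥ⁰ = 𝔫`, of which this is one inclusion. -/
theorem mem_nMod_of_Km {x : HH} (hx : x ∈ Km) (hx2 : x ∈ Hhat) : x ∈ nMod := by
  rw [Hhat_eq] at hx2
  rw [nMod_eq]
  exact vspan_mono (fun u h => ⟨h.2, h.1⟩) (fun u h => h.2) (vspan_inf_uspan hx hx2)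

/-! #### Closure under `sh_ħ` -/

theorem hsh_one_left (x : HH) : hsh 1 x = x := qsh_one_left _ x

theorem hsh_one_right (x : HH) : hsh x 1 = x := qsh_one_right _ x

theorem hsh_comm (x y : HH) : hsh x y = hsh y x := qsh_comm _ x y

theorem hsh_mul_uA_left (x y : HH) : hsh (x * uA 0) y = hsh x y * uA 0 := by
  have : uA 0 = hb • vb CC := by simp [uA, cl]
  rw [this, mul_smul_comm, map_smul, LinearMap.smul_apply, mul_smul_comm, hsh_eq, qsh_mul_b_left]

theorem hsh_mul_uA_right (x y : HH) : hsh x (y * uA 0) = hsh x y * uA 0 := by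
  rw [hsh_comm, hsh_mul_uA_left, hsh_comm]

theorem hsh_mul_cl_zero_left (x y : HH) : hsh (x * cl CC 0) y = hsh x y * cl CC 0 := by
  rw [cl, pow_zero, mul_one, hsh_eq, qsh_mul_b_left]

theorem hsh_mul_cl_zero_right (x y : HH) : hsh x (y * cl CC 0) = hsh x y * cl CC 0 := by
  rw [hsh_comm, hsh_mul_cl_zero_left, hsh_comm]

theorem hsh_cl_succ (x y : HH) (k l : ℕ) : hsh (x * cl CC (k + 1)) (y * cl CC (l + 1))
    = (hsh (x * cl CC (k + 1)) (y * cl CC l) + hsh (x * cl CC k) (y * cl CC (l + 1))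
      + hb • hsh (x * cl CC k) (y * cl CC l)) * va CC := by
  rw [← cl_mul_a, ← cl_mul_a, ← mul_assoc, ← mul_assoc, hsh_eq, qsh_mul_a]

/-- The step for the last letters in the shuffle product of two words in `A`. -/
theorem hsh_letters {C V : Submodule CC HH} (hg : ∀ x ∈ C, x * cl CC 1 ∈ V)
    (hB : ∀ x ∈ C, x * uA 0 ∈ C) (ha : ∀ x ∈ V, x * va CC ∈ V) {u v : HH} (h0 : hsh u v ∈ C)
    (h1 : ∀ k, hsh (u * cl CC (k + 1)) v ∈ C) (h2 : ∀ l, hsh u (v * cl CC (l + 1)) ∈ C)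
    (k l : ℕ) : hsh (u * cl CC (k + 1)) (v * cl CC (l + 1)) ∈ V := by
  have hc : ∀ x : HH, x * cl CC 0 * va CC = x * cl CC 1 := fun x => by rw [mul_assoc, cl_mul_a]
  induction k generalizing l with
  | zero =>
    induction l with
    | zero =>
      rw [hsh_cl_succ, add_mul, add_mul, smul_mul_assoc]
      simp only [hsh_mul_cl_zero_left, hsh_mul_cl_zero_right, hc]
      refine add_mem (add_mem (hg _ (h1 0)) (hg _ (h2 0))) ?_
      have := hg _ (hB _ h0)
      rwa [uA, if_pos rfl, mul_smul_comm, smul_mul_assoc] at this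
    | succ l ih =>
      rw [hsh_cl_succ, add_mul, add_mul, smul_mul_assoc]
      simp only [hsh_mul_cl_zero_left, hc]
      exact add_mem (add_mem (ha _ ih) (hg _ (h2 _)))
        (Submodule.smul_mem _ _ (hg _ (h2 _)))
  | succ k ihk =>
    induction l with
    | zero =>
      rw [hsh_cl_succ, add_mul, add_mul, smul_mul_assoc]
      simp only [hsh_mul_cl_zero_right, hc]
      exact add_mem (add_mem (hg _ (h1 _)) (ha _ (ihk 0)))
        (Submodule.smul_mem _ _ (hg _ (h1 _)))
    | succ l ih =>
      rw [hsh_cl_succ, add_mul, add_mul, smul_mul_assoc]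
      exact add_mem (add_mem (ha _ ih) (ha _ (ihk _)))
        (Submodule.smul_mem _ _ (ha _ (ihk _)))

/-- The products `sh_ħ` of words in `A`, with the conditions on letters that they inherit from the
factors; `n` bounds the total length. -/
theorem hsh_uw_mem (n : ℕ) : ∀ u v : List ℕ, u.length + v.length ≤ n →
    hsh (uw u) (uw v) ∈ Cm ∧ (endsGe 1 u → endsGe 1 v → hsh (uw u) (uw v) ∈ Vm) ∧
    (0 ∈ u → hsh (uw u) (uw v) ∈ Jm) ∧
    (0 ∈ u → endsGe 1 u → endsGe 1 v → hsh (uw u) (uw v) ∈ JVm) := by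
  have one : uw [] = 1 := by simp [uw]
  induction n with
  | zero =>
    intro u v h
    obtain rfl : u = [] := List.length_eq_zero_iff.mp (by omega)
    rw [one, hsh_one_left]
    exact ⟨uw_mem_uspan trivial, fun h => absurd h (not_endsGe_nil _), by simp, by simp⟩
  | succ n ih =>
    intro u v h
    rcases List.eq_nil_or_concat u with rfl | ⟨u, k, rfl⟩
    · rw [one, hsh_one_left]
      exact ⟨uw_mem_uspan trivial, fun h => absurd h (not_endsGe_nil _), by simp, by simp⟩
    rcases List.eq_nil_or_concat v with rfl | ⟨v, l, rfl⟩
    · rw [one, hsh_one_right]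
      exact ⟨uw_mem_uspan trivial, fun _ h => absurd h (not_endsGe_nil _),
        fun h => uspan_le_vspan (uw_mem_uspan h), fun _ _ h => absurd h (not_endsGe_nil _)⟩
    simp only [List.concat_eq_append, List.length_append, List.length_singleton, endsGe_append]
      at h ⊢
    rcases k with _ | k
    · obtain ⟨a, -, -, -⟩ := ih u (v ++ [l]) (by simp; omega)
      rw [uw_append_single u 0, hsh_mul_uA_left]
      exact ⟨Cm_mul a (uA_mem_Cm 0), by simp, fun _ => Cm_mul_Jm a uA_zero_mem_Jm, by simp⟩
    rcases l with _ | l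
    · obtain ⟨a, -, b, -⟩ := ih (u ++ [k + 1]) v (by simp; omega)
      rw [uw_append_single v 0, hsh_mul_uA_right]
      exact ⟨Cm_mul a (uA_mem_Cm 0), by simp, fun h => Jm_mul_Cm (b h) (uA_mem_Cm 0), by simp⟩
    have i0 := ih u v (by omega)
    have i1 := fun j => ih (u ++ [j + 1]) v (by simp; omega)
    have i2 := fun j => ih u (v ++ [j + 1]) (by simp; omega)
    simp only [uw_append_single, ← cl_succ] at i1 i2 ⊢
    have hV := hsh_letters (C := Cm) (V := Vm) (fun x hx => Cm_mul_Vm hx (cl_succ_mem_Vm 0))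
      (fun x hx => Cm_mul hx (uA_mem_Cm 0)) (fun x hx => Vm_mul_a hx) i0.1 (fun j => (i1 j).1)
      (fun j => (i2 j).1) k l
    have hJ : 0 ∈ u ++ [k + 1] →
        hsh (uw u * cl CC (k + 1)) (uw v * cl CC (l + 1)) ∈ JVm := by
      intro h0
      have h0u : 0 ∈ u := by simpa using h0
      exact hsh_letters (C := Jm) (V := JVm) (fun x hx => Jm_mul_cl hx 0)
        (fun x hx => Jm_mul_Cm hx (uA_mem_Cm 0)) (fun x hx => JVm_mul_a hx) (i0.2.2.1 h0u)
        (fun j => (i1 j).2.2.1 (by simp [h0u])) (fun j => (i2 j).2.2.1 h0u) k l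
    exact ⟨Vm_le_Cm hV, fun _ _ => hV, fun h => JVm_le_Jm (hJ h), fun h _ _ => hJ h⟩

theorem hsh_mem_Cm {x y : HH} (hx : x ∈ Cm) (hy : y ∈ Cm) : hsh x y ∈ Cm :=
  uspan_bilin hsh (fun u v _ _ => (hsh_uw_mem _ u v le_rfl).1) hx hy

theorem hsh_mem_Vm {x y : HH} (hx : x ∈ Vm) (hy : y ∈ Vm) : hsh x y ∈ Vm :=
  uspan_bilin hsh (fun u v hu hv => (hsh_uw_mem _ u v le_rfl).2.1 hu hv) hx hy

theorem hsh_mem_JVm {x y : HH} (hx : x ∈ JVm) (hy : y ∈ Vm) : hsh x y ∈ JVm := by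
  obtain ⟨x1, hx1, x2, hx2, rfl⟩ := Submodule.mem_sup.mp hx
  obtain ⟨x3, hx3, rfl⟩ := (Submodule.mem_smul_pointwise_iff_exists _ _ _).mp hx2
  rw [map_add, LinearMap.add_apply, map_smul, LinearMap.smul_apply]
  exact add_mem
    (uspan_bilin hsh (fun u v hu hv => (hsh_uw_mem _ u v le_rfl).2.2.2 hu.1 hu.2 hv) hx1 hy)
    (smul_mem_vspan (hsh_mem_Vm hx3 hy))

theorem hsh_mem_Hhat {x y : HH} (hx : x ∈ Hhat) (hy : y ∈ Hhat) : hsh x y ∈ Hhat := by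
  rw [Hhat_eq] at hx hy
  refine uspan_bilin hsh (fun u v hu hv => ?_) hx hy
  have one : uw [] = 1 := by simp [uw]
  rw [Hhat_eq]
  rcases lastGe_iff.mp hu with rfl | hu2
  · rw [one, hsh_one_left]; exact uw_mem_uspan hv
  rcases lastGe_iff.mp hv with rfl | hv2
  · rw [one, hsh_one_right]; exact uw_mem_uspan hu
  rw [← Hhat_eq]
  exact Vm_le_Hhat ((hsh_uw_mem _ u v le_rfl).2.1 hu2 hv2)

theorem Zq_hsh' {q : ℂ} (hq : ‖q‖ < 1) {x y : HH} (hx : x ∈ Hhat) (hy : y ∈ Hhat) :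
    Zq q (hsh x y) = Zq q x * Zq q y :=
  Zq_hsh hq hx hy (hsh_mem_Hhat hx hy)

open Finset.HasAntidiagonal (antidiagonal mem_antidiagonal)

/-! ### Divided powers of `g_1` and the elements `E_{1^m}` -/

/-- The scalar `1 / n!`. -/
noncomputable def fc (n : ℕ) : CC := Polynomial.C (1 / (n.factorial : ℚ))

theorem fc_zero : fc 0 = 1 := by simp [fc]

theorem fc_one : fc 1 = 1 := by simp [fc]

theorem succ_mul_fc (n : ℕ) : ((n + 1 : ℕ) : CC) * fc (n + 1) = fc n := by
  rw [fc, fc, ← map_natCast Polynomial.C, ← map_mul]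
  congr 1
  rw [Nat.factorial_succ]
  have h1 : ((n + 1 : ℕ) : ℚ) ≠ 0 := by exact_mod_cast Nat.succ_ne_zero n
  have h2 : (n.factorial : ℚ) ≠ 0 := by exact_mod_cast Nat.factorial_ne_zero n
  push_cast at h1 ⊢
  field_simp

theorem factorial_mul_fc (n : ℕ) : (n.factorial : CC) * fc n = 1 := by
  rw [fc, ← map_natCast Polynomial.C, ← map_mul, mul_one_div_cancel, map_one]
  exact_mod_cast Nat.factorial_ne_zero n

theorem succ_smul_cancel (n : ℕ) {x y : HH} (h : ((n + 1 : ℕ) : CC) • x = ((n + 1 : ℕ) : CC) • y) :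
    x = y := by
  have h2 := congrArg (fun z => ((n.factorial : CC) * fc (n + 1)) • z) h
  have h3 : (n.factorial : CC) * fc (n + 1) * ((n + 1 : ℕ) : CC) = 1 := by
    rw [mul_assoc, mul_comm (fc _), succ_mul_fc, factorial_mul_fc]
  simpa only [smul_smul, h3, one_smul] using h2

/-- The binomial theorem for divided powers. -/
theorem sum_fc (s t : CC) (n : ℕ) :
    ∑ p ∈ antidiagonal n, s ^ p.1 * fc p.1 * (t ^ p.2 * fc p.2) = (s + t) ^ n * fc n := by
  rw [add_comm s t, add_comm t s, Commute.add_pow' (Commute.all s t), Finset.sum_mul]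
  refine Finset.sum_congr rfl fun p hp => ?_
  rw [mem_antidiagonal] at hp
  have h : ((n.choose p.1 : ℕ) : CC) * fc n = fc p.1 * fc p.2 := by
    have h1 : (n.choose p.1 : CC) * p.1.factorial * p.2.factorial = n.factorial := by
      rw [← hp, ← Nat.add_choose_mul_factorial_mul_factorial p.1 p.2, Nat.choose_symm_add]
      push_cast; rfl
    have e1 := factorial_mul_fc p.1
    have e2 := factorial_mul_fc p.2
    have e3 := factorial_mul_fc n
    rw [← h1] at e3
    linear_combination (fc p.1 * fc p.2) * e3 - (n.choose p.1 : CC) * fc n *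
      ((p.2.factorial : CC) * fc p.2) * e1 - (n.choose p.1 : CC) * fc n * e2
  rw [nsmul_eq_mul]
  linear_combination -(s ^ p.1 * t ^ p.2) * h

theorem g_one : g 1 = cl CC 1 := rfl

/-- The divided shuffle power `g_1^{sh n} / n!`. -/
noncomputable def yd (n : ℕ) : HH := fc n • shPow (g 1) n

theorem yd_zero : yd 0 = 1 := by simp [yd, fc_zero, shPow]

theorem succ_smul_yd (n : ℕ) : ((n + 1 : ℕ) : CC) • yd (n + 1) = hsh (g 1) (yd n) := by
  rw [yd, yd, smul_smul, succ_mul_fc, map_smul, shPow]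

theorem hsh_uA_zero (x : HH) : hsh (uA 0) x = x * uA 0 := by
  rw [← one_mul (uA 0), hsh_mul_uA_left, hsh_one_left, one_mul]

theorem hsh_cl_one (x y : HH) : hsh (x * cl CC 1) (y * cl CC 1)
    = (hsh (x * cl CC 1) y + hsh x (y * cl CC 1) + hsh x y * uA 0) * cl CC 1 := by
  have h := hsh_cl_succ x y 0 0
  rw [zero_add] at h
  rw [h, hsh_mul_cl_zero_left, hsh_mul_cl_zero_right, hsh_mul_cl_zero_left,
    hsh_mul_cl_zero_right]
  have : uA 0 = hb • cl CC 0 := by simp [uA]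
  simp only [this, add_mul, mul_assoc, cl_mul_a, smul_mul_assoc, mul_smul_comm, zero_add]

theorem hsh_g_one (x : HH) : hsh (g 1) (x * cl CC 1)
    = (hsh (g 1) x + x * cl CC 1 + x * uA 0) * cl CC 1 := by
  have h := hsh_cl_one 1 x
  rwa [one_mul, hsh_one_left, hsh_one_left, ← g_one] at h

theorem hsh_assoc (x y z : HH) : hsh (hsh x y) z = hsh x (hsh y z) := qsh_assoc _ x y z

theorem hsh_e_one (x : HH) : hsh (e 1) x = hsh (g 1) x + x * uA 0 := by
  rw [show e 1 = g 1 + uA 0 by rw [← e_sub_g]; abel, map_add, LinearMap.add_apply, hsh_uA_zero]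

theorem EOne_zero : EOne 0 = 1 := by simp [EOne, shPow, hsh_one_left]

theorem EOne_succ (m : ℕ) : ((m + 2 : ℕ) : CC) • EOne (m + 1)
    = yd (m + 1) + hsh (g 1) (EOne m) + EOne m * uA 0 := by
  have h1 : ∑ j ∈ Finset.range (m + 2), hsh (shPow (g 1) j) (shPow (e 1) (m + 1 - j))
      = hsh (e 1) (∑ j ∈ Finset.range (m + 1), hsh (shPow (g 1) j) (shPow (e 1) (m - j)))
        + shPow (g 1) (m + 1) := by
    rw [Finset.sum_range_succ, Nat.sub_self, shPow.eq_1, hsh_one_right, map_sum]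
    congr 1
    refine Finset.sum_congr rfl fun j hj => ?_
    rw [Finset.mem_range] at hj
    rw [show m + 1 - j = (m - j) + 1 by omega, shPow, ← hsh_assoc, ← hsh_assoc, hsh_comm (e 1)]
  have h2 : EOne (m + 1) = fc (m + 2) •
      ∑ j ∈ Finset.range (m + 2), hsh (shPow (g 1) j) (shPow (e 1) (m + 1 - j)) := rfl
  have h3 : EOne m = fc (m + 1) •
      ∑ j ∈ Finset.range (m + 1), hsh (shPow (g 1) j) (shPow (e 1) (m - j)) := rfl
  rw [h2, smul_smul, succ_mul_fc (m + 1), h1, smul_add, h3, ← map_smul, hsh_e_one, yd]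
  abel

/-- The recursions of both sides in `n` agree after multiplication by `n + 1`. -/
theorem yd_succ (n : ℕ) : yd (n + 1) = EOne n * cl CC 1 := by
  induction n with
  | zero => rw [yd, EOne_zero, shPow, shPow, hsh_one_right, fc_one, one_smul, one_mul, g_one]
  | succ n ih =>
    refine succ_smul_cancel (n + 1) ?_
    rw [succ_smul_yd, ih, hsh_g_one, ← smul_mul_assoc, EOne_succ, ih]
    congr 1
    abel

/-- `E_{1^m}` in terms of the divided powers of `g_1`. -/
theorem EOne_eq (m : ℕ) : EOne m
    = ∑ p ∈ antidiagonal m, yd p.1 * (fc (p.2 + 1) • uA 0 ^ p.2) := by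
  induction m with
  | zero => simp [EOne_zero, yd_zero, fc_one]
  | succ m ih =>
    refine succ_smul_cancel (m + 1) ?_
    have hpow : ∀ (x : HH) (j : ℕ), hsh (g 1) (x * uA 0 ^ j) = hsh (g 1) x * uA 0 ^ j := by
      intro x j
      induction j with
      | zero => simp
      | succ j ih => rw [pow_succ, ← mul_assoc, hsh_mul_uA_right, ih, mul_assoc]
    have h1 : hsh (g 1) (EOne m) = ∑ p ∈ antidiagonal (m + 1),
        (p.1 : CC) • (yd p.1 * (fc (p.2 + 1) • uA 0 ^ p.2)) := by
      rw [ih, Finset.Nat.sum_antidiagonal_succ, map_sum]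
      simp only [Nat.cast_zero, zero_smul, zero_add]
      refine Finset.sum_congr rfl fun p _ => ?_
      rw [mul_smul_comm, map_smul, hpow, ← succ_smul_yd, mul_smul_comm, smul_mul_assoc, smul_comm]
    have h2 : yd (m + 1) + EOne m * uA 0 = ∑ p ∈ antidiagonal (m + 1),
        ((p.2 + 1 : ℕ) : CC) • (yd p.1 * (fc (p.2 + 1) • uA 0 ^ p.2)) := by
      rw [ih, Finset.Nat.sum_antidiagonal_succ', Finset.sum_mul]
      congr 1
      · simp [fc_one]
      · refine Finset.sum_congr rfl fun p _ => ?_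
        rw [mul_assoc, smul_mul_assoc, ← pow_succ, mul_smul_comm, mul_smul_comm, smul_smul,
          succ_mul_fc]
    rw [EOne_succ, add_right_comm, h2, h1, ← Finset.sum_add_distrib, Finset.smul_sum]
    refine Finset.sum_congr rfl fun p hp => ?_
    rw [mem_antidiagonal] at hp
    rw [← add_smul, ← Nat.cast_add]
    congr 2
    omega

/-! ### Generating series -/

/-- `∑ tⁿ yₙ Xⁿ`. -/
noncomputable def ys (t : CC) : PowerSeries HH := PowerSeries.mk fun n => t ^ n • yd n

/-- `(e^{tBX} - 1) / (tBX)` with `B = ħ b`. -/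
noncomputable def phs (t : CC) : PowerSeries HH :=
  PowerSeries.mk fun n => (t ^ n * fc (n + 1)) • uA 0 ^ n

/-- `e^{tBX}` with `B = ħ b`. -/
noncomputable def kap (t : CC) : PowerSeries HH :=
  PowerSeries.mk fun n => (t ^ n * fc n) • uA 0 ^ n

open PowerSeries in
theorem ys_eq (t : CC) : ys t = 1 + t • (X * (ys t * phs t * C (cl CC 1))) := by
  ext n
  rcases n with _ | n
  · simp [ys, yd_zero]
  · rw [map_add, coeff_smul, coeff_succ_X_mul, coeff_mul_C, coeff_mul, coeff_one,
      if_neg (by omega), zero_add, ys, phs, coeff_mk, yd_succ, EOne_eq, Finset.sum_mul,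
      Finset.sum_mul, Finset.smul_sum, Finset.smul_sum]
    refine Finset.sum_congr rfl fun p hp => ?_
    rw [mem_antidiagonal] at hp
    simp only [coeff_mk, smul_mul_assoc, mul_smul_comm, smul_smul]
    congr 1
    rw [← hp]; ring

open PowerSeries in
theorem eq_zero_of_eq_X_mul {D T : PowerSeries HH} (h : D = X * (D * T)) : D = 0 := by
  ext n
  induction n using Nat.strong_induction_on with
  | _ n ih =>
    rw [h]
    rcases n with _ | n
    · simp
    · rw [coeff_succ_X_mul, coeff_mul]
      refine Finset.sum_eq_zero fun p hp => ?_
      rw [mem_antidiagonal] at hp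
      rw [ih p.1 (by omega), map_zero, zero_mul]

open PowerSeries in
/-- The recursion of `ys` by first letters. It has the same solution as the one by last letters. -/
theorem ys_eq' (t : CC) : ys t = 1 + t • (X * (phs t * C (cl CC 1) * ys t)) := by
  set T := phs t * C (cl CC 1) with hT
  have h1 : ys t = 1 + t • (X * (ys t * T)) := by
    rw [hT, ← mul_assoc (ys t)]; exact ys_eq t
  have h2 : t • (X * (ys t * T)) = ys t - 1 := by rw [eq_sub_iff_add_eq, add_comm, ← h1]
  rw [← sub_eq_zero]
  refine eq_zero_of_eq_X_mul (T := t • T) ?_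
  have h3 : X * ((ys t - (1 + t • (X * (T * ys t)))) * t • T)
      = t • (X * (ys t * T)) - t • (X * T) - t • (X * (T * (t • (X * (ys t * T))))) := by
    clear_value T
    simp only [sub_mul, add_mul, mul_sub, mul_add, mul_smul_comm, smul_mul_assoc, smul_add,
      one_mul, smul_sub]
    rw [sub_sub, ← mul_assoc T X, ← X_mul]
    simp only [mul_assoc]
  rw [h3, h2, mul_sub, mul_sub, mul_one, smul_sub]
  abel

open PowerSeries in
theorem kap_eq (t : CC) : kap t = 1 + t • (X * (phs t * C (uA 0))) := by
  ext n
  rcases n with _ | n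
  · simp [kap, fc_zero]
  · rw [map_add, coeff_smul, coeff_succ_X_mul, coeff_mul_C, coeff_one, if_neg (by omega), kap, phs,
      coeff_mk, coeff_mk, zero_add, smul_mul_assoc, smul_smul, ← pow_succ, pow_succ t]
    congr 1
    ring

open PowerSeries in
theorem kap_mul_phs : kap 1 * phs (-1) = phs 1 := by
  ext n
  rw [coeff_mul]
  simp only [kap, phs, coeff_mk]
  have h := sum_fc 1 (-1) (n + 1)
  rw [Finset.Nat.sum_antidiagonal_succ'] at h
  simp only [add_neg_cancel, ne_eq, Nat.add_eq_zero_iff, one_ne_zero, and_false,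
    not_false_eq_true, zero_pow, zero_mul, pow_zero, fc_zero, one_pow, one_mul, mul_one] at h
  have h2 : ∑ p ∈ antidiagonal n, fc p.1 * ((-1) ^ p.2 * fc (p.2 + 1)) = fc (n + 1) := by
    have h3 : ∑ p ∈ antidiagonal n, fc p.1 * ((-1) ^ p.2 * fc (p.2 + 1))
        = - ∑ p ∈ antidiagonal n, fc p.1 * ((-1) ^ (p.2 + 1) * fc (p.2 + 1)) := by
      rw [← Finset.sum_neg_distrib]
      exact Finset.sum_congr rfl fun p _ => by ring
    rw [h3]
    linear_combination -h
  rw [one_pow, one_mul, ← h2, Finset.sum_smul]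
  refine Finset.sum_congr rfl fun p hp => ?_
  rw [mem_antidiagonal] at hp
  rw [smul_mul_smul_comm, ← pow_add, hp, one_pow, one_mul]

open PowerSeries in
/-- The recursion of `ys (-1)` by first letters, with `g_1` replaced by `g_1 + ħ b = -ψ^sh(g_1)`. -/
theorem phs_mul_ys : X * (phs 1 * C (cl CC 1 + uA 0) * ys (-1)) = kap 1 - ys (-1) := by
  have h1 : X * (phs (-1) * C (cl CC 1) * ys (-1)) = 1 - ys (-1) := by
    have := ys_eq' (-1)
    rw [neg_smul, one_smul] at this
    rw [eq_sub_iff_add_eq, add_comm]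
    nth_rw 1 [this]
    abel
  have h2 : X * (phs 1 * C (uA 0)) = kap 1 - 1 := by
    rw [kap_eq 1, one_smul]; abel
  have h3 : X * (phs 1 * C (cl CC 1) * ys (-1)) = kap 1 * (1 - ys (-1)) := by
    rw [← kap_mul_phs, ← h1, ← mul_assoc (kap 1) X, ← X_mul]
    simp only [mul_assoc]
  rw [map_add, mul_add, add_mul, mul_add, h3, ← mul_assoc X (phs 1 * C (uA 0)), h2]
  noncomm_ring

/-- The coefficients of `phs_mul_ys`. -/
theorem sum_phs_yd (k : ℕ) : ∑ p ∈ antidiagonal k,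
    (fc (p.1 + 1) • uA 0 ^ p.1) * ((cl CC 1 + uA 0) * ((-1 : CC) ^ p.2 • yd p.2))
      = fc (k + 1) • uA 0 ^ (k + 1) - (-1 : CC) ^ (k + 1) • yd (k + 1) := by
  have h := congrArg (PowerSeries.coeff (k + 1)) phs_mul_ys
  rw [PowerSeries.coeff_succ_X_mul, PowerSeries.coeff_mul, map_sub] at h
  simpa only [PowerSeries.coeff_mul_C, phs, kap, ys, PowerSeries.coeff_mk, one_pow, one_mul,
    mul_assoc] using h

theorem sum_antidiagonal_assoc {M : Type} [AddCommMonoid M] (n : ℕ) (f : ℕ → ℕ → ℕ → M) :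
    ∑ p ∈ antidiagonal n, ∑ r ∈ antidiagonal p.1, f r.1 r.2 p.2
      = ∑ p ∈ antidiagonal n, ∑ r ∈ antidiagonal p.2, f p.1 r.1 r.2 := by
  simp only [Finset.sum_sigma']
  apply Finset.sum_nbij' (fun ⟨⟨_i, j⟩, ⟨k, l⟩⟩ ↦ ⟨(k, l + j), (l, j)⟩)
    (fun ⟨⟨i, _j⟩, ⟨k, l⟩⟩ ↦ ⟨(i + k, l), (i, k)⟩)
  · rintro ⟨⟨i, j⟩, k, l⟩ h
    simp only [Finset.mem_sigma, mem_antidiagonal] at h ⊢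
    exact ⟨by omega, trivial⟩
  · rintro ⟨⟨i, j⟩, k, l⟩ h
    simp only [Finset.mem_sigma, mem_antidiagonal] at h ⊢
    exact ⟨by omega, trivial⟩
  · rintro ⟨⟨i, j⟩, k, l⟩ h
    simp only [Finset.mem_sigma, mem_antidiagonal] at h ⊢
    obtain ⟨-, rfl⟩ := h
    rfl
  · rintro ⟨⟨i, j⟩, k, l⟩ h
    simp only [Finset.mem_sigma, mem_antidiagonal] at h ⊢
    obtain ⟨-, rfl⟩ := h
    rfl
  · rintro ⟨⟨i, j⟩, k, l⟩ h
    rfl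

/-- The recursion of `E_{1^m}` by its last letter `g_1`. -/
theorem EOne_rec (m : ℕ) : EOne (m + 1) = fc (m + 2) • uA 0 ^ (m + 1)
    + ∑ p ∈ antidiagonal m, EOne p.1 * cl CC 1 * (fc (p.2 + 1) • uA 0 ^ p.2) := by
  rw [EOne_eq, Finset.Nat.sum_antidiagonal_succ]
  simp [yd_zero, yd_succ]

/-! ### Cutting words -/

/-- The trilinear cut `∑ (x u') sh_ħ (z ψ^sh(u''))` over all factorizations of a word `u = u' u''` into
words in the letters `b a^k`. -/
noncomputable def cutL : HH →ₗ[CC] HH →ₗ[CC] HH →ₗ[CC] HH :=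
  cext fun ks => ∑ i ∈ Finset.range (ks.length + 1),
    hsh.compl₁₂ (LinearMap.mulRight CC (cmono CC (ks.take i)))
      (LinearMap.mulRight CC (psiSh (cmono CC (ks.drop i))))

theorem cutL_cmono (ks : List ℕ) (x z : HH) : cutL (cmono CC ks) x z
    = ∑ i ∈ Finset.range (ks.length + 1),
        hsh (x * cmono CC (ks.take i)) (z * psiSh (cmono CC (ks.drop i))) := by
  rw [cutL, cext_cmono]
  simp [LinearMap.sum_apply]

theorem cmono_mem_Wmod (ks : List ℕ) : cmono CC ks ∈ Wmod := Submodule.subset_span ⟨ks, rfl⟩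

theorem wSh_eq {u : HH} (hu : u ∈ Wmod) : wSh u = cutL u 1 1 := by
  have : Wmod ≤ LinearMap.eqLocus wSh ((cutL.flip 1).flip 1) := by
    rw [Wmod, Submodule.span_le]
    rintro _ ⟨ks, rfl⟩
    simp [wSh, wS, cext_cmono, cutL_cmono]
  exact this hu

theorem psiSh_append (u v : List ℕ) :
    psiSh (cmono CC (u ++ v)) = psiSh (cmono CC v) * psiSh (cmono CC u) := by
  simp [psiSh, cext_cmono]

theorem psiSh_one : psiSh 1 = 1 := by
  rw [show (1 : HH) = cmono CC [] by simp [cmono], psiSh, cext_cmono]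
  simp [cmono]

theorem Wmod_eqOn {M : Type} [AddCommGroup M] [Module CC M] (f g : HH →ₗ[CC] M)
    (h : ∀ u, f (cmono CC u) = g (cmono CC u)) {x : HH} (hx : x ∈ Wmod) : f x = g x := by
  have : Wmod ≤ LinearMap.eqLocus f g := by
    rw [Wmod, Submodule.span_le]
    rintro _ ⟨u, rfl⟩
    exact h u
  exact this hx

theorem psiSh_mul {x y : HH} (hx : x ∈ Wmod) (hy : y ∈ Wmod) :
    psiSh (x * y) = psiSh y * psiSh x := by
  refine Wmod_eqOn (psiSh.comp (LinearMap.mulRight CC y))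
    ((LinearMap.mulLeft CC (psiSh y)).comp psiSh) (fun u => ?_) hx
  refine Wmod_eqOn (psiSh.comp (LinearMap.mulLeft CC (cmono CC u)))
    ((LinearMap.mulRight CC (psiSh (cmono CC u))).comp psiSh) (fun v => ?_) hy
  rw [LinearMap.comp_apply, LinearMap.comp_apply, LinearMap.mulLeft_apply,
    LinearMap.mulRight_apply, ← cmono_append, psiSh_append]

theorem psiSh_cl (k : ℕ) : psiSh (cl CC k) = vb CC * (-va CC - algebraMap CC HH hb) ^ k := by
  rw [← cmono_single, psiSh, cext_cmono]
  simp

theorem cl_mem_Wmod (k : ℕ) : cl CC k ∈ Wmod := cmono_single k ▸ cmono_mem_Wmod _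

theorem one_mem_Wmod : (1 : HH) ∈ Wmod := by
  have := cmono_mem_Wmod []
  simpa [cmono] using this

theorem Wmod_mul {x y : HH} (hx : x ∈ Wmod) (hy : y ∈ Wmod) : x * y ∈ Wmod := by
  have h1 : ∀ u, cmono CC u * y ∈ Wmod := by
    intro u
    have : Wmod ≤ Wmod.comap (LinearMap.mulLeft CC (cmono CC u)) := by
      nth_rw 1 [Wmod]
      rw [Submodule.span_le]
      rintro _ ⟨v, rfl⟩
      simpa [← cmono_append] using cmono_mem_Wmod _
    exact this hy
  have : Wmod ≤ Wmod.comap (LinearMap.mulRight CC y) := by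
    nth_rw 1 [Wmod]
    rw [Submodule.span_le]
    rintro _ ⟨u, rfl⟩
    exact h1 u
  exact this hx

theorem Cm_le_Wmod : Cm ≤ Wmod := uspan_induction fun u _ => uw_mem_Wmod u

theorem uA_zero_eq : uA 0 = hb • cl CC 0 := by simp [uA]

theorem psiSh_uA_zero : psiSh (uA 0) = uA 0 := by
  rw [uA_zero_eq, map_smul, psiSh_cl]; simp [cl]

theorem psiSh_cl_one : psiSh (cl CC 1) = -(cl CC 1 + uA 0) := by
  rw [psiSh_cl, uA_zero_eq, cl, cl, pow_one, pow_one, pow_zero, mul_one, mul_sub, Algebra.smul_def,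
    Algebra.commutes]
  noncomm_ring

theorem psiSh_uA_pow (j : ℕ) : psiSh (uA 0 ^ j) = uA 0 ^ j := by
  induction j with
  | zero => simp [psiSh_one]
  | succ j ih =>
    have h0 : ∀ n, uA 0 ^ n ∈ Wmod := by
      intro n
      induction n with
      | zero => exact one_mem_Wmod
      | succ n ih => exact Wmod_mul ih (Cm_le_Wmod (uA_mem_Cm 0))
    rw [pow_succ, psiSh_mul (h0 j) (Cm_le_Wmod (uA_mem_Cm 0)), ih, psiSh_uA_zero, ← pow_succ,
      pow_succ']

/-- The cut of a product with a distinguished letter. -/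
theorem cutL_mul {u v : HH} (hu : u ∈ Wmod) (hv : v ∈ Wmod) (k : ℕ) (x z : HH) :
    cutL (u * cl CC k * v) x z = cutL u x (z * psiSh (cl CC k * v))
      + cutL v (x * u * cl CC k) z := by
  have h := Wmod_eqOn (((cutL.flip x).flip z).comp (LinearMap.mulRight CC (cl CC k * v)))
    ((cutL.flip x).flip (z * psiSh (cl CC k * v))
      + ((cutL v).flip z).comp ((LinearMap.mulRight CC (cl CC k)).comp (LinearMap.mulLeft CC x)))
    (fun u => ?_) hu
  · simpa [mul_assoc] using h
  have h := Wmod_eqOn (((cutL.flip x).flip z).comp (LinearMap.mulLeft CC (cmono CC u * cl CC k)))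
    ((cutL (cmono CC u) x).comp ((LinearMap.mulLeft CC z).comp
        (psiSh.comp (LinearMap.mulLeft CC (cl CC k))))
      + (cutL.flip (x * cmono CC u * cl CC k)).flip z)
    (fun v => ?_) hv
  · simpa [mul_assoc] using h
  have e1 : cmono CC u * cl CC k * cmono CC v = cmono CC (u ++ k :: v) := by
    rw [← cmono_single, ← cmono_append, ← cmono_append]; simp
  have e2 : cl CC k * cmono CC v = cmono CC (k :: v) := by
    rw [← cmono_single, ← cmono_append]; simp
  simp only [LinearMap.comp_apply, LinearMap.flip_apply, LinearMap.mulLeft_apply,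
    LinearMap.add_apply]
  rw [e1, e2, cutL_cmono, cutL_cmono, cutL_cmono,
    show (u ++ k :: v).length + 1 = (u.length + 1) + (v.length + 1) by simp; omega,
    Finset.sum_range_add]
  congr 1
  · refine Finset.sum_congr rfl fun i hi => ?_
    rw [Finset.mem_range] at hi
    rw [List.take_append_of_le_length (by omega), List.drop_append_of_le_length (by omega),
      psiSh_append, mul_assoc]
  · refine Finset.sum_congr rfl fun i _ => ?_
    have : u ++ k :: v = (u ++ [k]) ++ v := by simp
    rw [this, show u.length + 1 + i = (u ++ [k]).length + i by simp, List.take_length_add_append,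
      List.drop_length_add_append, cmono_append, cmono_append, cmono_single]
    simp only [mul_assoc]

theorem uA_pow_mem_Cm (j : ℕ) : uA 0 ^ j ∈ Cm := by
  induction j with
  | zero => exact one_mem_Cm
  | succ j ih => rw [pow_succ]; exact Cm_mul ih (uA_mem_Cm 0)

theorem hsh_mul_uA_pow_right (x y : HH) (j : ℕ) : hsh x (y * uA 0 ^ j) = hsh x y * uA 0 ^ j := by
  induction j with
  | zero => simp
  | succ j ih => rw [pow_succ, ← mul_assoc, hsh_mul_uA_right, ih, mul_assoc]

theorem cutL_one (x z : HH) : cutL 1 x z = hsh x z := by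
  rw [show (1 : HH) = cmono CC [] by simp [cmono], cutL_cmono]
  simp [cmono, show psiSh 1 = 1 from psiSh_one]

theorem cutL_uA_pow (j : ℕ) (x z : HH) :
    cutL (uA 0 ^ j) x z = ((j + 1 : ℕ) : CC) • (hsh x z * uA 0 ^ j) := by
  induction j generalizing x with
  | zero => simp [cutL_one]
  | succ j ih =>
    have h := cutL_mul one_mem_Wmod (Cm_le_Wmod (uA_pow_mem_Cm j)) 0 x z
    rw [one_mul, mul_one, cutL_one] at h
    have h2 : cutL (uA 0 * uA 0 ^ j) x z
        = hsh x (z * psiSh (uA 0 * uA 0 ^ j)) + cutL (uA 0 ^ j) (x * uA 0) z := by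
      generalize uA 0 ^ j = P at h
      have h3 := congrArg (hb • ·) h
      simpa only [uA_zero_eq, smul_mul_assoc, mul_smul_comm, map_smul, LinearMap.smul_apply,
        smul_add] using h3
    rw [pow_succ', h2, ih, ← pow_succ', psiSh_uA_pow, hsh_mul_uA_pow_right, hsh_mul_uA_left,
      mul_assoc, ← pow_succ', add_comm]
    push_cast
    rw [add_smul ((j : CC) + 1), one_smul]

theorem yd_mem_Cm (n : ℕ) : yd n ∈ Cm := by
  have hg : ∀ n, shPow (g 1) n ∈ Cm := by
    intro n
    induction n with
    | zero => exact one_mem_Cm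
    | succ n ih => exact hsh_mem_Cm (cl_succ_mem_Cm 0) ih
  exact Submodule.smul_mem _ _ (hg n)

theorem EOne_mem_Cm (m : ℕ) : EOne m ∈ Cm := by
  rw [EOne_eq]
  refine Submodule.sum_mem _ fun p _ => ?_
  exact Cm_mul (yd_mem_Cm _) (Submodule.smul_mem _ _ (uA_pow_mem_Cm _))

/-- The cuts of `E_{1^m}` are those of a divided power of one letter: the reason is that the
generating series of the `y_n` is a shuffle exponential, and that `ψ^sh(g_1) = -(g_1 + ħ b)`. -/
theorem cutL_EOne (m : ℕ) (x z : HH) : cutL (EOne m) x z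
    = ∑ p ∈ antidiagonal m, (-1 : CC) ^ p.2 • hsh (x * yd p.1) (z * yd p.2) := by
  induction m using Nat.strong_induction_on generalizing x z with
  | _ m ih =>
    rcases m with _ | m
    · simp [EOne_zero, yd_zero, cutL_one]
    -- A summand of the recursion of `E_{1^{m+1}}`: the cuts in front of its last letter `g_1` and those
    -- behind it.
    have h1 : ∀ i j, i + j = m → cutL (EOne i * cl CC 1 * (fc (j + 1) • uA 0 ^ j)) x z
        = (∑ r ∈ antidiagonal i, (-1 : CC) ^ r.2 •
            hsh (x * yd r.1) (z * ((fc (j + 1) • uA 0 ^ j) * -(cl CC 1 + uA 0)) * yd r.2))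
          + fc j • (hsh (x * yd (i + 1)) z * uA 0 ^ j) := by
      intro i j hij
      have hB := Cm_le_Wmod (Submodule.smul_mem _ (fc (j + 1)) (uA_pow_mem_Cm j))
      rw [cutL_mul (Cm_le_Wmod (EOne_mem_Cm i)) hB, ih i (by omega), psiSh_mul (cl_mem_Wmod 1) hB,
        map_smul psiSh, psiSh_uA_pow, psiSh_cl_one, map_smul, LinearMap.smul_apply,
        LinearMap.smul_apply, cutL_uA_pow, smul_smul, mul_comm (fc _), succ_mul_fc, yd_succ,
        mul_assoc x]
    have h2 : ∀ a k, ∑ r ∈ antidiagonal k, (-1 : CC) ^ r.1 •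
          hsh (x * yd a) (z * ((fc (r.2 + 1) • uA 0 ^ r.2) * -(cl CC 1 + uA 0)) * yd r.1)
        = (-1 : CC) ^ (k + 1) • hsh (x * yd a) (z * yd (k + 1))
          - fc (k + 1) • (hsh (x * yd a) z * uA 0 ^ (k + 1)) := by
      intro a k
      have h := congrArg (fun w => hsh (x * yd a) (z * w)) (sum_phs_yd k)
      simp only [mul_sub, map_sub, mul_smul_comm, map_smul, hsh_mul_uA_pow_right,
        Finset.mul_sum, map_sum] at h
      rw [← neg_inj, neg_sub, ← h, ← Finset.Nat.sum_antidiagonal_swap, ← Finset.sum_neg_distrib]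
      refine Finset.sum_congr rfl fun r _ => ?_
      simp only [Prod.fst_swap, Prod.snd_swap, mul_neg, neg_mul, map_neg, smul_neg, neg_neg,
        mul_assoc, smul_mul_assoc, mul_smul_comm, map_smul]
    have h3 := sum_antidiagonal_assoc m (fun a b j => (-1 : CC) ^ b •
      hsh (x * yd a) (z * ((fc (j + 1) • uA 0 ^ j) * -(cl CC 1 + uA 0)) * yd b))
    rw [EOne_rec, map_add, map_sum, LinearMap.add_apply, LinearMap.add_apply, LinearMap.sum_apply,
      LinearMap.sum_apply, Finset.sum_congr rfl fun p hp => h1 p.1 p.2 (mem_antidiagonal.mp hp),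
      Finset.sum_add_distrib, h3, Finset.sum_congr rfl fun p _ => h2 p.1 p.2,
      Finset.sum_sub_distrib, map_smul, LinearMap.smul_apply, LinearMap.smul_apply, cutL_uA_pow,
      smul_smul, mul_comm (fc _), succ_mul_fc, Finset.Nat.sum_antidiagonal_succ']
    have h4 : fc (m + 1) • (hsh x z * uA 0 ^ (m + 1))
        + ∑ p ∈ antidiagonal m, fc p.2 • (hsh (x * yd (p.1 + 1)) z * uA 0 ^ p.2)
        = ∑ p ∈ antidiagonal (m + 1), fc p.2 • (hsh (x * yd p.1) z * uA 0 ^ p.2) := by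
      rw [Finset.Nat.sum_antidiagonal_succ]
      simp [yd_zero]
    rw [Finset.Nat.sum_antidiagonal_succ'] at h4
    simp only [yd_zero, fc_zero, pow_zero, one_smul, mul_one] at h4 ⊢
    rw [add_left_comm, h4]
    abel

/-! ### The shuffle product of power series -/

/-- The product `sh_ħ` of power series with coefficients in `ℌ`. -/
noncomputable def shp : PowerSeries HH →ₗ[CC] PowerSeries HH →ₗ[CC] PowerSeries HH :=
  LinearMap.mk₂ CC (fun U W => PowerSeries.mk fun n => ∑ p ∈ antidiagonal n,
      hsh (PowerSeries.coeff p.1 U) (PowerSeries.coeff p.2 W))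
    (fun U V W => by ext n; simp [Finset.sum_add_distrib])
    (fun c U W => by ext n; simp [Finset.smul_sum])
    (fun U V W => by ext n; simp [Finset.sum_add_distrib])
    (fun c U W => by ext n; simp [Finset.smul_sum])

theorem coeff_shp (n : ℕ) (U W : PowerSeries HH) : PowerSeries.coeff n (shp U W)
    = ∑ p ∈ antidiagonal n, hsh (PowerSeries.coeff p.1 U) (PowerSeries.coeff p.2 W) := by
  simp [shp]

theorem shp_comm (U W : PowerSeries HH) : shp U W = shp W U := by
  ext n
  rw [coeff_shp, coeff_shp, ← Finset.Nat.sum_antidiagonal_swap]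
  exact Finset.sum_congr rfl fun p _ => hsh_comm _ _

theorem shp_one_left (W : PowerSeries HH) : shp 1 W = W := by
  ext n
  rw [coeff_shp]
  cases n with
  | zero => simp [hsh_one_left]
  | succ n =>
    rw [Finset.Nat.sum_antidiagonal_succ]
    simp [PowerSeries.coeff_one, hsh_one_left]

/-- Right multiplication by `K` passes through the shuffle product of power series. -/
def ShCentral (K : PowerSeries HH) : Prop :=
  ∀ n x y, hsh (x * PowerSeries.coeff n K) y = hsh x y * PowerSeries.coeff n K

theorem shp_mul_left {K : PowerSeries HH} (hK : ShCentral K) (U W : PowerSeries HH) :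
    shp (U * K) W = shp U W * K := by
  ext n
  have h := sum_antidiagonal_assoc n (fun a b j => hsh (PowerSeries.coeff a U
    * PowerSeries.coeff b K) (PowerSeries.coeff j W))
  have h2 := sum_antidiagonal_assoc n (fun a b j => hsh (PowerSeries.coeff a U)
    (PowerSeries.coeff b W) * PowerSeries.coeff j K)
  rw [coeff_shp, PowerSeries.coeff_mul]
  simp only [PowerSeries.coeff_mul, coeff_shp, map_sum, LinearMap.sum_apply, Finset.sum_mul]
  rw [h, h2]
  refine Finset.sum_congr rfl fun p _ => ?_
  rw [← Finset.Nat.sum_antidiagonal_swap]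
  exact Finset.sum_congr rfl fun r _ => hK _ _ _

theorem shp_mul_right {K : PowerSeries HH} (hK : ShCentral K) (U W : PowerSeries HH) :
    shp U (W * K) = shp U W * K := by
  rw [shp_comm, shp_mul_left hK, shp_comm]

theorem shp_mul_a (U W : PowerSeries HH) :
    shp (U * PowerSeries.C (va CC)) (W * PowerSeries.C (va CC))
      = (shp (U * PowerSeries.C (va CC)) W + shp U (W * PowerSeries.C (va CC)) + hb • shp U W)
        * PowerSeries.C (va CC) := by
  ext n
  simp only [coeff_shp, PowerSeries.coeff_mul_C, map_add, PowerSeries.coeff_smul, hsh_eq,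
    qsh_mul_a, ← Finset.sum_mul, Finset.sum_add_distrib, Finset.smul_sum]

/-- The central series `N_t` with `e^{tħbX} = 1 + ħ N_t`. -/
noncomputable def nser (t : CC) : PowerSeries HH :=
  t • (PowerSeries.X * (phs t * PowerSeries.C (vb CC)))

theorem uA_zero_eq_b : uA 0 = hb • vb CC := by simp [uA, cl]

theorem kap_eq_nser (t : CC) : kap t = 1 + hb • nser t := by
  rw [kap_eq, nser, smul_comm hb t, uA_zero_eq_b]
  congr 2
  ext n
  rcases n with _ | n
  · simp
  · simp only [PowerSeries.coeff_smul, PowerSeries.coeff_succ_X_mul, PowerSeries.coeff_mul_C,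
      mul_smul_comm]

theorem ys_eq_nser (t : CC) : ys t = 1 + ys t * nser t * PowerSeries.C (va CC) := by
  nth_rw 1 [ys_eq]
  rw [nser, show cl CC 1 = vb CC * va CC by simp [cl], map_mul, mul_smul_comm, smul_mul_assoc,
    ← mul_assoc (ys t) PowerSeries.X, ← PowerSeries.X_mul]
  simp only [mul_assoc]

theorem hsh_mul_b_left (x y : HH) : hsh (x * vb CC) y = hsh x y * vb CC := by
  rw [hsh_eq, qsh_mul_b_left]

theorem hsh_mul_uA_pow_left (x y : HH) (j : ℕ) : hsh (x * uA 0 ^ j) y = hsh x y * uA 0 ^ j := by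
  rw [hsh_comm, hsh_mul_uA_pow_right, hsh_comm]

theorem shCentral_nser (t : CC) : ShCentral (nser t) := by
  intro n x y
  rcases n with _ | n
  · simp [nser]
  · rw [nser, PowerSeries.coeff_smul, PowerSeries.coeff_succ_X_mul, PowerSeries.coeff_mul_C, phs,
      PowerSeries.coeff_mk, smul_mul_assoc]
    simp only [mul_smul_comm, map_smul, LinearMap.smul_apply, ← mul_assoc, hsh_mul_b_left,
      hsh_mul_uA_pow_left]

theorem shCentral_mul_comm {K M : PowerSeries HH} (hK : ShCentral K) (hM : ShCentral M) :
    K * M = M * K := by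
  have h1 : shp (1 * K) (1 * M) = M * K := by
    rw [shp_mul_left hK, shp_one_left, one_mul]
  have h2 : shp (1 * K) (1 * M) = K * M := by
    rw [shp_mul_right hM, shp_comm, shp_one_left, one_mul]
  rw [← h1, h2]

theorem nser_add : nser 1 + nser (-1) + hb • (nser 1 * nser (-1)) = 0 := by
  have h : nser 1 + kap 1 * nser (-1) = 0 := by
    rw [nser, nser, neg_smul, one_smul, one_smul, mul_neg, ← mul_assoc (kap 1), ← PowerSeries.X_mul,
      mul_assoc PowerSeries.X, ← mul_assoc (kap 1), kap_mul_phs, add_neg_cancel]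
  rw [kap_eq_nser, add_mul, one_mul, smul_mul_assoc] at h
  rw [add_assoc, h]

section Products

open PowerSeries

theorem ser_step (F : HH) (t : CC) : C (F * va CC) * ys t
    = (C F + C (F * va CC) * ys t * nser t) * C (va CC) := by
  nth_rw 1 [ys_eq_nser]
  rw [mul_add, add_mul, mul_one, ← map_mul]
  simp only [mul_assoc]

/-- The product of `F a L(X)` and `G a L(-X)`, where `L(X) = ∑ yₙ Xⁿ`. Every term ends with `a` up to
powers of `ħ b`, hence has a convergent value: the contributions of trailing letters `g_1` cancel. -/
theorem shp_ser_ser (F G : HH) : shp (C (F * va CC) * ys 1) (C (G * va CC) * ys (-1))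
    = (shp (C (F * va CC) * ys 1) (C G) * kap 1 + shp (C F) (C (G * va CC) * ys (-1)) * kap (-1)
      + hb • shp (C F) (C G)) * C (va CC) := by
  have hU := ser_step F 1
  have hW := ser_step G (-1)
  set U := C (F * va CC) * ys 1
  set W := C (G * va CC) * ys (-1)
  have h := shp_mul_a (C F + U * nser 1) (C G + W * nser (-1))
  rw [← hU, ← hW] at h
  rw [h]
  congr 1
  simp only [map_add, LinearMap.add_apply, shp_mul_left (shCentral_nser _),
    shp_mul_right (shCentral_nser _), kap_eq_nser, mul_add, mul_one, mul_smul_comm, smul_add]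
  have h0 : shp U W * (nser 1 + nser (-1) + hb • (nser 1 * nser (-1))) = 0 := by
    rw [nser_add, mul_zero]
  rw [shCentral_mul_comm (shCentral_nser 1) (shCentral_nser (-1)), mul_add, mul_add,
    mul_smul_comm, ← mul_assoc] at h0
  rw [← sub_eq_zero, ← h0]
  abel_nf

/-- The product of `L(X)` and `G a L(-X)`, where `L(X) = ∑ yₙ Xⁿ`. -/
theorem shp_ys_ser (G : HH) : shp (ys 1) (C (G * va CC) * ys (-1))
    = shp (ys 1) (C G) * kap 1 * C (va CC) := by
  have hW := ser_step G (-1)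
  have hL := ys_eq_nser 1
  set W := C (G * va CC) * ys (-1)
  have h := shp_mul_a (ys 1 * nser 1) (C G + W * nser (-1))
  have hL1 : ys 1 * nser 1 * C (va CC) = ys 1 - 1 := by
    nth_rw 2 [hL]; abel
  rw [← hW, hL1] at h
  have h1 : shp (ys 1) W = W + shp (ys 1 - 1) W := by
    rw [map_sub, LinearMap.sub_apply, shp_one_left]; abel
  rw [h1, h]
  have h0 : shp (ys 1) W * (nser 1 + nser (-1) + hb • (nser 1 * nser (-1))) = 0 := by
    rw [nser_add, mul_zero]
  rw [shCentral_mul_comm (shCentral_nser 1) (shCentral_nser (-1)), mul_add, mul_add,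
    mul_smul_comm, ← mul_assoc] at h0
  nth_rw 1 [hW]
  rw [← add_mul]
  congr 1
  simp only [map_add, map_sub, LinearMap.sub_apply, shp_mul_left (shCentral_nser _),
    shp_mul_right (shCentral_nser _), kap_eq_nser, mul_add, add_mul, mul_one,
    mul_smul_comm, smul_add, shp_one_left]
  rw [← sub_eq_zero, ← h0]
  abel_nf

/-- `L(X) sh_ħ L(-X) = 1`. -/
theorem shp_ys_ys : shp (ys 1) (ys (-1)) = 1 := by
  have h := shp_mul_a (ys 1 * nser 1) (ys (-1) * nser (-1))
  have hL1 : ∀ t, ys t * nser t * C (va CC) = ys t - 1 := by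
    intro t
    nth_rw 2 [ys_eq_nser t]; abel
  rw [hL1, hL1] at h
  have h0 : shp (ys 1) (ys (-1)) * (nser 1 + nser (-1) + hb • (nser 1 * nser (-1))) = 0 := by
    rw [nser_add, mul_zero]
  rw [shCentral_mul_comm (shCentral_nser 1) (shCentral_nser (-1)), mul_add, mul_add,
    mul_smul_comm, ← mul_assoc] at h0
  have h2 : shp (ys 1 - 1) (ys (-1) * nser (-1)) + shp (ys 1 * nser 1) (ys (-1) - 1)
      + hb • shp (ys 1 * nser 1) (ys (-1) * nser (-1))
      = - (ys 1 * nser 1) - ys (-1) * nser (-1) := by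
    simp only [map_sub, LinearMap.sub_apply, shp_mul_left (shCentral_nser _),
      shp_mul_right (shCentral_nser _), shp_one_left, shp_comm _ 1, sub_mul]
    rw [← sub_eq_zero, ← h0]
    abel_nf
  rw [h2, sub_mul, neg_mul, hL1, hL1] at h
  simp only [map_sub, LinearMap.sub_apply, shp_one_left, shp_comm _ 1] at h
  rw [sub_sub, ← sub_eq_zero] at h
  rw [← sub_eq_zero, ← h]
  abel

end Products

/-! ### Cuts of `E_k` belong to `ℌ⁰` -/

theorem yd_succ_mem_Vm (n : ℕ) : yd (n + 1) ∈ Vm := by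
  rw [yd_succ]
  exact Cm_mul_Vm (EOne_mem_Cm n) (cl_succ_mem_Vm 0)

theorem Vm_mul_a_yd_mem {F : HH} (hF : F ∈ Vm) (n : ℕ) : F * va CC * yd n ∈ Vm := by
  rcases n with _ | n
  · rw [yd_zero, mul_one]; exact Vm_mul_a hF
  · exact Cm_mul_Vm (Vm_le_Cm (Vm_mul_a hF)) (yd_succ_mem_Vm n)

theorem Vm_mul_yd_mem {F : HH} (hF : F ∈ Vm) (n : ℕ) : F * yd n ∈ Vm := by
  rcases n with _ | n
  · rwa [yd_zero, mul_one]
  · exact Cm_mul_Vm (Vm_le_Cm hF) (yd_succ_mem_Vm n)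

theorem mul_uA_pow_succ_mul_a_mem {v : HH} (hv : v ∈ Vm) (j : ℕ) :
    v * uA 0 ^ (j + 1) * va CC ∈ nMod := by
  have : v * uA 0 ^ (j + 1) * va CC = hb • (v * uA 0 ^ j * cl CC 1) := by
    rw [pow_succ]
    nth_rw 2 [uA_zero_eq]
    rw [mul_smul_comm, mul_smul_comm, smul_mul_assoc, ← mul_assoc, mul_assoc _ (cl CC 0), cl_mul_a]
  rw [this]
  exact smul_mem_nMod (Vm_le_Hhat
    (Cm_mul_Vm (Cm_mul (Vm_le_Cm hv) (uA_pow_mem_Cm j)) (cl_succ_mem_Vm 0)))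

theorem mul_uA_pow_mul_a_mem {v : HH} (hv : v ∈ Vm) (j : ℕ) : v * uA 0 ^ j * va CC ∈ HZero := by
  rcases j with _ | j
  · rw [pow_zero, mul_one]; exact Vm_mul_a_mem_HZero hv
  · exact nMod_le_HZero (mul_uA_pow_succ_mul_a_mem hv j)

theorem coeff_mul_kap_mem {S : PowerSeries HH} (hS : ∀ n, PowerSeries.coeff n S ∈ Vm) (t : CC)
    (n : ℕ) : PowerSeries.coeff n (S * kap t * PowerSeries.C (va CC)) ∈ HZero := by
  rw [PowerSeries.coeff_mul_C, PowerSeries.coeff_mul, Finset.sum_mul]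
  refine Submodule.sum_mem _ fun p _ => ?_
  rw [kap, PowerSeries.coeff_mk, mul_smul_comm, smul_mul_assoc]
  exact Submodule.smul_mem _ _ (mul_uA_pow_mul_a_mem (hS _) _)

/-- `∑_{a+b=s} (-1)^b (x y_a) sh_ħ (z y_b)`: the cuts of `E_{1^s}` between `x` and `z`, see `cutL_EOne`. -/
noncomputable def cutOne (x z : HH) (s : ℕ) : HH :=
  ∑ p ∈ antidiagonal s, (-1 : CC) ^ p.2 • hsh (x * yd p.1) (z * yd p.2)

theorem cutOne_eq (x z : HH) (s : ℕ) : cutOne x z s = PowerSeries.coeff s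
    (shp (PowerSeries.C x * ys 1) (PowerSeries.C z * ys (-1))) := by
  rw [coeff_shp, cutOne]
  refine Finset.sum_congr rfl fun p _ => ?_
  simp [ys]

theorem cutOne_comm (x z : HH) (s : ℕ) : cutOne x z s = (-1 : CC) ^ s • cutOne z x s := by
  rw [cutOne, cutOne, ← Finset.Nat.sum_antidiagonal_swap, Finset.smul_sum]
  refine Finset.sum_congr rfl fun p hp => ?_
  rw [mem_antidiagonal] at hp
  simp only [Prod.fst_swap, Prod.snd_swap]
  rw [hsh_comm, smul_smul, ← hp, ← pow_add]
  congr 1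
  rw [show p.1 + p.2 + p.2 = p.1 + 2 * p.2 by ring, pow_add, pow_mul]
  simp

/-- The elements that end, up to a multiple of `ħ`, with a letter `g_k`, `k ≥ 2`. -/
def Bd (x : HH) : Prop := x = 1 ∨ ∃ F ∈ Vm, ∃ x' ∈ Vm, x = F * va CC + hb • x'

theorem Bd.mul_yd_mem {x : HH} (hx : Bd x) (n : ℕ) : x * yd n ∈ Hhat := by
  rcases hx with rfl | ⟨F, hF, x', hx', rfl⟩
  · rw [one_mul]
    rcases n with _ | n
    · rw [yd_zero]; exact HZero_le_Hhat one_mem_HZero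
    · exact Vm_le_Hhat (yd_succ_mem_Vm n)
  · rw [add_mul, smul_mul_assoc]
    exact add_mem (Vm_le_Hhat (Vm_mul_a_yd_mem hF n))
      (Submodule.smul_mem _ _ (Vm_le_Hhat (Vm_mul_yd_mem hx' n)))

theorem cutOne_smul_mem {x z : HH} (hx : x ∈ Vm) (hz : Bd z) (s : ℕ) :
    cutOne (hb • x) z s ∈ HZero := by
  refine Submodule.sum_mem _ fun p _ => Submodule.smul_mem _ _ ?_
  rw [smul_mul_assoc, map_smul, LinearMap.smul_apply]
  exact nMod_le_HZero (smul_mem_nMod (hsh_mem_Hhat (Vm_le_Hhat (Vm_mul_yd_mem hx _))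
    (hz.mul_yd_mem _)))

theorem cutOne_add_left (x y z : HH) (s : ℕ) :
    cutOne (x + y) z s = cutOne x z s + cutOne y z s := by
  simp [cutOne, add_mul, Finset.sum_add_distrib]

theorem cutOne_one_mem {G : HH} (hG : G ∈ Vm) (s : ℕ) : cutOne 1 (G * va CC) s ∈ HZero := by
  rw [cutOne_eq, map_one, one_mul, shp_ys_ser]
  refine coeff_mul_kap_mem (fun n => ?_) _ _
  rw [coeff_shp]
  refine Submodule.sum_mem _ fun p _ => ?_
  rw [PowerSeries.coeff_C, ys, PowerSeries.coeff_mk, map_smul, LinearMap.smul_apply]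
  refine Submodule.smul_mem _ _ ?_
  split_ifs
  · rcases p.1 with _ | n
    · rwa [yd_zero, hsh_one_left]
    · exact hsh_mem_Vm (yd_succ_mem_Vm n) hG
  · rw [map_zero]; exact Submodule.zero_mem _

theorem cutOne_a_mem {F G : HH} (hF : F ∈ Vm) (hG : G ∈ Vm) (s : ℕ) :
    cutOne (F * va CC) (G * va CC) s ∈ HZero := by
  have key : ∀ {F G : HH} (_ : F ∈ Vm) (_ : G ∈ Vm) (t : CC) (n : ℕ), PowerSeries.coeff n
      (shp (PowerSeries.C (F * va CC) * ys t) (PowerSeries.C G)) ∈ Vm := by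
    intro F G hF hG t n
    rw [coeff_shp]
    refine Submodule.sum_mem _ fun p _ => ?_
    rw [PowerSeries.coeff_C, PowerSeries.coeff_C_mul, ys, PowerSeries.coeff_mk, mul_smul_comm]
    split_ifs
    · exact hsh_mem_Vm (Submodule.smul_mem _ _ (Vm_mul_a_yd_mem hF _)) hG
    · rw [map_zero]; exact Submodule.zero_mem _
  rw [cutOne_eq, shp_ser_ser, add_mul, add_mul, map_add, map_add]
  refine add_mem (add_mem (coeff_mul_kap_mem (key hF hG 1) _ _) (coeff_mul_kap_mem (fun n => ?_) _ _)) ?_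
  · rw [shp_comm]; exact key hG hF _ n
  · rw [smul_mul_assoc, PowerSeries.coeff_smul, PowerSeries.coeff_mul_C, coeff_shp, Finset.sum_mul]
    refine Submodule.smul_mem _ _ (Submodule.sum_mem _ fun p _ => ?_)
    rw [PowerSeries.coeff_C, PowerSeries.coeff_C]
    split_ifs
    · exact Vm_mul_a_mem_HZero (hsh_mem_Vm hF hG)
    all_goals simp

/-- The letters `g_1` at the end of the single terms cancel in the alternating sum. -/
theorem cutOne_mem {x z : HH} (hx : Bd x) (hz : Bd z) (s : ℕ) : cutOne x z s ∈ HZero := by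
  have add_right : ∀ x y z, cutOne x (y + z) s = cutOne x y s + cutOne x z s := by
    intro x y z
    rw [cutOne_comm, cutOne_add_left, smul_add, ← cutOne_comm, ← cutOne_comm]
  have swap : ∀ {x z}, cutOne z x s ∈ HZero → cutOne x z s ∈ HZero := by
    intro x z h
    rw [cutOne_comm]
    exact Submodule.smul_mem _ _ h
  have one : ∀ {z}, Bd z → cutOne 1 z s ∈ HZero := by
    rintro z (rfl | ⟨G, hG, z', hz', rfl⟩)
    · rw [cutOne_eq, map_one, one_mul, one_mul, shp_ys_ys, PowerSeries.coeff_one]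
      split_ifs
      · exact one_mem_HZero
      · exact Submodule.zero_mem _
    · rw [add_right]
      exact add_mem (cutOne_one_mem hG s) (swap (cutOne_smul_mem hz' (Or.inl rfl) s))
  rcases hx with rfl | ⟨F, hF, x', hx', rfl⟩
  · exact one hz
  rw [cutOne_add_left]
  refine add_mem ?_ (cutOne_smul_mem hx' hz s)
  rcases hz with rfl | ⟨G, hG, z', hz', rfl⟩
  · exact swap (cutOne_one_mem hF s)
  rw [add_right]
  refine add_mem (cutOne_a_mem hF hG s) (swap (cutOne_smul_mem hz' (Or.inr ⟨F, hF, 0,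
    Submodule.zero_mem _, by simp⟩) s))

theorem mul_alg (x : HH) : x * algebraMap CC HH hb = hb • x := by
  rw [Algebra.smul_def, Algebra.commutes]

theorem e_add_two (n : ℕ) : e (n + 2) = cl CC (n + 1) * va CC + hb • cl CC (n + 1) := by
  rw [e, mul_add, mul_alg, add_mul, smul_mul_assoc, mul_assoc (vb CC), ← pow_succ', cl_mul_a]
  rfl

theorem e_mem_Cm (n : ℕ) : e (n + 2) ∈ Cm := by
  rw [e_add_two, cl_mul_a]
  exact add_mem (cl_succ_mem_Cm _) (Submodule.smul_mem _ _ (cl_succ_mem_Cm _))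

theorem Bd_mul_e {x : HH} (hx : x ∈ Cm) (n : ℕ) : Bd (x * e (n + 2)) :=
  Or.inr ⟨x * cl CC (n + 1), Cm_mul_Vm hx (cl_succ_mem_Vm n), x * cl CC (n + 1),
    Cm_mul_Vm hx (cl_succ_mem_Vm n), by rw [e_add_two, mul_add, mul_smul_comm, mul_assoc]⟩

/-- `b (-a) (-a-ħ)^n`. -/
noncomputable def ebar (n : ℕ) : HH :=
  vb CC * -va CC * (-va CC - algebraMap CC HH hb) ^ n

theorem psiSh_e (n : ℕ) : psiSh (e (n + 2)) = ebar (n + 1) := by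
  rw [e_add_two, cl_mul_a, map_add, map_smul, psiSh_cl, psiSh_cl, ebar, pow_succ' _ (n + 1),
    ← smul_mul_assoc, ← mul_assoc, ← add_mul, mul_sub, mul_alg, sub_add_cancel]

theorem ebar_succ (n : ℕ) : ebar (n + 1) = (-ebar n) * va CC + hb • (-ebar n) := by
  rw [ebar, pow_succ, ← mul_assoc, ← ebar, mul_sub, mul_alg]
  simp [sub_eq_add_neg]

theorem ebar_mem_Vm (n : ℕ) : ebar n ∈ Vm := by
  induction n with
  | zero =>
    have : ebar 0 = -cl CC 1 := by simp [ebar, cl]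
    rw [this]
    exact Submodule.neg_mem _ (cl_succ_mem_Vm 0)
  | succ n ih =>
    rw [ebar_succ]
    exact add_mem (Vm_mul_a (Submodule.neg_mem _ ih))
      (Submodule.smul_mem _ _ (Submodule.neg_mem _ ih))

theorem Bd_mul_ebar {x : HH} (hx : x ∈ Cm) (n : ℕ) : Bd (x * ebar (n + 1)) := by
  have h : x * -ebar n ∈ Vm := Cm_mul_Vm hx (Submodule.neg_mem _ (ebar_mem_Vm n))
  exact Or.inr ⟨x * -ebar n, h, x * -ebar n, h, by rw [ebar_succ, mul_add, mul_smul_comm, mul_assoc]⟩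

theorem psiSh_cl_succ (k : ℕ) : psiSh (cl CC (k + 1)) = ebar k - hb • psiSh (cl CC k) := by
  rw [psiSh_cl, psiSh_cl, ebar, pow_succ', ← mul_assoc, mul_sub, mul_alg, sub_mul, smul_mul_assoc]

theorem psiSh_cl_mem (k : ℕ) : hb • psiSh (cl CC k) ∈ Cm ∧ psiSh (cl CC (k + 1)) ∈ Cm := by
  have h : ∀ k, hb • psiSh (cl CC k) ∈ Cm → psiSh (cl CC (k + 1)) ∈ Cm := by
    intro k h
    rw [psiSh_cl_succ]
    exact sub_mem (Vm_le_Cm (ebar_mem_Vm k)) h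
  induction k with
  | zero =>
    have h0 : hb • psiSh (cl CC 0) ∈ Cm := by
      rw [← map_smul, ← uA_zero_eq, psiSh_uA_zero]; exact uA_mem_Cm 0
    exact ⟨h0, h 0 h0⟩
  | succ k ih => exact ⟨Submodule.smul_mem _ _ ih.2, h _ (Submodule.smul_mem _ _ ih.2)⟩

theorem psiSh_mem_Cm {x : HH} (hx : x ∈ Cm) : psiSh x ∈ Cm := by
  refine uspan_induction (V := Cm.comap psiSh) (fun u _ => ?_) hx
  rw [Submodule.mem_comap]
  induction u with
  | nil => rw [show uw [] = 1 by simp [uw], psiSh_one]; exact one_mem_Cm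
  | cons k u ih =>
    have : uw (k :: u) = uA k * uw u := by simp [uw]
    rw [this, psiSh_mul (Cm_le_Wmod (uA_mem_Cm k)) (uw_mem_Wmod u)]
    refine Cm_mul ih ?_
    rcases k with _ | k
    · rw [psiSh_uA_zero]; exact uA_mem_Cm 0
    · rw [← cl_succ]; exact (psiSh_cl_mem k).2

/-- The cuts of `E_{1^s} e_{n+2} w` are those inside `E_{1^s}` and those inside `w`. -/
theorem cutL_EOne_e_mul (s n : ℕ) {w : HH} (hw : w ∈ Cm) (x z : HH) :
    cutL (EOne s * e (n + 2) * w) x z = cutOne x (z * psiSh w * ebar (n + 1)) s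
      + cutL w (x * EOne s * e (n + 2)) z := by
  have h1 := cutL_mul (Cm_le_Wmod (EOne_mem_Cm s)) (Cm_le_Wmod hw) (n + 2) x z
  have h2 := cutL_mul (Cm_le_Wmod (EOne_mem_Cm s)) (Cm_le_Wmod hw) (n + 1) x z
  have h3 : psiSh (e (n + 2) * w) = psiSh w * ebar (n + 1) := by
    rw [psiSh_mul (Cm_le_Wmod (e_mem_Cm n)) (Cm_le_Wmod hw), psiSh_e]
  rw [mul_assoc z, ← h3, cutOne, ← cutL_EOne]
  have h4 : e (n + 2) = cl CC (n + 2) + hb • cl CC (n + 1) := by rw [e_add_two, cl_mul_a]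
  simp only [h4, mul_add, add_mul, smul_mul_assoc, mul_smul_comm, map_add, map_smul,
    LinearMap.add_apply, LinearMap.smul_apply, h1, h2, smul_add]
  abel

theorem exists_eq_add_two {k : ℕ+} (hk : k ≠ 1) : ∃ n, (k : ℕ) = n + 2 := by
  have h1 := k.pos
  have h2 : (k : ℕ) ≠ 1 := fun h => hk (PNat.eq h)
  exact ⟨k - 2, by omega⟩

theorem EAux_mem_Cm (s : ℕ) (ks : Index) : EAux s ks ∈ Cm := by
  induction ks generalizing s with
  | nil => exact EOne_mem_Cm s
  | cons k ks ih =>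
    rw [EAux]
    split_ifs with h
    · exact ih _
    · obtain ⟨n, hn⟩ := exists_eq_add_two h
      rw [hn]
      exact Cm_mul (Cm_mul (EOne_mem_Cm s) (e_mem_Cm n)) (ih 0)

/-- All cuts of `E_k` with a prefix `x`: one alternating sum `cutOne` for each block of ones. -/
theorem cutL_EAux_mem (s : ℕ) (ks : Index) {x : HH} (hx : Bd x) (hx2 : x ∈ Cm) :
    cutL (EAux s ks) x 1 ∈ HZero := by
  induction ks generalizing s x with
  | nil =>
    rw [EAux, cutL_EOne]
    exact cutOne_mem hx (Or.inl rfl) s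
  | cons k ks ih =>
    rw [EAux]
    split_ifs with h
    · exact ih _ hx hx2
    · obtain ⟨n, hn⟩ := exists_eq_add_two h
      rw [hn, cutL_EOne_e_mul s n (EAux_mem_Cm _ _), one_mul]
      exact add_mem (cutOne_mem hx (Bd_mul_ebar (psiSh_mem_Cm (EAux_mem_Cm _ _)) n) s)
        (ih 0 (Bd_mul_e (Cm_mul hx2 (EOne_mem_Cm s)) n)
          (Cm_mul (Cm_mul hx2 (EOne_mem_Cm s)) (e_mem_Cm n)))

theorem wSh_EI_mem (k : Index) : wSh (EI k) ∈ HZero := by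
  rw [EI, wSh_eq (Cm_le_Wmod (EAux_mem_Cm _ _))]
  exact cutL_EAux_mem 0 k (Or.inl rfl) one_mem_Cm

/-! ### Congruences of values -/

section Values

variable {q : ℂ} (hq : ‖q‖ < 1)

/-- The image in `ℂ` of an ideal of `𝒵_q`. -/
noncomputable def idealC (I : Ideal (Zalg q hq)) : AddSubgroup ℂ where
  carrier := {z | ∃ h : z ∈ Zalg q hq, (⟨z, h⟩ : Zalg q hq) ∈ I}
  zero_mem' := ⟨zero_mem _, I.zero_mem⟩
  add_mem' := by
    rintro x y ⟨h1, h2⟩ ⟨h3, h4⟩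
    exact ⟨add_mem h1 h3, I.add_mem h2 h4⟩
  neg_mem' := by
    rintro x ⟨h1, h2⟩
    exact ⟨neg_mem h1, I.neg_mem h2⟩

theorem idealC_mono {I J : Ideal (Zalg q hq)} (h : I ≤ J) : idealC hq I ≤ idealC hq J :=
  fun _ ⟨h1, h2⟩ => ⟨h1, h h2⟩

theorem mul_mem_idealC {I : Ideal (Zalg q hq)} {x y : ℂ} (hx : x ∈ Zalg q hq)
    (hy : y ∈ idealC hq I) : x * y ∈ idealC hq I := by
  obtain ⟨h1, h2⟩ := hy
  exact ⟨mul_mem hx h1, I.mul_mem_left ⟨x, hx⟩ h2⟩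

theorem mem_Zalg_of_mem_HZero {x : HH} (hx : x ∈ HZero) : Zq q x ∈ Zalg q hq := ⟨x, hx, rfl⟩

theorem mem_idealC_Nideal {x : HH} (hx : x ∈ nMod) : Zq q x ∈ idealC hq (Nideal q hq) :=
  ⟨mem_Zalg_of_mem_HZero hq (nMod_le_HZero hx), x, hx, rfl⟩

include hq in
theorem Zq_neg {x : HH} (hx : x ∈ Hhat) : Zq q (-x) = -Zq q x := by
  have := Zq_smul hq (-1) hx
  simpa using this

include hq in
theorem Zq_sub {x y : HH} (hx : x ∈ Hhat) (hy : y ∈ Hhat) : Zq q (x - y) = Zq q x - Zq q y := by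
  rw [sub_eq_add_neg, Zq_add hq hx (Submodule.neg_mem _ hy), Zq_neg hq hy, sub_eq_add_neg]

include hq in
theorem Zq_zero : Zq q 0 = 0 := by
  simpa using Zq_smul hq 0 (Submodule.zero_mem Hhat)

include hq in
theorem Zq_sum {ι : Type} (s : Finset ι) (f : ι → HH) (h : ∀ i ∈ s, f i ∈ Hhat) :
    Zq q (∑ i ∈ s, f i) = ∑ i ∈ s, Zq q (f i) := by
  classical
  induction s using Finset.induction_on with
  | empty => simp [Zq_zero hq]
  | insert i s hi ih =>
    rw [Finset.sum_insert hi, Finset.sum_insert hi, Zq_add hq (h i (by simp))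
      (Submodule.sum_mem _ fun j hj => h j (by simp [hj])), ih fun j hj => h j (by simp [hj])]

/-- `𝒩_q` absorbs the values on all of `Ĥ⁰`, not only those on `ℌ⁰`. -/
theorem mul_mem_Nideal {x : HH} (hx : x ∈ Hhat) {y : ℂ} (hy : y ∈ idealC hq (Nideal q hq)) :
    Zq q x * y ∈ idealC hq (Nideal q hq) := by
  obtain ⟨-, w, hw, rfl⟩ := hy
  rw [mul_comm, ← Zq_hstar hq (HZero_le_Hhat (nMod_le_HZero hw)) hx]
  exact mem_idealC_Nideal hq (hstar_mem_nMod hw hx)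

/-- Congruent elements of `Hhat` modulo `Km` have congruent values. -/
theorem Zq_sub_mem {x y : HH} (hx : x ∈ Hhat) (hy : y ∈ Hhat) (h : x - y ∈ Km) :
    Zq q x - Zq q y ∈ idealC hq (Nideal q hq) := by
  rw [← Zq_sub hq hx hy]
  exact mem_idealC_Nideal hq (mem_nMod_of_Km h (sub_mem hx hy))

/-! ### The values of the words `g_1 ⋯ g_1` -/

open PowerSeries in
/-- `∏_{0 < m < M} (1 + t x_m X)`. -/
noncomputable def oneSerM (q t : ℂ) (M : ℕ) : PowerSeries ℂ :=
  PowerSeries.mk fun n => t ^ n * nest q M (List.replicate n 1)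

theorem sum_Ico_succ (q : ℂ) (M k : ℕ) (hk : k ≠ 0) (f : ℕ → ℂ) :
    ∑ m ∈ Finset.Ico 1 (M + 1), Fq q m k * f m
      = ∑ m ∈ Finset.Ico 1 M, Fq q m k * f m + xval q M ^ k * f M := by
  rcases Nat.eq_zero_or_pos M with rfl | h
  · simp [xval_zero, hk]
  · rw [Finset.sum_Ico_succ_top h, Fq_eq_pow q M k]

open PowerSeries in
theorem oneSerM_succ (q t : ℂ) (M : ℕ) :
    oneSerM q t (M + 1) = oneSerM q t M * (1 + C (t * xval q M) * X) := by
  rw [mul_add, mul_one, mul_left_comm, mul_comm _ X]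
  ext n
  rcases n with _ | n
  · simp [oneSerM, nest]
  · rw [map_add, coeff_C_mul, coeff_succ_X_mul]
    simp only [oneSerM, coeff_mk, List.replicate_succ, nest]
    rw [sum_Ico_succ q M 1 one_ne_zero]
    ring

open PowerSeries in
/-- `∑_{k ≥ 1} ∑_{0 < m < M} x_m^{2k} X^{2k}`. -/
noncomputable def evenSerM (q : ℂ) (M : ℕ) : PowerSeries ℂ :=
  PowerSeries.mk fun n => if n ≠ 0 ∧ Even n then nest q M [n] else 0

open PowerSeries in
theorem evenSerM_succ (q : ℂ) (M : ℕ) : evenSerM q (M + 1) = evenSerM q M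
    + PowerSeries.mk fun n => if n ≠ 0 ∧ Even n then xval q M ^ n else 0 := by
  ext n
  simp only [evenSerM, map_add, coeff_mk]
  split_ifs with h
  · simp only [nest]
    rw [sum_Ico_succ q M n h.1, mul_one]
  · simp

open PowerSeries in
theorem one_sub_mul_evenSer (x : ℂ) :
    (1 - C (x ^ 2) * X ^ 2) * (PowerSeries.mk fun n => if n ≠ 0 ∧ Even n then x ^ n else 0)
      = C (x ^ 2) * X ^ 2 := by
  rw [sub_mul, one_mul, mul_assoc]
  ext n
  rw [map_sub, coeff_C_mul, coeff_C_mul, coeff_X_pow]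
  rcases n with _ | _ | n
  · simp [coeff_X_pow_mul']
  · simp [coeff_X_pow_mul']
  · rw [show n + 1 + 1 = n + 2 from rfl, coeff_X_pow_mul, coeff_mk, coeff_mk]
    by_cases h : Even n
    · by_cases h0 : n = 0
      · simp [h0]
      · simp [h, h0, pow_add, mul_comm, Nat.even_add]
    · have h0 : n ≠ 0 := by rintro rfl; simp at h
      simp [h, h0, Nat.even_add]

open PowerSeries in
/-- The logarithmic derivative of `∏ (1 - x_m² X²)` involves only even power sums. -/
theorem derivative_oneSerM (q : ℂ) (M : ℕ) :
    X * derivative ℂ (oneSerM q 1 M * oneSerM q (-1) M)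
      = -2 * (oneSerM q 1 M * oneSerM q (-1) M) * evenSerM q M := by
  induction M with
  | zero =>
    have h : ∀ t, oneSerM q t 0 = 1 := by
      intro t
      ext n
      rcases n with _ | n
      · simp [oneSerM, nest]
      · simp [oneSerM, nest, List.replicate_succ, coeff_one]
    have h2 : evenSerM q 0 = 0 := by
      ext n
      simp [evenSerM, nest]
    rw [h, h, h2]
    simp
  | succ M ih =>
    have h : oneSerM q 1 (M + 1) * oneSerM q (-1) (M + 1)
        = (oneSerM q 1 M * oneSerM q (-1) M) * (1 - C (xval q M ^ 2) * X ^ 2) := by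
      rw [oneSerM_succ, oneSerM_succ]
      simp only [one_mul, neg_mul, map_neg, map_pow]
      ring
    have h2 : X * derivative ℂ (1 - C (xval q M ^ 2) * X ^ 2)
        = -2 * (C (xval q M ^ 2) * X ^ 2) := by
      rw [map_sub, Derivation.leibniz]
      simp [derivative_C, derivative_X]
      ring
    have h3 := one_sub_mul_evenSer (xval q M)
    rw [h, evenSerM_succ, Derivation.leibniz, smul_eq_mul, smul_eq_mul]
    linear_combination (1 - C (xval q M ^ 2) * X ^ 2) * ih
      + (oneSerM q 1 M * oneSerM q (-1) M) * h2
      + 2 * (oneSerM q 1 M * oneSerM q (-1) M) * h3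

theorem cmono_mem_Gmod {u : List ℕ} (hu : ∀ k ∈ u, 1 ≤ k) : cmono CC u ∈ Gmod :=
  Submodule.subset_span ⟨u, hu, rfl⟩

theorem Gmod_le_Hhat : Gmod ≤ Hhat := by
  rw [Gmod, Submodule.span_le, Hhat_eq]
  rintro _ ⟨u, hu, rfl⟩
  rw [← uw_eq_cmono u hu]
  exact uw_mem_uspan fun i hi => hu i (List.mem_of_getLast? hi)

/-- The value of `g_1 ⋯ g_1`. -/
noncomputable def oneVal (q : ℂ) (n : ℕ) : ℂ := Zq q (cmono CC (List.replicate n 1))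

/-- `∑ tⁿ Z_q(g_1 ⋯ g_1) Xⁿ`. -/
noncomputable def oneSer (q t : ℂ) : PowerSeries ℂ := PowerSeries.mk fun n => t ^ n * oneVal q n

include hq in
theorem tendsto_nest {u : List ℕ} (hu : ∀ k ∈ u, 1 ≤ k) :
    Tendsto (fun M => nest q M u.reverse) atTop (𝓝 (Zq q (cmono CC u))) :=
  (tendsto_ZqM hq (Gmod_le_Hhat (cmono_mem_Gmod hu))).congr fun M => ZqM_cmono q M u

include hq in
theorem tendsto_coeff_oneSerM (t : ℂ) (n : ℕ) : Tendsto
    (fun M => PowerSeries.coeff n (oneSerM q t M)) atTop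
    (𝓝 (PowerSeries.coeff n (oneSer q t))) := by
  simp only [oneSerM, oneSer, PowerSeries.coeff_mk]
  refine Tendsto.const_mul _ ?_
  have := tendsto_nest hq (u := List.replicate n 1) (fun k hk => by simp_all)
  simpa [oneVal] using this

/-- `∑ Z_q(g_{2k}) X^{2k}`. -/
noncomputable def evenSer (q : ℂ) : PowerSeries ℂ :=
  PowerSeries.mk fun n => if n ≠ 0 ∧ Even n then Zq q (g n) else 0

include hq in
theorem succ_mul_coeff_oneSer (n : ℕ) : (n + 1 : ℂ) *
      PowerSeries.coeff (n + 1) (oneSer q 1 * oneSer q (-1))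
    = -2 * PowerSeries.coeff (n + 1) (oneSer q 1 * oneSer q (-1) * evenSer q) := by
  have key : ∀ M, (n + 1 : ℂ) * PowerSeries.coeff (n + 1) (oneSerM q 1 M * oneSerM q (-1) M)
      = -2 * PowerSeries.coeff (n + 1) (oneSerM q 1 M * oneSerM q (-1) M * evenSerM q M) := by
    intro M
    have h := congrArg (PowerSeries.coeff (n + 1)) (derivative_oneSerM q M)
    rw [PowerSeries.coeff_succ_X_mul, PowerSeries.coeff_derivative, mul_assoc,
      show (-2 : PowerSeries ℂ) = PowerSeries.C (-2) by simp [map_ofNat], PowerSeries.coeff_C_mul, mul_comm] at h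
    exact h
  have lim1 : ∀ n, Tendsto (fun M => PowerSeries.coeff n (oneSerM q 1 M * oneSerM q (-1) M)) atTop
      (𝓝 (PowerSeries.coeff n (oneSer q 1 * oneSer q (-1)))) := by
    intro n
    simp only [PowerSeries.coeff_mul]
    exact tendsto_finsetSum _ fun p _ =>
      (tendsto_coeff_oneSerM hq 1 p.1).mul (tendsto_coeff_oneSerM hq (-1) p.2)
  have lim2 : ∀ n, Tendsto (fun M => PowerSeries.coeff n (evenSerM q M)) atTop
      (𝓝 (PowerSeries.coeff n (evenSer q))) := by
    intro n
    simp only [evenSerM, evenSer, PowerSeries.coeff_mk]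
    split_ifs with h
    · have := tendsto_nest hq (u := [n]) (fun k hk => by
        simp only [List.mem_singleton] at hk; omega)
      simpa [cmono_single, cl, g] using this
    · exact tendsto_const_nhds
  refine tendsto_nhds_unique ((lim1 (n + 1)).const_mul _) (Tendsto.congr (fun M => (key M).symm) ?_)
  refine Tendsto.const_mul _ ?_
  simp only [PowerSeries.coeff_mul _ _ (evenSerM q _), PowerSeries.coeff_mul _ _ (evenSer q)]
  exact tendsto_finsetSum _ fun p _ => (lim1 p.1).mul (lim2 p.2)

/-- The product of the generating series of `Z_q(g_1 ⋯ g_1)` at `X` and `-X` is `∏ (1 - x_m² X²)`, which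
is `1` modulo `𝒫_q` by its logarithmic derivative. -/
theorem coeff_oneSer_mem (n : ℕ) : PowerSeries.coeff (n + 1) (oneSer q 1 * oneSer q (-1))
    ∈ idealC hq (Pideal q hq) := by
  induction n using Nat.strong_induction_on with
  | _ n ih =>
    have h0 : PowerSeries.coeff 0 (oneSer q 1 * oneSer q (-1)) = 1 := by
      simp [PowerSeries.coeff_mul, oneSer, oneVal, cmono, Zq_one hq]
    have hev : ∀ m, PowerSeries.coeff m (evenSer q) ∈ idealC hq (Pideal q hq) := by
      intro m
      rw [evenSer, PowerSeries.coeff_mk]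
      split_ifs with h
      · obtain ⟨k, rfl⟩ := h.2
        have hz : Zq q (g (k + k)) ∈ Zalg q hq := by
          refine mem_Zalg_of_mem_HZero hq (Submodule.mem_sup_left (Submodule.subset_span (Or.inr
            ⟨1, one_mem _, k + k, by omega, by rw [one_mul]⟩)))
        exact ⟨hz, Ideal.subset_span ⟨k, by omega, by rw [two_mul]⟩⟩
      · exact zero_mem _
    have hs : PowerSeries.coeff (n + 1) (oneSer q 1 * oneSer q (-1) * evenSer q)
        ∈ idealC hq (Pideal q hq) := by
      rw [PowerSeries.coeff_mul]
      refine sum_mem fun p hp => ?_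
      rw [mem_antidiagonal] at hp
      by_cases h2 : p.2 = 0
      · have : PowerSeries.coeff 0 (evenSer q) = 0 := by simp [evenSer]
        rw [h2, this, mul_zero]
        exact zero_mem _
      refine mul_mem_idealC hq ?_ (hev _)
      rcases hp1 : p.1 with _ | m
      · rw [h0]; exact one_mem _
      · obtain ⟨h3, -⟩ := ih m (by omega)
        exact h3
    have h1 := succ_mul_coeff_oneSer hq n
    have h2 : (n + 1 : ℂ) ≠ 0 := by exact_mod_cast Nat.succ_ne_zero n
    have h3 : PowerSeries.coeff (n + 1) (oneSer q 1 * oneSer q (-1))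
        = algebraMap ℚ ℂ (-2 / (n + 1))
          * PowerSeries.coeff (n + 1) (oneSer q 1 * oneSer q (-1) * evenSer q) := by
      rw [← mul_right_inj' h2, h1]
      simp
      field_simp
    rw [h3]
    exact mul_mem_idealC hq (algebraMap_mem _ _) hs

end Values

/-! ### Harmonic regularization -/

/-- The word consists of positive integers and its last entry, if any, is at least two. -/
def Good (u : List ℕ) : Prop := (∀ k ∈ u, 1 ≤ k) ∧ lastGe 2 u

theorem good_nil : Good [] := ⟨by simp, lastGe_nil 2⟩

theorem good_append {u : List ℕ} (hu : ∀ k ∈ u, 1 ≤ k) {k : ℕ} (hk : 2 ≤ k) : Good (u ++ [k]) := by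
  refine ⟨fun j hj => ?_, (lastGe_append _ _ _).mpr hk⟩
  rw [List.mem_append, List.mem_singleton] at hj
  rcases hj with hj | rfl
  · exact hu j hj
  · omega

/-- The word `g_1 ⋯ g_1` with `n` letters. -/
noncomputable def ones (n : ℕ) : HH := cmono CC (List.replicate n 1)

theorem ones_zero : ones 0 = 1 := by simp [ones, cmono]

theorem ones_mem_Gmod (n : ℕ) : ones n ∈ Gmod := cmono_mem_Gmod (by simp)

/-- The elements `x_s` with `g_α g_1^s = ∑_{p+i=s} x_p ∗_ħ g_1^i`. -/
noncomputable def xreg (α : List ℕ) (s : ℕ) : HH :=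
  cmono CC α * ones s - ∑ i : Fin s, hstar (xreg α i) (ones (s - i))
termination_by s

theorem Gmod_le_Wmod : Gmod ≤ Wmod := by
  rw [Gmod, Submodule.span_le]
  rintro _ ⟨u, -, rfl⟩
  exact cmono_mem_Wmod u

theorem Gmod_induction₂ {p : HH → HH → Prop}
    (h : ∀ u v : List ℕ, (∀ k ∈ u, 1 ≤ k) → (∀ k ∈ v, 1 ≤ k) → p (cmono CC u) (cmono CC v))
    (h1 : ∀ x y z, p x z → p y z → p (x + y) z) (h2 : ∀ (c : CC) x z, p x z → p (c • x) z)
    (h3 : ∀ x y z, p x y → p x z → p x (y + z)) (h4 : ∀ (c : CC) x z, p x z → p x (c • z))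
    {x y : HH} (hx : x ∈ Gmod) (hy : y ∈ Gmod) : p x y := by
  have key : ∀ u : List ℕ, (∀ k ∈ u, 1 ≤ k) → p (cmono CC u) y := by
    intro u hu
    induction hy using Submodule.span_induction with
    | mem y hy =>
      obtain ⟨v, hv, rfl⟩ := hy
      exact h u v hu hv
    | zero => simpa using h4 0 _ _ (h u [] hu (by simp))
    | add y z _ _ hy hz => exact h3 _ _ _ hy hz
    | smul c y _ hy => exact h4 _ _ _ hy
  induction hx using Submodule.span_induction with
  | mem x hx =>
    obtain ⟨u, hu, rfl⟩ := hx
    exact key u hu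
  | zero => simpa using h2 0 _ _ (key [] (by simp))
  | add y z _ _ hy hz => exact h1 _ _ _ hy hz
  | smul c y _ hy => exact h2 _ _ _ hy

theorem hstar_mem_Gmod {x y : HH} (hx : x ∈ Gmod) (hy : y ∈ Gmod) : hstar x y ∈ Gmod := by
  refine Gmod_induction₂ (p := fun x y => hstar x y ∈ Gmod) ?_ ?_ ?_ ?_ ?_ hx hy
  · intro u v hu hv
    rw [hstar, harm_cmono]
    exact harmRev_mem_Gmod _ _ (fun k hk => hu k (List.mem_reverse.mp hk))
      (fun k hk => hv k (List.mem_reverse.mp hk))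
  · intro x y z h1 h2
    rw [map_add]
    exact add_mem h1 h2
  · intro c x z h
    rw [map_smul]
    exact Submodule.smul_mem _ _ h
  · intro x y z h1 h2
    rw [map_add]
    exact add_mem h1 h2
  · intro c x z h
    rw [map_smul]
    exact Submodule.smul_mem _ _ h

theorem delta_hstar_Gmod {x y : HH} (hx : x ∈ Gmod) (hy : y ∈ Gmod) :
    delta (hstar x y) = hstar (delta x) y + hstar x (delta y) := by
  refine Gmod_induction₂ (p := fun x y => delta (hstar x y)
    = hstar (delta x) y + hstar x (delta y)) ?_ ?_ ?_ ?_ ?_ hx hy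
  · exact fun u v hu hv => delta_hstar u v hu hv
  · intro x y z h1 h2
    simp only [map_add, LinearMap.add_apply, h1, h2]
    abel
  · intro c x z h
    simp only [map_smul, LinearMap.smul_apply, h, smul_add]
  · intro x y z h1 h2
    simp only [map_add, h1, h2]
    abel
  · intro c x z h
    simp only [map_smul, h, smul_add]

theorem delta_mul_ones (u : List ℕ) (n : ℕ) : delta (cmono CC u * ones (n + 1))
    = cmono CC u * ones n := by
  rw [ones, List.replicate_succ', cmono_append, cmono_single, ← mul_assoc,
    delta_mul_cl, if_pos rfl, ones]
  rw [← cmono_append]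
  exact cmono_mem_Wmod _

theorem hstar_one_right {x : HH} (hx : x ∈ Wmod) : hstar x 1 = x := by
  rw [hstar_comm hx one_mem_Wmod, hstar_nil_left x hx]

theorem cmono_mul_ones (α : List ℕ) (s : ℕ) :
    cmono CC α * ones s = cmono CC (α ++ List.replicate s 1) := by
  rw [ones, cmono_append]

theorem cmono_mul_ones_mem {α : List ℕ} (hα : ∀ k ∈ α, 1 ≤ k) (s : ℕ) :
    cmono CC α * ones s ∈ Gmod := by
  rw [cmono_mul_ones]
  refine cmono_mem_Gmod fun k hk => ?_
  rw [List.mem_append, List.mem_replicate] at hk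
  rcases hk with hk | hk
  · exact hα k hk
  · omega

theorem xreg_mem_Gmod {α : List ℕ} (hα : ∀ k ∈ α, 1 ≤ k) (s : ℕ) : xreg α s ∈ Gmod := by
  induction s using Nat.strong_induction_on with
  | _ s ih =>
    rw [xreg]
    refine sub_mem (cmono_mul_ones_mem hα s) (Submodule.sum_mem _ fun i _ => ?_)
    exact hstar_mem_Gmod (ih i i.isLt) (ones_mem_Gmod _)

/-- The defining property of `xreg`. -/
theorem xreg_sum {α : List ℕ} (hα : ∀ k ∈ α, 1 ≤ k) (s : ℕ) : cmono CC α * ones s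
    = ∑ p ∈ antidiagonal s, hstar (xreg α p.1) (ones p.2) := by
  rw [Finset.Nat.sum_antidiagonal_eq_sum_range_succ (fun i j => hstar (xreg α i) (ones j)),
    Finset.sum_range_succ, Nat.sub_self, ones_zero,
    hstar_one_right (Gmod_le_Wmod (xreg_mem_Gmod hα s)), xreg,
    ← Fin.sum_univ_eq_sum_range (fun i => hstar (xreg α i) (ones (s - i)))]
  abel

/-- `δ` is a derivation for `∗_ħ` with `δ(g_1^{n+1}) = g_1^n`, so the recursion of `xreg` forces
`δ(x_s) = 0`. -/
theorem delta_xreg {α : List ℕ} (hα : Good α) (s : ℕ) : delta (xreg α s) = 0 := by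
  induction s using Nat.strong_induction_on with
  | _ s ih =>
    have h1 : ∀ i : Fin s, delta (hstar (xreg α i) (ones (s - i)))
        = hstar (xreg α i) (ones (s - 1 - i)) := by
      intro i
      have hi := i.isLt
      rw [delta_hstar_Gmod (xreg_mem_Gmod hα.1 _) (ones_mem_Gmod _), ih i hi, map_zero,
        LinearMap.zero_apply, zero_add]
      congr 1
      have := delta_mul_ones [] (s - 1 - i)
      rw [show cmono CC [] = (1 : HH) by simp [cmono], one_mul, one_mul] at this
      rw [← this]
      congr 2
      omega
    rw [xreg, map_sub, map_sum, Finset.sum_congr rfl fun i _ => h1 i]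
    rcases s with _ | s
    · rw [ones_zero, mul_one, Finset.univ_eq_empty, Finset.sum_empty, sub_zero]
      rcases List.eq_nil_or_concat α with rfl | ⟨v, k, rfl⟩
      · rw [show cmono CC [] = (1 : HH) by simp [cmono], delta_one]
      · rw [List.concat_eq_append] at hα ⊢
        have := (lastGe_append _ _ _).mp hα.2
        rw [cmono_append, cmono_single, delta_mul_cl (cmono_mem_Wmod _), if_neg (by omega)]
    · rw [delta_mul_ones, xreg_sum hα.1,
        Finset.Nat.sum_antidiagonal_eq_sum_range_succ (fun i j => hstar (xreg α i) (ones j)),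
        Fin.sum_univ_eq_sum_range (fun i => hstar (xreg α i) (ones (s + 1 - 1 - i)))]
      simp

theorem sub_delta_mem_uspan {x : HH} (hx : x ∈ Gmod) :
    x - delta x * cl CC 1 ∈ uspan (lastGe 2) := by
  have : Gmod ≤ (uspan (lastGe 2)).comap
      (LinearMap.id - (LinearMap.mulRight CC (cl CC 1)).comp delta) := by
    nth_rw 1 [Gmod]
    rw [Submodule.span_le]
    rintro _ ⟨u, hu, rfl⟩
    simp only [SetLike.mem_coe, Submodule.mem_comap, LinearMap.sub_apply, LinearMap.id_apply,
      LinearMap.comp_apply, LinearMap.mulRight_apply]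
    rcases List.eq_nil_or_concat u with rfl | ⟨v, k, rfl⟩
    · rw [show cmono CC [] = (1 : HH) by simp [cmono], delta_one, zero_mul, sub_zero,
        show (1 : HH) = uw [] by simp [uw]]
      exact uw_mem_uspan (lastGe_nil 2)
    · rw [List.concat_eq_append] at hu ⊢
      have hk := hu k (by simp)
      rw [cmono_append, cmono_single, delta_mul_cl (cmono_mem_Wmod _)]
      split_ifs with h
      · rw [h, sub_self]; exact Submodule.zero_mem _
      · rw [zero_mul, sub_zero, ← cmono_single, ← cmono_append, ← uw_eq_cmono _ hu]
        exact uw_mem_uspan ((lastGe_append _ _ _).mpr (by omega))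
  exact this hx

theorem xreg_mem_uspan {α : List ℕ} (hα : Good α) (s : ℕ) : xreg α s ∈ uspan (lastGe 2) := by
  have := sub_delta_mem_uspan (xreg_mem_Gmod hα.1 s)
  rwa [delta_xreg hα, zero_mul, sub_zero] at this

theorem xreg_mem_HZero {α : List ℕ} (hα : Good α) (s : ℕ) : xreg α s ∈ HZero := by
  rw [HZero_eq]
  exact uspan_le_vspan (uspan_mono (fun _ h => Or.inl h) (xreg_mem_uspan hα s))

/-! ### Harmonic products modulo `Km` -/

theorem smul_mem_Km {x : HH} (hx : x ∈ Cm) : hb • x ∈ Km := smul_mem_vspan hx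

theorem hstar_uw_mem_Jm (u v : List ℕ) (h : 0 ∈ v) : hstar (uw u) (uw v) ∈ Jm := by
  rw [hstar_comm (uw_mem_Wmod _) (uw_mem_Wmod _)]
  exact (hstar_uw_mem v u).2.1 h

/-- Modulo `Km`, a harmonic product with a word ending in some `g_k`, `k ≥ 2`, takes place to the
left of any `ħ b`. -/
theorem hstar_mul_uA_uw (γ u v : List ℕ) (hγ : lastGe 2 γ) :
    hstar (uw γ) (uw u * uA 0 * uw v) - hstar (uw γ) (uw u) * uA 0 * uw v ∈ Km := by
  rcases List.eq_nil_or_concat γ with rfl | ⟨γ, k, rfl⟩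
  · have h1 : uw [] = 1 := by simp [uw]
    have h2 : uw u * uA 0 * uw v = uw (u ++ 0 :: v) := by simp [uw, mul_assoc]
    rw [h1, hstar_nil_left _ (uw_mem_Wmod u), h2, hstar_nil_left _ (uw_mem_Wmod _), sub_self]
    exact Submodule.zero_mem _
  rw [List.concat_eq_append] at hγ ⊢
  rw [lastGe_append] at hγ
  obtain ⟨k, rfl⟩ : ∃ j, k = j + 2 := ⟨k - 2, by omega⟩
  have hk : ∀ l, uA (l + 2) = cl CC (l + 2) := fun l => (cl_succ (l + 1)).symm
  have mem : ∀ a b : List ℕ, hstar (uw a) (uw b) ∈ Cm := fun a b =>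
    vspan_le_Cm _ _ (hstar_uw_mem a b).1
  induction v using List.reverseRecOn with
  | nil =>
    rw [show uw [] = 1 by simp [uw], mul_one, mul_one, ← uw_append_single, hstar_uw_append,
      circ, if_pos (Or.inr rfl), hk]
    have h : ∀ a b c : HH, a + b + c - b = a + c := fun a b c => by abel
    rw [h, mul_smul_comm]
    exact add_mem (Jm_mul_cl_two (hstar_uw_mem_Jm _ _ (by simp)) k)
      (smul_mem_Km (Cm_mul (mem _ _) (cl_succ_mem_Cm _)))
  | append_singleton v l ih =>
    have h2 : ∀ w, uw u * uA 0 * uw w = uw (u ++ 0 :: w) := fun w => by simp [uw, mul_assoc]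
    have h3 : uw (u ++ 0 :: (v ++ [l])) = uw ((u ++ 0 :: v) ++ [l]) := by simp
    rw [h2] at ih
    rw [h2, h3, hstar_uw_append, uw_append_single v, ← mul_assoc]
    have h : ∀ a b c d f : HH, a + b + c - d = a + c + (b - d) := fun a b c d _ => by abel
    rw [h _ _ _ _ 0, ← sub_mul]
    refine add_mem (add_mem ?_ ?_) (Km_mul_Cm ih (uA_mem_Cm l))
    · rw [hk]
      exact Jm_mul_cl_two (hstar_uw_mem_Jm _ _ (by simp)) k
    · rw [circ]
      by_cases h0 : k + 2 = 0 ∨ l = 0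
      · rw [if_pos h0, mul_smul_comm]
        exact smul_mem_Km (Cm_mul (mem _ _) (uA_mem_Cm _))
      · rw [if_neg h0, show k + 2 + l = (k + l) + 2 by ring, hk]
        exact Jm_mul_cl_two (hstar_uw_mem_Jm _ _ (by simp)) _

theorem hstar_mul_uA_mem {x v : HH} (hx : x ∈ uspan (lastGe 2)) (u : List ℕ) (hv : v ∈ Cm) :
    hstar x (uw u * uA 0 * v) - hstar x (uw u) * uA 0 * v ∈ Km := by
  have h1 : ∀ γ, lastGe 2 γ →
      hstar (uw γ) (uw u * uA 0 * v) - hstar (uw γ) (uw u) * uA 0 * v ∈ Km := by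
    intro γ hγ
    exact (uspan_induction (V := Km.comap ((hstar (uw γ)).comp (LinearMap.mulLeft CC (uw u * uA 0))
      - LinearMap.mulLeft CC (hstar (uw γ) (uw u) * uA 0)))
      (fun v _ => hstar_mul_uA_uw γ u v hγ)) hv
  have := (uspan_induction (V := Km.comap (hstar.flip (uw u * uA 0 * v)
      - (LinearMap.mulRight CC (uA 0 * v)).comp (hstar.flip (uw u))))
      (fun γ hγ => by
        have := h1 γ hγ
        simpa [mul_assoc] using this)) hx
  simpa [mul_assoc] using this

/-- The remainder in `y_{n+1} = g_1 y_n + ħ b r_n`. -/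
noncomputable def yrem (n : ℕ) : HH := ∑ p ∈ antidiagonal n,
  if p.1 = 0 then 0 else (fc (p.1 + 1) • uA 0 ^ (p.1 - 1)) * cl CC 1 * yd p.2

theorem yrem_mem_Cm (n : ℕ) : yrem n ∈ Cm := by
  refine Submodule.sum_mem _ fun p _ => ?_
  split_ifs
  · exact Submodule.zero_mem _
  · exact Cm_mul (Cm_mul (Submodule.smul_mem _ _ (uA_pow_mem_Cm _)) (cl_succ_mem_Cm 0))
      (yd_mem_Cm _)

theorem yd_succ_left (n : ℕ) : yd (n + 1) = cl CC 1 * yd n + uA 0 * yrem n := by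
  have h := congrArg (PowerSeries.coeff (n + 1)) (ys_eq' 1)
  rw [map_add, PowerSeries.coeff_smul, PowerSeries.coeff_succ_X_mul, PowerSeries.coeff_mul,
    PowerSeries.coeff_one, if_neg (by omega), zero_add, one_smul] at h
  simp only [ys, PowerSeries.coeff_mk, one_pow, one_smul, PowerSeries.coeff_mul_C, phs,
    one_mul] at h
  rw [h, yrem, Finset.mul_sum]
  rcases n with _ | n
  · simp [fc_one]
  · rw [Finset.Nat.sum_antidiagonal_succ, Finset.Nat.sum_antidiagonal_succ]
    simp only [zero_add, fc_one, pow_zero, one_smul, one_mul, if_true, mul_zero,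
      Nat.add_eq_zero_iff, one_ne_zero, and_false, if_false, Nat.add_sub_cancel]
    congr 1
    refine Finset.sum_congr rfl fun p _ => ?_
    rw [smul_mul_assoc, smul_mul_assoc, smul_mul_assoc, smul_mul_assoc, mul_smul_comm,
      pow_succ' _ p.1]
    simp only [mul_assoc]

/-- The terms `ρ_c` in `y_s = g_1^s + ∑_{a+c=s} g_1^a ρ_c`. -/
noncomputable def yrho : ℕ → HH
  | 0 => 0
  | c + 1 => uA 0 * yrem c

theorem ones_succ (n : ℕ) : ones (n + 1) = cl CC 1 * ones n := by
  rw [ones, List.replicate_succ, ← List.singleton_append, cmono_append, cmono_single, ones]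

theorem yd_eq_ones (s : ℕ) : yd s = ones s + ∑ p ∈ antidiagonal s, ones p.1 * yrho p.2 := by
  induction s with
  | zero => simp [yd_zero, ones_zero, yrho]
  | succ s ih =>
    rw [yd_succ_left, ih, mul_add, ← ones_succ, Finset.Nat.sum_antidiagonal_succ, ones_zero, one_mul,
      yrho, Finset.mul_sum]
    simp only [ones_succ, mul_assoc]
    abel

theorem yrho_mem_Jm (c : ℕ) : yrho c ∈ Jm := by
  rcases c with _ | c
  · exact Submodule.zero_mem _
  · exact Jm_mul_Cm uA_zero_mem_Jm (yrem_mem_Cm c)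

theorem ones_mem_Cm (n : ℕ) : ones n ∈ Cm := by
  rw [ones, ← uw_eq_cmono _ (by simp)]
  exact uw_mem_uspan trivial

theorem yd_sub_ones_mem (s : ℕ) : yd s - ones s ∈ Jm := by
  rw [yd_eq_ones, add_sub_cancel_left]
  exact Submodule.sum_mem _ fun p _ => Cm_mul_Jm (ones_mem_Cm _) (yrho_mem_Jm _)

theorem EOne_sub_ones_mem (s : ℕ) : EOne s - ones s ∈ Jm := by
  rcases s with _ | s
  · rw [EOne_zero, ones_zero, sub_self]; exact Submodule.zero_mem _
  · rw [EOne_eq, Finset.Nat.sum_antidiagonal_succ', add_sub_right_comm]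
    simp only [zero_add, pow_zero, fc_one, one_smul, mul_one]
    refine add_mem (yd_sub_ones_mem _) (Submodule.sum_mem _ fun p _ => ?_)
    rw [pow_succ]
    exact Cm_mul_Jm (yd_mem_Cm _) (Submodule.smul_mem _ _ (Cm_mul_Jm (uA_pow_mem_Cm _)
      uA_zero_mem_Jm))

/-- The harmonic regularization also computes the products `g_α y_s` modulo `Km`, because `y_s` agrees
with `g_1^s` up to words that contain `ħ b`. -/
theorem xreg_yd_mem {α : List ℕ} (hα : Good α) (s : ℕ) :
    ∑ p ∈ antidiagonal s, hstar (xreg α p.1) (yd p.2) - cmono CC α * yd s ∈ Km := by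
  have hrho : ∀ p a c, hstar (xreg α p) (ones a * yrho c) - hstar (xreg α p) (ones a) * yrho c
      ∈ Km := by
    intro p a c
    rcases c with _ | c
    · simp [yrho]
    · have := hstar_mul_uA_mem (xreg_mem_uspan hα p) (List.replicate a 1) (yrem_mem_Cm c)
      rw [uw_eq_cmono _ (by simp)] at this
      rwa [yrho, ← mul_assoc, ← mul_assoc]
  have h1 : ∑ p ∈ antidiagonal s, hstar (xreg α p.1) (yd p.2) = cmono CC α * ones s
      + ∑ p ∈ antidiagonal s, ∑ r ∈ antidiagonal p.1,
        hstar (xreg α r.1) (ones r.2 * yrho p.2) := by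
    rw [xreg_sum hα.1, sum_antidiagonal_assoc s fun a b c =>
      hstar (xreg α a) (ones b * yrho c), ← Finset.sum_add_distrib]
    refine Finset.sum_congr rfl fun p _ => ?_
    rw [yd_eq_ones, map_add, map_sum]
  have h2 : cmono CC α * yd s = cmono CC α * ones s
      + ∑ p ∈ antidiagonal s, ∑ r ∈ antidiagonal p.1,
        hstar (xreg α r.1) (ones r.2) * yrho p.2 := by
    rw [yd_eq_ones, mul_add, Finset.mul_sum]
    congr 1
    refine Finset.sum_congr rfl fun p _ => ?_
    rw [← mul_assoc, xreg_sum hα.1, Finset.sum_mul]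
  rw [h1, h2, add_sub_add_left_eq_sub, ← Finset.sum_sub_distrib]
  refine Submodule.sum_mem _ fun p _ => ?_
  rw [← Finset.sum_sub_distrib]
  exact Submodule.sum_mem _ fun r _ => hrho _ _ _

/-! ### Cut sums over a block of ones -/

section Blocks

variable {q : ℂ} (hq : ‖q‖ < 1)

/-- The harmonic regularized value of `g_α g_1^s`. -/
noncomputable def regVal (q : ℂ) (α : List ℕ) (s : ℕ) : ℂ := Zq q (xreg α s)

/-- The generating series of the regularized values. -/
noncomputable def regSer (q t : ℂ) (α : List ℕ) : PowerSeries ℂ :=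
  PowerSeries.mk fun n => t ^ n * regVal q α n

/-- `∑_{a+b=s} (-1)^b` times the regularized values of `g_α g_1^a` and `g_β g_1^b`. -/
noncomputable def blk (q : ℂ) (α β : List ℕ) (s : ℕ) : ℂ :=
  ∑ p ∈ antidiagonal s, (-1) ^ p.2 * (regVal q α p.1 * regVal q β p.2)

theorem regVal_mem {α : List ℕ} (hα : Good α) (s : ℕ) : regVal q α s ∈ Zalg q hq :=
  mem_Zalg_of_mem_HZero hq (xreg_mem_HZero hα s)

theorem coeff_mul_signed (f h : ℕ → ℂ) (s : ℕ) :
    PowerSeries.coeff s ((PowerSeries.mk fun n => 1 ^ n * f n) *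
      (PowerSeries.mk fun n => (-1) ^ n * h n))
      = ∑ p ∈ antidiagonal s, (-1) ^ p.2 * (f p.1 * h p.2) := by
  rw [PowerSeries.coeff_mul]
  refine Finset.sum_congr rfl fun p _ => ?_
  rw [PowerSeries.coeff_mk, PowerSeries.coeff_mk, one_pow, one_mul]
  ring

theorem blk_eq (α β : List ℕ) (s : ℕ) :
    blk q α β s = PowerSeries.coeff s (regSer q 1 α * regSer q (-1) β) :=
  (coeff_mul_signed _ _ s).symm

theorem blk_mem {α β : List ℕ} (hα : Good α) (hβ : Good β) (s : ℕ) : blk q α β s ∈ Zalg q hq :=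
  sum_mem fun _ _ => mul_mem (pow_mem (neg_mem (one_mem _)) _)
    (mul_mem (regVal_mem hq hα _) (regVal_mem hq hβ _))

/-- The value of the word `g_u`. -/
noncomputable def wordVal (q : ℂ) (u : List ℕ) : ℂ := Zq q (cmono CC u)

include hq in
theorem wordVal_append {α : List ℕ} (hα : Good α) (s : ℕ) : wordVal q (α ++ List.replicate s 1)
    = ∑ p ∈ antidiagonal s, regVal q α p.1 * oneVal q p.2 := by
  have h1 : ∀ n, xreg α n ∈ Hhat := fun n => Gmod_le_Hhat (xreg_mem_Gmod hα.1 n)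
  have h2 : ∀ n, ones n ∈ Hhat := fun n => Gmod_le_Hhat (ones_mem_Gmod n)
  rw [wordVal, ← cmono_mul_ones, xreg_sum hα.1, Zq_sum hq]
  · exact Finset.sum_congr rfl fun p _ => Zq_hstar hq (h1 _) (h2 _)
  · exact fun p _ => hstar_mem_Hhat (h1 _) (h2 _)

include hq in
theorem wordVal_ser {α : List ℕ} (hα : Good α) (t : ℂ) :
    (PowerSeries.mk fun n => t ^ n * wordVal q (α ++ List.replicate n 1))
      = regSer q t α * oneSer q t := by
  ext n
  rw [PowerSeries.coeff_mul, PowerSeries.coeff_mk, wordVal_append hq hα, Finset.mul_sum]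
  refine Finset.sum_congr rfl fun p hp => ?_
  rw [mem_antidiagonal] at hp
  simp only [regSer, oneSer, PowerSeries.coeff_mk]
  rw [← hp, pow_add]
  ring

/-- In the cuts of a block of ones, the values of words may be replaced modulo `𝒫_q` by the harmonic
regularized values. -/
theorem wordVal_blk {α β : List ℕ} (hα : Good α) (hβ : Good β) (s : ℕ) :
    ∑ p ∈ antidiagonal s, (-1) ^ p.2 * (wordVal q (α ++ List.replicate p.1 1)
      * wordVal q (β ++ List.replicate p.2 1)) - blk q α β s ∈ idealC hq (Pideal q hq) := by
  have h0 : PowerSeries.coeff 0 (oneSer q 1 * oneSer q (-1)) = 1 := by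
    simp [PowerSeries.coeff_mul, oneSer, oneVal, cmono, Zq_one hq]
  have e := coeff_mul_signed (fun n => wordVal q (α ++ List.replicate n 1))
    (fun n => wordVal q (β ++ List.replicate n 1)) s
  beta_reduce at e
  rw [← e, wordVal_ser hq hα, wordVal_ser hq hβ, mul_mul_mul_comm,
    PowerSeries.coeff_mul]
  rcases s with _ | s
  · simp [blk_eq, PowerSeries.coeff_mul, oneSer, oneVal, cmono, Zq_one hq, zero_mem]
  · rw [Finset.Nat.sum_antidiagonal_succ', h0, mul_one, ← blk_eq, add_sub_cancel_left]
    refine sum_mem fun p _ => mul_mem_idealC hq ?_ (coeff_oneSer_mem hq _)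
    rw [← blk_eq]
    exact blk_mem hq hα hβ _

/-- `∑ tⁿ Z_q(y_n) Xⁿ`. -/
noncomputable def ydSer (q t : ℂ) : PowerSeries ℂ := PowerSeries.mk fun n => t ^ n * Zq q (yd n)

theorem yd_mem_Hhat (n : ℕ) : yd n ∈ Hhat := by
  have := Bd.mul_yd_mem (Or.inl rfl) n
  rwa [one_mul] at this

include hq in
theorem Zq_neg_one_pow_smul (n : ℕ) {x : HH} (hx : x ∈ Hhat) :
    Zq q ((-1 : CC) ^ n • x) = (-1) ^ n * Zq q x := by
  rw [Zq_smul hq _ hx]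
  simp

include hq in
theorem Zq_cutOne {x z : HH} (hx : Bd x) (hz : Bd z) (s : ℕ) : Zq q (cutOne x z s)
    = ∑ p ∈ antidiagonal s, (-1) ^ p.2 * (Zq q (x * yd p.1) * Zq q (z * yd p.2)) := by
  have h : ∀ p : ℕ × ℕ, hsh (x * yd p.1) (z * yd p.2) ∈ Hhat := fun p =>
    hsh_mem_Hhat (hx.mul_yd_mem _) (hz.mul_yd_mem _)
  rw [cutOne, Zq_sum hq _ _ fun p _ => Submodule.smul_mem _ _ (h p)]
  refine Finset.sum_congr rfl fun p _ => ?_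
  rw [Zq_neg_one_pow_smul hq _ (h p), Zq_hsh' hq (hx.mul_yd_mem _) (hz.mul_yd_mem _)]

include hq in
theorem ydSer_mul : ydSer q 1 * ydSer q (-1) = 1 := by
  ext s
  rw [ydSer, ydSer, coeff_mul_signed]
  have h := Zq_cutOne hq (Or.inl rfl) (Or.inl rfl) s
  simp only [one_mul] at h
  rw [← h, cutOne_eq, map_one, one_mul, one_mul, shp_ys_ys, PowerSeries.coeff_one,
    PowerSeries.coeff_one]
  split_ifs
  · exact Zq_one hq
  · exact Zq_zero hq

/-- The value of `x y_n` for `x` congruent to a multiple of `g_α` modulo `Km`. -/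
theorem Zq_mul_yd_sub_mem {α : List ℕ} (hα : Good α) {x : HH} (hx : Bd x) (m : ℕ)
    (h : x - (-1 : CC) ^ m • cmono CC α ∈ Km) (n : ℕ) :
    Zq q (x * yd n) - (-1) ^ m * ∑ p ∈ antidiagonal n, regVal q α p.1 * Zq q (yd p.2)
      ∈ idealC hq (Nideal q hq) ∧
    ∃ w ∈ Hhat, (-1) ^ m * ∑ p ∈ antidiagonal n, regVal q α p.1 * Zq q (yd p.2) = Zq q w := by
  have h1 : ∀ n, xreg α n ∈ Hhat := fun n => Gmod_le_Hhat (xreg_mem_Gmod hα.1 n)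
  have h2 : ∑ p ∈ antidiagonal n, hstar (xreg α p.1) (yd p.2) ∈ Hhat :=
    Submodule.sum_mem _ fun p _ => hstar_mem_Hhat (h1 _) (yd_mem_Hhat _)
  have h3 : (-1) ^ m * ∑ p ∈ antidiagonal n, regVal q α p.1 * Zq q (yd p.2)
      = Zq q ((-1 : CC) ^ m • ∑ p ∈ antidiagonal n, hstar (xreg α p.1) (yd p.2)) := by
    rw [Zq_neg_one_pow_smul hq _ h2, Zq_sum hq _ _ fun p _ => hstar_mem_Hhat (h1 _) (yd_mem_Hhat _)]
    congr 1
    exact Finset.sum_congr rfl fun p _ => (Zq_hstar hq (h1 _) (yd_mem_Hhat _)).symm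
  rw [h3]
  refine ⟨Zq_sub_mem hq (hx.mul_yd_mem n) (Submodule.smul_mem _ _ h2) ?_,
    _, Submodule.smul_mem _ _ h2, rfl⟩
  have h4 := sub_mem (Km_mul_Cm h (yd_mem_Cm n))
    (Submodule.smul_mem _ ((-1 : CC) ^ m) (xreg_yd_mem hα n))
  rw [sub_mul, smul_mul_assoc, smul_sub] at h4
  simpa using h4

/-- The cuts of `E_{1^s}` give, modulo `𝒩_q`, the same sum of harmonic regularized values as those of
a block of ones: the factors `∑ Z_q(y_n) (±X)^n` cancel. -/
theorem Zq_cutOne_blk {α β : List ℕ} (hα : Good α) (hβ : Good β) {x z : HH} (hx : Bd x)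
    (hz : Bd z) (m : ℕ) (hxα : x - cmono CC α ∈ Km)
    (hzβ : z - (-1 : CC) ^ m • cmono CC β ∈ Km) (s : ℕ) :
    Zq q (cutOne x z s) - (-1) ^ m * blk q α β s ∈ idealC hq (Nideal q hq) := by
  have hx2 := fun n => Zq_mul_yd_sub_mem hq hα hx 0 (by simpa using hxα) n
  have hz2 := fun n => Zq_mul_yd_sub_mem hq hβ hz m hzβ n
  simp only [pow_zero, one_mul] at hx2
  have ser : ∀ (t : ℂ) (γ : List ℕ), (PowerSeries.mk fun n => t ^ n *
      ∑ p ∈ antidiagonal n, regVal q γ p.1 * Zq q (yd p.2)) = regSer q t γ * ydSer q t := by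
    intro t γ
    ext n
    rw [PowerSeries.coeff_mul, PowerSeries.coeff_mk, Finset.mul_sum]
    refine Finset.sum_congr rfl fun p hp => ?_
    rw [mem_antidiagonal] at hp
    simp only [regSer, ydSer, PowerSeries.coeff_mk]
    rw [← hp, pow_add]
    ring
  have hblk : blk q α β s = ∑ p ∈ antidiagonal s, (-1) ^ p.2 *
      ((∑ r ∈ antidiagonal p.1, regVal q α r.1 * Zq q (yd r.2))
        * ∑ r ∈ antidiagonal p.2, regVal q β r.1 * Zq q (yd r.2)) := by
    have e := coeff_mul_signed (fun n => ∑ r ∈ antidiagonal n, regVal q α r.1 * Zq q (yd r.2))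
      (fun n => ∑ r ∈ antidiagonal n, regVal q β r.1 * Zq q (yd r.2)) s
    beta_reduce at e
    rw [← e, ser, ser, mul_mul_mul_comm, ydSer_mul hq, mul_one, blk_eq]
  rw [Zq_cutOne hq hx hz, hblk, Finset.mul_sum, ← Finset.sum_sub_distrib]
  refine sum_mem fun p _ => ?_
  obtain ⟨h1, w, hw, hw2⟩ := hx2 p.1
  obtain ⟨h3, -⟩ := hz2 p.2
  rw [hw2] at h1 ⊢
  have key : Zq q (x * yd p.1) * Zq q (z * yd p.2) - Zq q w * ((-1) ^ m *
      ∑ r ∈ antidiagonal p.2, regVal q β r.1 * Zq q (yd r.2)) ∈ idealC hq (Nideal q hq) := by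
    have := add_mem (mul_mem_Nideal hq (hz.mul_yd_mem p.2) h1) (mul_mem_Nideal hq hw h3)
    convert this using 1
    ring
  convert mul_mem_idealC hq (pow_mem (neg_mem (one_mem _)) p.2) key using 1
  ring

end Blocks

/-! ### Cut sums of words -/

/-- The sum of `F (u u') u''` over all factorizations `v = u' u''`. -/
def cutSum {A M : Type} [AddCommMonoid M] (F : List A → List A → M) : List A → List A → M
  | u, [] => F u []
  | u, k :: v => F u (k :: v) + cutSum F (u ++ [k]) v

theorem cutSum_eq {A M : Type} [AddCommMonoid M] (F : List A → List A → M) (u v : List A) :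
    cutSum F u v = ∑ i ∈ Finset.range (v.length + 1), F (u ++ v.take i) (v.drop i) := by
  induction v generalizing u with
  | nil => simp [cutSum]
  | cons k v ih =>
    rw [cutSum, ih, List.length_cons, Finset.sum_range_succ' _ (v.length + 1), add_comm]
    simp

theorem cutSum_ones_append (F : List ℕ → List ℕ → ℂ) (u v : List ℕ) (s : ℕ) :
    cutSum F u (List.replicate s 1 ++ v) + F (u ++ List.replicate s 1) v
      = ∑ p ∈ antidiagonal s, F (u ++ List.replicate p.1 1) (List.replicate p.2 1 ++ v)
        + cutSum F (u ++ List.replicate s 1) v := by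
  induction s generalizing u with
  | zero => simp [add_comm]
  | succ s ih =>
    have h := ih (u ++ [1])
    rw [Finset.Nat.sum_antidiagonal_succ, List.replicate_succ, List.cons_append, cutSum]
    simp only [List.append_assoc, List.singleton_append, ← List.replicate_succ] at h ⊢
    simp only [List.replicate_zero, List.append_nil]
    rw [add_assoc, h, ← add_assoc]

/-- The sum over all blocks of ones of a word `g_u g_1^s g_{ks}`, the prefix `u` being fixed. It is the
common value, up to the ideals, of both descriptions of the symmetric values. -/
noncomputable def blkSum (q : ℂ) : List ℕ → ℕ → List ℕ → ℂ
  | u, s, [] => blk q u [] s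
  | u, s, k :: ks => if k = 1 then blkSum q u (s + 1) ks
      else (-1) ^ (k :: ks).sum * blk q u (k :: ks).reverse s
        + blkSum q (u ++ List.replicate s 1 ++ [k]) 0 ks

theorem good_next {u : List ℕ} (hu : Good u) (s : ℕ) {k : ℕ} (hk : 2 ≤ k) :
    Good (u ++ List.replicate s 1 ++ [k]) := by
  refine good_append (fun j hj => ?_) hk
  rw [List.mem_append, List.mem_replicate] at hj
  rcases hj with hj | hj
  · exact hu.1 j hj
  · omega

theorem good_reverse {k : ℕ} {ks : List ℕ} (hks : ∀ j ∈ k :: ks, 1 ≤ j) (hk : k ≠ 1) :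
    Good (k :: ks).reverse := by
  have := hks k (by simp)
  rw [List.reverse_cons]
  exact good_append (fun j hj => hks j (by simp [List.mem_reverse.mp hj])) (by omega)

/-- A cut sum is determined modulo a subgroup by its blocks: the positions between two entries of a
word are grouped by the blocks of ones that contain them. -/
theorem cutSum_sub_mem {q : ℂ} (I : AddSubgroup ℂ) (F : List ℕ → List ℕ → ℂ)
    (hF : ∀ u v s, Good u → Good v.reverse →
      ∑ p ∈ antidiagonal s, F (u ++ List.replicate p.1 1) (List.replicate p.2 1 ++ v)
        - (-1) ^ v.sum * blk q u v.reverse s ∈ I)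
    {u : List ℕ} (hu : Good u) (s : ℕ) {ks : List ℕ} (hks : ∀ k ∈ ks, 1 ≤ k) :
    cutSum F u (List.replicate s 1 ++ ks) - blkSum q u s ks ∈ I := by
  induction ks generalizing u s with
  | nil =>
    have h := cutSum_ones_append F u [] s
    have h2 := hF u [] s hu good_nil
    rw [cutSum, add_left_inj] at h
    rw [h, blkSum]
    simpa using h2
  | cons k ks ih =>
    have hk := hks k (by simp)
    have hks2 : ∀ k ∈ ks, 1 ≤ k := fun j hj => hks j (by simp [hj])
    rw [blkSum]
    split_ifs with h
    · have := ih hu (s + 1) hks2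
      rw [List.replicate_succ', List.append_assoc, List.singleton_append] at this
      rwa [h]
    · have h1 := cutSum_ones_append F u (k :: ks) s
      have h2 := hF u (k :: ks) s hu (good_reverse hks h)
      have h3 := ih (good_next hu s (k := k) (by omega)) 0 hks2
      rw [cutSum, ← add_assoc, add_right_comm, add_left_inj] at h1
      rw [List.replicate_zero, List.nil_append] at h3
      rw [h1]
      convert add_mem h2 h3 using 1
      ring

/-! ### Both descriptions of the symmetric values -/

section Comparison

variable {q : ℂ} (hq : ‖q‖ < 1)

theorem psiStar_eq (ks : List ℕ) :
    psiStar (cmono CC ks) = (-1 : CC) ^ ks.sum • cmono CC ks.reverse := by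
  induction ks with
  | nil => rw [psiStar_nil]; simp [cmono]
  | cons k ks ih =>
    rw [psiStar_cons, ih, List.reverse_cons, cmono_append, cmono_single, smul_mul_assoc, smul_smul,
      List.sum_cons, pow_add]

include hq in
theorem Zq_wStar {ks : List ℕ} (hks : ∀ k ∈ ks, 1 ≤ k) : Zq q (wStar (cmono CC ks))
    = cutSum (fun u v => (-1) ^ v.sum * (wordVal q u * wordVal q v.reverse)) [] ks := by
  have h1 : ∀ i, cmono CC (ks.take i) ∈ Hhat := fun i =>
    Gmod_le_Hhat (cmono_mem_Gmod fun k hk => hks k (List.mem_of_mem_take hk))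
  have h2 : ∀ i, cmono CC (ks.drop i).reverse ∈ Hhat := fun i =>
    Gmod_le_Hhat (cmono_mem_Gmod fun k hk => hks k
      (List.mem_of_mem_drop (List.mem_reverse.mp hk)))
  rw [cutSum_eq, wStar, wS, cext_cmono, Zq_sum hq]
  · refine Finset.sum_congr rfl fun i _ => ?_
    rw [psiStar_eq, map_smul, Zq_neg_one_pow_smul hq _ (hstar_mem_Hhat (h1 i) (h2 i)),
      Zq_hstar hq (h1 i) (h2 i)]
    rfl
  · intro i _
    rw [psiStar_eq, map_smul]
    exact Submodule.smul_mem _ _ (hstar_mem_Hhat (h1 i) (h2 i))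

theorem replicate_append_reverse (b : ℕ) (v : List ℕ) :
    (List.replicate b 1 ++ v).reverse = v.reverse ++ List.replicate b 1 := by simp

theorem Zq_wStar_sub_mem {ks : List ℕ} (hks : ∀ k ∈ ks, 1 ≤ k) :
    Zq q (wStar (cmono CC ks)) - blkSum q [] 0 ks ∈ idealC hq (Pideal q hq) := by
  rw [Zq_wStar hq hks]
  refine cutSum_sub_mem _ _ (fun u v s hu hv => ?_) good_nil 0 hks
  convert mul_mem_idealC hq (pow_mem (neg_mem (one_mem _)) v.sum) (wordVal_blk hq hu hv s) using 1
  rw [mul_sub, Finset.mul_sum]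
  congr 1
  refine Finset.sum_congr rfl fun p _ => ?_
  rw [replicate_append_reverse, List.sum_append, List.sum_replicate, pow_add]
  simp
  ring

theorem psiSh_mem_Jm {x : HH} (hx : x ∈ Jm) : psiSh x ∈ Jm := by
  obtain ⟨x1, hx1, x2, hx2, rfl⟩ := Submodule.mem_sup.mp hx
  obtain ⟨x3, hx3, rfl⟩ := (Submodule.mem_smul_pointwise_iff_exists _ _ _).mp hx2
  rw [map_add, map_smul]
  refine add_mem ?_ (smul_mem_vspan (psiSh_mem_Cm hx3))
  refine uspan_induction (V := Jm.comap psiSh) (fun u hu => ?_) hx1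
  obtain ⟨s, t, rfl⟩ := List.append_of_mem hu
  have h : uw (s ++ 0 :: t) = uw s * (uA 0 * uw t) := by simp [uw]
  have ht := uw_mem_uspan (P := fun _ => True) (u := t) trivial
  have hs := uw_mem_uspan (P := fun _ => True) (u := s) trivial
  rw [Submodule.mem_comap, h, psiSh_mul (uw_mem_Wmod s) (Cm_le_Wmod (Cm_mul (uA_mem_Cm 0) ht)),
    psiSh_mul (Cm_le_Wmod (uA_mem_Cm 0)) (uw_mem_Wmod t), psiSh_uA_zero]
  exact Jm_mul_Cm (Cm_mul_Jm (psiSh_mem_Cm ht) uA_zero_mem_Jm) (psiSh_mem_Cm hs)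

theorem psiSh_ones_sub_mem (s : ℕ) : psiSh (ones s) - (-1 : CC) ^ s • ones s ∈ Jm := by
  induction s with
  | zero => simp [ones_zero, psiSh_one]
  | succ s ih =>
    have h2 : ones (s + 1) = ones s * cl CC 1 := by
      rw [ones, List.replicate_succ', cmono_append, cmono_single, ones]
    rw [ones_succ, psiSh_mul (cl_mem_Wmod 1) (Cm_le_Wmod (ones_mem_Cm s)), psiSh_cl_one,
      ← ones_succ, h2]
    have e : psiSh (ones s) * -(cl CC 1 + uA 0) - (-1 : CC) ^ (s + 1) • (ones s * cl CC 1)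
        = -((psiSh (ones s) - (-1 : CC) ^ s • ones s) * cl CC 1 + psiSh (ones s) * uA 0) := by
      rw [sub_mul, smul_mul_assoc, pow_succ, mul_neg_one, neg_smul]
      noncomm_ring
    rw [e]
    exact Submodule.neg_mem _ (add_mem (Jm_mul_Cm ih (cl_succ_mem_Cm 0))
      (Cm_mul_Jm (psiSh_mem_Cm (ones_mem_Cm s)) uA_zero_mem_Jm))

theorem psiSh_EOne_sub_mem (s : ℕ) : psiSh (EOne s) - (-1 : CC) ^ s • ones s ∈ Jm := by
  have h := add_mem (psiSh_mem_Jm (EOne_sub_ones_mem s)) (psiSh_ones_sub_mem s)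
  rw [map_sub] at h
  simpa using h

theorem Jm_mul_e_mem {x : HH} (hx : x ∈ Jm) (n : ℕ) : x * e (n + 2) ∈ Km := by
  rw [e_add_two, cl_mul_a, mul_add, mul_smul_comm]
  exact add_mem (Jm_mul_cl_two hx n) (smul_mem_Km (Cm_mul (Jm_le_Cm hx) (cl_succ_mem_Cm n)))

theorem ebar_eq (n : ℕ) : ∃ v ∈ Vm, ebar n = (-1 : CC) ^ (n + 1) • cl CC (n + 1) + hb • v := by
  induction n with
  | zero => exact ⟨0, Submodule.zero_mem _, by simp [ebar, cl]⟩
  | succ n ih =>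
    obtain ⟨v, hv, h⟩ := ih
    refine ⟨-(v * va CC) - ebar n, sub_mem (Submodule.neg_mem _ (Vm_mul_a hv)) (ebar_mem_Vm n), ?_⟩
    rw [ebar_succ, smul_sub, smul_neg]
    nth_rw 1 [h]
    rw [neg_mul, add_mul, smul_mul_assoc, smul_mul_assoc, cl_mul_a, pow_succ _ (n + 1), mul_neg_one,
      neg_smul, smul_neg]
    abel

theorem Jm_mul_ebar_mem {x : HH} (hx : x ∈ Jm) (n : ℕ) : x * ebar (n + 1) ∈ Km := by
  obtain ⟨v, hv, h⟩ := ebar_eq (n + 1)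
  rw [h, mul_add, mul_smul_comm, mul_smul_comm]
  exact add_mem (Submodule.smul_mem _ _ (Jm_mul_cl_two hx n))
    (smul_mem_Km (Cm_mul (Jm_le_Cm hx) (Vm_le_Cm hv)))

/-- The prefix of `E_k` that ends with some `e_k`, `k ≥ 2`, modulo `Km`. -/
theorem prefix_sub_mem {u : List ℕ} {x : HH} (hx : x - cmono CC u ∈ Km) (hu : ∀ k ∈ u, 1 ≤ k)
    (s n : ℕ) : x * EOne s * e (n + 2)
      - cmono CC (u ++ List.replicate s 1 ++ [n + 2]) ∈ Km := by
  have hu2 : cmono CC u ∈ Cm := by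
    rw [← uw_eq_cmono u hu]; exact uw_mem_uspan trivial
  have h1 := Km_mul_Cm (Km_mul_Cm hx (EOne_mem_Cm s)) (e_mem_Cm n)
  have h2 := Cm_mul_Km hu2 (Jm_mul_e_mem (EOne_sub_ones_mem s) n)
  have h3 := smul_mem_Km (Cm_mul (Cm_mul hu2 (ones_mem_Cm s)) (cl_succ_mem_Cm n))
  have h4 : e (n + 2) = cl CC (n + 2) + hb • cl CC (n + 1) := by rw [e_add_two, cl_mul_a]
  convert add_mem (add_mem h1 h2) h3 using 1
  rw [cmono_append, cmono_append, cmono_single, ← mul_smul_comm,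
    show hb • cl CC (n + 1) = e (n + 2) - cl CC (n + 2) by rw [h4, add_sub_cancel_left], ones]
  noncomm_ring

/-- The image under `ψ^sh` of a suffix of `E_k` that starts with some `e_k`, `k ≥ 2`, modulo `Km`. -/
theorem suffix_sub_mem (s : ℕ) (ks : Index) (n : ℕ) : psiSh (EAux s ks) * ebar (n + 1)
    - (-1 : CC) ^ ((n + 2) + (s + (ks.map fun i : ℕ+ => (i : ℕ)).sum)) •
      cmono CC ((n + 2) :: (List.replicate s 1 ++ ks.map fun i : ℕ+ => (i : ℕ))).reverse ∈ Km := by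
  have step : ∀ (w : HH) (c : CC) (l : List ℕ) (s n : ℕ), w - c • cmono CC l ∈ Km →
      cmono CC l ∈ Cm → w * psiSh (EOne s) * ebar (n + 1)
        - ((-1) ^ (n + 2 + s) * c) • cmono CC (l ++ List.replicate s 1 ++ [n + 2]) ∈ Km := by
    intro w c l s n hw hl
    obtain ⟨v, hv, h⟩ := ebar_eq (n + 1)
    have h1 := Km_mul_Cm (Km_mul_Cm hw (psiSh_mem_Cm (EOne_mem_Cm s)))
      (Vm_le_Cm (ebar_mem_Vm (n + 1)))
    have h2 := Submodule.smul_mem _ c (Cm_mul_Km hl (Jm_mul_ebar_mem (psiSh_EOne_sub_mem s) n))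
    have h3 := Submodule.smul_mem _ (c * (-1) ^ s)
      (smul_mem_Km (Cm_mul (Cm_mul hl (ones_mem_Cm s)) (Vm_le_Cm hv)))
    convert add_mem (add_mem h1 h2) h3 using 1
    rw [← mul_smul_comm hb _ v, show hb • v = ebar (n + 1) - (-1 : CC) ^ (n + 1 + 1) • cl CC (n + 1 + 1) by
      rw [h, add_sub_cancel_left], cmono_append, cmono_append, cmono_single, ones]
    simp only [sub_mul, mul_sub, smul_sub, smul_mul_assoc, mul_smul_comm, smul_smul, mul_assoc]
    have e1 : (-1 : CC) ^ (n + 2 + s) * c = c * ((-1) ^ s * (-1) ^ (n + 1 + 1)) := by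
      rw [pow_add]; ring
    rw [e1]
    abel
  induction ks generalizing s n with
  | nil =>
    have h := step 1 1 [] s n (by simp [cmono]) (by simpa [cmono] using one_mem_Cm)
    simpa [EAux] using h
  | cons k ks ih =>
    rw [EAux]
    split_ifs with h
    · have := ih (s + 1) n
      subst h
      simp only [List.map_cons, List.sum_cons, PNat.one_coe]
      rw [List.replicate_succ', List.append_assoc, List.singleton_append, add_assoc s] at this
      exact this
    · obtain ⟨m, hm⟩ := exists_eq_add_two h
      have h0 := ih 0 m
      have hl : cmono CC ((m + 2) :: (List.replicate 0 1 ++ ks.map fun i : ℕ+ => (i : ℕ))).reverse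
          ∈ Cm := by
        rw [← uw_eq_cmono]
        · exact uw_mem_uspan trivial
        · intro j hj
          simp only [List.replicate_zero, List.nil_append, List.reverse_cons, List.mem_append,
            List.mem_reverse, List.mem_map, List.mem_singleton] at hj
          rcases hj with ⟨i, -, rfl⟩ | rfl
          · exact i.pos
          · omega
      have h1 := step _ _ _ s n h0 hl
      have hE := EAux_mem_Cm 0 ks
      rw [hm, mul_assoc, psiSh_mul (Cm_le_Wmod (EOne_mem_Cm s))
        (Cm_le_Wmod (Cm_mul (e_mem_Cm m) hE)), psiSh_mul (Cm_le_Wmod (e_mem_Cm m)) (Cm_le_Wmod hE),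
        psiSh_e]
      convert h1 using 2
      rw [← pow_add]
      congr 1
      · simp only [List.map_cons, List.sum_cons, hm]
        congr 1
        omega
      · congr 1
        simp [hm]

/-- The shuffle description is the block sum modulo `𝒩_q`, block by block from the left. -/
theorem Zq_cutL_sub_mem (s : ℕ) (ks : Index) {u : List ℕ} (hu : Good u) {x : HH} (hx : Bd x)
    (hx2 : x ∈ Cm) (hxu : x - cmono CC u ∈ Km) :
    Zq q (cutL (EAux s ks) x 1) - blkSum q u s (ks.map fun i : ℕ+ => (i : ℕ))
      ∈ idealC hq (Nideal q hq) := by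
  induction ks generalizing s u x with
  | nil =>
    rw [EAux, cutL_EOne]
    have := Zq_cutOne_blk hq hu good_nil hx (Or.inl rfl) 0 hxu (by simp [cmono]) s
    simpa [blkSum, cutOne] using this
  | cons k ks ih =>
    rw [EAux, List.map_cons, blkSum]
    by_cases h : k = 1
    · rw [if_pos h, if_pos (by simp [h])]
      exact ih _ hu hx hx2 hxu
    · have h' : (k : ℕ) ≠ 1 := fun h1 => h (PNat.eq h1)
      rw [if_neg h, if_neg h']
      obtain ⟨n, hn⟩ := exists_eq_add_two h
      have hz : Bd (psiSh (EAux 0 ks) * ebar (n + 1)) :=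
        Bd_mul_ebar (psiSh_mem_Cm (EAux_mem_Cm _ _)) n
      have hx3 : Bd (x * EOne s * e (n + 2)) := Bd_mul_e (Cm_mul hx2 (EOne_mem_Cm s)) n
      have hx4 : x * EOne s * e (n + 2) ∈ Cm := Cm_mul (Cm_mul hx2 (EOne_mem_Cm s)) (e_mem_Cm n)
      have hpos : ∀ j ∈ (k : ℕ) :: ks.map fun i : ℕ+ => (i : ℕ), 1 ≤ j := by
        intro j hj
        rw [← List.map_cons (f := fun i : ℕ+ => (i : ℕ)), List.mem_map] at hj
        obtain ⟨i, -, rfl⟩ := hj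
        exact i.pos
      have h1 := Zq_cutOne_blk hq hu (good_reverse hpos h') hx hz
        ((k : ℕ) :: ks.map fun i : ℕ+ => (i : ℕ)).sum hxu
        (by simpa [hn] using suffix_sub_mem 0 ks n) s
      have h2 := ih 0 (good_next hu s (k := k) (by omega)) hx3 hx4
        (by rw [hn]; exact prefix_sub_mem hxu hu.1 s n)
      rw [hn, cutL_EOne_e_mul s n (EAux_mem_Cm _ _), one_mul,
        Zq_add hq (HZero_le_Hhat (cutOne_mem hx hz s))
          (HZero_le_Hhat (cutL_EAux_mem 0 ks hx3 hx4))]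
      rw [hn] at h1 h2
      convert add_mem h1 h2 using 1
      ring

/-- The harmonic description is the block sum modulo `𝒫_q`. -/
theorem ZqStar_sub_mem (k : Index) :
    ZqStar q (gI k) - blkSum q [] 0 (k.map fun i : ℕ+ => (i : ℕ)) ∈ idealC hq (Pideal q hq) := by
  rw [ZqStar, gI_eq]
  refine Zq_wStar_sub_mem hq fun j hj => ?_
  obtain ⟨i, -, rfl⟩ := List.mem_map.mp hj
  exact i.pos

theorem ZqStar_sub_ZqSh_mem (k : Index) :
    ZqStar q (gI k) - ZqSh q (EI k) ∈ idealC hq (Nideal q hq ⊔ Pideal q hq) := by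
  have h1 := idealC_mono hq (le_sup_right (a := Nideal q hq)) (ZqStar_sub_mem hq k)
  have h2 := idealC_mono hq (le_sup_left (b := Pideal q hq)) (Zq_cutL_sub_mem hq 0 k good_nil (Or.inl rfl) one_mem_Cm
    (by simp [cmono]))
  rw [ZqSh, EI, wSh_eq (Cm_le_Wmod (EAux_mem_Cm _ _))]
  convert sub_mem h1 h2 using 1
  ring

theorem mk_eq_of_sub_mem {I : Ideal (Zalg q hq)} {x y : Zalg q hq}
    (h : (x : ℂ) - y ∈ idealC hq I) : Ideal.Quotient.mk I x = Ideal.Quotient.mk I y := by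
  obtain ⟨h1, h2⟩ := h
  exact Ideal.Quotient.eq.mpr h2

end Comparison

/-- Both descriptions reduce to the same block sum: modulo `𝒫_q` on the harmonic side and modulo `𝒩_q`
on the shuffle side. -/
theorem zetaS_eq_sh {q : ℂ} (hq : ‖q‖ < 1) (k : Index) :
    ∃ h : wSh (EI k) ∈ HZero, zetaS q hq k =
      Ideal.Quotient.mk (Nideal q hq ⊔ Pideal q hq) ⟨ZqSh q (EI k), ZqSh_mem q hq h⟩ :=
  ⟨wSh_EI_mem k, mk_eq_of_sub_mem hq (ZqStar_sub_ZqSh_mem hq k)⟩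

/-! ### Nested sums over lists of numbers and the harmonic product -/

/-- The nested sum `∑ v_{i_1}^{k_1} ⋯ v_{i_r}^{k_r}` over increasing positions `i_1 < ⋯ < i_r` in a
list of numbers. Both lists are written from right to left. -/
def nsum : List ℂ → List ℕ → ℂ
  | _, [] => 1
  | [], _ :: _ => 0
  | x :: X, k :: ks => nsum X (k :: ks) + x ^ k * nsum X ks

theorem nsum_nil_right (X : List ℂ) : nsum X [] = 1 := by cases X <;> rw [nsum]

/-- In a nested sum over a concatenation, the first `i` exponents belong to `X` and the others to `Y`. -/
theorem nsum_append (X Y : List ℂ) (ks : List ℕ) : nsum (X ++ Y) ks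
    = ∑ i ∈ Finset.range (ks.length + 1), nsum X (ks.take i) * nsum Y (ks.drop i) := by
  induction X generalizing ks with
  | nil =>
    rw [Finset.sum_range_succ', Finset.sum_eq_zero]
    · simp [nsum_nil_right]
    · intro i hi
      rcases ks with _ | ⟨k, ks⟩
      · simp at hi
      · rw [List.take_succ_cons, nsum, zero_mul]
  | cons x X ih =>
    rcases ks with _ | ⟨k, ks⟩
    · simp [nsum_nil_right]
    · rw [List.cons_append, nsum, ih, ih, List.length_cons, Finset.sum_range_succ',
        Finset.sum_range_succ' _ (ks.length + 1), Finset.mul_sum]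
      simp only [List.take_succ_cons, List.drop_succ_cons, List.take_zero, List.drop_zero,
        nsum_nil_right, nsum, add_mul, Finset.sum_add_distrib, mul_assoc]
      ring

theorem nsum_append_single (X : List ℂ) (x : ℂ) (ks : List ℕ) (k : ℕ) :
    nsum (X ++ [x]) (ks ++ [k]) = nsum X (ks ++ [k]) + x ^ k * nsum X ks := by
  have h1 : ∀ a b l, nsum [x] (a :: b :: l) = 0 := by
    intro a b l
    simp [nsum]
  rw [nsum_append, List.length_append, List.length_singleton, Finset.sum_range_succ,
    Finset.sum_range_succ, Finset.sum_eq_zero, zero_add]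
  · rw [List.take_left, List.drop_left, show ks.length + 1 = (ks ++ [k]).length by simp,
      List.take_length, List.drop_length]
    simp [nsum]
    ring
  · intro i hi
    rw [Finset.mem_range] at hi
    rw [List.drop_append_of_le_length hi.le]
    obtain ⟨a, b, l, h⟩ : ∃ a b l, List.drop i ks ++ [k] = a :: b :: l := by
      rw [List.drop_eq_getElem_cons hi]
      rcases List.drop (i + 1) ks with _ | ⟨b, l⟩
      · exact ⟨_, _, _, rfl⟩
      · exact ⟨_, _, _, rfl⟩
    rw [h, h1, mul_zero]

theorem nsum_reverse (X : List ℂ) (ks : List ℕ) : nsum X.reverse ks.reverse = nsum X ks := by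
  induction X generalizing ks with
  | nil =>
    rcases ks with _ | ⟨k, ks⟩
    · simp
    · rw [List.reverse_nil, nsum]
      rcases h : (k :: ks).reverse with _ | ⟨a, l⟩
      · simp at h
      · rw [nsum]
  | cons x X ih =>
    rcases ks with _ | ⟨k, ks⟩
    · rw [List.reverse_nil, nsum_nil_right, nsum_nil_right]
    · rw [List.reverse_cons, List.reverse_cons, nsum_append_single, ← List.reverse_cons, ih, ih, nsum]

theorem nsum_map_neg (X : List ℂ) (ks : List ℕ) :
    nsum (X.map Neg.neg) ks = (-1) ^ ks.sum * nsum X ks := by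
  induction X generalizing ks with
  | nil => rcases ks with _ | ⟨k, ks⟩ <;> simp [nsum]
  | cons x X ih =>
    rcases ks with _ | ⟨k, ks⟩
    · simp [nsum]
    · rw [List.map_cons, nsum, nsum, ih, ih, List.sum_cons, pow_add, neg_pow]
      ring

theorem blocks_append (w : List Gen) (k : ℕ) :
    blocks (w ++ Gen.b :: List.replicate k Gen.a) = ((blocks w).1, (blocks w).2 ++ [k]) := by
  induction w with
  | nil =>
    have := blocks_cword [k]
    simpa [cword, blocks] using this
  | cons c w ih => rcases c <;> simp [blocks, ih]

theorem cext_mono {R : Type} [CommRing R] {M : Type} [AddCommGroup M] [Module R M]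
    (f : List ℕ → M) (w : List Gen) :
    cext f (mono R w) = if (blocks w).1 = 0 then f (blocks w).2 else 0 := by
  rw [← wordBasis_apply, cext, Module.Basis.constr_basis]

theorem mono_mul_cl {R : Type} [CommRing R] (w : List Gen) (k : ℕ) :
    mono R w * cl R k = mono R (w ++ Gen.b :: List.replicate k Gen.a) := by
  rw [mono_append, mono_cons]
  simp [mono, cl, vb, va]

/-- Evaluation of the words `z_k` as nested sums over a list of numbers. -/
noncomputable def nev (X : List ℂ) : NC ℚ →ₗ[ℚ] ℂ :=
  cext fun ks => nsum X (ks.reverse.map (· + 1))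

theorem nev_nil_mul_cl (w : NC ℚ) (k : ℕ) : nev [] (w * cl ℚ k) = 0 := by
  induction w using nc_induction with
  | hm w => simp [mono_mul_cl, nev, cext_mono, blocks_append, nsum]
  | ha x y hx hy => rw [add_mul, map_add, hx, hy, add_zero]
  | hs c x hx => rw [smul_mul_assoc, map_smul, hx, smul_zero]

theorem nev_cons_mul_cl (x : ℂ) (X : List ℂ) (w : NC ℚ) (k : ℕ) :
    nev (x :: X) (w * cl ℚ k) = nev X (w * cl ℚ k) + x ^ (k + 1) * nev X w := by
  induction w using nc_induction with
  | hm w =>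
    simp only [mono_mul_cl, nev, cext_mono, blocks_append]
    split_ifs
    · simp [nsum]
    · simp
  | ha x y hx hy => simp only [add_mul, map_add, hx, hy]; ring
  | hs c x hx => simp only [smul_mul_assoc, map_smul, hx, smul_add, mul_smul_comm]

theorem nev_cmono (X : List ℂ) (ks : List ℕ) :
    nev X (cmono ℚ ks) = nsum X (ks.reverse.map (· + 1)) := by
  rw [nev, cext_cmono]

theorem nev_harmRev (X : List ℂ) (u v : List ℕ) :
    nev X (harmRev (fun i j => i + j + 1) u v)
      = nsum X (u.map (· + 1)) * nsum X (v.map (· + 1)) := by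
  induction X generalizing u v with
  | nil =>
    rcases u with _ | ⟨k, u⟩
    · rw [harmRev, nev_cmono, List.reverse_reverse]; simp [nsum]
    rcases v with _ | ⟨l, v⟩
    · rw [harmRev, nev_cmono, List.reverse_reverse]; simp [nsum]
    · rw [harmRev, map_add, map_add, nev_nil_mul_cl, nev_nil_mul_cl, nev_nil_mul_cl]
      simp [nsum]
  | cons x X ih =>
    rcases u with _ | ⟨k, u⟩
    · rw [harmRev, nev_cmono, List.reverse_reverse]; simp [nsum]
    rcases v with _ | ⟨l, v⟩
    · rw [harmRev, nev_cmono, List.reverse_reverse]; simp [nsum]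
    · have h := ih (k :: u) (l :: v)
      rw [harmRev] at h ⊢
      simp only [map_add] at h
      rw [map_add, map_add, nev_cons_mul_cl, nev_cons_mul_cl, nev_cons_mul_cl, ih, ih, ih]
      simp only [List.map_cons, nsum] at h ⊢
      linear_combination h

theorem nev_starProd (X : List ℂ) (k l : Index) :
    nev X (starProd (z k) (z l)) = nev X (z k) * nev X (z l) := by
  rw [z_eq_cmono, z_eq_cmono, starProd, harm_cmono, nev_harmRev, nev_cmono, nev_cmono]

theorem nev_z (X : List ℂ) (k : Index) :
    nev X (z k) = nsum X (k.map fun i : ℕ+ => (i : ℕ)).reverse := by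
  rw [z_eq_cmono, nev_cmono, ← List.map_reverse, ← List.map_reverse, List.map_map]
  congr 1
  refine List.map_congr_left fun i _ => ?_
  have := i.pos
  simp only [Function.comp_apply]
  omega

/-! ### The harmonic relation -/

/-- The list `x_{M-1}, …, x_1, x_0`, where `x_0 = 0`. -/
noncomputable def xlist (q : ℂ) : ℕ → List ℂ
  | 0 => []
  | M + 1 => xval q M :: xlist q M

theorem nest_eq_nsum (q : ℂ) (M : ℕ) (ks : List ℕ) (hks : ∀ k ∈ ks, 1 ≤ k) :
    nest q M ks = nsum (xlist q M) ks := by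
  induction M generalizing ks with
  | zero => rcases ks with _ | ⟨k, ks⟩ <;> simp [nest, nsum, xlist]
  | succ M ih =>
    rcases ks with _ | ⟨k, ks⟩
    · simp [nest, nsum]
    · have hk : 1 ≤ k := hks k (by simp)
      rw [xlist, nsum, ← ih _ hks, ← ih _ fun j hj => hks j (by simp [hj]), nest,
        sum_Ico_succ q M k (by omega), nest]

/-- `x_1, …, x_{M-1}, -x_{M-1}, …, -x_1`, written from right to left; both ends carry in addition the
term `x_0 = 0`, which contributes nothing to nested sums with positive exponents. -/
noncomputable def symList (q : ℂ) (M : ℕ) : List ℂ :=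
  ((xlist q M).map Neg.neg).reverse ++ xlist q M

/-- The truncated symmetric values are nested sums over `x_1, …, x_{M-1}, -x_{M-1}, …, -x_1`. -/
theorem ZqM_wStar (q : ℂ) (M : ℕ) (ks : List ℕ) (hks : ∀ k ∈ ks, 1 ≤ k) :
    ZqM q M (wStar (cmono CC ks)) = nsum (symList q M) ks.reverse := by
  have hsum : ∀ (s : Finset ℕ) (f : ℕ → HH), ZqM q M (∑ i ∈ s, f i) = ∑ i ∈ s, ZqM q M (f i) := by
    intro s f
    induction s using Finset.induction_on with
    | empty => simp [ZqM_zero]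
    | insert i s hi ih => rw [Finset.sum_insert hi, Finset.sum_insert hi, ZqM_add, ih]
  rw [wStar, wS, cext_cmono, hsum, symList, nsum_append, List.length_reverse,
    ← Finset.sum_range_reflect]
  refine Finset.sum_congr rfl fun i hi => ?_
  rw [Finset.mem_range] at hi
  rw [psiStar_eq, map_smul, ZqM_smul, ZqM_hstar q M (cmono_mem_Wmod _) (cmono_mem_Wmod _), ZqM_cmono,
    ZqM_cmono, List.reverse_reverse, List.take_reverse, List.drop_reverse, nsum_reverse, nsum_map_neg,
    nest_eq_nsum, nest_eq_nsum]
  · rw [show ks.length + 1 - 1 - i = ks.length - i by omega]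
    simp only [map_pow, map_neg, map_one]
    ring
  · exact fun k hk => hks k (List.mem_of_mem_drop hk)
  · exact fun k hk => hks k (List.mem_of_mem_take (List.mem_reverse.mp hk))

theorem ZqM_wStar_gI (q : ℂ) (M : ℕ) (k : Index) :
    ZqM q M (wStar (gI k)) = nev (symList q M) (z k) := by
  rw [gI_eq, ZqM_wStar, nev_z]
  intro j hj
  obtain ⟨i, -, rfl⟩ := List.mem_map.mp hj
  exact i.pos

theorem tendsto_nev {q : ℂ} (hq : ‖q‖ < 1) (k : Index) :
    Tendsto (fun M => nev (symList q M) (z k)) atTop (𝓝 (ZqStar q (gI k))) :=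
  (tendsto_ZqM hq (HZero_le_Hhat (wStar_gI_mem k))).congr fun M => ZqM_wStar_gI q M k

/-- Nested sums over a fixed list are multiplicative for the harmonic product; this passes to the limit
`M → ∞`. -/
theorem ZqStar_mul {q : ℂ} (hq : ‖q‖ < 1) (k l : Index) :
    ZqStar q (gI k) * ZqStar q (gI l) = (dStar k l).sum fun m c => c • ZqStar q (gI m) := by
  refine tendsto_nhds_unique ((tendsto_nev hq k).mul (tendsto_nev hq l)) ?_
  have h : ∀ M, nev (symList q M) (z k) * nev (symList q M) (z l)
      = (dStar k l).sum fun m c => c • nev (symList q M) (z m) := by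
    intro M
    rw [← nev_starProd, dStar_spec, Finsupp.sum, map_sum]
    exact Finset.sum_congr rfl fun m _ => map_nsmul _ _ _
  refine Tendsto.congr (fun M => (h M).symm) ?_
  exact tendsto_finsetSum _ fun m _ => (tendsto_nev hq m).const_smul _

theorem zetaS_mul {q : ℂ} (hq : ‖q‖ < 1) (k l : Index) :
    zetaS q hq k * zetaS q hq l = (dStar k l).sum fun m c => c • zetaS q hq m := by
  have h : (⟨ZqStar q (gI k), ZqStar_mem q hq k⟩ : Zalg q hq) * ⟨ZqStar q (gI l), ZqStar_mem q hq l⟩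
      = (dStar k l).sum fun m c => c • (⟨ZqStar q (gI m), ZqStar_mem q hq m⟩ : Zalg q hq) := by
    apply Subtype.ext
    rw [Finsupp.sum, AddSubmonoidClass.coe_finsetSum]
    exact ZqStar_mul hq k l
  simp only [zetaS]
  rw [← map_mul, h, Finsupp.sum, map_sum]
  exact Finset.sum_congr rfl fun m _ => map_nsmul _ _ _

/-! ### Deconcatenation and the classical shuffle product -/

section CutSum

variable {A M : Type} [AddCommMonoid M]

theorem cutSum_prefix (F : List A → List A → M) (p v : List A) :
    cutSum F p v = cutSum (fun P Q => F (p ++ P) Q) [] v := by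
  simp [cutSum_eq]

theorem cutSum_cons (F : List A → List A → M) (c : A) (v : List A) :
    cutSum F [] (c :: v) = F [] (c :: v) + cutSum (fun P Q => F (c :: P) Q) [] v := by
  rw [cutSum, cutSum_prefix]
  rfl

theorem cutSum_add (F G : List A → List A → M) (p v : List A) :
    cutSum (fun P Q => F P Q + G P Q) p v = cutSum F p v + cutSum G p v := by
  simp [cutSum_eq, Finset.sum_add_distrib]

theorem map_cutSum {N H : Type} [AddCommMonoid N] [FunLike H M N] [AddMonoidHomClass H M N]
    (f : H) (F : List A → List A → M) (p v : List A) :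
    f (cutSum F p v) = cutSum (fun P Q => f (F P Q)) p v := by
  simp [cutSum_eq]

theorem cutSum_congr {F G : List A → List A → M} {p v : List A}
    (h : ∀ P Q, P ++ Q = v → F (p ++ P) Q = G (p ++ P) Q) : cutSum F p v = cutSum G p v := by
  rw [cutSum_eq, cutSum_eq]
  exact Finset.sum_congr rfl fun i _ => h _ _ (List.take_append_drop i v)

theorem cutSum_nil_congr {F G : List A → List A → M} {v : List A}
    (h : ∀ P Q, P ++ Q = v → F P Q = G P Q) : cutSum F [] v = cutSum G [] v :=
  cutSum_congr h

end CutSum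

section Cut

variable {R : Type} [CommRing R] {M : Type} [AddCommGroup M] [Module R M]

/-- The linear extension of the sum of `F P Q` over all factorizations `w = P Q` of a word. -/
noncomputable def cutF (F : NC R →ₗ[R] NC R →ₗ[R] M) : NC R →ₗ[R] M :=
  (wordBasis R).constr R fun w => cutSum (fun P Q => F (mono R P) (mono R Q)) [] w

theorem cutF_mono (F : NC R →ₗ[R] NC R →ₗ[R] M) (w : List Gen) :
    cutF F (mono R w) = cutSum (fun P Q => F (mono R P) (mono R Q)) [] w := by
  rw [cutF, ← wordBasis_apply, Module.Basis.constr_basis]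

theorem cutF_ι_mul (F : NC R →ₗ[R] NC R →ₗ[R] M) (c : Gen) (w : NC R) :
    cutF F (FreeAlgebra.ι R c * w) = F 1 (FreeAlgebra.ι R c * w)
      + cutF (F.comp (LinearMap.mulLeft R (FreeAlgebra.ι R c))) w := by
  induction w using nc_induction with
  | hm w =>
    rw [← mono_cons, cutF_mono, cutF_mono, cutSum_cons, mono_nil]
    simp only [mono_cons, LinearMap.comp_apply, LinearMap.mulLeft_apply]
  | ha x y hx hy => simp only [mul_add, map_add, hx, hy]; abel
  | hs c x hx => simp only [mul_smul_comm, map_smul, hx, smul_add]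

/-- Deconcatenation is a homomorphism for the shuffle product. -/
theorem cutF_csh (F : NC R →ₗ[R] NC R →ₗ[R] M) (u v : List Gen) :
    cutF F (csh (mono R u) (mono R v)) = cutSum (fun P₁ Q₁ => cutSum (fun P₂ Q₂ =>
      F (csh (mono R P₁) (mono R P₂)) (csh (mono R Q₁) (mono R Q₂))) [] v) [] u := by
  induction u generalizing F v with
  | nil => simp only [cutSum, mono_nil, csh_one_left, cutF_mono]
  | cons c u ihu =>
    induction v generalizing F with
    | nil => simp only [cutSum.eq_1, mono_nil, csh_one_right, cutF_mono]
    | cons d v ihv =>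
      have h1 := ihu (F.comp (LinearMap.mulLeft R (FreeAlgebra.ι R c))) (d :: v)
      have h2 := ihv (F.comp (LinearMap.mulLeft R (FreeAlgebra.ι R d)))
      rw [mono_cons c, mono_cons d, csh_ι_mul, map_add, cutF_ι_mul, cutF_ι_mul, ← mono_cons c,
        ← mono_cons d, h1, h2]
      simp only [cutSum_cons, mono_nil, csh_one_left, csh_one_right, LinearMap.comp_apply,
        LinearMap.mulLeft_apply, mono_cons, csh_ι_mul, map_add, LinearMap.add_apply, cutSum_add]
      abel

/-- The antipode of the shuffle algebra: the reversal of words with the sign given by the length. -/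
noncomputable def antip : NC R →ₗ[R] NC R :=
  (wordBasis R).constr R fun w => (-1 : R) ^ w.length • mono R w.reverse

theorem antip_mono (w : List Gen) :
    antip (mono R w) = (-1 : R) ^ w.length • mono R w.reverse := by
  rw [antip, ← wordBasis_apply, Module.Basis.constr_basis]

theorem antip_one : antip (1 : NC R) = 1 := by
  rw [← mono_nil, antip_mono, List.reverse_nil, List.length_nil, pow_zero, one_smul]

theorem antip_ι_mul (c : Gen) (w : NC R) :
    antip (FreeAlgebra.ι R c * w) = -(antip w * FreeAlgebra.ι R c) := by
  induction w using nc_induction with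
  | hm w =>
    rw [← mono_cons, antip_mono, mono_reverse_cons, antip_mono, List.length_cons, pow_succ,
      mul_neg_one, neg_smul, smul_mul_assoc]
  | ha x y hx hy => rw [mul_add, map_add, map_add, hx, hy, add_mul, neg_add]
  | hs c x hx => rw [mul_smul_comm, map_smul, map_smul, hx, smul_mul_assoc, smul_neg]

theorem antip_csh (u v : List Gen) : antip (csh (mono R u) (mono R v))
    = csh (antip (mono R u)) (antip (mono R v)) := by
  induction u generalizing v with
  | nil => rw [mono_nil, csh_one_left, antip_one, csh_one_left]
  | cons c u ihu =>
    induction v with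
    | nil => rw [mono_nil, csh_one_right, antip_one, csh_one_right]
    | cons d v ihv =>
      rw [mono_cons c, mono_cons d, csh_ι_mul, map_add, antip_ι_mul, antip_ι_mul, ← mono_cons c,
        ← mono_cons d, ihu, ihv, mono_cons c, mono_cons d, antip_ι_mul, antip_ι_mul]
      simp only [map_neg, LinearMap.neg_apply, neg_neg, csh_mul_ι, neg_mul]

/-- The partial sums in the antipode relation telescope. -/
theorem cutSum_antipode (p : List Gen) (c : Gen) (v : List Gen) :
    cutSum (fun P Q => (-1 : R) ^ Q.length • csh (mono R P) (mono R Q.reverse)) (p ++ [c]) v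
      = (-1 : R) ^ v.length • (csh (mono R p) (mono R v.reverse) * FreeAlgebra.ι R c) := by
  induction v generalizing p c with
  | nil => simp [cutSum, mono_nil, csh_one_right, mono_append, mono_single]
  | cons d v ih =>
    rw [cutSum, ih, mono_reverse_cons, mono_append, mono_single, csh_mul_ι]
    simp only [List.length_cons, pow_succ, mul_neg_one, neg_smul, smul_add]
    abel

/-- The antipode relation of the shuffle algebra. -/
theorem cutSum_antipode_eq_zero {v : List Gen} (hv : v ≠ []) :
    cutSum (fun P Q => (-1 : R) ^ Q.length • csh (mono R P) (mono R Q.reverse)) [] v = 0 := by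
  obtain ⟨c, v, rfl⟩ := List.exists_cons_of_ne_nil hv
  have h := cutSum_antipode (R := R) [] c v
  rw [List.nil_append] at h
  rw [cutSum, List.nil_append, h, mono_nil, csh_one_left, csh_one_left, mono_reverse_cons,
    List.length_cons, pow_succ, mul_neg_one, neg_smul, neg_add_cancel]

/-- The antipode relation moves a word through a letter. -/
theorem cutSum_csh_vb_mul (v : List Gen) (q : NC R) :
    cutSum (fun P Q => (-1 : R) ^ Q.length • csh (mono R P) (vb R * csh q (mono R Q.reverse))) [] v
      = mono R v * (vb R * q) := by
  induction v with
  | nil => simp [cutSum, mono_nil, csh_one_left, csh_one_right]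
  | cons c v ih =>
    have h := congrArg (fun x => vb R * csh q x) (cutSum_antipode_eq_zero (R := R)
      (List.cons_ne_nil c v))
    simp only [map_zero, mul_zero] at h
    rw [cutSum_cons, mono_nil, csh_one_left, map_add, mul_add, map_cutSum, ← LinearMap.mulLeft_apply
      (R := R), ← LinearMap.mulLeft_apply (R := R), map_cutSum] at h
    rw [cutSum_cons, mono_nil, csh_one_left, mono_cons, mul_assoc, ← ih,
      ← LinearMap.mulLeft_apply (R := R) (FreeAlgebra.ι R c), map_cutSum]
    have e : ∀ P Q : List Gen, (-1 : R) ^ Q.length • csh (mono R (c :: P)) (vb R * csh q (mono R Q.reverse))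
        = LinearMap.mulLeft R (FreeAlgebra.ι R c) ((-1 : R) ^ Q.length •
            csh (mono R P) (vb R * csh q (mono R Q.reverse)))
          + LinearMap.mulLeft R (vb R) (csh q ((-1 : R) ^ Q.length •
            csh (mono R (c :: P)) (mono R Q.reverse))) := by
      intro P Q
      have e1 : csh (mono R (c :: P)) (csh q (mono R Q.reverse))
          = csh q (csh (mono R (c :: P)) (mono R Q.reverse)) := by
        rw [← csh_assoc, csh_comm _ q, csh_assoc]
      simp only [map_smul, LinearMap.mulLeft_apply, ← smul_add]
      rw [mono_cons, vb, csh_ι_mul, ← vb, ← mono_cons, e1]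
    simp only [e, cutSum_add]
    rw [← sub_eq_zero, ← h]
    simp only [LinearMap.mulLeft_apply, map_smul]
    abel

/-- The algebra homomorphism that kills `a` and maps `b` to `-b`. -/
noncomputable def chi : NC R →ₐ[R] NC R :=
  FreeAlgebra.lift R fun c => (match c with | Gen.a => (0 : R) | Gen.b => -1) • FreeAlgebra.ι R c

theorem chi_csh (u v : List Gen) :
    chi (csh (mono R u) (mono R v)) = csh (chi (mono R u)) (chi (mono R v)) := by
  induction u generalizing v with
  | nil => rw [mono_nil, csh_one_left, map_one, csh_one_left]
  | cons c u ihu =>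
    induction v with
    | nil => rw [mono_nil, csh_one_right, map_one, csh_one_right]
    | cons d v ihv =>
      rw [mono_cons c, mono_cons d, csh_ι_mul, map_add, map_mul chi, map_mul chi, ← mono_cons c,
        ← mono_cons d, ihu, ihv, mono_cons c, mono_cons d, map_mul chi, map_mul chi, chi,
        FreeAlgebra.lift_ι_apply, FreeAlgebra.lift_ι_apply, ← chi]
      simp only [smul_mul_assoc, mul_smul_comm, map_smul, LinearMap.smul_apply, csh_ι_mul, smul_add]
      congr 1
      rw [smul_comm]

theorem chi_mono_of_mem {w : List Gen} (h : Gen.a ∈ w) : chi (mono R w) = 0 := by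
  induction w with
  | nil => simp at h
  | cons c w ih =>
    rw [mono_cons, map_mul]
    rcases List.mem_cons.mp h with rfl | h
    · rw [chi, FreeAlgebra.lift_ι_apply]
      simp
    · rw [ih h, mul_zero]

theorem chi_mono_replicate (n : ℕ) :
    chi (mono R (List.replicate n Gen.b))
      = (-1 : R) ^ n • mono R (List.replicate n Gen.b).reverse := by
  rw [List.reverse_replicate]
  induction n with
  | zero => simp [mono_nil]
  | succ n ih =>
    rw [List.replicate_succ, mono_cons, map_mul, ih, chi, FreeAlgebra.lift_ι_apply]
    simp [pow_succ]

/-- The regularization with respect to the shuffle product: the homomorphism onto the span of the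
words that do not end with `b`. -/
noncomputable def reg : NC R →ₗ[R] NC R :=
  cutF (csh.compl₂ chi.toLinearMap)

theorem reg_mono (w : List Gen) :
    reg (mono R w) = cutSum (fun P Q => csh (mono R P) (chi (mono R Q))) [] w :=
  cutF_mono _ w

theorem reg_csh (u v : List Gen) :
    reg (csh (mono R u) (mono R v)) = csh (reg (mono R u)) (reg (mono R v)) := by
  rw [reg, cutF_csh, ← reg, reg_mono, reg_mono, ← LinearMap.flip_apply (f := csh), map_cutSum]
  refine cutSum_congr fun P₁ Q₁ _ => ?_
  rw [LinearMap.flip_apply, map_cutSum]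
  refine cutSum_congr fun P₂ Q₂ _ => ?_
  rw [LinearMap.compl₂_apply, AlgHom.toLinearMap_apply, chi_csh, csh_mul_mul_mul_comm]

theorem reg_one : reg (1 : NC R) = 1 := by
  rw [← mono_nil, reg_mono]
  simp [cutSum, mono_nil, csh_one_left]

theorem reg_mono_replicate (n : ℕ) :
    reg (mono R (List.replicate (n + 1) Gen.b)) = 0 := by
  rw [reg_mono, ← cutSum_antipode_eq_zero (R := R) (v := List.replicate (n + 1) Gen.b) (by simp)]
  refine cutSum_congr fun P Q h => ?_
  obtain ⟨m, rfl⟩ : ∃ m, Q = List.replicate m Gen.b :=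
    ⟨_, (List.append_eq_replicate_iff.mp h).2.2⟩
  rw [chi_mono_replicate, map_smul, List.length_replicate]

theorem cutSum_append_of_eq_zero {A M : Type} [AddCommMonoid M] (F : List A → List A → M)
    (p u v : List A) (h : ∀ P Q, Q ≠ [] → P ++ Q = u → F (p ++ P) (Q ++ v) = 0) :
    cutSum F p (u ++ v) = cutSum F (p ++ u) v := by
  induction u generalizing p with
  | nil => simp
  | cons c u ih =>
    have h0 := h [] (c :: u) (by simp) rfl
    rw [List.append_nil, List.cons_append] at h0
    rw [List.cons_append, cutSum, h0, zero_add, ih, List.append_assoc, List.singleton_append]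
    intro P Q hQ hPQ
    rw [List.append_assoc]
    exact h (c :: P) Q hQ (by rw [List.cons_append, hPQ])

/-- The regularization of a word that is not a power of `b`. -/
theorem reg_mono_append (w : List Gen) (s : ℕ) :
    reg (mono R (w ++ Gen.a :: List.replicate s Gen.b))
      = (-1 : R) ^ s • (csh (mono R w) (mono R (List.replicate s Gen.b)) * va R) := by
  have h := cutSum_antipode (R := R) w Gen.a (List.replicate s Gen.b)
  rw [List.length_replicate, List.reverse_replicate] at h
  rw [va, ← h, reg_mono, List.append_cons, cutSum_append_of_eq_zero, List.nil_append]
  · refine cutSum_congr fun P Q h => ?_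
    obtain ⟨m, rfl⟩ : ∃ m, Q = List.replicate m Gen.b :=
      ⟨_, (List.append_eq_replicate_iff.mp h).2.2⟩
    rw [chi_mono_replicate, map_smul, List.length_replicate]
  · intro P Q hQ h
    rw [chi_mono_of_mem, map_zero]
    obtain ⟨Q, c, rfl⟩ := (List.eq_nil_or_concat Q).resolve_left hQ
    rw [List.concat_eq_append, ← List.append_assoc] at h
    have := (List.append_inj' h rfl).2
    simp_all

end Cut

/-! ### The classical and the `q`-deformed shuffle products -/

/-- The embedding `z_k ↦ g_k` of words, given by `x ↦ a`, `y ↦ g_1`. -/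
noncomputable def toHH : NC ℚ →ₐ[ℚ] HH :=
  FreeAlgebra.lift ℚ fun c => match c with | Gen.a => va CC | Gen.b => g 1

theorem toHH_ι_a : toHH (FreeAlgebra.ι ℚ Gen.a) = va CC := by
  rw [toHH, FreeAlgebra.lift_ι_apply]

theorem toHH_ι_b : toHH (FreeAlgebra.ι ℚ Gen.b) = cl CC 1 := by
  rw [toHH, FreeAlgebra.lift_ι_apply, g_one]

theorem toHH_a : toHH (va ℚ) = va CC := toHH_ι_a

theorem toHH_b : toHH (vb ℚ) = cl CC 1 := toHH_ι_b

theorem toHH_cl (k : ℕ) : toHH (cl ℚ k) = cl CC (k + 1) := by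
  rw [cl, map_mul, map_pow, toHH_a, toHH_b]
  induction k with
  | zero => simp
  | succ k ih => rw [pow_succ, ← mul_assoc, ih, cl_mul_a]

theorem toHH_cmono (ks : List ℕ) : toHH (cmono ℚ ks) = cmono CC (ks.map (· + 1)) := by
  simp [cmono, map_list_prod, Function.comp_def, toHH_cl]

theorem mono_append_a (w : List Gen) : mono ℚ (w ++ [Gen.a]) = mono ℚ w * va ℚ := by
  rw [mono_append, mono_single, va]

theorem mono_append_b (w : List Gen) : mono ℚ (w ++ [Gen.b]) = mono ℚ w * vb ℚ := by
  rw [mono_append, mono_single, vb]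

theorem toHH_mono_append_a (w : List Gen) :
    toHH (mono ℚ (w ++ [Gen.a])) = toHH (mono ℚ w) * va CC := by
  rw [mono_append_a, map_mul, toHH_a]

theorem toHH_mono_append_b (w : List Gen) :
    toHH (mono ℚ (w ++ [Gen.b])) = toHH (mono ℚ w) * cl CC 1 := by
  rw [mono_append_b, map_mul, toHH_b]

/-- The words that do not start with `a`. -/
def startsB (w : List Gen) : Prop := ∀ c ∈ w.head?, c = Gen.b

theorem startsB_nil : startsB [] := by simp [startsB]

theorem startsB_cons (w : List Gen) : startsB (Gen.b :: w) := by simp [startsB]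

theorem startsB.cases {w : List Gen} (h : startsB w) : w = [] ∨ ∃ v, w = Gen.b :: v := by
  rcases w with _ | ⟨c, w⟩
  · exact Or.inl rfl
  · exact Or.inr ⟨w, by rw [h c (by simp)]⟩

theorem startsB.of_append {u v : List Gen} (h : startsB (u ++ v)) : startsB u := by
  rcases u with _ | ⟨c, u⟩
  · exact startsB_nil
  · simpa [startsB] using h

theorem startsB.of_append_a {u : List Gen} (h : startsB (u ++ [Gen.a])) :
    ∃ v, u = Gen.b :: v := by
  rcases u with _ | ⟨c, u⟩
  · simp [startsB] at h
  · exact ⟨u, by rw [h c (by simp)]⟩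

theorem toHH_mono_cons_mem (w : List Gen) : toHH (mono ℚ (Gen.b :: w)) ∈ Vm := by
  induction w using List.reverseRecOn with
  | nil => rw [mono_single, ← vb, toHH_b]; exact cl_succ_mem_Vm 0
  | append_singleton w c ih =>
    rw [← List.cons_append]
    cases c
    · rw [toHH_mono_append_a]; exact Vm_mul_a ih
    · rw [toHH_mono_append_b]; exact Cm_mul_Vm (Vm_le_Cm ih) (cl_succ_mem_Vm 0)

theorem toHH_mono_mem {w : List Gen} (h : startsB w) : toHH (mono ℚ w) ∈ Cm := by
  rcases h.cases with rfl | ⟨v, rfl⟩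
  · rw [mono_nil, map_one]; exact one_mem_Cm
  · exact Vm_le_Cm (toHH_mono_cons_mem v)

/-- The failure of `toHH` to respect the shuffle products. -/
noncomputable def shDefect (u v : List Gen) : HH :=
  hsh (toHH (mono ℚ u)) (toHH (mono ℚ v)) - toHH (csh (mono ℚ u) (mono ℚ v))

theorem shDefect_comm (u v : List Gen) : shDefect u v = shDefect v u := by
  rw [shDefect, hsh_comm, csh_comm, shDefect]

theorem hsh_mul_a (x y : HH) : hsh (x * va CC) (y * va CC)
    = (hsh (x * va CC) y + hsh x (y * va CC) + hb • hsh x y) * va CC :=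
  qsh_mul_a _ x y

theorem shDefect_a_a (u v : List Gen) : shDefect (u ++ [Gen.a]) (v ++ [Gen.a])
    = (shDefect (u ++ [Gen.a]) v + shDefect u (v ++ [Gen.a])
      + hb • hsh (toHH (mono ℚ u)) (toHH (mono ℚ v))) * va CC := by
  simp only [shDefect, toHH_mono_append_a, hsh_mul_a]
  simp only [mono_append, mono_single, csh_mul_ι, map_add, map_mul, toHH_ι_a]
  noncomm_ring

theorem shDefect_a_b (u v : List Gen) : shDefect (u ++ [Gen.a]) (v ++ [Gen.b])
    = shDefect (u ++ [Gen.a]) v * cl CC 1 + shDefect u (v ++ [Gen.b]) * va CC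
      + hb • (hsh (toHH (mono ℚ u)) (toHH (mono ℚ v)) * cl CC 1) := by
  have h : cl CC 1 = cl CC 0 * va CC := (cl_mul_a 0).symm
  simp only [shDefect, toHH_mono_append_a, toHH_mono_append_b]
  simp only [mono_append, mono_single, csh_mul_ι, map_add, map_mul, toHH_ι_a, toHH_ι_b]
  rw [h, ← mul_assoc, hsh_mul_a, hsh_mul_cl_zero_right, hsh_mul_cl_zero_right, ← mul_assoc]
  simp only [sub_mul, add_mul, mul_assoc, smul_mul_assoc]
  abel

theorem shDefect_b_b (u v : List Gen) : shDefect (u ++ [Gen.b]) (v ++ [Gen.b])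
    = shDefect (u ++ [Gen.b]) v * cl CC 1 + shDefect u (v ++ [Gen.b]) * cl CC 1
      + hsh (toHH (mono ℚ u)) (toHH (mono ℚ v)) * uA 0 * cl CC 1 := by
  simp only [shDefect, toHH_mono_append_b, hsh_cl_one]
  simp only [mono_append, mono_single, csh_mul_ι, map_add, map_mul, toHH_ι_b]
  noncomm_ring

/-- The embedding of words respects the shuffle products up to words containing `ħ b`. -/
theorem shDefect_mem {u v : List Gen} (hu : startsB u) (hv : startsB v) : shDefect u v ∈ JVm := by
  induction u using List.reverseRecOn generalizing v with
  | nil => simp [shDefect, mono_nil, hsh_one_left, csh_one_left]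
  | append_singleton u c ihu =>
    induction v using List.reverseRecOn with
    | nil => simp [shDefect, mono_nil, hsh_one_right, csh_one_right]
    | append_singleton v d ihv =>
      have hu' := hu.of_append
      have hv' := hv.of_append
      have hC := hsh_mem_Cm (toHH_mono_mem hu') (toHH_mono_mem hv')
      have h1 := ihv hv'
      have h2 := ihu hu' hv
      have hx : hb • (hsh (toHH (mono ℚ u)) (toHH (mono ℚ v)) * cl CC 1) ∈ JVm :=
        smul_mem_vspan (Cm_mul_Vm hC (cl_succ_mem_Vm 0))
      cases c <;> cases d
      · obtain ⟨u', rfl⟩ := hu.of_append_a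
        obtain ⟨v', rfl⟩ := hv.of_append_a
        rw [shDefect_a_a]
        exact JVm_mul_a (add_mem (add_mem h1 h2) (smul_mem_vspan
          (hsh_mem_Vm (toHH_mono_cons_mem _) (toHH_mono_cons_mem _))))
      · rw [shDefect_a_b]
        exact add_mem (add_mem (Jm_mul_cl (JVm_le_Jm h1) 0) (JVm_mul_a h2)) hx
      · rw [shDefect_comm] at h1 h2 ⊢
        rw [hsh_comm] at hx
        rw [shDefect_a_b]
        exact add_mem (add_mem (Jm_mul_cl (JVm_le_Jm h2) 0) (JVm_mul_a h1)) hx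
      · rw [shDefect_b_b]
        exact add_mem (add_mem (Jm_mul_cl (JVm_le_Jm h1) 0) (Jm_mul_cl (JVm_le_Jm h2) 0))
          (Jm_mul_cl (Cm_mul_Jm hC uA_zero_mem_Jm) 0)

theorem shDefect_a_a_mem (u v : List Gen) :
    shDefect (Gen.b :: (u ++ [Gen.a])) (Gen.b :: (v ++ [Gen.a])) ∈ nMod := by
  rw [← List.cons_append, ← List.cons_append, shDefect_a_a]
  exact JVm_mul_a_mem_nMod (add_mem (add_mem (shDefect_mem (startsB_cons _) (startsB_cons _))
    (shDefect_mem (startsB_cons _) (startsB_cons _)))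
    (smul_mem_vspan (hsh_mem_Vm (toHH_mono_cons_mem _) (toHH_mono_cons_mem _))))

/-- The shuffle product of two words that start with `b` is a combination of such words. -/
theorem exists_csh_eq_vb_mul (u v : List Gen) :
    ∃ p : NC ℚ, csh (mono ℚ (Gen.b :: u)) (mono ℚ (Gen.b :: v)) = vb ℚ * p :=
  ⟨csh (mono ℚ u) (mono ℚ (Gen.b :: v)) + csh (mono ℚ (Gen.b :: u)) (mono ℚ v), by
    rw [mul_add, mono_cons Gen.b u, mono_cons Gen.b v, csh_ι_mul, ← vb]⟩

theorem exists_csh_a_a_eq (u v : List Gen) : ∃ p : NC ℚ,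
    csh (mono ℚ (Gen.b :: (u ++ [Gen.a]))) (mono ℚ (Gen.b :: (v ++ [Gen.a]))) = vb ℚ * p * va ℚ := by
  obtain ⟨p, hp⟩ := exists_csh_eq_vb_mul u (v ++ [Gen.a])
  obtain ⟨p', hp'⟩ := exists_csh_eq_vb_mul (u ++ [Gen.a]) v
  refine ⟨p + p', ?_⟩
  rw [mul_add, ← hp, ← hp', add_mul]
  simp only [← List.cons_append]
  simp only [mono_append _ [Gen.a], mono_single, csh_mul_ι]
  rw [va]

/-- The regularization of a word that starts with `b`. -/
theorem exists_reg_eq (w : List Gen) :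
    ∃ p : NC ℚ, reg (mono ℚ (Gen.b :: w)) = vb ℚ * p * va ℚ := by
  obtain ⟨v, s, h⟩ : ∃ v s, (Gen.b :: w = v ++ Gen.a :: List.replicate s Gen.b) ∨
      Gen.b :: w = List.replicate (s + 1) Gen.b := by
    induction w using List.reverseRecOn with
    | nil => exact ⟨[], 0, Or.inr rfl⟩
    | append_singleton w c ih =>
      cases c
      · exact ⟨Gen.b :: w, 0, Or.inl rfl⟩
      · obtain ⟨v, s, h | h⟩ := ih
        · refine ⟨v, s + 1, Or.inl ?_⟩
          rw [← List.cons_append, h, List.replicate_succ']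
          simp
        · refine ⟨[], s + 1, Or.inr ?_⟩
          rw [← List.cons_append, h, List.replicate_succ' (n := s + 1)]
  rcases h with h | h
  · rw [h, reg_mono_append]
    have hv : ∃ v', v = Gen.b :: v' := by
      rcases v with _ | ⟨c, v⟩
      · simp at h
      · rw [List.cons_append, List.cons.injEq] at h
        exact ⟨v, by rw [← h.1]⟩
    obtain ⟨v', rfl⟩ := hv
    rcases s with _ | s
    · exact ⟨mono ℚ v', by simp [mono_nil, csh_one_right, mono_cons, vb]⟩
    · obtain ⟨p, hp⟩ := exists_csh_eq_vb_mul v' (List.replicate s Gen.b)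
      refine ⟨(-1 : ℚ) ^ (s + 1) • p, ?_⟩
      rw [List.replicate_succ, hp, mul_smul_comm, smul_mul_assoc]
  · rw [h, reg_mono_replicate]
    exact ⟨0, by simp⟩

/-! ### Regularized values in the quotient -/

section Classes

variable {q : ℂ} (hq : ‖q‖ < 1)

open Classical in
/-- The class of `Z_q(x)` in the quotient; it is set to `0` outside of `ℌ⁰`. -/
noncomputable def cls (x : HH) : Zquot q hq :=
  if h : x ∈ HZero then Ideal.Quotient.mk _ ⟨Zq q x, mem_Zalg_of_mem_HZero hq h⟩ else 0

theorem cls_eq {x : HH} (h : x ∈ HZero) :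
    cls hq x = Ideal.Quotient.mk _ ⟨Zq q x, mem_Zalg_of_mem_HZero hq h⟩ := dif_pos h

theorem cls_add {x y : HH} (hx : x ∈ HZero) (hy : y ∈ HZero) :
    cls hq (x + y) = cls hq x + cls hq y := by
  rw [cls_eq hq hx, cls_eq hq hy, cls_eq hq (add_mem hx hy), ← map_add]
  exact congrArg _ (Subtype.ext (Zq_add hq (HZero_le_Hhat hx) (HZero_le_Hhat hy)))

theorem ratCast_smul_eq (c : ℚ) (x : HH) : c • x = (Polynomial.C c : CC) • x :=
  (algebraMap_smul CC c x).symm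

theorem cls_smul (c : ℚ) {x : HH} (hx : x ∈ HZero) : cls hq (c • x) = c • cls hq x := by
  rw [ratCast_smul_eq, cls_eq hq hx, cls_eq hq (Submodule.smul_mem _ _ hx)]
  have h : (⟨Zq q ((Polynomial.C c : CC) • x), mem_Zalg_of_mem_HZero hq (Submodule.smul_mem _ _ hx)⟩
      : Zalg q hq) = c • ⟨Zq q x, mem_Zalg_of_mem_HZero hq hx⟩ := by
    apply Subtype.ext
    refine (Zq_smul hq _ (HZero_le_Hhat hx)).trans ?_
    simp [Algebra.smul_def]
  rw [h]
  rfl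

theorem cls_hsh {x y : HH} (hx : x ∈ HZero) (hy : y ∈ HZero) (hxy : hsh x y ∈ HZero) :
    cls hq (hsh x y) = cls hq x * cls hq y := by
  rw [cls_eq hq hx, cls_eq hq hy, cls_eq hq hxy, ← map_mul]
  exact congrArg _ (Subtype.ext (Zq_hsh' hq (HZero_le_Hhat hx) (HZero_le_Hhat hy)))

theorem cls_eq_zero {x : HH} (hx : x ∈ nMod) : cls hq x = 0 := by
  rw [cls_eq hq (nMod_le_HZero hx)]
  exact Ideal.Quotient.eq_zero_iff_mem.mpr (Ideal.mem_sup_left ⟨x, hx, rfl⟩)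

theorem cls_congr {x y : HH} (hy : y ∈ HZero) (h : x - y ∈ nMod) : cls hq x = cls hq y := by
  have h1 := cls_add hq (nMod_le_HZero h) hy
  rwa [sub_add_cancel, cls_eq_zero hq h, zero_add] at h1

/-- The value of a word in `x, y` as the class of the value of its image in `ℌ`. -/
noncomputable def wordCls : NC ℚ →ₗ[ℚ] Zquot q hq :=
  (wordBasis ℚ).constr ℚ fun w => cls hq (toHH (mono ℚ w))

theorem wordCls_mono (w : List Gen) : wordCls hq (mono ℚ w) = cls hq (toHH (mono ℚ w)) := by
  rw [wordCls, ← wordBasis_apply, Module.Basis.constr_basis, wordBasis_apply]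

theorem mono_b_a (w : List Gen) :
    mono ℚ (Gen.b :: (w ++ [Gen.a])) = vb ℚ * mono ℚ w * va ℚ := by
  rw [mono_cons, mono_append_a, mul_assoc, vb]

/-- Words that start with `y` and end with `x` are mapped to `ℌ⁰`. -/
theorem toHH_vb_mul_va_mem (p : NC ℚ) : toHH (vb ℚ * p * va ℚ) ∈ HZero := by
  induction p using nc_induction with
  | hm w =>
    rw [map_mul, vb, ← mono_cons, toHH_a]
    exact Vm_mul_a_mem_HZero (toHH_mono_cons_mem w)
  | ha x y hx hy => rw [mul_add, add_mul, map_add]; exact add_mem hx hy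
  | hs c x hx =>
    rw [mul_smul_comm, smul_mul_assoc, map_smul, ratCast_smul_eq]
    exact Submodule.smul_mem _ _ hx

theorem wordCls_vb_mul_va (p : NC ℚ) :
    wordCls hq (vb ℚ * p * va ℚ) = cls hq (toHH (vb ℚ * p * va ℚ)) := by
  induction p using nc_induction with
  | hm w => rw [← mono_b_a, wordCls_mono]
  | ha x y hx hy =>
    rw [mul_add, add_mul, map_add, map_add, hx, hy,
      cls_add hq (toHH_vb_mul_va_mem x) (toHH_vb_mul_va_mem y)]
  | hs c x hx =>
    rw [mul_smul_comm, smul_mul_assoc, map_smul, map_smul, hx, cls_smul hq c (toHH_vb_mul_va_mem x)]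

theorem wordCls_one : wordCls hq 1 = 1 := by
  rw [← mono_nil, wordCls_mono, mono_nil, map_one, cls_eq hq one_mem_HZero, ← map_one
    (Ideal.Quotient.mk (Nideal q hq ⊔ Pideal q hq))]
  exact congrArg _ (Subtype.ext (Zq_one hq))

/-- By `shDefect_a_a_mem`, both sides have the value of the `q`-deformed shuffle product. -/
theorem wordCls_csh_mono (u v : List Gen) :
    wordCls hq (csh (vb ℚ * mono ℚ u * va ℚ) (vb ℚ * mono ℚ v * va ℚ))
      = wordCls hq (vb ℚ * mono ℚ u * va ℚ) * wordCls hq (vb ℚ * mono ℚ v * va ℚ) := by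
  obtain ⟨p, hp⟩ := exists_csh_a_a_eq u v
  have h1 := toHH_vb_mul_va_mem (mono ℚ u)
  have h2 := toHH_vb_mul_va_mem (mono ℚ v)
  have h3 := shDefect_a_a_mem u v
  rw [shDefect, hp, mono_b_a, mono_b_a] at h3
  rw [mono_b_a, mono_b_a] at hp
  have h4 := toHH_vb_mul_va_mem p
  have h5 := add_mem (nMod_le_HZero h3) h4
  rw [sub_add_cancel] at h5
  rw [hp, wordCls_vb_mul_va, wordCls_vb_mul_va, wordCls_vb_mul_va, ← cls_hsh hq h1 h2 h5]
  exact (cls_congr hq h4 h3).symm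

theorem wordCls_csh (x y : NC ℚ) :
    wordCls hq (csh (vb ℚ * x * va ℚ) (vb ℚ * y * va ℚ))
      = wordCls hq (vb ℚ * x * va ℚ) * wordCls hq (vb ℚ * y * va ℚ) := by
  induction x using nc_induction with
  | hm u =>
    induction y using nc_induction with
    | hm v => exact wordCls_csh_mono hq u v
    | ha x y hx hy => simp only [mul_add, add_mul, map_add, hx, hy]
    | hs c x hx => simp only [mul_smul_comm, smul_mul_assoc, map_smul, hx]
  | ha x y hx hy => simp only [mul_add, add_mul, map_add, LinearMap.add_apply, hx, hy]
  | hs c x hx => simp only [mul_smul_comm, smul_mul_assoc, map_smul, LinearMap.smul_apply, hx]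

/-- The shuffle regularized value of a combination of words. -/
noncomputable def regCls : NC ℚ →ₗ[ℚ] Zquot q hq := (wordCls hq).comp reg

theorem regCls_one : regCls hq 1 = 1 := by
  rw [regCls, LinearMap.comp_apply, reg_one, wordCls_one]

/-- The regularized values are multiplicative for the shuffle product. -/
theorem regCls_csh {u v : List Gen} (hu : startsB u) (hv : startsB v) :
    regCls hq (csh (mono ℚ u) (mono ℚ v)) = regCls hq (mono ℚ u) * regCls hq (mono ℚ v) := by
  rcases hu.cases with rfl | ⟨u, rfl⟩
  · rw [mono_nil, csh_one_left, regCls_one, one_mul]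
  rcases hv.cases with rfl | ⟨v, rfl⟩
  · rw [mono_nil, csh_one_right, regCls_one, mul_one]
  obtain ⟨x, hx⟩ := exists_reg_eq u
  obtain ⟨y, hy⟩ := exists_reg_eq v
  rw [regCls, LinearMap.comp_apply, reg_csh, LinearMap.comp_apply, LinearMap.comp_apply, hx, hy,
    wordCls_csh]

/-! ### Comparison with the harmonic regularization -/

/-- The word of `z_k` for a list of positive numbers. -/
def zword (ks : List ℕ) : List Gen := cword (ks.map (· - 1))

theorem cword_append (u v : List ℕ) : cword (u ++ v) = cword u ++ cword v := by simp [cword]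

theorem cword_replicate_zero (s : ℕ) : cword (List.replicate s 0) = List.replicate s Gen.b := by
  induction s with
  | zero => rfl
  | succ s ih => rw [List.replicate_succ, List.replicate_succ, ← ih]; rfl

theorem startsB_cword (ks : List ℕ) : startsB (cword ks) := by
  rcases ks with _ | ⟨k, ks⟩
  · exact startsB_nil
  · exact startsB_cons _

theorem xreg_nil (s : ℕ) : xreg [] s = if s = 0 then 1 else 0 := by
  have h1 : cmono CC [] = (1 : HH) := by simp [cmono]
  induction s using Nat.strong_induction_on with
  | _ s ih =>
    rcases s with _ | s
    · rw [xreg, h1]; simp [ones_zero]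
    · rw [xreg, Fin.sum_univ_succ, Finset.sum_eq_zero, add_zero, ih _ (by simp)]
      · simp [h1, hstar_nil_left _ (Gmod_le_Wmod (ones_mem_Gmod (s + 1)))]
      · intro i _
        rw [ih _ (by simp)]
        simp

theorem toHH_replicate (s : ℕ) : toHH (mono ℚ (List.replicate s Gen.b)) = ones s := by
  rw [← cword_replicate_zero, mono_cword, toHH_cmono, ones]
  simp

/-- Both `y_s` and `g_1^s` end with `g_1`, so that their difference ends with some `g_k` as well. -/
theorem yd_sub_ones_mem_JVm (s : ℕ) : yd s - ones s ∈ JVm := by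
  rcases s with _ | s
  · rw [yd_zero, ones_zero, sub_self]; exact Submodule.zero_mem _
  · have h2 : ones (s + 1) ∈ Vm := by
      rw [← toHH_replicate, List.replicate_succ]; exact toHH_mono_cons_mem _
    exact vspan_mono (fun u h => h) (fun u h => h.2)
      (vspan_inf_uspan (yd_sub_ones_mem (s + 1)) (sub_mem (yd_succ_mem_Vm s) h2))

theorem regVal_nil (hq : ‖q‖ < 1) (s : ℕ) : regVal q [] s = if s = 0 then 1 else 0 := by
  rw [regVal, xreg_nil]
  split_ifs
  · exact Zq_one hq
  · exact Zq_zero hq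

include hq in
theorem blk_nil_right (α : List ℕ) (s : ℕ) : blk q α [] s = regVal q α s := by
  rw [blk]
  rcases s with _ | s
  · simp [regVal_nil hq]
  · rw [Finset.Nat.sum_antidiagonal_succ']
    simp [regVal_nil hq]

/-- Only the constant term of `kap 1` contributes to the value of the cut. -/
theorem cutOne_one_sub_mem {F : HH} (hF : F ∈ Vm) (s : ℕ) :
    cutOne 1 (F * va CC) s - hsh (yd s) F * va CC ∈ nMod := by
  have h0 : ∀ n, PowerSeries.coeff n (shp (ys 1) (PowerSeries.C F)) = hsh (yd n) F := by
    intro n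
    rw [coeff_shp]
    rcases n with _ | n
    · simp [ys]
    · rw [Finset.Nat.sum_antidiagonal_succ', Finset.sum_eq_zero]
      · simp [ys]
      · intro p _
        rw [PowerSeries.coeff_C, if_neg (by omega), map_zero]
  have hV : ∀ n, hsh (yd n) F ∈ Vm := by
    intro n
    rcases n with _ | n
    · rwa [yd_zero, hsh_one_left]
    · exact hsh_mem_Vm (yd_succ_mem_Vm n) hF
  rw [cutOne_eq, map_one, one_mul, shp_ys_ser, PowerSeries.coeff_mul_C, PowerSeries.coeff_mul]
  simp only [h0, kap, PowerSeries.coeff_mk, one_pow, one_mul]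
  rcases s with _ | s
  · simp [fc_zero, zero_mem]
  · rw [Finset.Nat.sum_antidiagonal_succ', pow_zero, fc_zero, one_smul, mul_one, add_mul,
      add_sub_cancel_left, Finset.sum_mul]
    refine Submodule.sum_mem _ fun p _ => ?_
    rw [mul_smul_comm, smul_mul_assoc]
    exact Submodule.smul_mem _ _ (mul_uA_pow_succ_mul_a_mem (hV _) _)

/-- The harmonic and the shuffle regularizations agree in the quotient. -/
theorem regCls_zword {α : List ℕ} (hα : Good α) (s : ℕ) :
    regCls hq (mono ℚ (zword (α ++ List.replicate s 1)))
      = Ideal.Quotient.mk _ ⟨regVal q α s, regVal_mem hq hα s⟩ := by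
  rcases List.eq_nil_or_concat α with rfl | ⟨β, k, rfl⟩
  · have h : zword ([] ++ List.replicate s 1) = List.replicate s Gen.b := by
      rw [← cword_replicate_zero]; simp [zword]
    rw [h]
    rcases s with _ | s
    · rw [List.replicate_zero, mono_nil, regCls_one, ← map_one (Ideal.Quotient.mk _)]
      exact congrArg _ (Subtype.ext (by simp [regVal_nil hq]))
    · rw [regCls, LinearMap.comp_apply, reg_mono_replicate, map_zero, ← map_zero
        (Ideal.Quotient.mk _)]
      exact congrArg _ (Subtype.ext (by simp [regVal_nil hq]))
  simp only [List.concat_eq_append] at hα ⊢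
  obtain ⟨k, rfl⟩ : ∃ j, k = j + 2 := ⟨k - 2, by
    have := (lastGe_append _ _ _).mp hα.2
    omega⟩
  have hβ : ∀ j ∈ β, 1 ≤ j := fun j hj => hα.1 j (by simp [hj])
  set W := cword (β.map (· - 1) ++ [k]) with hW
  have hw : zword (β ++ [k + 2] ++ List.replicate s 1) = W ++ Gen.a :: List.replicate s Gen.b := by
    rw [hW, zword, List.map_append, List.map_append, cword_append, cword_append, cword_append,
      List.map_replicate, Nat.sub_self, cword_replicate_zero]
    simp [cword, List.replicate_succ']
  have hF : toHH (mono ℚ W) = cmono CC (β ++ [k + 1]) := by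
    rw [mono_cword, toHH_cmono, List.map_append, List.map_map]
    congr 2
    · refine (List.map_congr_left fun j hj => ?_).trans (List.map_id _)
      have := hβ j hj
      simp; omega
  have hWb : ∃ w, W = Gen.b :: w := by
    rw [hW]
    cases β <;> exact ⟨_, rfl⟩
  have hFV : toHH (mono ℚ W) ∈ Vm := by
    obtain ⟨w, hw⟩ := hWb
    rw [hw]; exact toHH_mono_cons_mem w
  have hFa : toHH (mono ℚ W) * va CC = cmono CC (β ++ [k + 2]) := by
    rw [hF, cmono_append, cmono_single, mul_assoc, cl_mul_a, cmono_append, cmono_single]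
  have hBd : Bd (toHH (mono ℚ W) * va CC) :=
    Or.inr ⟨_, hFV, 0, Submodule.zero_mem _, by simp⟩
  -- the value of the cut is the harmonic regularization
  have h1 := Zq_cutOne_blk hq hα good_nil hBd (Or.inl rfl) 0 (by rw [hFa, sub_self]; exact Submodule.zero_mem _)
    (by simp [cmono]) s
  rw [pow_zero, one_mul, blk_nil_right hq, cutOne_comm] at h1
  have h2 : (-1 : CC) ^ s • cutOne 1 (toHH (mono ℚ W) * va CC) s ∈ HZero :=
    Submodule.smul_mem _ _ (cutOne_one_mem hFV s)
  -- the value of the shuffle regularization is the same cut modulo `𝔫`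
  have h3 : (-1 : CC) ^ s • cutOne 1 (toHH (mono ℚ W) * va CC) s
      - toHH (reg (mono ℚ (W ++ Gen.a :: List.replicate s Gen.b))) ∈ nMod := by
    have e1 := cutOne_one_sub_mem hFV s
    have e2 := JVm_mul_a_mem_nMod (add_mem (hsh_mem_JVm (yd_sub_ones_mem_JVm s) hFV)
      (shDefect_mem (u := List.replicate s Gen.b) (v := W)
        (by rw [← cword_replicate_zero]; exact startsB_cword _) (startsB_cword _)))
    convert Submodule.smul_mem nMod ((-1 : CC) ^ s) (add_mem e1 e2) using 1
    rw [reg_mono_append, map_smul, map_mul, toHH_a, shDefect, toHH_replicate, map_sub,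
      LinearMap.sub_apply, csh_comm, ratCast_smul_eq, map_pow, map_neg, map_one, ← smul_sub]
    congr 1
    noncomm_ring
  have h4 : regCls hq (mono ℚ (W ++ Gen.a :: List.replicate s Gen.b))
      = cls hq (toHH (reg (mono ℚ (W ++ Gen.a :: List.replicate s Gen.b))))
      ∧ toHH (reg (mono ℚ (W ++ Gen.a :: List.replicate s Gen.b))) ∈ HZero := by
    obtain ⟨w, hw⟩ := hWb
    obtain ⟨p, hp⟩ := exists_reg_eq (w ++ Gen.a :: List.replicate s Gen.b)
    rw [regCls, LinearMap.comp_apply, hw, List.cons_append, hp]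
    exact ⟨wordCls_vb_mul_va hq p, toHH_vb_mul_va_mem p⟩
  rw [hw, h4.1, ← cls_congr hq h4.2 h3, cls_eq hq h2]
  exact mk_eq_of_sub_mem hq (idealC_mono hq le_sup_left h1)

end Classes

/-! ### Symmetric values as cut sums of regularized values -/

section CutSumLemmas

variable {A M : Type} [AddCommMonoid M]

theorem cutSum_map {B : Type} (f : B → A) (F : List A → List A → M) (v : List B) :
    cutSum F [] (v.map f) = cutSum (fun P Q => F (P.map f) (Q.map f)) [] v := by
  simp [cutSum_eq, List.map_take, List.map_drop]

theorem cutSum_reverse (F : List A → List A → M) (v : List A) :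
    cutSum F [] v.reverse = cutSum (fun P Q => F Q.reverse P.reverse) [] v := by
  rw [cutSum_eq, cutSum_eq, List.length_reverse, ← Finset.sum_range_reflect]
  refine Finset.sum_congr rfl fun i hi => ?_
  rw [Finset.mem_range] at hi
  simp only [List.nil_append, List.take_reverse, List.drop_reverse]
  congr 3 <;> omega

theorem cutSum_comm {B : Type} (F : List A → List A → List B → List B → M) (u : List A)
    (v : List B) :
    cutSum (fun P₁ Q₁ => cutSum (fun P₂ Q₂ => F P₁ Q₁ P₂ Q₂) [] v) [] u
      = cutSum (fun P₂ Q₂ => cutSum (fun P₁ Q₁ => F P₁ Q₁ P₂ Q₂) [] u) [] v := by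
  simp only [cutSum_eq]
  exact Finset.sum_comm

/-- The cuts of a concatenation, the second factor being nonempty. -/
theorem cutSum_append_cons (F : List A → List A → M) (p u : List A) (c : A) (w : List A) :
    cutSum F p (u ++ c :: w)
      = cutSum (fun P Q => F P (Q ++ c :: w)) p u + cutSum F (p ++ u ++ [c]) w := by
  induction u generalizing p with
  | nil => simp [cutSum]
  | cons d u ih => rw [List.cons_append, cutSum, ih, cutSum, add_assoc]; simp

/-- Cuts behind a letter correspond to cuts before it. -/
theorem cutSum_shift (L G : List A → List A → M) (h : ∀ P c Q, L (P ++ [c]) Q = G P (c :: Q))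
    (h0 : ∀ P, G P [] = 0) (p v : List A) : cutSum L p v = L p v + cutSum G p v := by
  induction v generalizing p with
  | nil => simp [cutSum, h0]
  | cons c v ih => rw [cutSum, ih, h, cutSum]

theorem cutSum_eq_last (F : List A → List A → M) (h : ∀ P c Q, F P (c :: Q) = 0) (p v : List A) :
    cutSum F p v = F (p ++ v) [] := by
  induction v generalizing p with
  | nil => simp [cutSum]
  | cons c v ih => rw [cutSum, h, zero_add, ih]; simp

/-- If a cut before the letter `a` contributes nothing, a cut sum over a word is a sum over its
blocks `b a^k`. -/
theorem cutSum_cword (G : List Gen → List Gen → M) (h : ∀ P Q, G P (Gen.a :: Q) = 0)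
    (p : List Gen) (ks : List ℕ) :
    cutSum G p (cword ks) = cutSum (fun u v => G (p ++ cword u) (cword v)) [] ks := by
  induction ks generalizing p with
  | nil => simp [cutSum, cword]
  | cons k ks ih =>
    have e : cword (k :: ks) = Gen.b :: (List.replicate k Gen.a ++ cword ks) := by simp [cword]
    rw [cutSum_cons]
    nth_rw 1 [e]
    rw [cutSum, cutSum_append_of_eq_zero, ih, e]
    · simp only [cword, List.flatMap_nil, List.append_nil, List.flatMap_cons, List.append_assoc,
        List.nil_append, List.cons_append]
    · intro P Q hQ hPQ
      obtain ⟨c, Q, rfl⟩ := List.exists_cons_of_ne_nil hQ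
      have hc := (List.append_eq_replicate_iff.mp hPQ).2.2
      rw [List.length_cons, List.replicate_succ, List.cons.injEq] at hc
      rw [hc.1]
      exact h _ _

end CutSumLemmas

section Symmetric

variable {q : ℂ} (hq : ‖q‖ < 1)

theorem zword_append (u v : List ℕ) : zword (u ++ v) = zword u ++ zword v := by
  rw [zword, List.map_append, cword_append]; rfl

theorem z_eq_mono (k : Index) : z k = mono ℚ (zword (k.map fun i : ℕ+ => (i : ℕ))) := by
  rw [zword, mono_cword, z_eq_cmono, List.map_map]
  rfl

theorem sub_mem_idealC {I : Ideal (Zalg q hq)} {x y : Zalg q hq}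
    (h : Ideal.Quotient.mk I x = Ideal.Quotient.mk I y) : (x : ℂ) - y ∈ idealC hq I :=
  ⟨sub_mem x.2 y.2, Ideal.Quotient.eq.mp h⟩

/-- The symmetric values in terms of the shuffle regularized values. -/
theorem zetaS_eq_cutSum (k : Index) : zetaS q hq k = cutSum (fun u v : Index =>
    (-1) ^ v.wt * (regCls hq (z u) * regCls hq (z v.reverse))) [] k := by
  -- lifts of the regularized values to `𝒵_q`
  let r : List ℕ → Zalg q hq := fun w => Quotient.out (regCls hq (mono ℚ (zword w)))
  have hr : ∀ w, Ideal.Quotient.mk (Nideal q hq ⊔ Pideal q hq) (r w)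
      = regCls hq (mono ℚ (zword w)) := fun w => Ideal.Quotient.mk_out _
  let F : List ℕ → List ℕ → Zalg q hq := fun u v => (-1) ^ v.sum * (r u * r v.reverse)
  have hks : ∀ j ∈ k.map (fun i : ℕ+ => (i : ℕ)), 1 ≤ j := by
    intro j hj
    obtain ⟨i, -, rfl⟩ := List.mem_map.mp hj
    exact i.pos
  have h1 := cutSum_sub_mem (q := q) (idealC hq (Nideal q hq ⊔ Pideal q hq)) (fun u v => (F u v : ℂ))
    (fun u v s hu hv => by
      have h : Ideal.Quotient.mk (Nideal q hq ⊔ Pideal q hq)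
          (∑ p ∈ antidiagonal s, F (u ++ List.replicate p.1 1) (List.replicate p.2 1 ++ v))
          = Ideal.Quotient.mk _ ((-1) ^ v.sum * ∑ p ∈ antidiagonal s, (-1) ^ p.2 *
            (⟨regVal q u p.1, regVal_mem hq hu _⟩ * ⟨regVal q v.reverse p.2, regVal_mem hq hv _⟩)) := by
        rw [Finset.mul_sum, map_sum, map_sum]
        refine Finset.sum_congr rfl fun p _ => ?_
        simp only [F, map_mul, hr, replicate_append_reverse, regCls_zword hq hu, regCls_zword hq hv,
          List.sum_append, List.sum_replicate, pow_add, map_pow, map_neg, map_one, smul_eq_mul,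
          mul_one]
        ring
      have h2 := sub_mem_idealC hq h
      rw [AddSubmonoidClass.coe_finsetSum] at h2
      convert h2 using 2
      simp [blk]) good_nil 0 hks
  rw [List.replicate_zero, List.nil_append] at h1
  have h2 := sub_mem (idealC_mono hq le_sup_right (ZqStar_sub_mem hq k)) h1
  have h3 : cutSum (fun u v => (F u v : ℂ)) [] (k.map fun i : ℕ+ => (i : ℕ))
      = ((cutSum F [] (k.map fun i : ℕ+ => (i : ℕ)) : Zalg q hq) : ℂ) :=
    (map_cutSum (Zalg q hq).val F [] _).symm
  rw [sub_sub_sub_cancel_right, h3] at h2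
  rw [zetaS, mk_eq_of_sub_mem hq (x := ⟨ZqStar q (gI k), ZqStar_mem q hq k⟩) h2, map_cutSum,
    cutSum_map]
  refine cutSum_congr fun u v _ => ?_
  simp only [F, map_mul, hr, z_eq_mono, map_pow, map_neg, map_one, List.map_reverse, Index.wt]

/-- The value of `b S(w)` with the opposite sign, for a word `b w`, where `S` is the antipode. For the
word of `z_k` this is `(-1)^{wt(k)}` times the value of the reversed index. -/
noncomputable def revCls : List Gen → Zquot q hq
  | [] => 1
  | Gen.a :: _ => 0
  | Gen.b :: w => -regCls hq (vb ℚ * antip (mono ℚ w))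

/-- The linear extension of `revCls`. -/
noncomputable def revClsL : NC ℚ →ₗ[ℚ] Zquot q hq := (wordBasis ℚ).constr ℚ (revCls hq)

/-- The linear extension of the symmetric values to all words. Since `revCls` vanishes on words that
start with `a`, only the cuts in front of letters `b` and the one at the end contribute. -/
noncomputable def symCls : NC ℚ →ₗ[ℚ] Zquot q hq :=
  cutF ((LinearMap.mul ℚ (Zquot q hq)).compl₁₂ (regCls hq) (revClsL hq))

theorem revClsL_mono (w : List Gen) : revClsL hq (mono ℚ w) = revCls hq w := by
  rw [revClsL, ← wordBasis_apply, Module.Basis.constr_basis]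

theorem symCls_mono (w : List Gen) : symCls hq (mono ℚ w)
    = cutSum (fun P Q => regCls hq (mono ℚ P) * revCls hq Q) [] w := by
  rw [symCls, cutF_mono]
  simp only [LinearMap.compl₁₂_apply, LinearMap.mul_apply', revClsL_mono]

theorem b_cons_cword_reverse (ks : List ℕ) :
    Gen.b :: (cword ks).reverse = cword ks.reverse ++ [Gen.b] := by
  induction ks with
  | nil => rfl
  | cons k ks ih =>
    have e : cword (k :: ks) = Gen.b :: List.replicate k Gen.a ++ cword ks := by simp [cword]
    rw [e, List.reverse_append, ← List.cons_append, ih, List.reverse_cons (as := ks), cword_append]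
    simp [cword]

theorem length_cword (ks : List ℕ) : (cword ks).length = (ks.map (· + 1)).sum := by
  induction ks with
  | nil => rfl
  | cons k ks ih =>
    rw [← List.singleton_append, cword_append, List.length_append, ih]
    simp [cword]

theorem cword_cons (k : ℕ) (ks : List ℕ) :
    cword (k :: ks) = Gen.b :: (List.replicate k Gen.a ++ cword ks) := by simp [cword]

theorem cword_cons_reverse (k : ℕ) (ks : List ℕ) :
    cword (k :: ks).reverse = Gen.b :: (List.replicate k Gen.a ++ cword ks).reverse := by
  rw [List.reverse_append, ← List.cons_append, b_cons_cword_reverse, List.reverse_cons,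
    cword_append, List.append_assoc, List.reverse_replicate]
  simp [cword]

theorem revCls_cword (ks : List ℕ) : revCls hq (cword ks)
    = (-1) ^ (cword ks).length * regCls hq (mono ℚ (cword ks.reverse)) := by
  rcases ks with _ | ⟨k, ks⟩
  · simp [cword, revCls, mono_nil, regCls_one]
  · rw [cword_cons_reverse, cword_cons, revCls, antip_mono, mul_smul_comm, map_smul, mono_cons,
      ← vb, List.length_cons, pow_succ, mul_neg_one, neg_mul, Algebra.smul_def, map_pow, map_neg,
      map_one]

theorem length_zword (v : Index) : (zword (v.map fun i : ℕ+ => (i : ℕ))).length = v.wt := by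
  rw [zword, length_cword, List.map_map, List.map_map, Index.wt]
  congr 1
  refine List.map_congr_left fun i _ => ?_
  have := i.pos
  simp only [Function.comp_apply]
  omega

theorem symCls_z (k : Index) : symCls hq (z k) = zetaS q hq k := by
  rw [zetaS_eq_cutSum, z_eq_mono, symCls_mono, zword, cutSum_cword, cutSum_map, cutSum_map]
  · refine cutSum_nil_congr fun u v _ => ?_
    have h := length_zword v
    rw [zword] at h
    rw [revCls_cword, h, z_eq_mono, z_eq_mono, zword, zword, List.nil_append,
      List.map_reverse, List.map_reverse]
    ring
  · intro P Q
    rw [revCls, mul_zero]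

end Symmetric

/-! ### The shuffle relation -/

section Shuffle

variable {q : ℂ} (hq : ‖q‖ < 1)

theorem regCls_csh_vb_mul {u : List Gen} (hu : startsB u) (x : NC ℚ) :
    regCls hq (csh (mono ℚ u) (vb ℚ * x)) = regCls hq (mono ℚ u) * regCls hq (vb ℚ * x) := by
  induction x using nc_induction with
  | hm w => rw [vb, ← mono_cons]; exact regCls_csh hq hu (startsB_cons w)
  | ha x y hx hy => simp only [mul_add, map_add, hx, hy]
  | hs c x hx => simp only [mul_smul_comm, map_smul, hx]

theorem revClsL_a_mul (x : NC ℚ) : revClsL hq (FreeAlgebra.ι ℚ Gen.a * x) = 0 := by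
  induction x using nc_induction with
  | hm w => rw [← mono_cons, revClsL_mono, revCls]
  | ha x y hx hy => rw [mul_add, map_add, hx, hy, add_zero]
  | hs c x hx => rw [mul_smul_comm, map_smul, hx, smul_zero]

theorem revClsL_b_mul (x : NC ℚ) :
    revClsL hq (FreeAlgebra.ι ℚ Gen.b * x) = -regCls hq (vb ℚ * antip x) := by
  induction x using nc_induction with
  | hm w => rw [← mono_cons, revClsL_mono, revCls]
  | ha x y hx hy => simp only [mul_add, map_add, hx, hy, neg_add]
  | hs c x hx => simp only [mul_smul_comm, map_smul, hx, smul_neg]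

/-- The indicator of the empty word. -/
noncomputable def emptyCls : List Gen → Zquot q hq
  | [] => 1
  | _ :: _ => 0

/-- The value of `b (S(w) ⧢ x)` for a word `b w`, where `S` is the antipode. -/
noncomputable def headCls : List Gen → NC ℚ → Zquot q hq
  | Gen.b :: w, x => regCls hq (vb ℚ * csh (antip (mono ℚ w)) x)
  | _, _ => 0

/-- The value of `v b S(w)` for a word `b w`, where `S` is the antipode. -/
noncomputable def joinCls (v : List Gen) : List Gen → Zquot q hq
  | Gen.b :: w => regCls hq (mono ℚ v * (vb ℚ * antip (mono ℚ w)))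
  | _ => 0

/-- The first letter of a word of `u ⧢ v` comes from `u` or from `v`. -/
theorem revClsL_csh (u v : List Gen) : revClsL hq (csh (mono ℚ u) (mono ℚ v))
    = emptyCls hq u * emptyCls hq v - headCls hq u (antip (mono ℚ v))
      - headCls hq v (antip (mono ℚ u)) := by
  rcases u with _ | ⟨c, u⟩
  · rw [mono_nil, csh_one_left, revClsL_mono, antip_one]
    rcases v with _ | ⟨_ | _, v⟩ <;> simp [emptyCls, headCls, revCls, csh_one_right]
  rcases v with _ | ⟨d, v⟩
  · rw [mono_nil, csh_one_right, revClsL_mono, antip_one]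
    cases c <;> simp [emptyCls, headCls, revCls, csh_one_right]
  rw [mono_cons c, mono_cons d, csh_ι_mul, map_add, ← mono_cons c, ← mono_cons d]
  cases c <;> cases d <;>
    simp only [revClsL_a_mul, revClsL_b_mul, antip_csh, emptyCls, headCls, csh_comm (antip (mono ℚ v))]
    <;> ring

/-- The antipode relation makes the sum over all cuts of `v` collapse to a single value. -/
theorem cutSum_headCls {v : List Gen} (hv : startsB v) (w : List Gen) :
    cutSum (fun P Q => regCls hq (mono ℚ P) * headCls hq w (antip (mono ℚ Q))) [] v
      = joinCls hq v w := by
  rcases w with _ | ⟨_ | _, w⟩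
  · simp [headCls, joinCls, cutSum_eq]
  · simp [headCls, joinCls, cutSum_eq]
  · rw [joinCls, ← cutSum_csh_vb_mul, map_cutSum]
    refine cutSum_congr fun P Q h => ?_
    have hP : startsB P := (h ▸ hv).of_append
    rw [List.nil_append, headCls, ← regCls_csh_vb_mul hq hP, antip_mono Q]
    simp only [map_smul, mul_smul_comm]

theorem cutSum_emptyCls (f : List Gen → Zquot q hq) (v : List Gen) :
    cutSum (fun P Q => f P * emptyCls hq Q) [] v = f v := by
  rw [cutSum_eq_last]
  · simp [emptyCls]
  · intro P c Q
    rw [emptyCls, mul_zero]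

theorem mul_cutSum {A : Type} (c : Zquot q hq) (F : List A → List A → Zquot q hq) (p v : List A) :
    c * cutSum F p v = cutSum (fun P Q => c * F P Q) p v := by
  simp [cutSum_eq, Finset.mul_sum]

theorem cutSum_sub {A : Type} (F G : List A → List A → Zquot q hq) (p v : List A) :
    cutSum (fun P Q => F P Q - G P Q) p v = cutSum F p v - cutSum G p v := by
  simp [cutSum_eq]

/-- The sum of the regularized values of `u′` and `v b S(u″)` over all factorizations `u = u′ b u″`,
where `S` is the antipode. -/
noncomputable def crossCls (u v : List Gen) : Zquot q hq :=
  cutSum (fun P Q => regCls hq (mono ℚ P) * joinCls hq v Q) [] u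

/-- The symmetric value of a shuffle product. Deconcatenation is multiplicative for the shuffle product
and the antipode relation removes the cuts in one of the two words. -/
theorem symCls_csh {u v : List Gen} (hu : startsB u) (hv : startsB v) :
    symCls hq (csh (mono ℚ u) (mono ℚ v))
      = regCls hq (mono ℚ u) * regCls hq (mono ℚ v) - crossCls hq u v - crossCls hq v u := by
  have h : ∀ P₁ Q₁ P₂ Q₂, P₁ ++ Q₁ = u → P₂ ++ Q₂ = v →
      regCls hq (csh (mono ℚ P₁) (mono ℚ P₂)) * revClsL hq (csh (mono ℚ Q₁) (mono ℚ Q₂))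
      = (regCls hq (mono ℚ P₁) * emptyCls hq Q₁) * (regCls hq (mono ℚ P₂) * emptyCls hq Q₂)
        - regCls hq (mono ℚ P₁) * (regCls hq (mono ℚ P₂) * headCls hq Q₁ (antip (mono ℚ Q₂)))
        - regCls hq (mono ℚ P₂) * (regCls hq (mono ℚ P₁) * headCls hq Q₂ (antip (mono ℚ Q₁))) := by
    intro P₁ Q₁ P₂ Q₂ h₁ h₂
    rw [regCls_csh hq (h₁ ▸ hu).of_append (h₂ ▸ hv).of_append, revClsL_csh]
    ring
  rw [symCls, cutF_csh]
  simp only [LinearMap.compl₁₂_apply, LinearMap.mul_apply']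
  rw [cutSum_nil_congr fun P₁ Q₁ h₁ => cutSum_nil_congr fun P₂ Q₂ h₂ => h P₁ Q₁ P₂ Q₂ h₁ h₂]
  simp only [cutSum_sub]
  rw [cutSum_comm (fun P₁ Q₁ P₂ Q₂ => regCls hq (mono ℚ P₂) *
    (regCls hq (mono ℚ P₁) * headCls hq Q₂ (antip (mono ℚ Q₁))))]
  simp only [← mul_cutSum, cutSum_headCls hq hu, cutSum_headCls hq hv, cutSum_emptyCls, crossCls]
  congr 2
  rw [← cutSum_emptyCls hq (fun P => regCls hq (mono ℚ P)) u, mul_comm, mul_cutSum]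
  refine cutSum_congr fun P Q _ => mul_comm _ _

/-- The cuts of `b v'` before a letter `b` and the cuts of the reversal of `v'`. -/
theorem cutSum_reverse_revCls (u v : List Gen) :
    cutSum (fun P Q => regCls hq (mono ℚ (u ++ Gen.b :: P)) * revCls hq Q) [] v.reverse
      = (-1) ^ v.length * crossCls hq (Gen.b :: v) u := by
  have hmono : ∀ w : List Gen, regCls hq (mono ℚ (u ++ Gen.b :: w.reverse))
      = (-1) ^ w.length * regCls hq (mono ℚ u * (vb ℚ * antip (mono ℚ w))) := by
    intro w
    rw [antip_mono, mul_smul_comm, mul_smul_comm, map_smul, mono_append, mono_cons, ← vb,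
      Algebra.smul_def, map_pow, map_neg, map_one, ← mul_assoc ((-1) ^ _), ← mul_pow]
    simp
  rw [cutSum_reverse, cutSum_shift _ (fun P Q => (-1) ^ (P.length + Q.length) *
    (regCls hq (mono ℚ (Gen.b :: P)) * joinCls hq u Q))]
  · rw [crossCls, cutSum_cons, mono_nil, regCls_one, one_mul, joinCls, mul_add, mul_cutSum,
      List.reverse_nil, revCls, mul_one, hmono]
    congr 1
    refine cutSum_congr fun P Q h => ?_
    rw [List.nil_append, ← h, List.length_append]
  · intro P c Q
    rw [List.reverse_append, List.reverse_singleton, List.singleton_append]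
    cases c
    · simp [revCls, joinCls]
    · rw [revCls, joinCls, hmono, antip_mono P.reverse, List.reverse_reverse, mul_smul_comm, map_smul,
        mono_cons Gen.b P, ← vb, List.length_reverse, List.length_cons, Algebra.smul_def, map_pow,
        map_neg, map_one, pow_add, pow_succ]
      ring
  · intro P
    rw [joinCls, mul_zero, mul_zero]
    simp

/-- The symmetric value of `u b rev(v)`: the cuts inside `u` and those behind the letter `b` give the two
sums `crossCls`, the cut in front of `b` gives the product. -/
theorem symCls_append_reverse (u v : List Gen) :
    symCls hq (mono ℚ (u ++ Gen.b :: v.reverse)) = (-1) ^ (v.length + 1) *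
      (regCls hq (mono ℚ u) * regCls hq (mono ℚ (Gen.b :: v)) - crossCls hq u (Gen.b :: v)
        - crossCls hq (Gen.b :: v) u) := by
  have h : ∀ Q : List Gen, revCls hq (Q ++ Gen.b :: v.reverse)
      = (-1) ^ (v.length + 1) * (regCls hq (mono ℚ (Gen.b :: v)) * emptyCls hq Q - joinCls hq (Gen.b :: v) Q) := by
    rintro (_ | ⟨_ | _, Q⟩)
    · rw [List.nil_append, revCls, joinCls, emptyCls, antip_mono, List.reverse_reverse, mul_smul_comm,
        map_smul, mono_cons, ← vb, List.length_reverse, Algebra.smul_def, map_pow, map_neg, map_one,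
        pow_succ]
      · ring
      · simp
    · simp [revCls, joinCls, emptyCls]
    · rw [List.cons_append, revCls, joinCls, emptyCls, antip_mono, antip_mono, List.reverse_append,
        List.reverse_cons, List.reverse_reverse, mono_append, mono_append, mono_single, mono_cons,
        List.length_append, List.length_cons, List.length_reverse, ← vb]
      simp only [mul_smul_comm, map_smul]
      simp only [Algebra.smul_def, map_pow, map_neg, map_one, map_mul, mul_assoc, pow_add]
      ring
  have e1 : ∀ P Q : List Gen, regCls hq (mono ℚ P) * revCls hq (Q ++ Gen.b :: v.reverse)
      = (-1) ^ (v.length + 1) * (regCls hq (mono ℚ (Gen.b :: v)) *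
          (regCls hq (mono ℚ P) * emptyCls hq Q) - regCls hq (mono ℚ P) * joinCls hq (Gen.b :: v) Q) := by
    intro P Q
    rw [h]
    ring
  have e2 : ∀ P : List Gen, [] ++ u ++ [Gen.b] ++ P = u ++ Gen.b :: P := by simp
  rw [symCls_mono, cutSum_append_cons, cutSum_prefix _ ([] ++ u ++ [Gen.b])]
  simp only [e1, e2, ← mul_cutSum, cutSum_sub]
  rw [cutSum_reverse_revCls, cutSum_emptyCls hq fun P => regCls hq (mono ℚ P), ← crossCls, pow_succ]
  ring

/-- Up to sign, `symCls_csh` and `symCls_append_reverse` have the same right-hand side. -/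
theorem zetaS_shuffle (k l : Index) : (-1) ^ l.wt * zetaS q hq (k ++ l.reverse)
    = (dSh k l).sum fun m c => c • zetaS q hq m := by
  have h : ((dSh k l).sum fun m c => c • zetaS q hq m) = symCls hq (csh (z k) (z l)) := by
    have h0 : csh (z k) (z l) = (dSh k l).sum fun m c => c • z m := dSh_spec k l
    rw [h0, map_finsuppSum]
    exact Finsupp.sum_congr fun m _ => by rw [map_nsmul, symCls_z]
  rw [h]
  rcases l with _ | ⟨i, l⟩
  · rw [List.reverse_nil, List.append_nil, ← symCls_z, show z [] = 1 by simp [z], csh_one_right]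
    simp [Index.wt]
  · obtain ⟨v, hv, hv'⟩ : ∃ v, zword ((i :: l).map fun i : ℕ+ => (i : ℕ)) = Gen.b :: v ∧
        zword ((i :: l).reverse.map fun i : ℕ+ => (i : ℕ)) = Gen.b :: v.reverse := by
      refine ⟨_, cword_cons _ _, ?_⟩
      rw [← cword_cons_reverse, zword, List.map_reverse, List.map_reverse]
      rfl
    have hl := length_zword (i :: l)
    rw [hv, List.length_cons] at hl
    rw [← symCls_z, z_eq_mono, z_eq_mono k, z_eq_mono (i :: l), List.map_append, zword_append, hv, hv',
      symCls_append_reverse, symCls_csh hq (u := zword _) (startsB_cword _) (startsB_cons v), ← hl, ← mul_assoc,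
      ← mul_pow]
    simp

end Shuffle

end QSMZV

theorem mainTheorem1 (q : ℂ) (hq0 : 0 < ‖q‖) (hq : ‖q‖ < 1) :
    (∀ k : QSMZV.Index, ∃ h : QSMZV.wSh (QSMZV.EI k) ∈ QSMZV.HZero,
      QSMZV.zetaS q hq k =
        Ideal.Quotient.mk (QSMZV.Nideal q hq ⊔ QSMZV.Pideal q hq)
          ⟨QSMZV.ZqSh q (QSMZV.EI k), QSMZV.ZqSh_mem q hq h⟩) ∧
    (∀ k l : QSMZV.Index,
      QSMZV.zetaS q hq k * QSMZV.zetaS q hq l =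
        (QSMZV.dStar k l).sum fun m c => c • QSMZV.zetaS q hq m) ∧
    (∀ k l : QSMZV.Index, k.Admissible ∨ l.Admissible →
      (-1) ^ l.wt * QSMZV.zetaS q hq (k ++ l.reverse) =
        (QSMZV.dSh k l).sum fun m c => c • QSMZV.zetaS q hq m) :=
  ⟨fun k => QSMZV.zetaS_eq_sh hq k, fun k l => QSMZV.zetaS_mul hq k l,
    fun k l _ => QSMZV.zetaS_shuffle hq k l⟩
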